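/- **Setting.** Let $d=N+1$ and let $(t,x^i)$ be coordinates on an open set $\Omega\subseteq\mathbb R^{N+1}$. Given are $C^1$ fields: positive lapses $\mathsf N,\mathsf M$, a shift $q^i$, a boost vector $p^a$, and spatial vielbeins $e,m$ ($N\times N$ matrices). Put $\lambda=(1+p^{T}p)^{1/2}$, $v=\lambda^{-1}p$, $\Lambda=(I+pp^{T})^{1/2}$, and assume that $\chi=e^{T}\Lambda m$ is symmetric and positive definite. Let $\gamma=e^{T}e$, $\varphi=m^{T}m$, $\mathsf n=e^{-1}v$, $\tilde{\mathsf n}=m^{-1}v$. Let $g$ be the Lorentzian metric with lapse $\mathsf N$, shift $q+\mathsf N\mathsf n$ and spatial metric $\gamma$, and $f$ the one with lapse $\mathsf M$, shift $q-\mathsf M\tilde{\mathsf n}$ and spatial metric $\varphi$; a metric with lapse $N$, shift $N^i$ and spatial metric $\gamma$ is $-N^2dt^2+\gamma_{ij}(dx^i+N^idt)(dx^j+N^jdt)$. Let $S=(g^{-1}f)^{1/2}$ be the principal square root and $h=gS$ the geometric mean. With $\det(I+tX)=\sum_n e_n(X)t^n$, $Y_n(X)=\sum_{k=0}^n(-1)^{n+k}e_k(X)X^{n-k}$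 and $e_{-1}=0$, $Y_{-1}=0$, the Hassan–Rosen (HR) potential is $V=-\ell^{-2}\sum_{n=0}^{d}\beta_n e_n(S)$ and its effective stress-energy tensor is $V_g=-\ell^{-2}\sum_{n=0}^{d}\beta_nY_n(S)$ ($\ell>0$, $\beta_n\in\mathbb R$). Let $\mathcal B=e^{-1}\Lambda m$, $\tilde{\mathcal D}=e^{-1}\Lambda^{-1}m$, $$\mathcal U=-\ell^{-2}\sum_n\beta_n\lambda^{-1}Y_{n-1}(\mathcal B),\qquad \tilde{\mathcal U}=-\ell^{-2}\sum_n\beta_n\tilde{\mathcal D}\,Y_{n-1}(\tilde{\mathcal D}).$$ $\nabla$ is the covariant derivative of $g$; $D_i,\tilde D_i$ are those of $\gamma,\varphi$; $K_{ij}=-\tfrac12(\mathscr L_{n}\gamma)_{ij}$ and $\tilde K_{ij}$ are the extrinsic curvatures of the slices $t=\mathrm{const}$ in $g$ and $f$ ($n=n_g$, $n_f$ the future unit normal; index raised with $\gamma^{-1}$, $\varphi^{-1}$). Let $n_h$ be the future unit normal of the slices relative to $h$, $H=(\mathsf N\mathsf M/\lambda)^{1/2}$ the lapse of $h$, and let $F$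 be the left side minus the right side of $$\mathcal U^i{}_j\big(D_i\mathsf n^j-K^j{}_i\big)+\tilde{\mathcal U}^i{}_j\big(\tilde D_i\tilde{\mathsf n}^j+\tilde K^j{}_i\big)=D_i\big[\mathcal U^i{}_j\mathsf n^j\big].\tag{1}$$ **Theorem.** (a) At every point of $\Omega$ the principal square root exists, and the projection of the conservation law onto the normal of $h$ is $$n_h^\nu\nabla_\mu V_g{}^\mu{}_\nu=-\frac{\mathsf M}{H}F,\qquad\text{equivalently}\qquad n_g^\nu\nabla_\mu V_g{}^\mu{}_\nu+\mathsf n^i\perp_g{}^{\nu}{}_i\nabla_\mu V_g{}^\mu{}_\nu=-\frac{\mathsf M}{\mathsf N}F,$$ where $\perp_g{}^\mu{}_\nu=\delta^\mu_\nu+n_g^\mu n_{g\,\nu}$. Hence this projection vanishes if and only if (1) holds, and $\nabla_\mu V_g{}^\mu{}_\nu=0$ for all $\nu$ if and only if (1) holds and the spatial components $\nabla_\mu V_g{}^\mu{}_i$ vanish. (b) $F$ is built from $e,m,p,K,\tilde K$ on one slice only. In particular the lapses and the shift drop out: for two sets of fields on $\Omega$ which agree in $e,m,p$ on the slice near a point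 and in $K,\tilde K$ at that point, but may have different lapses and shifts $q$, the projected law holds at that point for the one if and only if it does for the other. (c) (1) is equivalent to the symmetric equation $$\tfrac12D_i[\mathcal U^i{}_j\mathsf n^j]+\tfrac12\tilde D_i[\tilde{\mathcal U}^i{}_j\tilde{\mathsf n}^j]=\mathcal U^i{}_j\Big(D_i\mathsf n^j-\tfrac12\tfrac{\partial_i\sqrt\gamma}{\sqrt\gamma}\mathsf n^j-K^j{}_i\Big)+\tilde{\mathcal U}^i{}_j\Big(\tilde D_i\tilde{\mathsf n}^j+\tfrac12\tfrac{\partial_i\sqrt\varphi}{\sqrt\varphi}\tilde{\mathsf n}^j+\tilde K^j{}_i\Big),\tag{2}$$ and right minus left side of (2) equals $F$. Equation (2) is dual-symmetric: under $e\leftrightarrow m$, $K\leftrightarrow\tilde K$, $p\mapsto-p$, $\beta_n\mapsto\beta_{d-n}$, right minus left side of (2) is multiplied by $-\sqrt\gamma/\sqrt\varphi$, so that (2) is mapped to an equivalent equation. (d) Put $\mathcal V=-\ell^{-2}\sum_n\beta_ne_n(\tilde{\mathcal D})$ and $\tilde{\mathcal V}=-\ell^{-2}\sum_n\beta_n\lambda^{-1}e_{n-1}(\mathcal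 B)$. As functions of $(\gamma,\varphi,\mathsf n)$ they are given by $\lambda=(1-\mathsf n^T\gamma\mathsf n)^{-1/2}$, $\tilde{\mathcal D}=((\gamma^{-1}-\mathsf n\mathsf n^T)\varphi)^{1/2}$ and $\mathcal B=(I+\lambda^2\mathsf n\mathsf n^T\gamma)\tilde{\mathcal D}$, while $\tilde{\mathsf n}=\lambda^{-1}\tilde{\mathcal D}^{-1}\mathsf n$; and $\sqrt{-g}\,V=\sqrt\gamma\,(\mathsf N\mathcal V+\mathsf M\tilde{\mathcal V})$. Let $N\ge2$, $\kappa_g,\kappa_f>0$. Consider the vacuum Hamiltonian theory with Einstein–Hilbert terms $\sqrt{-g}R_g/2\kappa_g$, $\sqrt{-f}R_f/2\kappa_f$ and interaction $\sqrt{-g}V$, with canonical pairs $(\gamma_{ij},\pi^{ij})$, $(\varphi_{ij},\varpi^{ij})$ and Hamiltonian density $-(\mathsf N\mathcal C+\mathsf M\tilde{\mathcal C}+q^i(R_i+\tilde R_i))$, where $$\mathcal C=R^0+R_i\mathsf n^i+\sqrt\gamma\,\mathcal V,\qquad \tilde{\mathcal C}=\tilde R^0-\tilde R_i\tilde{\mathsf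 n}^i+\sqrt\gamma\,\tilde{\mathcal V},$$ $$R^0=\tfrac{\sqrt\gamma}{2\kappa_g}R-\tfrac{2\kappa_g}{\sqrt\gamma}\big(\pi_{ij}\pi^{ij}-\tfrac{1}{N-1}(\pi^k{}_k)^2\big),\qquad R_i=2\gamma_{ij}D_k\pi^{jk},\qquad \pi^{ij}=-\tfrac{\sqrt\gamma}{2\kappa_g}(K^{ij}-K\gamma^{ij}),$$ and likewise $\tilde R^0,\tilde R_i,\varpi^{ij}$ from $\varphi,\tilde K,\kappa_f$; $\mathsf n^i$ carries no momentum and is an independent variable in Poisson brackets. Let $A\subseteq\mathbb R^N$ be open with smooth data $e,m,p,K,\tilde K$ on $A$ ($\chi$ symmetric positive definite, $K,\tilde K$ symmetric) that satisfy the vector constraints $R_i+\sqrt\gamma\,j_i=0$, where $j=-\gamma\,e^{-1}\Lambda^2e\,\tilde{\mathcal U}\,\mathsf n$ (the equation of $\mathsf n^i$), and $R_i+\tilde R_i=0$ (the equation of $q^i$). Then for all smooth $\xi,\zeta$ with compact support in $A$ $$\Big\{\int\xi\,\mathcal C,\int\zeta\,\tilde{\mathcal C}\Big\}=\int_A\xi\,\zeta\,\sqrt\gamma\,F\,d^Nx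 .$$ Hence the secondary constraint (the vanishing of these brackets, that is, of the contribution of $\mathsf M\tilde{\mathcal C}$ to the time derivative of the primary constraint $\mathcal C$) holds on $A$ if and only if (1) holds on $A$. -/

import Mathlib

open scoped ContDiff Topology

noncomputable section

namespace Bimetric

/-! ### Coordinates, matrices and elementary symmetric polynomials -/

/-- Points (or vectors) of a coordinate chart with `n` coordinates. -/
abbrev Pt (n : ℕ) := Fin n → ℝ

/-- Real `n × n` matrices; `A i j` is the entry in row `i` and column `j`. -/
abbrev Mat (n : ℕ) := Matrix (Fin n) (Fin n) ℝ

/-- The partial derivative `∂ᵢ u` at `x`. -/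
def pd {n : ℕ} (i : Fin n) (u : Pt n → ℝ) (x : Pt n) : ℝ := fderiv ℝ u x (Pi.single i 1)

/-- The elementary symmetric polynomial `eₙ(X)`: the coefficient of `tⁿ` in `det (I + t X)`. -/
def esym {D : ℕ} (n : ℕ) (X : Mat D) : ℝ :=
  (Matrix.det (1 + (Polynomial.X : Polynomial ℝ) • X.map Polynomial.C)).coeff n

/-- `Yₙ(X) = ∑ₖ₌₀ⁿ (-1)ⁿ⁺ᵏ eₖ(X) Xⁿ⁻ᵏ`. -/
def Ypol {D : ℕ} (n : ℕ) (X : Mat D) : Mat D :=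
  ∑ k ∈ Finset.range (n + 1), ((-1 : ℝ) ^ (n + k) * esym k X) • X ^ (n - k)

/-- `eₙ₋₁(X)`, where `e₋₁ = 0`. -/
def esymPred {D : ℕ} : ℕ → Mat D → ℝ
  | 0, _ => 0
  | n + 1, X => esym n X

/-- `Yₙ₋₁(X)`, where `Y₋₁ = 0`. -/
def YpolPred {D : ℕ} : ℕ → Mat D → Mat D
  | 0, _ => 0
  | n + 1, X => Ypol n X

/-- The linear combination `-ℓ⁻² ∑ₙ βₙ aₙ`, over `0 ≤ n ≤ d = N + 1`. -/
def span {A : Type*} [AddCommGroup A] [Module ℝ A] (N : ℕ) (β : ℕ → ℝ) (ℓ : ℝ) (a : ℕ → A) : A :=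
  -((ℓ ^ 2)⁻¹ • ∑ n ∈ Finset.range (N + 2), β n • a n)

/-- `X` is the principal square root of `A`: `X² = A`, and every complex eigenvalue of `X` lies in
the open right half plane. -/
def IsPrincipalSqrt {D : ℕ} (A X : Mat D) : Prop :=
  X * X = A ∧ ∀ z ∈ spectrum ℂ (X.map (algebraMap ℝ ℂ)), 0 < z.re

open Classical in
/-- The principal square root `A^{1/2}` (zero if there is none). -/
def principalSqrt {D : ℕ} (A : Mat D) : Mat D :=
  if h : ∃ X, IsPrincipalSqrt A X then h.choose else 0

/-! ### Coordinate tensor calculus for a metric field `k` -/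

/-- The Christoffel symbol `Γᵃ_bc` of the Levi-Civita connection of `k`. -/
def christoffel {n : ℕ} (k : Pt n → Mat n) (x : Pt n) (a b c : Fin n) : ℝ :=
  1 / 2 * ∑ d, (k x)⁻¹ a d *
    (pd b (fun y => k y d c) x + pd c (fun y => k y d b) x - pd d (fun y => k y b c) x)

/-- The divergence `∇_μ X^μ_ν` of an operator field `X^μ_ν`. -/
def divOperator {n : ℕ} (k X : Pt n → Mat n) (x : Pt n) (ν : Fin n) : ℝ :=
  ∑ μ, (pd μ (fun y => X y μ ν) x
    + ∑ σ, (christoffel k x μ μ σ * X x σ ν - christoffel k x σ μ ν * X x μ σ))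

/-- The covariant derivative `D_i ξ^j` of a vector field. -/
def covDeriv {n : ℕ} (k : Pt n → Mat n) (ξ : Pt n → Pt n) (x : Pt n) (i j : Fin n) : ℝ :=
  pd i (fun y => ξ y j) x + ∑ l, christoffel k x j i l * ξ x l

/-- The divergence `D_i ξ^i` of a vector field. -/
def divVector {n : ℕ} (k : Pt n → Mat n) (ξ : Pt n → Pt n) (x : Pt n) : ℝ :=
  ∑ i, covDeriv k ξ x i i

/-- The Lie derivative `(ℒ_w T)_μν` of a covariant two-tensor field. -/
def lieDeriv {n : ℕ} (w : Pt n → Pt n) (T : Pt n → Mat n) (x : Pt n) (μ ν : Fin n) : ℝ :=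
  ∑ σ, (w x σ * pd σ (fun y => T y μ ν) x + T x σ ν * pd μ (fun y => w y σ) x
    + T x μ σ * pd ν (fun y => w y σ) x)

/-- The volume factor `√det k`. -/
def sqrtDet {n : ℕ} (k : Mat n) : ℝ := Real.sqrt k.det

/-- The Ricci tensor `R_ij` of `k`. -/
def ricci {n : ℕ} (k : Pt n → Mat n) (x : Pt n) (i j : Fin n) : ℝ :=
  ∑ a, (pd a (fun y => christoffel k y a i j) x - pd j (fun y => christoffel k y a i a) x
    + ∑ b, (christoffel k x a a b * christoffel k x b i j
      - christoffel k x a j b * christoffel k x b i a))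

/-- The scalar curvature `R = k^ij R_ij`. -/
def scalarCurv {n : ℕ} (k : Pt n → Mat n) (x : Pt n) : ℝ :=
  ∑ i, ∑ j, (k x)⁻¹ i j * ricci k x i j

/-! ### Foliation by the slices `x⁰ = const` -/

/-- The shear `Ξ[ξ] = (1, 0; ξ, I)`. -/
def shear {N : ℕ} (ξ : Pt N) : Mat (N + 1) :=
  Matrix.of (Fin.cons (Fin.cons 1 0) fun i => Fin.cons (ξ i) (Pi.single i 1))

/-- The block matrix `diag(a, A)`. -/
def blockDiag {N : ℕ} (a : ℝ) (A : Mat N) : Mat (N + 1) :=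
  Matrix.of (Fin.cons (Fin.cons a 0) fun i => Fin.cons 0 (A i))

/-- The spacetime metric with given lapse, shift vector and spatial metric. -/
def metricOf {N : ℕ} (lapse : ℝ) (shift : Pt N) (γ : Mat N) : Mat (N + 1) :=
  (shear shift).transpose * blockDiag (-lapse ^ 2) γ * shear shift

/-- The future-pointing unit normal `n^μ` (`n⁰ > 0`) of the slice, relative to a Lorentzian metric
`k` for which the slice is spacelike: `n^μ = -k^{μ0} / √(-k^{00})`. -/
def unitNormal {N : ℕ} (k : Mat (N + 1)) (μ : Fin (N + 1)) : ℝ :=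
  -(k⁻¹ μ 0) / Real.sqrt (-(k⁻¹ 0 0))

/-- The induced metric `γ_μν = k_μν + n_μ n_ν` as a spacetime tensor. -/
def inducedMetric {N : ℕ} (k : Mat (N + 1)) : Mat (N + 1) :=
  k + Matrix.vecMulVec (k.mulVec (unitNormal k)) (k.mulVec (unitNormal k))

/-- The projector `⊥^μ_ν = δ^μ_ν + n^μ n_ν`. -/
def projector {N : ℕ} (k : Mat (N + 1)) : Mat (N + 1) :=
  1 + Matrix.vecMulVec (unitNormal k) (k.mulVec (unitNormal k))

/-- The extrinsic curvature of the slices, `K_ij = -½ (ℒ_n γ)_ij`. -/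
def extrinsicCurv {N : ℕ} (k : Pt (N + 1) → Mat (N + 1)) (x : Pt (N + 1)) : Mat N :=
  Matrix.of fun i j => -(1 / 2) *
    lieDeriv (fun y => unitNormal (k y)) (fun y => inducedMetric (k y)) x i.succ j.succ

/-! ### Algebra of the boost: `p` is the boost vector, `e` and `m` are the spatial vielbeins -/

/-- The Lorentz factor `λ = (1 + pᵀ p)^{1/2}`. -/
def lorentz {N : ℕ} (p : Pt N) : ℝ := Real.sqrt (1 + dotProduct p p)

/-- `v = λ⁻¹ p`. -/
def vel {N : ℕ} (p : Pt N) : Pt N := (lorentz p)⁻¹ • p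

/-- The spatial part of the boost, `Λ = (I + p pᵀ)^{1/2}`. -/
def boost {N : ℕ} (p : Pt N) : Mat N := principalSqrt (1 + Matrix.vecMulVec p p)

/-- The spatial metric `eᵀ e` of a spatial vielbein. -/
def gram {N : ℕ} (e : Mat N) : Mat N := e.transpose * e

/-- The boost parameter `e⁻¹ v` relative to the vielbein `e`. -/
def boostVec {N : ℕ} (e : Mat N) (p : Pt N) : Pt N := e⁻¹.mulVec (vel p)

/-- `χ = eᵀ Λ m`, the spatial metric of the geometric mean. -/
def chi {N : ℕ} (e m : Mat N) (p : Pt N) : Mat N := e.transpose * boost p * m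

/-- `B = e⁻¹ Λ m`. -/
def Bop {N : ℕ} (e m : Mat N) (p : Pt N) : Mat N := e⁻¹ * boost p * m

/-- `D̃ = e⁻¹ Λ⁻¹ m`. -/
def Dop {N : ℕ} (e m : Mat N) (p : Pt N) : Mat N := e⁻¹ * (boost p)⁻¹ * m

/-- `Q = e⁻¹ Λ² e`. -/
def Qop {N : ℕ} (e : Mat N) (p : Pt N) : Mat N := e⁻¹ * (boost p) ^ 2 * e

/-- `U = -ℓ⁻² ∑ₙ βₙ λ⁻¹ Yₙ₋₁(B)`. -/
def Uop {N : ℕ} (β : ℕ → ℝ) (ℓ : ℝ) (e m : Mat N) (p : Pt N) : Mat N :=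
  span N β ℓ fun n => (lorentz p)⁻¹ • YpolPred n (Bop e m p)

/-- `Ũ = -ℓ⁻² ∑ₙ βₙ D̃ Yₙ₋₁(D̃)`. -/
def Utop {N : ℕ} (β : ℕ → ℝ) (ℓ : ℝ) (e m : Mat N) (p : Pt N) : Mat N :=
  span N β ℓ fun n => Dop e m p * YpolPred n (Dop e m p)

/-! ### Data on one slice and the projected conservation law -/

/-- Fields on a single slice: the spatial vielbeins `e`, `m`, the boost vector `p`, and the
extrinsic curvatures `K_ij`, `K̃_ij`. There are no lapses and no shifts here. -/
structure SliceData (N : ℕ) where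
  e : Pt N → Mat N
  m : Pt N → Mat N
  p : Pt N → Pt N
  K : Pt N → Mat N
  Kt : Pt N → Mat N

namespace SliceData

variable {N : ℕ}

/-- The spatial metric `γ = eᵀ e`. -/
def γ (s : SliceData N) (y : Pt N) : Mat N := gram (s.e y)

/-- The spatial metric `φ = mᵀ m`. -/
def φ (s : SliceData N) (y : Pt N) : Mat N := gram (s.m y)

/-- The boost parameter `𝗇 = e⁻¹ v`. -/
def nv (s : SliceData N) (y : Pt N) : Pt N := boostVec (s.e y) (s.p y)

/-- The boost parameter `𝗇̃ = m⁻¹ v`. -/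
def nt (s : SliceData N) (y : Pt N) : Pt N := boostVec (s.m y) (s.p y)

/-- The operator field `U`. -/
def U (β : ℕ → ℝ) (ℓ : ℝ) (s : SliceData N) (y : Pt N) : Mat N := Uop β ℓ (s.e y) (s.m y) (s.p y)

/-- The operator field `Ũ`. -/
def Ut (β : ℕ → ℝ) (ℓ : ℝ) (s : SliceData N) (y : Pt N) : Mat N := Utop β ℓ (s.e y) (s.m y) (s.p y)

/-- `U^i_j (D_i 𝗇^j - K^j_i) + Ũ^i_j (D̃_i 𝗇̃^j + K̃^j_i)`. -/
def lhs (β : ℕ → ℝ) (ℓ : ℝ) (s : SliceData N) (y : Pt N) : ℝ :=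
  (∑ i, ∑ j, s.U β ℓ y i j * (covDeriv s.γ s.nv y i j - ((s.γ y)⁻¹ * s.K y) j i))
  + ∑ i, ∑ j, s.Ut β ℓ y i j * (covDeriv s.φ s.nt y i j + ((s.φ y)⁻¹ * s.Kt y) j i)

/-- `D_i [U^i_j 𝗇^j]`. -/
def rhs (β : ℕ → ℝ) (ℓ : ℝ) (s : SliceData N) (y : Pt N) : ℝ :=
  divVector s.γ (fun z => (s.U β ℓ z).mulVec (s.nv z)) y

/-- `½ D_i [U^i_j 𝗇^j] + ½ D̃_i [Ũ^i_j 𝗇̃^j]`. -/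
def symLhs (β : ℕ → ℝ) (ℓ : ℝ) (s : SliceData N) (y : Pt N) : ℝ :=
  1 / 2 * divVector s.γ (fun z => (s.U β ℓ z).mulVec (s.nv z)) y
  + 1 / 2 * divVector s.φ (fun z => (s.Ut β ℓ z).mulVec (s.nt z)) y

/-- `U^i_j (D_i 𝗇^j - ½ (∂_i √γ / √γ) 𝗇^j - K^j_i)
  + Ũ^i_j (D̃_i 𝗇̃^j + ½ (∂_i √φ / √φ) 𝗇̃^j + K̃^j_i)`. -/
def symRhs (β : ℕ → ℝ) (ℓ : ℝ) (s : SliceData N) (y : Pt N) : ℝ :=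
  (∑ i, ∑ j, s.U β ℓ y i j * (covDeriv s.γ s.nv y i j
    - 1 / 2 * (pd i (fun z => sqrtDet (s.γ z)) y / sqrtDet (s.γ y)) * s.nv y j
    - ((s.γ y)⁻¹ * s.K y) j i))
  + ∑ i, ∑ j, s.Ut β ℓ y i j * (covDeriv s.φ s.nt y i j
    + 1 / 2 * (pd i (fun z => sqrtDet (s.φ z)) y / sqrtDet (s.φ y)) * s.nt y j
    + ((s.φ y)⁻¹ * s.Kt y) j i)

/-- The same slice with the roles of the two metrics exchanged. The boost from the first to the
second metric changes its sign. -/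
def dual (s : SliceData N) : SliceData N where
  e := s.m
  m := s.e
  p := fun y => -s.p y
  K := s.Kt
  Kt := s.K

end SliceData

/-- The exchanged parameters `βₙ ↦ β_{d-n}`, `d = N + 1`. -/
def dualBeta (N : ℕ) (β : ℕ → ℝ) (n : ℕ) : ℝ := β (N + 1 - n)

/-! ### Spacetime fields -/

/-- The fields of the parametrization of two metrics relative to their geometric mean: the lapses
of the two metrics, the shift `q` of the geometric mean, the boost vector `p`, and the spatial
vielbeins `e`, `m`. -/
structure Fields (N : ℕ) where
  lapseG : Pt (N + 1) → ℝ
  lapseF : Pt (N + 1) → ℝ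
  q : Pt (N + 1) → Pt N
  p : Pt (N + 1) → Pt N
  e : Pt (N + 1) → Mat N
  m : Pt (N + 1) → Mat N

namespace Fields

variable {N : ℕ}

/-- On `Ω` the fields are continuously differentiable, the lapses are positive, and `χ = eᵀ Λ m` is
symmetric and positive definite (so `e` and `m` are invertible). -/
structure Admissible (c : Fields N) (Ω : Set (Pt (N + 1))) : Prop where
  lapseG_diff : ContDiffOn ℝ 1 c.lapseG Ω
  lapseF_diff : ContDiffOn ℝ 1 c.lapseF Ω
  q_diff : ContDiffOn ℝ 1 c.q Ω
  p_diff : ContDiffOn ℝ 1 c.p Ω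
  e_diff : ∀ i j, ContDiffOn ℝ 1 (fun x => c.e x i j) Ω
  m_diff : ∀ i j, ContDiffOn ℝ 1 (fun x => c.m x i j) Ω
  lapseG_pos : ∀ x ∈ Ω, 0 < c.lapseG x
  lapseF_pos : ∀ x ∈ Ω, 0 < c.lapseF x
  chi_posDef : ∀ x ∈ Ω, (chi (c.e x) (c.m x) (c.p x)).PosDef

/-- The metric `g`, with lapse `N`, shift `q + N e⁻¹ v` and spatial metric `eᵀ e`. -/
def g (c : Fields N) (x : Pt (N + 1)) : Mat (N + 1) :=
  metricOf (c.lapseG x) (c.q x + c.lapseG x • boostVec (c.e x) (c.p x)) (gram (c.e x))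

/-- The metric `f`, with lapse `M`, shift `q - M m⁻¹ v` and spatial metric `mᵀ m`. -/
def f (c : Fields N) (x : Pt (N + 1)) : Mat (N + 1) :=
  metricOf (c.lapseF x) (c.q x - c.lapseF x • boostVec (c.m x) (c.p x)) (gram (c.m x))

/-- `S = (g⁻¹ f)^{1/2}`. -/
def S (c : Fields N) (x : Pt (N + 1)) : Mat (N + 1) := principalSqrt ((c.g x)⁻¹ * c.f x)

/-- The geometric mean metric `h = g S = g (g⁻¹ f)^{1/2}`. -/
def h (c : Fields N) (x : Pt (N + 1)) : Mat (N + 1) := c.g x * c.S x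

/-- The Hassan–Rosen potential `V(S) = -ℓ⁻² ∑ₙ βₙ eₙ(S)`. -/
def V (β : ℕ → ℝ) (ℓ : ℝ) (c : Fields N) (x : Pt (N + 1)) : ℝ :=
  span N β ℓ fun n => esym n (c.S x)

/-- The effective stress-energy tensor `V_g = -ℓ⁻² ∑ₙ βₙ Yₙ(S)`, as an operator `V_g^μ_ν`. -/
def Vg (β : ℕ → ℝ) (ℓ : ℝ) (c : Fields N) (x : Pt (N + 1)) : Mat (N + 1) :=
  span N β ℓ fun n => Ypol n (c.S x)

/-- `∇_μ V_g^μ_ν`, with the covariant derivative of `g`. -/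
def divVg (β : ℕ → ℝ) (ℓ : ℝ) (c : Fields N) (x : Pt (N + 1)) (ν : Fin (N + 1)) : ℝ :=
  divOperator c.g (c.Vg β ℓ) x ν

/-- The projection `n_h^ν ∇_μ V_g^μ_ν` onto the unit normal relative to the geometric mean. -/
def normalProj (β : ℕ → ℝ) (ℓ : ℝ) (c : Fields N) (x : Pt (N + 1)) : ℝ :=
  ∑ ν, unitNormal (c.h x) ν * c.divVg β ℓ x ν

/-- The fields induced on the slice `x⁰ = t`. -/
def slice (c : Fields N) (t : ℝ) : SliceData N where
  e := fun y => c.e (Fin.cons t y)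
  m := fun y => c.m (Fin.cons t y)
  p := fun y => c.p (Fin.cons t y)
  K := fun y => extrinsicCurv c.g (Fin.cons t y)
  Kt := fun y => extrinsicCurv c.f (Fin.cons t y)

end Fields

/-! ### Hamiltonian formalism on one slice

The canonical Hamiltonian density is
`-(N C + M C̃ + q^i (R_i + R̃_i))`, with canonical pairs `(γ_ij, π^ij)` and `(φ_ij, ϖ^ij)`: the shifts
of the two metrics are `q^i + N 𝗇^i` and `q^i - M 𝗇̃^i`, and `√-g V(S) = √γ (N 𝒱 + M 𝒱̃)`. The variables
`N`, `M`, `q^i` and `𝗇^i` have no conjugate momenta; they are independent of the canonical pairs. -/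

/-- A phase space point: spatial metrics `γ_ij`, `φ_ij` and momentum densities `π^ij`, `ϖ^ij`. -/
structure Phase (N : ℕ) where
  γ : Pt N → Mat N
  π : Pt N → Mat N
  φ : Pt N → Mat N
  ϖ : Pt N → Mat N

/-- `λ = (1 - 𝗇ᵀ γ 𝗇)^{-1/2}`. -/
def phLorentz {N : ℕ} (γ : Mat N) (n : Pt N) : ℝ :=
  (Real.sqrt (1 - dotProduct n (γ.mulVec n)))⁻¹

/-- `D̃ = ((γ⁻¹ - 𝗇 𝗇ᵀ) φ)^{1/2}`. -/
def phD {N : ℕ} (γ φ : Mat N) (n : Pt N) : Mat N :=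
  principalSqrt ((γ⁻¹ - Matrix.vecMulVec n n) * φ)

/-- `B = (I + λ² 𝗇 𝗇ᵀ γ) D̃`. -/
def phB {N : ℕ} (γ φ : Mat N) (n : Pt N) : Mat N :=
  (1 + phLorentz γ n ^ 2 • (Matrix.vecMulVec n n * γ)) * phD γ φ n

/-- `𝗇̃ = λ⁻¹ D̃⁻¹ 𝗇`. -/
def phNt {N : ℕ} (γ φ : Mat N) (n : Pt N) : Pt N :=
  (phLorentz γ n)⁻¹ • (phD γ φ n)⁻¹.mulVec n

/-- The coefficient of `N` in `N V(S)`: `𝒱 = -ℓ⁻² ∑ₙ βₙ eₙ(D̃)`. -/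
def phV {N : ℕ} (β : ℕ → ℝ) (ℓ : ℝ) (γ φ : Mat N) (n : Pt N) : ℝ :=
  span N β ℓ fun k => esym k (phD γ φ n)

/-- The coefficient of `M` in `N V(S)`: `𝒱̃ = -ℓ⁻² ∑ₙ βₙ λ⁻¹ eₙ₋₁(B)`. -/
def phVt {N : ℕ} (β : ℕ → ℝ) (ℓ : ℝ) (γ φ : Mat N) (n : Pt N) : ℝ :=
  span N β ℓ fun k => (phLorentz γ n)⁻¹ * esymPred k (phB γ φ n)

/-- The momentum `π^ij = -(√γ / 2κ) (K^ij - K γ^ij)` conjugate to `γ_ij` for the Einstein–Hilbert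
Lagrangian `√-g R_g / 2κ`. -/
def momentumOf {N : ℕ} (κ : ℝ) (γ K : Mat N) : Mat N :=
  -(sqrtDet γ / (2 * κ)) • (γ⁻¹ * K * γ⁻¹ - (γ⁻¹ * K).trace • γ⁻¹)

/-- The Einstein–Hilbert coefficient of the lapse,
`R⁰ = (√γ / 2κ) R - (2κ / √γ) (π_ij π^ij - π² / (N - 1))`. -/
def superHam {N : ℕ} (κ : ℝ) (γ π : Pt N → Mat N) (y : Pt N) : ℝ :=
  sqrtDet (γ y) / (2 * κ) * scalarCurv γ y
  - 2 * κ / sqrtDet (γ y) *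
    ((γ y * π y * γ y * π y).trace - (γ y * π y).trace ^ 2 / ((N : ℝ) - 1))

/-- The Einstein–Hilbert coefficient of the shift, `R_i = 2 γ_ij D_k π^jk`, where `π` is a density
of weight one. -/
def superMom {N : ℕ} (γ π : Pt N → Mat N) (y : Pt N) (i : Fin N) : ℝ :=
  2 * ∑ j, γ y i j *
    ∑ k, (pd k (fun z => π z j k) y + ∑ l, christoffel γ y j k l * π y k l)

/-- The constraint `C = R⁰ + R_i 𝗇^i + √γ 𝒱` (the coefficient of the lapse of `g`), smeared with a
test function `ξ`. -/
def constraintG {N : ℕ} (β : ℕ → ℝ) (ℓ κg : ℝ) (A : Set (Pt N)) (n : Pt N → Pt N) (ξ : Pt N → ℝ)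
    (z : Phase N) : ℝ :=
  ∫ y in A, ξ y * (superHam κg z.γ z.π y + (∑ i, superMom z.γ z.π y i * n y i)
    + sqrtDet (z.γ y) * phV β ℓ (z.γ y) (z.φ y) (n y))

/-- The constraint `C̃ = R̃⁰ - R̃_i 𝗇̃^i + √γ 𝒱̃` (the coefficient of the lapse of `f`), smeared with a
test function `ζ`. -/
def constraintF {N : ℕ} (β : ℕ → ℝ) (ℓ κf : ℝ) (A : Set (Pt N)) (n : Pt N → Pt N) (ζ : Pt N → ℝ)
    (z : Phase N) : ℝ :=
  ∫ y in A, ζ y * (superHam κf z.φ z.ϖ y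
    - (∑ i, superMom z.φ z.ϖ y i * phNt (z.γ y) (z.φ y) (n y) i)
    + sqrtDet (z.γ y) * phVt β ℓ (z.γ y) (z.φ y) (n y))

/-- Smooth functions with compact support in `A`. -/
def IsTest {N : ℕ} (A : Set (Pt N)) (ξ : Pt N → ℝ) : Prop :=
  ContDiff ℝ ∞ ξ ∧ HasCompactSupport ξ ∧ tsupport ξ ⊆ A

/-- `E` is the functional derivative `δF/δu` on `A` of a functional `F` of a symmetric matrix field
`u`: `d/ds F(u + s η) = ∫_A E · η` at `s = 0`, for all symmetric test variations `η`. -/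
def HasFunctionalDeriv {N : ℕ} (A : Set (Pt N)) (F : (Pt N → Mat N) → ℝ) (u E : Pt N → Mat N) :
    Prop :=
  (∀ i j, ContinuousOn (fun y => E y i j) A) ∧ (∀ y ∈ A, (E y).IsSymm) ∧
    ∀ η : Pt N → Mat N, (∀ i j, IsTest A fun y => η y i j) → (∀ y, (η y).IsSymm) →
      HasDerivAt (fun s : ℝ => F fun y => u y + s • η y)
        (∫ y in A, ∑ i, ∑ j, E y i j * η y i j) 0

open Classical in
/-- The functional derivative `δF/δu` on `A` (zero if there is none). -/
def functionalDeriv {N : ℕ} (A : Set (Pt N)) (F : (Pt N → Mat N) → ℝ) (u : Pt N → Mat N) :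
    Pt N → Mat N :=
  if h : ∃ E, HasFunctionalDeriv A F u E then h.choose else 0

/-- The canonical Poisson bracket
`{F, G} = ∫_A (δF/δγ δG/δπ - δF/δπ δG/δγ + δF/δφ δG/δϖ - δF/δϖ δG/δφ)`. -/
def poisson {N : ℕ} (A : Set (Pt N)) (F G : Phase N → ℝ) (z : Phase N) : ℝ :=
  let dγ := fun H : Phase N → ℝ => functionalDeriv A (fun u => H { z with γ := u }) z.γ
  let dπ := fun H : Phase N → ℝ => functionalDeriv A (fun u => H { z with π := u }) z.π
  let dφ := fun H : Phase N → ℝ => functionalDeriv A (fun u => H { z with φ := u }) z.φ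
  let dϖ := fun H : Phase N → ℝ => functionalDeriv A (fun u => H { z with ϖ := u }) z.ϖ
  ∫ y in A, ∑ i, ∑ j, (dγ F y i j * dπ G y i j - dπ F y i j * dγ G y i j
    + dφ F y i j * dϖ G y i j - dϖ F y i j * dφ G y i j)

namespace SliceData

variable {N : ℕ}

/-- On `A` the data are smooth, `χ = eᵀ Λ m` is symmetric and positive definite, and `K`, `K̃` are
symmetric. -/
structure Admissible (s : SliceData N) (A : Set (Pt N)) : Prop where
  e_smooth : ∀ i j, ContDiffOn ℝ ∞ (fun y => s.e y i j) A
  m_smooth : ∀ i j, ContDiffOn ℝ ∞ (fun y => s.m y i j) A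
  p_smooth : ContDiffOn ℝ ∞ s.p A
  K_smooth : ∀ i j, ContDiffOn ℝ ∞ (fun y => s.K y i j) A
  Kt_smooth : ∀ i j, ContDiffOn ℝ ∞ (fun y => s.Kt y i j) A
  chi_posDef : ∀ y ∈ A, (chi (s.e y) (s.m y) (s.p y)).PosDef
  K_symm : ∀ y ∈ A, (s.K y).IsSymm
  Kt_symm : ∀ y ∈ A, (s.Kt y).IsSymm

/-- The phase space point of the slice. -/
def phase (κg κf : ℝ) (s : SliceData N) : Phase N where
  γ := s.γ
  π := fun y => momentumOf κg (s.γ y) (s.K y)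
  φ := s.φ
  ϖ := fun y => momentumOf κf (s.φ y) (s.Kt y)

/-- The energy flux covector `j_i = -γ_ij (Q Ũ)^j_k 𝗇^k`. -/
def flux (β : ℕ → ℝ) (ℓ : ℝ) (s : SliceData N) (y : Pt N) : Pt N :=
  -(s.γ y).mulVec ((Qop (s.e y) (s.p y) * s.Ut β ℓ y).mulVec (s.nv y))

/-- The vector constraints on `A`: `R_i + √γ j_i = 0` (from the variation of `𝗇`) and
`R_i + R̃_i = 0` (from the variation of `q`). -/
def VectorConstraints (β : ℕ → ℝ) (ℓ κg κf : ℝ) (s : SliceData N) (A : Set (Pt N)) : Prop :=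
  ∀ y ∈ A, ∀ i,
    superMom (s.phase κg κf).γ (s.phase κg κf).π y i + sqrtDet (s.γ y) * s.flux β ℓ y i = 0 ∧
    superMom (s.phase κg κf).γ (s.phase κg κf).π y i
      + superMom (s.phase κg κf).φ (s.phase κg κf).ϖ y i = 0

/-- `{C[ξ], C̃[ζ]}` on the slice. -/
def bracket (β : ℕ → ℝ) (ℓ κg κf : ℝ) (s : SliceData N) (A : Set (Pt N)) (ξ ζ : Pt N → ℝ) : ℝ :=
  poisson A (constraintG β ℓ κg A s.nv ξ) (constraintF β ℓ κf A s.nv ζ) (s.phase κg κf)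

/-- The secondary constraint on `A`: the time derivative of the primary constraint `C` under the
Hamiltonian flow, which comes from the term `M C̃` of the Hamiltonian, vanishes, that is
`{C[ξ], C̃[ζ]} = 0` for all test functions `ξ`, `ζ`. -/
def SecondaryConstraint (β : ℕ → ℝ) (ℓ κg κf : ℝ) (s : SliceData N) (A : Set (Pt N)) : Prop :=
  ∀ ξ ζ : Pt N → ℝ, IsTest A ξ → IsTest A ζ → s.bracket β ℓ κg κf A ξ ζ = 0

end SliceData

end Bimetric

end

open scoped Topology
open Bimetric

open scoped ContDiff Topology

namespace Bimetric

open Matrix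

/-! ### Generating functions of `eₙ` and `Yₙ` -/

section GeneratingFunctions

variable {D : ℕ}

/-! Sums over `n` are handled by generating functions. Only finitely many `βₙ` enter, so `-ℓ⁻² βₙ =
∑ⱼ cⱼ sⱼⁿ` with positive nodes `sⱼ` (`exists_isMoment`). Every sum of `eₙ` becomes `∑ cⱼ det (1 + sⱼ
X)` and every sum of `Yₙ` becomes `∑ cⱼ adj (1 + sⱼ X)`, which leaves the algebra of a single matrix
`1 + s X`.

`BoostRel` isolates this algebra. With `D = (γ⁻¹ - n nᵀ) χ` and `B = γ⁻¹ χ` one has `χ D = φ`, `γ B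
= χ`, and `B = D + n (χ n)ᵀ` is a rank one perturbation. Hence `adj (1 + s B) n = adj (1 + s D) n`,
and the two currents `U n` and `Ũ ñ` coincide (`BoostRel.current_eq`). Exchanging the metrics
replaces `D` by `B⁻¹` and `B` by `D⁻¹` (`BoostRel.dual`).

In the frame `(∂ₜ - qⁱ ∂ᵢ, ∂ᵢ)` the root `S` is an explicit block matrix with `g S = h` and `h S =
f`. It is principal by Lyapunov's criterion (`re_pos_of_formPos`) and unique because a Sylvester
equation has only the zero solution. The adjugate of `1 + s S` is explicit as well
(`BoostRel.adjugate_frame`) and gives the blocks of `V_g`.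

For the projected law, `∇_μ V_g^μ_ν` is contracted with `W = ∂ₜ - qⁱ ∂ᵢ`, which is parallel to
`n_h`. Derivatives of the potential cancel by its variation formula (`fderiv_potV_relD`). The
remaining `W`-derivatives of `γ` and `φ` are extrinsic curvatures up to gradients of the shifts, and
the gradients of both lapses cancel because the current is common. What is left is `-M F`, and `F`
contains slice data only. The symmetric form also rests on the common current: its divergences for
`γ` and `φ` differ by the logarithmic derivative of the volume ratio. Duality exchanges `U` and `Ũ`
up to the factor `√γ / √φ`.

For the bracket, `C` does not contain `ϖ` and `C̃` does not contain `π`, so no variation of the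
curvature is needed. The momentum derivatives are `2 ξ K - ℒ_{ξ n} γ` and its analogue for `φ`; the
metric derivatives are `½ ξ √γ Ũ φ⁻¹` and `½ ζ √γ U γ⁻¹`. In the latter the dependence of `ñ` on `γ`
cancels by the vector constraints. The integrand is then `ξ ζ √γ F` plus a divergence
(`SliceData.bracket_density`). Smooth dependence of the potentials on arbitrary nearby metrics comes
from the inverse function theorem for `Z ↦ Z²` (`exists_sqrt_field`). -/

theorem natDegree_det_one_add_X_smul_le (X : Mat D) :
    (Matrix.det (1 + (Polynomial.X : Polynomial ℝ) • X.map Polynomial.C)).natDegree ≤ D := by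
  have h := Polynomial.natDegree_det_X_add_C_le X (1 : Mat D)
  rw [Fintype.card_fin, add_comm] at h
  simpa using h

theorem esym_eq_zero {n : ℕ} (hn : D < n) (X : Mat D) : esym n X = 0 :=
  Polynomial.coeff_eq_zero_of_natDegree_lt ((natDegree_det_one_add_X_smul_le X).trans_lt hn)

/-- Coefficients beyond the degree vanish, so one range of weights serves spatial and spacetime
matrices alike. -/
theorem sum_esym (s : ℝ) (X : Mat D) {n : ℕ} (hn : D ≤ n) :
    ∑ k ∈ Finset.range (n + 1), s ^ k * esym k X = (1 + s • X).det := by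
  have h := Polynomial.eval_eq_sum_range'
    (Nat.lt_succ_of_le ((natDegree_det_one_add_X_smul_le X).trans hn)) s
  have h2 : (1 + (Polynomial.X : Polynomial ℝ) • X.map Polynomial.C).det.eval s
      = (1 + s • X).det := by
    rw [← Polynomial.coe_evalRingHom, RingHom.map_det]
    congr 1
    ext i j
    simp [Matrix.one_apply, apply_ite]
    ring
  rw [← h2, h]
  exact Finset.sum_congr rfl fun k _ => mul_comm _ _

theorem Ypol_zero (X : Mat D) : Ypol 0 X = esym 0 X • 1 := by
  simp [Ypol]

/-- Horner's scheme. Apart from the Cayley–Hamilton theorem this recursion is all that is needed of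
`Yₙ`. -/
theorem Ypol_succ (n : ℕ) (X : Mat D) :
    Ypol (n + 1) X = esym (n + 1) X • 1 - X * Ypol n X := by
  rw [Ypol, Finset.sum_range_succ, Ypol, Finset.mul_sum]
  have h1 : ((-1 : ℝ) ^ (n + 1 + (n + 1)) * esym (n + 1) X) • X ^ (n + 1 - (n + 1))
      = esym (n + 1) X • (1 : Mat D) := by
    rw [Even.neg_one_pow ⟨n + 1, rfl⟩]; simp
  rw [h1, add_comm, sub_eq_add_neg, ← Finset.sum_neg_distrib]
  congr 1
  refine Finset.sum_congr rfl fun k hk => ?_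
  have hk' : k ≤ n := Nat.lt_succ_iff.mp (Finset.mem_range.mp hk)
  rw [Nat.succ_sub hk', pow_succ' X, Matrix.mul_smul, ← neg_smul]
  congr 1
  ring

theorem esym_zero (X : Mat D) : esym 0 X = 1 := by
  have h := sum_esym 0 X (le_refl D)
  rw [Finset.sum_range_succ'] at h
  simpa using h

/-- The Cayley–Hamilton theorem for `Yₙ`. -/
theorem Ypol_card (X : Mat D) : Ypol D X = 0 := by
  -- `det (1 + t X)` is the reversed characteristic polynomial of `-X`, so its coefficients are
  -- those of `X.charpoly` in reverse order, up to sign.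
  have hes : ∀ k ≤ D, esym k X = (-1) ^ k * X.charpoly.coeff (D - k) := by
    intro k hk
    have h1 : esym k X = (-X).charpolyRev.coeff k := by
      rw [esym, Matrix.charpolyRev]
      congr 3
      ext i j
      simp
    have h2 : (-X).charpoly = (-1) ^ D * X.charpoly.comp (-Polynomial.X) := by
      rw [Matrix.charpoly, Matrix.charpoly, ← Polynomial.coe_compRingHom_apply, RingHom.map_det]
      have h3 : (-X).charmatrix
          = -((Polynomial.compRingHom (-Polynomial.X)).mapMatrix X.charmatrix) := by
        ext1 i j
        by_cases hij : i = j
        · subst hij; simp [add_comm]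
        · simp [hij]
      rw [h3, Matrix.det_neg, Fintype.card_fin]
    rw [h1, ← Matrix.reverse_charpoly, Polynomial.coeff_reverse, Matrix.charpoly_natDegree_eq_dim,
      Fintype.card_fin, Polynomial.revAt_le hk, h2]
    have h4 : ((-1 : Polynomial ℝ) ^ D) = Polynomial.C ((-1) ^ D) := by simp
    have h5 : (-Polynomial.X : Polynomial ℝ) = Polynomial.C (-1) * Polynomial.X := by simp
    rw [h4, Polynomial.coeff_C_mul, h5, Polynomial.comp_C_mul_X_coeff, mul_comm (X.charpoly.coeff _),
      ← mul_assoc, ← pow_add]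
    congr 1
    obtain ⟨m, rfl⟩ := Nat.exists_eq_add_of_le hk
    rw [Nat.add_sub_cancel_left, show k + m + m = k + (m + m) by ring, pow_add,
      Even.neg_one_pow ⟨m, rfl⟩, mul_one]
  have hch := Matrix.aeval_self_charpoly X
  rw [Polynomial.aeval_eq_sum_range, Matrix.charpoly_natDegree_eq_dim, Fintype.card_fin,
    ← Finset.sum_range_reflect] at hch
  have : Ypol D X = ((-1 : ℝ) ^ D) • ∑ j ∈ Finset.range (D + 1),
      X.charpoly.coeff (D + 1 - 1 - j) • X ^ (D + 1 - 1 - j) := by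
    rw [Ypol, Finset.smul_sum]
    refine Finset.sum_congr rfl fun k hk => ?_
    have hk' : k ≤ D := Nat.lt_succ_iff.mp (Finset.mem_range.mp hk)
    rw [hes k hk', Nat.add_sub_cancel, smul_smul, pow_add]
    congr 1
    have : ((-1 : ℝ) ^ k) * (-1) ^ k = 1 := by rw [← pow_add, Even.neg_one_pow ⟨k, rfl⟩]
    linear_combination ((-1 : ℝ) ^ D * X.charpoly.coeff (D - k)) * this
  rw [this, hch, smul_zero]

/-- The product telescopes by the recursion. The one remaining top term is removed by
Cayley–Hamilton at `n = D`. -/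
theorem one_add_smul_mul_sum_Ypol (s : ℝ) (X : Mat D) (n : ℕ) :
    (1 + s • X) * ∑ k ∈ Finset.range (n + 1), s ^ k • Ypol k X
      = (∑ k ∈ Finset.range (n + 1), s ^ k * esym k X) • 1 + s ^ (n + 1) • (X * Ypol n X) := by
  induction n with
  | zero => simp [Ypol_zero, esym_zero]
  | succ n ih =>
    rw [Finset.sum_range_succ, Matrix.mul_add, ih, Finset.sum_range_succ _ (n + 1), add_smul,
      add_assoc, add_assoc]
    congr 1
    simp only [Ypol_succ, Matrix.mul_sub, Matrix.mul_smul, Matrix.mul_one, Matrix.add_mul,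
      Matrix.one_mul, Matrix.smul_mul, smul_sub, smul_add, smul_smul, pow_succ s (n + 1)]
    module

/-- Both sides are inverse to `1 + s X` up to the nonzero determinant. The range need only reach `D
- 1`, since `Y_D = 0`. -/
theorem sum_Ypol {s : ℝ} {X : Mat D} (hs : (1 + s • X).det ≠ 0) {n : ℕ} (hn : D ≤ n + 1) :
    ∑ k ∈ Finset.range (n + 1), s ^ k • Ypol k X = (1 + s • X).adjugate := by
  have key : ∑ k ∈ Finset.range (D + 1), s ^ k • Ypol k X = (1 + s • X).adjugate := by
    have h := one_add_smul_mul_sum_Ypol s X D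
    rw [Ypol_card, Matrix.mul_zero, smul_zero, add_zero, sum_esym s X le_rfl] at h
    have h2 := congrArg (fun M => (1 + s • X).adjugate * M) h
    simp only [← Matrix.mul_assoc, Matrix.adjugate_mul, Matrix.smul_mul, Matrix.one_mul,
      Matrix.mul_smul, Matrix.mul_one] at h2
    exact smul_right_injective _ hs h2
  -- Once `Y_D = 0`, the recursion propagates zero, because `eₖ` vanishes beyond the dimension.
  have hz : ∀ k, Ypol (D + k) X = 0 := by
    intro k
    induction k with
    | zero => exact Ypol_card X
    | succ k ih => rw [← add_assoc, Ypol_succ, ih, esym_eq_zero (by omega)]; simp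
  have hD : ∑ k ∈ Finset.range (D + 1), s ^ k • Ypol k X
      = ∑ k ∈ Finset.range D, s ^ k • Ypol k X := by
    rw [Finset.sum_range_succ, Ypol_card, smul_zero, add_zero]
  rw [← key, hD]
  refine (Finset.sum_subset (Finset.range_mono hn) fun k _ hk => ?_).symm
  have hk' : D ≤ k := by simpa using hk
  obtain ⟨m, rfl⟩ := Nat.exists_eq_add_of_le hk'
  rw [hz, smul_zero]

end GeneratingFunctions

/-! ### Reduction to geometric weights -/

/-- The weights `-ℓ⁻² βₙ`, `n ≤ N + 1`, are the moments `∑ⱼ cⱼ sⱼⁿ` of a measure with masses `cⱼ`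
at finitely many positive points `sⱼ`. -/
structure IsMoment (N : ℕ) (β : ℕ → ℝ) (ℓ : ℝ) {K : ℕ} (c s : Fin K → ℝ) : Prop where
  pos : ∀ j, 0 < s j
  eq : ∀ n, n < N + 2 → -((ℓ ^ 2)⁻¹ * β n) = ∑ j, c j * s j ^ n

/-- The nodes `1, …, N + 2` are distinct, so the Vandermonde matrix is invertible. Only distinctness
and positivity of the nodes matter; the masses may have any sign. -/
theorem exists_isMoment (N : ℕ) (β : ℕ → ℝ) (ℓ : ℝ) :
    ∃ c s : Fin (N + 2) → ℝ, IsMoment N β ℓ c s := by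
  let s : Fin (N + 2) → ℝ := fun j => (j : ℝ) + 1
  have hs : Function.Injective s := fun i j h => by
    have : (i : ℝ) = j := by simpa [s] using h
    exact Fin.ext (by exact_mod_cast this)
  have hdet : IsUnit (Matrix.vandermonde s).det :=
    isUnit_iff_ne_zero.mpr (Matrix.det_vandermonde_ne_zero_iff.mpr hs)
  let b : Fin (N + 2) → ℝ := fun n => -((ℓ ^ 2)⁻¹ * β n)
  refine ⟨b ᵥ* (Matrix.vandermonde s)⁻¹, s, fun j => by positivity, fun n hn => ?_⟩
  have h : (b ᵥ* (Matrix.vandermonde s)⁻¹) ᵥ* Matrix.vandermonde s = b := by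
    rw [Matrix.vecMul_vecMul, Matrix.nonsing_inv_mul _ hdet, Matrix.vecMul_one]
  have := congrFun h ⟨n, hn⟩
  simp only [Matrix.vecMul, dotProduct, Matrix.vandermonde_apply] at this ⊢
  exact this.symm

/-- Reversing the order of the weights is the substitution `s ↦ s⁻¹` of the nodes; the masses absorb
the power `s ^ (N + 1)`. -/
theorem IsMoment.dual {N : ℕ} {β : ℕ → ℝ} {ℓ : ℝ} {K : ℕ} {c s : Fin K → ℝ}
    (h : IsMoment N β ℓ c s) :
    IsMoment N (dualBeta N β) ℓ (fun j => c j * s j ^ (N + 1)) fun j => (s j)⁻¹ where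
  pos j := inv_pos.mpr (h.pos j)
  eq n hn := by
    rw [dualBeta, h.eq (N + 1 - n) (by omega)]
    refine Finset.sum_congr rfl fun j _ => ?_
    have hj := (h.pos j).ne'
    obtain ⟨m, hm⟩ := Nat.exists_eq_add_of_le (Nat.lt_succ_iff.mp hn)
    rw [hm, Nat.add_sub_cancel_left, pow_add, inv_pow]
    field_simp

theorem IsMoment.span_eq {N : ℕ} {β : ℕ → ℝ} {ℓ : ℝ} {K : ℕ} {c s : Fin K → ℝ}
    (h : IsMoment N β ℓ c s) {A : Type*} [AddCommGroup A] [Module ℝ A] (a : ℕ → A) :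
    span N β ℓ a = ∑ j, c j • ∑ n ∈ Finset.range (N + 2), s j ^ n • a n := by
  simp only [span, Finset.smul_sum, smul_smul]
  rw [Finset.sum_comm, ← Finset.sum_neg_distrib]
  refine Finset.sum_congr rfl fun n hn => ?_
  rw [← Finset.sum_smul, ← neg_smul, h.eq n (Finset.mem_range.mp hn)]

/-! ### Positive forms, Lyapunov's criterion and the principal square root -/

/-- The quadratic form of `k` is positive definite (`k` need not be symmetric). -/
def FormPos {n : ℕ} (k : Mat n) : Prop := ∀ x : Pt n, x ≠ 0 → 0 < x ⬝ᵥ (k *ᵥ x)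

section Lyapunov

variable {n : ℕ} {k X : Mat n}

theorem FormPos.det_ne_zero (hk : FormPos k) : k.det ≠ 0 := by
  intro h
  obtain ⟨x, hx, hx0⟩ := Matrix.exists_mulVec_eq_zero_iff.mpr h
  have := hk x hx
  rw [hx0, dotProduct_zero] at this
  exact lt_irrefl _ this

theorem FormPos.nonneg (hk : FormPos k) (x : Pt n) : 0 ≤ x ⬝ᵥ (k *ᵥ x) := by
  by_cases h : x = 0
  · simp [h]
  · exact (hk x h).le

/-- A null vector `x` of `1 + s X`, paired with itself by `k`, would give `0 = k(x, x) + s (k X)(x,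
x) > 0`. Positivity of the nodes is needed for this reason. -/
theorem det_one_add_smul_ne_zero (hk : FormPos k) (hkX : FormPos (k * X)) {s : ℝ} (hs : 0 ≤ s) :
    (1 + s • X).det ≠ 0 := by
  intro h
  obtain ⟨x, hx, hx0⟩ := Matrix.exists_mulVec_eq_zero_iff.mpr h
  have h1 : x ⬝ᵥ (k *ᵥ ((1 + s • X) *ᵥ x)) = x ⬝ᵥ (k *ᵥ x) + s * (x ⬝ᵥ ((k * X) *ᵥ x)) := by
    rw [Matrix.add_mulVec, Matrix.one_mulVec, Matrix.smul_mulVec, Matrix.mulVec_add,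
      Matrix.mulVec_smul, Matrix.mulVec_mulVec, dotProduct_add, dotProduct_smul, smul_eq_mul]
  rw [hx0, Matrix.mulVec_zero, dotProduct_zero] at h1
  have := hk x hx
  have := mul_nonneg hs (hkX x hx).le
  linarith

theorem dotProduct_mulVec_comm {k : Mat n} (hk : kᵀ = k) (x y : Pt n) :
    x ⬝ᵥ (k *ᵥ y) = y ⬝ᵥ (k *ᵥ x) := by
  rw [Matrix.dotProduct_mulVec, ← Matrix.mulVec_transpose, hk, dotProduct_comm]

/-- Lyapunov's criterion. For an eigenvector `a + i b` with eigenvalue `z`, the form of `k X` on `a`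
plus that on `b` is `Re z` times the same sum for `k`; the `Im z` terms cancel by symmetry of `k`.
Symmetry of `k X` plays no role. -/
theorem re_pos_of_formPos (hsymm : kᵀ = k) (hk : FormPos k) (hkX : FormPos (k * X)) :
    ∀ z ∈ spectrum ℂ (X.map (algebraMap ℝ ℂ)), 0 < z.re := by
  intro z hz
  rw [Matrix.mem_spectrum_iff_isRoot_charpoly, Polynomial.IsRoot, Matrix.eval_charpoly] at hz
  obtain ⟨v, hv, hv0⟩ := Matrix.exists_mulVec_eq_zero_iff.mpr hz
  set a : Pt n := fun i => (v i).re with ha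
  set b : Pt n := fun i => (v i).im with hb
  have hXv : ∀ i, ∑ j, ((X i j : ℝ) : ℂ) * v j = z * v i := by
    intro i
    have := congrFun hv0 i
    rw [Matrix.sub_mulVec] at this
    simp only [Pi.sub_apply, Pi.zero_apply, Matrix.mulVec, dotProduct, Matrix.map_apply,
      Matrix.scalar_apply, Matrix.diagonal_apply, ite_mul, zero_mul, Finset.sum_ite_eq,
      Finset.mem_univ, if_true, Complex.coe_algebraMap] at this
    linear_combination -this
  have hXa : X *ᵥ a = z.re • a - z.im • b := by
    ext i
    have := congrArg Complex.re (hXv i)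
    simpa [Matrix.mulVec, dotProduct, ha, hb] using this
  have hXb : X *ᵥ b = z.re • b + z.im • a := by
    ext i
    have := congrArg Complex.im (hXv i)
    simpa [Matrix.mulVec, dotProduct, ha, hb] using this
  have h1 : a ⬝ᵥ ((k * X) *ᵥ a) + b ⬝ᵥ ((k * X) *ᵥ b)
      = z.re * (a ⬝ᵥ (k *ᵥ a) + b ⬝ᵥ (k *ᵥ b)) := by
    rw [← Matrix.mulVec_mulVec, ← Matrix.mulVec_mulVec, hXa, hXb]
    simp only [Matrix.mulVec_sub, Matrix.mulVec_add, Matrix.mulVec_smul, dotProduct_sub,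
      dotProduct_add, dotProduct_smul, smul_eq_mul]
    rw [dotProduct_mulVec_comm hsymm a b]
    ring
  have hab : a ≠ 0 ∨ b ≠ 0 := by
    by_contra! hcon
    apply hv
    ext i
    exact Complex.ext (congrFun hcon.1 i) (congrFun hcon.2 i)
  have hpos : 0 < a ⬝ᵥ ((k * X) *ᵥ a) + b ⬝ᵥ ((k * X) *ᵥ b) := by
    rcases hab with h | h
    · exact add_pos_of_pos_of_nonneg (hkX a h) (hkX.nonneg b)
    · exact add_pos_of_nonneg_of_pos (hkX.nonneg a) (hkX b h)
  have hnn : 0 ≤ a ⬝ᵥ (k *ᵥ a) + b ⬝ᵥ (k *ᵥ b) := add_nonneg (hk.nonneg a) (hk.nonneg b)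
  rw [h1] at hpos
  exact pos_of_mul_pos_left hpos hnn

/-- The homogeneous Sylvester equation has no nontrivial solution if the spectra are disjoint. -/
theorem eq_zero_of_mul_add_mul_eq_zero {X Y Z : Mat n}
    (hX : ∀ z ∈ spectrum ℂ (X.map (algebraMap ℝ ℂ)), 0 < z.re)
    (hY : ∀ z ∈ spectrum ℂ (Y.map (algebraMap ℝ ℂ)), 0 < z.re) (h : X * Z + Z * Y = 0) :
    Z = 0 := by
  set φ := (algebraMap ℝ ℂ).mapMatrix (m := Fin n) with hφ
  have hZ : φ X * φ Z = φ Z * (-φ Y) := by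
    rw [← map_mul, mul_neg, ← map_mul, ← map_neg]
    exact congrArg φ (eq_neg_of_add_eq_zero_left h)
  -- The relation `X Z = Z (-Y)` extends to polynomials. For the characteristic polynomial of `-Y`
  -- the right side vanishes, while the left factor is invertible because the spectra of `X` and
  -- `-Y` lie in opposite half planes.
  have hpow : ∀ p : Polynomial ℂ,
      Polynomial.aeval (φ X) p * φ Z = φ Z * Polynomial.aeval (-φ Y) p := by
    intro p
    induction p using Polynomial.induction_on' with
    | add p q hp hq => rw [map_add, map_add, add_mul, mul_add, hp, hq]
    | monomial m a =>
      rw [Polynomial.aeval_monomial, Polynomial.aeval_monomial]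
      have hm : ∀ m : ℕ, φ X ^ m * φ Z = φ Z * (-φ Y) ^ m := by
        intro m
        induction m with
        | zero => simp
        | succ m ih => rw [pow_succ, mul_assoc, hZ, ← mul_assoc, ih, mul_assoc, ← pow_succ]
      rw [mul_assoc, hm, ← mul_assoc, ← mul_assoc, Algebra.commutes]
  have h0 := hpow (-φ Y).charpoly
  rw [Matrix.aeval_self_charpoly, mul_zero] at h0
  have hu : IsUnit (Polynomial.aeval (φ X) (-φ Y).charpoly) := by
    by_contra hnu
    rw [← spectrum.zero_mem_iff ℂ] at hnu
    -- Spectral mapping is applied to a polynomial of positive degree, so dimension zero is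
    -- separate.
    rcases isEmpty_or_nonempty (Fin n) with hn | hn
    · exact (spectrum.zero_mem_iff ℂ).mp hnu (isUnit_of_subsingleton _)
    rw [spectrum.map_polynomial_aeval_of_degree_pos] at hnu
    · obtain ⟨z, hz, hz0⟩ := hnu
      have h1 : z ∈ spectrum ℂ (-φ Y) := Matrix.mem_spectrum_iff_isRoot_charpoly.mpr hz0
      rw [← spectrum.neg_eq, Set.mem_neg] at h1
      have h2 := hX z hz
      have h3 := hY (-z) h1
      rw [Complex.neg_re] at h3
      linarith
    · rw [Matrix.charpoly_degree_eq_dim]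
      exact_mod_cast Fintype.card_pos
  have hz : φ Z = 0 := (hu.mul_right_eq_zero).mp h0
  ext i j
  have := congrFun (congrFun hz i) j
  simpa [hφ] using this

/-- The difference solves a Sylvester equation: `X (X - Y) + (X - Y) Y = X² - Y² = 0`. -/
theorem IsPrincipalSqrt.unique {A X Y : Mat n} (hX : IsPrincipalSqrt A X)
    (hY : IsPrincipalSqrt A Y) : X = Y := by
  refine sub_eq_zero.mp (eq_zero_of_mul_add_mul_eq_zero hX.2 hY.2 ?_)
  rw [mul_sub, sub_mul, hX.1, hY.1]
  abel

theorem IsPrincipalSqrt.principalSqrt_eq {A X : Mat n} (h : IsPrincipalSqrt A X) :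
    principalSqrt A = X := by
  have hex : ∃ X, IsPrincipalSqrt A X := ⟨X, h⟩
  rw [principalSqrt, dif_pos hex]
  exact hex.choose_spec.unique h

end Lyapunov

end Bimetric

namespace Bimetric

open Matrix

/-! ### Algebra of two spatial metrics related by a boost -/

section Adjugate

variable {n : ℕ}

theorem vecMulVec_mulVec' (u w x : Pt n) : vecMulVec u w *ᵥ x = (w ⬝ᵥ x) • u := by
  ext i
  simp only [Matrix.mulVec, dotProduct, vecMulVec_apply, Pi.smul_apply, smul_eq_mul, Finset.sum_mul]
  exact Finset.sum_congr rfl fun _ _ => by ring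

theorem vecMulVec_mul' (u w : Pt n) (M : Mat n) : vecMulVec u w * M = vecMulVec u (Mᵀ *ᵥ w) := by
  ext i j
  simp only [Matrix.mul_apply, Matrix.mulVec, dotProduct, vecMulVec_apply, Finset.mul_sum,
    Matrix.transpose_apply]
  exact Finset.sum_congr rfl fun _ _ => by ring

theorem mul_vecMulVec' (u w : Pt n) (M : Mat n) : M * vecMulVec u w = vecMulVec (M *ᵥ u) w := by
  ext i j
  simp [Matrix.mul_apply, Matrix.mulVec, dotProduct, vecMulVec_apply, Finset.sum_mul, mul_assoc]

/-- An operator selfadjoint for `k` has a selfadjoint adjugate: sandwich the relation between the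
two adjugates and cancel the determinant. The symmetry of `V_g`, `U` and `Ũ` comes from here. -/
theorem adjugate_mul_comm {k X : Mat n} (hX : X.det ≠ 0) (h : k * X = Xᵀ * k) :
    k * X.adjugate = X.adjugateᵀ * k := by
  have h1 : X.det • (k * X.adjugate) = X.det • (X.adjugateᵀ * k) := by
    have h2 : X.adjugateᵀ * (k * X) * X.adjugate = X.adjugateᵀ * (Xᵀ * k) * X.adjugate := by rw [h]
    have h3 : X.adjugateᵀ * Xᵀ = X.det • 1 := by
      rw [← Matrix.transpose_mul, Matrix.mul_adjugate, Matrix.transpose_smul, Matrix.transpose_one]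
    rw [Matrix.mul_assoc, Matrix.mul_assoc k, Matrix.mul_adjugate, ← Matrix.mul_assoc _ Xᵀ, h3,
      Matrix.mul_smul, Matrix.mul_smul, Matrix.mul_one, Matrix.smul_mul, Matrix.smul_mul,
      Matrix.one_mul] at h2
    exact h2.symm
  exact smul_right_injective _ hX h1

/-- Selfadjointness of an operator is turned into symmetry of the tensor with raised index, which is
the form needed for contractions with Christoffel symbols. -/
theorem mul_inv_symm_of_comm {k U : Mat n} (hk : IsUnit k.det) (hks : kᵀ = k) (hU : k * U = Uᵀ * k) :
    (U * k⁻¹)ᵀ = U * k⁻¹ := by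
  rw [Matrix.transpose_mul, Matrix.transpose_nonsing_inv, hks]
  calc k⁻¹ * Uᵀ = k⁻¹ * (Uᵀ * k) * k⁻¹ := by
        rw [Matrix.mul_assoc, Matrix.mul_assoc, Matrix.mul_nonsing_inv _ hk, Matrix.mul_one]
    _ = U * k⁻¹ := by rw [← hU, ← Matrix.mul_assoc, Matrix.nonsing_inv_mul _ hk, Matrix.one_mul]

theorem mul_one_add_smul_comm {k X : Mat n} (h : k * X = Xᵀ * k) (s : ℝ) :
    k * (1 + s • X) = (1 + s • X)ᵀ * k := by
  simp [mul_add, add_mul, h]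

theorem adjugate_one_add_smul_commute (X : Mat n) (s : ℝ) :
    X * (1 + s • X).adjugate = (1 + s • X).adjugate * X := by
  by_cases hs : s = 0
  · simp [hs]
  · have h := (Matrix.mul_adjugate (1 + s • X)).trans (Matrix.adjugate_mul (1 + s • X)).symm
    rw [Matrix.add_mul, Matrix.mul_add, Matrix.one_mul, Matrix.mul_one, Matrix.smul_mul,
      Matrix.mul_smul] at h
    exact smul_right_injective _ hs (add_left_cancel h)

/-- The matrix determinant lemma. -/
theorem det_add_vecMulVec {X : Mat n} (hX : X.det ≠ 0) (u w : Pt n) :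
    (X + vecMulVec u w).det = X.det + w ⬝ᵥ (X.adjugate *ᵥ u) := by
  have h1 : X + vecMulVec u w = X * (1 + replicateCol Unit (X⁻¹ *ᵥ u) * replicateRow Unit w) := by
    rw [← vecMulVec_eq, mul_add, mul_one, mul_vecMulVec', Matrix.mulVec_mulVec,
      Matrix.mul_nonsing_inv _ (isUnit_iff_ne_zero.mpr hX), Matrix.one_mulVec]
  rw [h1, Matrix.det_mul, Matrix.det_one_add_replicateCol_mul_replicateRow, Matrix.inv_def,
    Ring.inverse_eq_inv', Matrix.smul_mulVec, dotProduct_smul, smul_eq_mul]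
  field_simp

/-- The adjugate of a rank one perturbation `X + u wᵀ`, applied to `u`. -/
theorem adjugate_add_vecMulVec_mulVec {X : Mat n} (hX : X.det ≠ 0) {u w : Pt n}
    (hX' : (X + vecMulVec u w).det ≠ 0) :
    (X + vecMulVec u w).adjugate *ᵥ u = X.adjugate *ᵥ u := by
  -- By the matrix determinant lemma the factor produced is exactly the perturbed determinant, which
  -- the perturbed adjugate then reproduces and which cancels.
  have h1 : (X + vecMulVec u w) *ᵥ (X.adjugate *ᵥ u) = (X + vecMulVec u w).det • u := by
    rw [det_add_vecMulVec hX, Matrix.add_mulVec, Matrix.mulVec_mulVec, Matrix.mul_adjugate,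
      Matrix.smul_mulVec, Matrix.one_mulVec, vecMulVec_mulVec', add_smul]
  have h2 := congrArg (fun x => (X + vecMulVec u w).adjugate *ᵥ x) h1
  simp only [Matrix.mulVec_mulVec (M := (X + vecMulVec u w).adjugate), Matrix.mulVec_smul,
    Matrix.adjugate_mul, Matrix.smul_mulVec, Matrix.one_mulVec] at h2
  exact (smul_right_injective _ hX' h2).symm

end Adjugate

variable {N : ℕ}

/-- `D = (γ⁻¹ - n nᵀ) χ`. -/
noncomputable def relD (γ χ : Mat N) (n : Pt N) : Mat N := (γ⁻¹ - vecMulVec n n) * χ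

/-- `B = γ⁻¹ χ`. -/
noncomputable def relB (γ χ : Mat N) : Mat N := γ⁻¹ * χ

/-- Two spatial metrics `γ`, `φ` with the metric `χ` of their geometric mean, the boost parameters
`n`, `n'` relative to the vielbeins of `γ` and `φ`, and the Lorentz factor. -/
structure BoostRel (γ φ χ : Mat N) (n nt : Pt N) (lam : ℝ) : Prop where
  γ_symm : γᵀ = γ
  χ_symm : χᵀ = χ
  γ_pos : FormPos γ
  φ_pos : FormPos φ
  χ_pos : FormPos χ
  lam_pos : 0 < lam
  φ_eq : φ = χ * (γ⁻¹ - vecMulVec n n) * χ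
  lam_eq : lam ^ 2 * (1 - n ⬝ᵥ (γ *ᵥ n)) = 1
  nt_eq : φ *ᵥ nt = lam⁻¹ • (χ *ᵥ n)

namespace BoostRel

variable {γ φ χ : Mat N} {n nt : Pt N} {lam : ℝ} (h : BoostRel γ φ χ n nt lam)

include h

theorem γ_unit : IsUnit γ.det := isUnit_iff_ne_zero.mpr h.γ_pos.det_ne_zero
theorem φ_unit : IsUnit φ.det := isUnit_iff_ne_zero.mpr h.φ_pos.det_ne_zero
theorem χ_unit : IsUnit χ.det := isUnit_iff_ne_zero.mpr h.χ_pos.det_ne_zero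

theorem γinv_symm : (γ⁻¹)ᵀ = γ⁻¹ := by rw [Matrix.transpose_nonsing_inv, h.γ_symm]

theorem φ_symm : φᵀ = φ := by
  rw [h.φ_eq, Matrix.transpose_mul, Matrix.transpose_mul, Matrix.transpose_sub, h.γinv_symm,
    h.χ_symm, Matrix.transpose_vecMulVec, Matrix.mul_assoc]

theorem χ_mul_relD : χ * relD γ χ n = φ := by rw [h.φ_eq, relD, Matrix.mul_assoc]

theorem γ_mul_relB : γ * relB γ χ = χ := by
  rw [relB, ← Matrix.mul_assoc, Matrix.mul_nonsing_inv _ h.γ_unit, Matrix.one_mul]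

/-- Every comparison between determinants or adjugates of `B` and `D` rests on this rank one
difference in the direction `n`. -/
theorem relB_eq : relB γ χ = relD γ χ n + vecMulVec n (χ *ᵥ n) := by
  rw [relB, relD, Matrix.sub_mul, vecMulVec_mul', h.χ_symm, sub_add_cancel]

theorem relD_unit : IsUnit (relD γ χ n).det := by
  have := h.φ_unit
  rw [← h.χ_mul_relD, Matrix.det_mul] at this
  exact isUnit_of_mul_isUnit_right this

theorem relB_unit : IsUnit (relB γ χ).det := by
  have := h.χ_unit
  rw [← h.γ_mul_relB, Matrix.det_mul] at this
  exact isUnit_of_mul_isUnit_right this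

theorem formPos_χ_mul_relD : FormPos (χ * relD γ χ n) := by rw [h.χ_mul_relD]; exact h.φ_pos

/-- Since `γ B = χ`, the form of `χ B` at `x` is that of `γ` at `B x`. -/
theorem formPos_χ_mul_relB : FormPos (χ * relB γ χ) := by
  intro x hx
  have h1 : x ⬝ᵥ ((χ * relB γ χ) *ᵥ x) = (relB γ χ *ᵥ x) ⬝ᵥ (γ *ᵥ (relB γ χ *ᵥ x)) := by
    rw [Matrix.mulVec_mulVec, h.γ_mul_relB, ← Matrix.mulVec_mulVec,
      dotProduct_mulVec_comm h.χ_symm]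
  rw [h1]
  refine h.γ_pos _ fun h0 => hx ?_
  exact Matrix.eq_zero_of_mulVec_eq_zero h.relB_unit.ne_zero h0

theorem det_relD {s : ℝ} (hs : 0 ≤ s) : (1 + s • relD γ χ n).det ≠ 0 :=
  det_one_add_smul_ne_zero h.χ_pos h.formPos_χ_mul_relD hs

theorem det_relB {s : ℝ} (hs : 0 ≤ s) : (1 + s • relB γ χ).det ≠ 0 :=
  det_one_add_smul_ne_zero h.χ_pos h.formPos_χ_mul_relB hs

/-- The square is immediate from `φ_eq`; the spectral condition is Lyapunov's criterion with the
form `χ`, as `χ D = φ` is positive. -/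
theorem isPrincipalSqrt_relD :
    IsPrincipalSqrt ((γ⁻¹ - vecMulVec n n) * φ) (relD γ χ n) := by
  refine ⟨?_, re_pos_of_formPos h.χ_symm h.χ_pos h.formPos_χ_mul_relD⟩
  rw [relD, h.φ_eq]
  simp only [Matrix.mul_assoc]

theorem relD_mulVec_nt : relD γ χ n *ᵥ nt = lam⁻¹ • n := by
  have h1 : χ *ᵥ (relD γ χ n *ᵥ nt) = χ *ᵥ (lam⁻¹ • n) := by
    rw [Matrix.mulVec_mulVec, h.χ_mul_relD, h.nt_eq, Matrix.mulVec_smul]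
  exact Matrix.mulVec_injective_of_isUnit ((Matrix.isUnit_iff_isUnit_det _).mpr h.χ_unit) h1

theorem sub_vecMulVec_mulVec : (γ⁻¹ - vecMulVec n n) *ᵥ (γ *ᵥ n) = (lam ^ 2)⁻¹ • n := by
  have h1 : (lam ^ 2)⁻¹ = 1 - n ⬝ᵥ (γ *ᵥ n) := by
    have := h.lam_pos.ne'
    field_simp
    linarith [h.lam_eq]
  rw [Matrix.sub_mulVec, Matrix.mulVec_mulVec, Matrix.nonsing_inv_mul _ h.γ_unit,
    Matrix.one_mulVec, vecMulVec_mulVec', h1, sub_smul, one_smul]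

theorem χ_mulVec_nt : χ *ᵥ nt = lam • (γ *ᵥ n) := by
  have hl := h.lam_pos.ne'
  have h1 : φ *ᵥ (χ⁻¹ *ᵥ (γ *ᵥ n)) = φ *ᵥ (lam⁻¹ • nt) := by
    rw [Matrix.mulVec_smul, h.nt_eq]
    nth_rewrite 1 [h.φ_eq]
    rw [Matrix.mulVec_mulVec, Matrix.mul_assoc, Matrix.mul_nonsing_inv _ h.χ_unit, Matrix.mul_one,
      ← Matrix.mulVec_mulVec, h.sub_vecMulVec_mulVec, Matrix.mulVec_smul, smul_smul]
    congr 1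
    field_simp
  have h2 := Matrix.mulVec_injective_of_isUnit ((Matrix.isUnit_iff_isUnit_det _).mpr h.φ_unit) h1
  have h3 : nt = lam • (χ⁻¹ *ᵥ (γ *ᵥ n)) := by rw [h2, smul_smul, mul_inv_cancel₀ hl, one_smul]
  rw [h3, Matrix.mulVec_smul, Matrix.mulVec_mulVec, Matrix.mul_nonsing_inv _ h.χ_unit,
    Matrix.one_mulVec]

theorem nt_dotProduct : nt ⬝ᵥ (φ *ᵥ nt) = n ⬝ᵥ (γ *ᵥ n) := by
  have hl := h.lam_pos.ne'
  rw [h.nt_eq, dotProduct_smul, dotProduct_mulVec_comm h.χ_symm, h.χ_mulVec_nt, dotProduct_smul,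
    smul_smul, inv_mul_cancel₀ hl, one_smul]

/-- The exchange keeps `χ` and `λ`. The substance is `φ_eq`: inverting `φ = χ (γ⁻¹ - n nᵀ) χ` as in
the Sherman–Morrison formula gives `χ φ⁻¹ χ = γ + λ² (γ n)(γ n)ᵀ`, and `χ ñ = λ γ n` identifies the
rank one term as `(χ ñ)(χ ñ)ᵀ`. -/
theorem dual : BoostRel φ γ χ nt n lam where
  γ_symm := h.φ_symm
  χ_symm := h.χ_symm
  γ_pos := h.φ_pos
  φ_pos := h.γ_pos
  χ_pos := h.χ_pos
  lam_pos := h.lam_pos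
  lam_eq := by rw [h.nt_dotProduct]; exact h.lam_eq
  nt_eq := by
    rw [h.χ_mulVec_nt, smul_smul, inv_mul_cancel₀ h.lam_pos.ne', one_smul]
  φ_eq := by
    have hl := h.lam_pos.ne'
    have hP : (γ⁻¹ - vecMulVec n n) * (γ + (lam ^ 2) • vecMulVec (γ *ᵥ n) (γ *ᵥ n)) = 1 := by
      rw [Matrix.mul_add, Matrix.mul_smul, mul_vecMulVec', h.sub_vecMulVec_mulVec, Matrix.sub_mul,
        Matrix.nonsing_inv_mul _ h.γ_unit, vecMulVec_mul', h.γ_symm, Matrix.smul_vecMulVec,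
        smul_smul, mul_inv_cancel₀ (pow_ne_zero 2 hl), one_smul, sub_add_cancel]
    have hP2 : (γ⁻¹ - vecMulVec n n) * (χ * φ⁻¹ * χ) = 1 := by
      have h1 : (γ⁻¹ - vecMulVec n n) * χ = χ⁻¹ * φ := by
        have := h.χ_mul_relD
        rw [relD] at this
        rw [← this, Matrix.nonsing_inv_mul_cancel_left _ _ h.χ_unit]
      rw [← Matrix.mul_assoc, ← Matrix.mul_assoc, h1, Matrix.mul_nonsing_inv_cancel_right _ _ h.φ_unit,
        Matrix.nonsing_inv_mul _ h.χ_unit]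
    have h2 : χ * φ⁻¹ * χ = γ + (lam ^ 2) • vecMulVec (γ *ᵥ n) (γ *ᵥ n) := by
      rw [← Matrix.inv_eq_right_inv hP2, ← Matrix.inv_eq_right_inv hP]
    rw [Matrix.mul_sub, Matrix.sub_mul, h2, mul_vecMulVec', vecMulVec_mul', h.χ_symm, h.χ_mulVec_nt,
      Matrix.smul_vecMulVec, Matrix.vecMulVec_smul, smul_smul, ← pow_two, add_sub_cancel_right]

theorem relB_dual : relB φ χ = (relD γ χ n)⁻¹ := by
  rw [relB, ← h.χ_mul_relD, Matrix.mul_inv_rev, Matrix.nonsing_inv_mul_cancel_right _ _ h.χ_unit]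

theorem relD_dual : relD φ χ nt = (relB γ χ)⁻¹ := by
  rw [h.dual.relB_dual, Matrix.nonsing_inv_nonsing_inv _ h.dual.relD_unit]

theorem nt_eq_inv_mulVec : nt = lam⁻¹ • ((relD γ χ n)⁻¹ *ᵥ n) := by
  rw [← Matrix.mulVec_smul, ← h.relD_mulVec_nt, Matrix.mulVec_mulVec,
    Matrix.nonsing_inv_mul _ h.relD_unit, Matrix.one_mulVec]

/-- This matches the phase space definition `phB`, which knows `γ`, `φ`, `n` but not `χ`. The
prefactor turns `γ⁻¹ - n nᵀ` back into `γ⁻¹`. -/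
theorem relB_eq_mul_relD : relB γ χ = (1 + lam ^ 2 • (vecMulVec n n * γ)) * relD γ χ n := by
  have hl : lam ^ 2 * (n ⬝ᵥ (γ *ᵥ n)) = lam ^ 2 - 1 := by linarith [h.lam_eq]
  have h1 : (1 + lam ^ 2 • (vecMulVec n n * γ)) * (γ⁻¹ - vecMulVec n n) = γ⁻¹ := by
    have h2 : vecMulVec n n * γ * γ⁻¹ = vecMulVec n n :=
      Matrix.mul_nonsing_inv_cancel_right _ _ h.γ_unit
    have h3 : vecMulVec n n * γ * vecMulVec n n = (n ⬝ᵥ (γ *ᵥ n)) • vecMulVec n n := by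
      rw [Matrix.mul_assoc, mul_vecMulVec', mul_vecMulVec', vecMulVec_mulVec', Matrix.smul_vecMulVec]
    rw [Matrix.add_mul, Matrix.one_mul, Matrix.smul_mul, Matrix.mul_sub, h2, h3, smul_sub, smul_smul,
      hl]
    module
  rw [relD, ← Matrix.mul_assoc, h1, relB]

theorem χ_comm_relD : χ * relD γ χ n = (relD γ χ n)ᵀ * χ := by
  have h2 : (χ * relD γ χ n)ᵀ = (relD γ χ n)ᵀ * χ := by rw [Matrix.transpose_mul, h.χ_symm]
  rw [← h2, h.χ_mul_relD, h.φ_symm]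

theorem φ_comm_relD : φ * relD γ χ n = (relD γ χ n)ᵀ * φ := by
  conv_lhs => rw [← h.χ_mul_relD, h.χ_comm_relD, Matrix.mul_assoc, h.χ_mul_relD]

theorem γ_comm_relB : γ * relB γ χ = (relB γ χ)ᵀ * γ := by
  have h2 : (γ * relB γ χ)ᵀ = (relB γ χ)ᵀ * γ := by rw [Matrix.transpose_mul, h.γ_symm]
  rw [← h2, h.γ_mul_relB, h.χ_symm]

theorem det_one_add_relB {s : ℝ} (hs : 0 ≤ s) : (1 + s • relB γ χ).det
    = (1 + s • relD γ χ n).det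
      + s * ((χ *ᵥ n) ⬝ᵥ ((1 + s • relD γ χ n).adjugate *ᵥ n)) := by
  have h1 : 1 + s • relB γ χ = 1 + s • relD γ χ n + vecMulVec n (s • (χ *ᵥ n)) := by
    rw [h.relB_eq, smul_add, add_assoc, Matrix.vecMulVec_smul]
  rw [h1, det_add_vecMulVec (h.det_relD hs), smul_dotProduct, smul_eq_mul]

theorem adjugate_relB_mulVec {s : ℝ} (hs : 0 ≤ s) :
    (1 + s • relB γ χ).adjugate *ᵥ n = (1 + s • relD γ χ n).adjugate *ᵥ n := by
  have h1 : 1 + s • relB γ χ = 1 + s • relD γ χ n + vecMulVec n (s • (χ *ᵥ n)) := by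
    rw [h.relB_eq, smul_add, add_assoc, Matrix.vecMulVec_smul]
  have h2 := h.det_relB hs
  rw [h1] at h2 ⊢
  exact adjugate_add_vecMulVec_mulVec (h.det_relD hs) h2

theorem χ_mul_adjugate_relD {s : ℝ} (hs : 0 ≤ s) :
    χ * (1 + s • relD γ χ n).adjugate = (1 + s • relD γ χ n).adjugateᵀ * χ :=
  adjugate_mul_comm (h.det_relD hs) (mul_one_add_smul_comm h.χ_comm_relD s)

theorem γ_mul_adjugate_relB {s : ℝ} (hs : 0 ≤ s) :
    γ * (1 + s • relB γ χ).adjugate = (1 + s • relB γ χ).adjugateᵀ * γ :=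
  adjugate_mul_comm (h.det_relB hs) (mul_one_add_smul_comm h.γ_comm_relB s)

theorem φ_mul_adjugate_relD {s : ℝ} (hs : 0 ≤ s) :
    φ * (1 + s • relD γ χ n).adjugate = (1 + s • relD γ χ n).adjugateᵀ * φ :=
  adjugate_mul_comm (h.det_relD hs) (mul_one_add_smul_comm h.φ_comm_relD s)

/-- `B` is selfadjoint for `χ` as well as for `γ`, since `χ B = χ γ⁻¹ χ`; so `χ` carries the
identity for columns over to rows. -/
theorem adjugate_relB_transpose_mulVec {s : ℝ} (hs : 0 ≤ s) :
    (1 + s • relB γ χ).adjugateᵀ *ᵥ (χ *ᵥ n) = (1 + s • relD γ χ n).adjugateᵀ *ᵥ (χ *ᵥ n) := by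
  have h1 : χ * (1 + s • relB γ χ).adjugate = (1 + s • relB γ χ).adjugateᵀ * χ := by
    refine adjugate_mul_comm (h.det_relB hs) (mul_one_add_smul_comm ?_ s)
    have h2 : χ * relB γ χ = (relB γ χ)ᵀ * γ * relB γ χ := by
      rw [← h.γ_comm_relB, h.γ_mul_relB]
    rw [h2, Matrix.mul_assoc, h.γ_mul_relB]
  rw [Matrix.mulVec_mulVec, Matrix.mulVec_mulVec, ← h1, ← h.χ_mul_adjugate_relD hs,
    ← Matrix.mulVec_mulVec, ← Matrix.mulVec_mulVec, h.adjugate_relB_mulVec hs]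

end BoostRel

/-! ### The potentials and operators for given weights -/

section Weights

variable {K : ℕ} (c s : Fin K → ℝ)

/-- `∑ c det (1 + s D)`. -/
noncomputable def potV (D : Mat N) : ℝ := ∑ j, c j * (1 + s j • D).det

/-- `∑ c adj (1 + s D)`. -/
noncomputable def opX (D : Mat N) : Mat N := ∑ j, c j • (1 + s j • D).adjugate

/-- `∑ c s adj (1 + s B)`. -/
noncomputable def opY (B : Mat N) : Mat N := ∑ j, (c j * s j) • (1 + s j • B).adjugate

/-- `∑ c s det (1 + s B)`. -/
noncomputable def potW (B : Mat N) : ℝ := ∑ j, c j * s j * (1 + s j • B).det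

variable {c s}

/-- The weighted sum of `(1 + s D) adj (1 + s D) = det (1 + s D)`. It splits the spatial block of
`V_g` into `𝒱` times the identity minus `Ũ`. -/
theorem opX_add (D : Mat N) : opX c s D + D * opY c s D = potV c s D • 1 := by
  rw [opX, opY, potV, Finset.mul_sum, ← Finset.sum_add_distrib, Finset.sum_smul]
  refine Finset.sum_congr rfl fun j _ => ?_
  rw [mul_smul (c j) (det _), ← Matrix.mul_adjugate, Matrix.add_mul, Matrix.one_mul, smul_add,
    Matrix.mul_smul, mul_smul, Matrix.smul_mul]

theorem opY_commute (D : Mat N) : D * opY c s D = opY c s D * D := by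
  rw [opY, Finset.mul_sum, Finset.sum_mul]
  refine Finset.sum_congr rfl fun j _ => ?_
  rw [Matrix.mul_smul, Matrix.smul_mul, adjugate_one_add_smul_commute]

theorem IsMoment.sum_det {β : ℕ → ℝ} {ℓ : ℝ} (h : IsMoment N β ℓ c s) {n : ℕ}
    (hn : n ≤ N + 1) (X : Mat n) : span N β ℓ (fun k => esym k X) = potV c s X := by
  rw [h.span_eq, potV]
  refine Finset.sum_congr rfl fun j _ => ?_
  rw [← sum_esym (s j) X hn]
  rfl

theorem IsMoment.sum_adjugate {β : ℕ → ℝ} {ℓ : ℝ} (h : IsMoment N β ℓ c s) {n : ℕ}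
    (hn : n ≤ N + 1) {X : Mat n} (hX : ∀ j, (1 + s j • X).det ≠ 0) :
    span N β ℓ (fun k => Ypol k X) = opX c s X := by
  rw [h.span_eq, opX]
  refine Finset.sum_congr rfl fun j _ => ?_
  rw [← sum_Ypol (hX j) (n := N + 1) (by omega)]

/-- The shift from `Yₙ` to `Yₙ₋₁` costs one factor `sⱼ` in each mass, which is the weight built into
`opY`. -/
theorem IsMoment.sum_pred {β : ℕ → ℝ} {ℓ : ℝ} (h : IsMoment N β ℓ c s) {X : Mat N}
    (hX : ∀ j, (1 + s j • X).det ≠ 0) : span N β ℓ (fun k => YpolPred k X) = opY c s X := by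
  rw [h.span_eq, opY]
  refine Finset.sum_congr rfl fun j _ => ?_
  rw [← sum_Ypol (hX j) (n := N) (by omega), Finset.sum_range_succ', mul_smul]
  simp [YpolPred, Finset.smul_sum, pow_succ', mul_smul]

theorem IsMoment.sum_esymPred {β : ℕ → ℝ} {ℓ : ℝ} (h : IsMoment N β ℓ c s) (X : Mat N) :
    span N β ℓ (fun k => esymPred k X) = potW c s X := by
  rw [h.span_eq, potW]
  refine Finset.sum_congr rfl fun j _ => ?_
  rw [← sum_esym (s j) X (n := N) le_rfl, Finset.sum_range_succ']
  simp [esymPred, Finset.mul_sum, pow_succ', mul_assoc]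

theorem span_smul {A : Type*} [AddCommGroup A] [Module ℝ A] (β : ℕ → ℝ) (ℓ r : ℝ) (a : ℕ → A) :
    span N β ℓ (fun n => r • a n) = r • span N β ℓ a := by
  simp only [span, smul_neg, Finset.smul_sum, smul_smul]
  congr 1
  exact Finset.sum_congr rfl fun _ _ => by congr 1; ring

theorem span_mul_left (β : ℕ → ℝ) (ℓ : ℝ) (X : Mat N) (a : ℕ → Mat N) :
    span N β ℓ (fun n => X * a n) = X * span N β ℓ a := by
  simp [span, Finset.mul_sum, Finset.smul_sum]

namespace BoostRel

variable {γ φ χ : Mat N} {n nt : Pt N} {lam : ℝ} (h : BoostRel γ φ χ n nt lam)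

include h

theorem opY_mulVec (hs : ∀ j, 0 < s j) :
    opY c s (relB γ χ) *ᵥ n = opY c s (relD γ χ n) *ᵥ n := by
  simp only [opY, Matrix.sum_mulVec, Matrix.smul_mulVec]
  exact Finset.sum_congr rfl fun j _ => by rw [h.adjugate_relB_mulVec (hs j).le]

/-- `U n = Ũ ñ`. -/
theorem current_eq (hs : ∀ j, 0 < s j) : (lam⁻¹ • opY c s (relB γ χ)) *ᵥ n
    = (relD γ χ n * opY c s (relD γ χ n)) *ᵥ nt := by
  -- `D ñ = λ⁻¹ n`, and the adjugates of `1 + s B` and `1 + s D` agree on `n`.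
  rw [opY_commute, ← Matrix.mulVec_mulVec, h.relD_mulVec_nt, Matrix.mulVec_smul,
    Matrix.smul_mulVec, h.opY_mulVec hs]

theorem χ_mul_opY (hs : ∀ j, 0 < s j) :
    χ * opY c s (relD γ χ n) = (opY c s (relD γ χ n))ᵀ * χ := by
  simp only [opY, Finset.mul_sum, Matrix.transpose_sum, Finset.sum_mul, Matrix.mul_smul,
    Matrix.transpose_smul, Matrix.smul_mul]
  exact Finset.sum_congr rfl fun j _ => by rw [h.χ_mul_adjugate_relD (hs j).le]

theorem γ_mul_opY (hs : ∀ j, 0 < s j) :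
    γ * opY c s (relB γ χ) = (opY c s (relB γ χ))ᵀ * γ := by
  simp only [opY, Finset.mul_sum, Matrix.transpose_sum, Finset.sum_mul, Matrix.mul_smul,
    Matrix.transpose_smul, Matrix.smul_mul]
  exact Finset.sum_congr rfl fun j _ => by rw [h.γ_mul_adjugate_relB (hs j).le]

theorem φ_mul_opY (hs : ∀ j, 0 < s j) :
    φ * opY c s (relD γ χ n) = (opY c s (relD γ χ n))ᵀ * φ := by
  simp only [opY, Finset.mul_sum, Matrix.transpose_sum, Finset.sum_mul, Matrix.mul_smul,
    Matrix.transpose_smul, Matrix.smul_mul]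
  exact Finset.sum_congr rfl fun j _ => by rw [h.φ_mul_adjugate_relD (hs j).le]

/-- `U γ⁻¹` is symmetric. -/
theorem U_symm (hs : ∀ j, 0 < s j) :
    ((lam⁻¹ • opY c s (relB γ χ)) * γ⁻¹)ᵀ = (lam⁻¹ • opY c s (relB γ χ)) * γ⁻¹ := by
  refine mul_inv_symm_of_comm h.γ_unit h.γ_symm ?_
  rw [Matrix.mul_smul, h.γ_mul_opY hs, Matrix.transpose_smul, Matrix.smul_mul]

/-- `Ũ φ⁻¹` is symmetric. -/
theorem Ut_symm (hs : ∀ j, 0 < s j) :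
    ((relD γ χ n * opY c s (relD γ χ n)) * φ⁻¹)ᵀ = (relD γ χ n * opY c s (relD γ χ n)) * φ⁻¹ := by
  refine mul_inv_symm_of_comm h.φ_unit h.φ_symm ?_
  rw [← Matrix.mul_assoc, h.φ_comm_relD, Matrix.mul_assoc, h.φ_mul_opY hs, opY_commute,
    Matrix.transpose_mul, Matrix.mul_assoc]

end BoostRel

end Weights

end Bimetric

namespace Bimetric

open Matrix

variable {N : ℕ}

/-! ### The boost and the vielbeins -/

theorem lorentz_sq (p : Pt N) : lorentz p ^ 2 = 1 + p ⬝ᵥ p := by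
  rw [lorentz, Real.sq_sqrt]
  have : 0 ≤ p ⬝ᵥ p := Finset.sum_nonneg fun i _ => mul_self_nonneg (p i)
  linarith

theorem lorentz_pos (p : Pt N) : 0 < lorentz p := by
  refine Real.sqrt_pos.mpr ?_
  have : 0 ≤ p ⬝ᵥ p := Finset.sum_nonneg fun i _ => mul_self_nonneg (p i)
  linarith

theorem vecMulVec_mul_vecMulVec' (u w x y : Pt N) :
    vecMulVec u w * vecMulVec x y = (w ⬝ᵥ x) • vecMulVec u y := by
  rw [mul_vecMulVec', vecMulVec_mulVec', Matrix.smul_vecMulVec]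

theorem dotProduct_self_pos {x : Pt N} (hx : x ≠ 0) : 0 < x ⬝ᵥ x := by
  obtain ⟨i, hi⟩ := Function.ne_iff.mp hx
  exact Finset.sum_pos' (fun i _ => mul_self_nonneg (x i))
    ⟨i, Finset.mem_univ i, mul_self_pos.mpr hi⟩

theorem formPos_one : FormPos (1 : Mat N) := fun x hx => by
  rw [Matrix.one_mulVec]
  exact dotProduct_self_pos hx

/-- With the ansatz `1 + a p pᵀ` and `pᵀ p = λ² - 1`, squaring requires `2 a + a² (λ² - 1) = 1`,
solved by `a = (1 + λ)⁻¹`. The closed form also shows that `Λ` is smooth in `p`. -/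
theorem isPrincipalSqrt_boost (p : Pt N) :
    IsPrincipalSqrt (1 + vecMulVec p p) (1 + (1 + lorentz p)⁻¹ • vecMulVec p p) := by
  have hl := lorentz_pos p
  refine ⟨?_, re_pos_of_formPos (k := 1) Matrix.transpose_one formPos_one ?_⟩
  · have hpp : p ⬝ᵥ p = lorentz p ^ 2 - 1 := by linarith [lorentz_sq p]
    rw [mul_add, add_mul, add_mul, mul_one, mul_one, one_mul, Matrix.smul_mul, Matrix.mul_smul,
      vecMulVec_mul_vecMulVec', smul_smul, smul_smul, add_assoc, ← add_smul, ← add_smul, hpp]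
    have : (1 + lorentz p)⁻¹ + ((1 + lorentz p)⁻¹ + (1 + lorentz p)⁻¹ * (1 + lorentz p)⁻¹
        * (lorentz p ^ 2 - 1)) = 1 := by
      field_simp
      ring
    rw [this, one_smul]
  · intro x hx
    rw [one_mul, Matrix.add_mulVec, Matrix.one_mulVec, Matrix.smul_mulVec, vecMulVec_mulVec',
      dotProduct_add, dotProduct_smul, dotProduct_smul, smul_eq_mul, smul_eq_mul,
      dotProduct_comm x p]
    exact add_pos_of_pos_of_nonneg (dotProduct_self_pos hx)
      (mul_nonneg (by positivity) (mul_self_nonneg _))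

theorem boost_eq (p : Pt N) : boost p = 1 + (1 + lorentz p)⁻¹ • vecMulVec p p :=
  (isPrincipalSqrt_boost p).principalSqrt_eq

theorem boost_mul_boost (p : Pt N) : boost p * boost p = 1 + vecMulVec p p := by
  rw [boost_eq]
  exact (isPrincipalSqrt_boost p).1

theorem boost_symm (p : Pt N) : (boost p)ᵀ = boost p := by
  rw [boost_eq, Matrix.transpose_add, Matrix.transpose_smul, Matrix.transpose_vecMulVec,
    Matrix.transpose_one]

theorem boost_neg (p : Pt N) : boost (-p) = boost p := by
  rw [boost, boost, Matrix.neg_vecMulVec, Matrix.vecMulVec_neg, neg_neg]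

theorem lorentz_neg (p : Pt N) : lorentz (-p) = lorentz p := by
  rw [lorentz, lorentz, neg_dotProduct_neg]

theorem boostVec_neg (e : Mat N) (p : Pt N) : boostVec e (-p) = -boostVec e p := by
  rw [boostVec, boostVec, vel, vel, lorentz_neg, smul_neg, Matrix.mulVec_neg]

theorem vel_dotProduct (p : Pt N) : lorentz p ^ 2 * (1 - vel p ⬝ᵥ vel p) = 1 := by
  have hl := (lorentz_pos p).ne'
  rw [vel, smul_dotProduct, dotProduct_smul, smul_eq_mul, smul_eq_mul]
  field_simp
  linarith [lorentz_sq p]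

theorem boost_mulVec_vel (p : Pt N) : boost p *ᵥ vel p = p := by
  have hl := lorentz_pos p
  have hpp : p ⬝ᵥ p = lorentz p ^ 2 - 1 := by linarith [lorentz_sq p]
  rw [boost_eq, vel, Matrix.add_mulVec, Matrix.one_mulVec, Matrix.smul_mulVec, vecMulVec_mulVec',
    dotProduct_smul, smul_smul, ← add_smul, hpp, smul_eq_mul]
  have : (lorentz p)⁻¹ + (1 + lorentz p)⁻¹ * ((lorentz p)⁻¹ * (lorentz p ^ 2 - 1)) = 1 := by
    field_simp
    ring
  rw [this, one_smul]

theorem boost_mul_sub_vel_mul_boost (p : Pt N) :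
    boost p * (1 - vecMulVec (vel p) (vel p)) * boost p = 1 := by
  rw [mul_sub, sub_mul, mul_one, mul_vecMulVec', boost_mulVec_vel, vecMulVec_mul', boost_symm,
    boost_mulVec_vel]
  rw [boost_mul_boost, add_sub_cancel_right]

theorem boost_unit (p : Pt N) : IsUnit (boost p).det :=
  Matrix.isUnit_det_of_left_inverse (boost_mul_sub_vel_mul_boost p)

theorem boost_inv (p : Pt N) : (boost p)⁻¹ = (1 - vecMulVec (vel p) (vel p)) * boost p := by
  refine Matrix.inv_eq_right_inv ?_
  rw [← Matrix.mul_assoc]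
  exact boost_mul_sub_vel_mul_boost p

theorem formPos_gram {e : Mat N} (he : IsUnit e.det) : FormPos (gram e) := by
  intro x hx
  rw [gram, ← Matrix.mulVec_mulVec, Matrix.dotProduct_mulVec, Matrix.vecMul_transpose]
  exact dotProduct_self_pos fun h0 => hx (Matrix.eq_zero_of_mulVec_eq_zero he.ne_zero h0)

theorem formPos_of_posDef {k : Mat N} (hk : k.PosDef) : FormPos k := fun x hx => by
  have := hk.dotProduct_mulVec_pos hx
  simpa using this

theorem gram_inv_sub (e : Mat N) (p : Pt N) : (gram e)⁻¹ - vecMulVec (boostVec e p) (boostVec e p)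
    = e⁻¹ * (1 - vecMulVec (vel p) (vel p)) * (eᵀ)⁻¹ := by
  rw [gram, Matrix.mul_inv_rev, boostVec, mul_sub, sub_mul, mul_one, mul_vecMulVec',
    vecMulVec_mul', Matrix.transpose_nonsing_inv, Matrix.transpose_transpose]

section Vielbeins

variable {e m : Mat N} {p : Pt N} (hχ : (chi e m p).PosDef)

include hχ

theorem vielbein_unit : IsUnit e.det ∧ IsUnit m.det := by
  have h := (formPos_of_posDef hχ).det_ne_zero
  rw [chi, Matrix.det_mul, Matrix.det_mul, Matrix.det_transpose] at h
  exact ⟨isUnit_iff_ne_zero.mpr (left_ne_zero_of_mul (left_ne_zero_of_mul h)),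
    isUnit_iff_ne_zero.mpr (right_ne_zero_of_mul h)⟩

theorem chi_symm : (chi e m p)ᵀ = chi e m p := by
  have := hχ.isHermitian
  rwa [Matrix.IsHermitian, Matrix.conjTranspose_eq_transpose_of_trivial] at this

theorem chi_eq : chi e m p = mᵀ * boost p * e := by
  rw [← chi_symm hχ, chi, Matrix.transpose_mul, Matrix.transpose_mul, boost_symm,
    Matrix.transpose_transpose, Matrix.mul_assoc]

theorem relB_eq_Bop : relB (gram e) (chi e m p) = Bop e m p := by
  have he := (vielbein_unit hχ).1
  rw [relB, gram, Matrix.mul_inv_rev, chi, Bop]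
  have : IsUnit (eᵀ).det := by rwa [Matrix.det_transpose]
  simp only [Matrix.mul_assoc]
  rw [Matrix.nonsing_inv_mul_cancel_left _ _ this]

theorem relD_eq_Dop : relD (gram e) (chi e m p) (boostVec e p) = Dop e m p := by
  have he := (vielbein_unit hχ).1
  have : IsUnit (eᵀ).det := by rwa [Matrix.det_transpose]
  rw [relD, gram_inv_sub, chi, Dop, boost_inv]
  simp only [Matrix.mul_assoc]
  rw [Matrix.nonsing_inv_mul_cancel_left _ _ this]

/-- In `φ_eq` the two readings `χ = mᵀ Λ e` and `χ = eᵀ Λ m`, equal by symmetry of `χ`, are placed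
left and right, so that `Λ (1 - v vᵀ) Λ = 1` appears in the middle. -/
theorem boostRel_of_vielbein :
    BoostRel (gram e) (gram m) (chi e m p) (boostVec e p) (boostVec m p) (lorentz p) where
  γ_symm := by rw [gram, Matrix.transpose_mul, Matrix.transpose_transpose]
  χ_symm := chi_symm hχ
  γ_pos := formPos_gram (vielbein_unit hχ).1
  φ_pos := formPos_gram (vielbein_unit hχ).2
  χ_pos := formPos_of_posDef hχ
  lam_pos := lorentz_pos p
  φ_eq := by
    have he := (vielbein_unit hχ).1
    have he' : IsUnit (eᵀ).det := by rwa [Matrix.det_transpose]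
    have h1 : chi e m p * (e⁻¹ * (1 - vecMulVec (vel p) (vel p)) * (eᵀ)⁻¹) * chi e m p
        = mᵀ * (boost p * (1 - vecMulVec (vel p) (vel p)) * boost p) * m := by
      nth_rewrite 1 [chi_eq hχ]
      rw [chi]
      simp only [Matrix.mul_assoc]
      rw [Matrix.mul_nonsing_inv_cancel_left _ _ he, Matrix.nonsing_inv_mul_cancel_left _ _ he']
    rw [gram_inv_sub, h1, boost_mul_sub_vel_mul_boost, Matrix.mul_one, gram]
  lam_eq := by
    have he := (vielbein_unit hχ).1
    have h1 : boostVec e p ⬝ᵥ (gram e *ᵥ boostVec e p) = vel p ⬝ᵥ vel p := by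
      rw [gram, ← Matrix.mulVec_mulVec, Matrix.dotProduct_mulVec, Matrix.vecMul_transpose, boostVec,
        Matrix.mulVec_mulVec, Matrix.mul_nonsing_inv _ he, Matrix.one_mulVec]
    rw [h1, vel_dotProduct]
  nt_eq := by
    have he := (vielbein_unit hχ).1
    have hm := (vielbein_unit hχ).2
    rw [chi_eq hχ, gram, boostVec, boostVec, Matrix.mulVec_mulVec, Matrix.mulVec_mulVec,
      Matrix.mul_nonsing_inv_cancel_right _ _ hm, Matrix.mul_nonsing_inv_cancel_right _ _ he,
      ← Matrix.mulVec_mulVec, boost_mulVec_vel, ← Matrix.mulVec_smul, vel]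

variable {β : ℕ → ℝ} {ℓ : ℝ} {K : ℕ} {c s : Fin K → ℝ}

theorem Uop_eq (hM : IsMoment N β ℓ c s) : Uop β ℓ e m p
    = (lorentz p)⁻¹ • opY c s (relB (gram e) (chi e m p)) := by
  have h := boostRel_of_vielbein hχ
  rw [Uop, span_smul, ← relB_eq_Bop hχ, hM.sum_pred fun j => h.det_relB (hM.pos j).le]

theorem Utop_eq (hM : IsMoment N β ℓ c s) : Utop β ℓ e m p
    = relD (gram e) (chi e m p) (boostVec e p)
      * opY c s (relD (gram e) (chi e m p) (boostVec e p)) := by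
  have h := boostRel_of_vielbein hχ
  rw [Utop, ← relD_eq_Dop hχ, span_mul_left, hM.sum_pred fun j => h.det_relD (hM.pos j).le]

theorem Qop_mul_Dop : Qop e p * Dop e m p = Bop e m p := by
  rw [Qop, Dop, Bop, pow_two]
  simp only [Matrix.mul_assoc]
  rw [Matrix.mul_nonsing_inv_cancel_left _ _ (vielbein_unit hχ).1,
    Matrix.mul_nonsing_inv_cancel_left _ _ (boost_unit p)]

/-- The energy flux covector is `-λ χ (U n)`. -/
theorem flux_eq (hM : IsMoment N β ℓ c s) :
    -(gram e *ᵥ ((Qop e p * Utop β ℓ e m p) *ᵥ boostVec e p))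
      = -(lorentz p • (chi e m p *ᵥ (Uop β ℓ e m p *ᵥ boostVec e p))) := by
  have h := boostRel_of_vielbein hχ
  -- `Q D̃ = B` and `γ B = χ` bring the left side to `χ` applied to the common vector of `B` and
  -- `D`.
  rw [Utop_eq hχ hM, Uop_eq hχ hM, ← Matrix.mul_assoc]
  nth_rewrite 1 [relD_eq_Dop hχ]
  rw [Qop_mul_Dop hχ, ← relB_eq_Bop hχ, Matrix.mulVec_mulVec, ← Matrix.mul_assoc, h.γ_mul_relB,
    Matrix.smul_mulVec, h.opY_mulVec hM.pos, Matrix.mulVec_smul, smul_smul,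
    mul_inv_cancel₀ h.lam_pos.ne', one_smul, Matrix.mulVec_mulVec]

end Vielbeins

namespace BoostRel

variable {γ φ χ : Mat N} {n nt : Pt N} {lam : ℝ} (h : BoostRel γ φ χ n nt lam)

include h

/-- This and the following evaluations let the phase space functions, defined without vielbeins, be
computed from any `BoostRel`. -/
theorem phLorentz_eq : phLorentz γ n = lam := by
  have hl := h.lam_pos
  have h1 : 1 - n ⬝ᵥ (γ *ᵥ n) = (lam⁻¹) ^ 2 := by
    have := h.lam_eq
    field_simp
    linarith
  rw [phLorentz, h1, Real.sqrt_sq (by positivity), inv_inv]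

theorem phD_eq : phD γ φ n = relD γ χ n := h.isPrincipalSqrt_relD.principalSqrt_eq

theorem phB_eq : phB γ φ n = relB γ χ := by
  rw [phB, h.phLorentz_eq, h.phD_eq, h.relB_eq_mul_relD]

theorem phNt_eq : phNt γ φ n = nt := by
  rw [phNt, h.phLorentz_eq, h.phD_eq]
  exact h.nt_eq_inv_mulVec.symm

variable {β : ℕ → ℝ} {ℓ : ℝ} {K : ℕ} {c s : Fin K → ℝ} (hM : IsMoment N β ℓ c s)

include hM

theorem phV_eq : phV β ℓ γ φ n = potV c s (relD γ χ n) := by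
  rw [phV, h.phD_eq, hM.sum_det (by omega)]

theorem phVt_eq : phVt β ℓ γ φ n = lam⁻¹ * potW c s (relB γ χ) := by
  rw [phVt, h.phB_eq, h.phLorentz_eq]
  simp only [← smul_eq_mul (lam⁻¹)]
  rw [span_smul, hM.sum_esymPred]

end BoostRel

/-! ### Duality of the weights -/

section Duality

variable {K : ℕ} {c s : Fin K → ℝ}

/-- The simultaneous inversion of node and matrix is what realises `βₙ ↦ β_{d-n}`; the rules for
determinants and adjugates follow from this factorisation. -/
theorem one_add_inv_smul_inv {X : Mat N} (hX : IsUnit X.det) {s : ℝ} (hs : s ≠ 0) :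
    1 + s⁻¹ • X⁻¹ = s⁻¹ • (X⁻¹ * (1 + s • X)) := by
  rw [mul_add, mul_one, Matrix.mul_smul, Matrix.nonsing_inv_mul _ hX, smul_add, smul_smul,
    inv_mul_cancel₀ hs, one_smul, add_comm]

theorem det_one_add_inv {X : Mat N} (hX : IsUnit X.det) {s : ℝ} (hs : s ≠ 0) :
    s ^ N * (1 + s⁻¹ • X⁻¹).det = X.det⁻¹ * (1 + s • X).det := by
  rw [one_add_inv_smul_inv hX hs, Matrix.det_smul, Fintype.card_fin, Matrix.det_mul,
    Matrix.det_nonsing_inv, Ring.inverse_eq_inv', ← mul_assoc, ← mul_pow, mul_inv_cancel₀ hs,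
    one_pow, one_mul]

theorem adjugate_one_add_inv {X : Mat N} (hX : IsUnit X.det) {s : ℝ} (hs : s ≠ 0)
    (hsX : (1 + s • X).det ≠ 0) :
    s ^ N • (1 + s⁻¹ • X⁻¹).adjugate = (X.det⁻¹ * s) • (X * (1 + s • X).adjugate) := by
  have hZ : (1 + s⁻¹ • X⁻¹).det ≠ 0 := by
    intro h0
    have := det_one_add_inv hX hs
    rw [h0, mul_zero] at this
    exact mul_ne_zero (inv_ne_zero hX.ne_zero) hsX this.symm
  have h1 : (1 + s⁻¹ • X⁻¹) * ((X.det⁻¹ * s) • (X * (1 + s • X).adjugate))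
      = (1 + s⁻¹ • X⁻¹) * (s ^ N • (1 + s⁻¹ • X⁻¹).adjugate) := by
    rw [Matrix.mul_smul _ (s ^ N), Matrix.mul_adjugate, smul_smul, det_one_add_inv hX hs,
      one_add_inv_smul_inv hX hs, Matrix.smul_mul, Matrix.mul_smul, smul_smul,
      adjugate_one_add_smul_commute, Matrix.mul_assoc, ← Matrix.mul_assoc (1 + s • X),
      Matrix.mul_adjugate, Matrix.smul_mul, Matrix.one_mul, Matrix.mul_smul,
      Matrix.nonsing_inv_mul _ hX, smul_smul]
    congr 1
    field_simp
  exact ((Matrix.isUnit_iff_isUnit_det _).mpr (isUnit_iff_ne_zero.mpr hZ)).mul_left_cancel h1.symm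

/-- The power in the dual masses clears the inverse nodes. The factor `X.det⁻¹` later becomes a
ratio of volume densities. -/
theorem opY_dual {X : Mat N} (hX : IsUnit X.det) (hs : ∀ j, 0 < s j)
    (hsX : ∀ j, (1 + s j • X).det ≠ 0) :
    opY (fun j => c j * s j ^ (N + 1)) (fun j => (s j)⁻¹) X⁻¹ = X.det⁻¹ • (X * opY c s X) := by
  simp only [opY, Finset.mul_sum, Finset.smul_sum]
  refine Finset.sum_congr rfl fun j _ => ?_
  have h1 := adjugate_one_add_inv hX (hs j).ne' (hsX j)
  have h2 : c j * s j ^ (N + 1) * (s j)⁻¹ = c j * s j ^ N := by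
    have := (hs j).ne'
    rw [pow_succ]
    field_simp
  rw [h2, mul_smul, h1, smul_smul, Matrix.mul_smul, smul_smul]
  congr 1
  ring

theorem potW_dual {X : Mat N} (hX : IsUnit X.det) (hs : ∀ j, 0 < s j) :
    potV (fun j => c j * s j ^ (N + 1)) (fun j => (s j)⁻¹) X⁻¹ = X.det⁻¹ * potW c s X := by
  simp only [potV, potW, Finset.mul_sum]
  refine Finset.sum_congr rfl fun j _ => ?_
  have h1 := det_one_add_inv hX (hs j).ne'
  rw [pow_succ]
  linear_combination (c j * s j) * h1

end Duality

/-! ### Block matrices adapted to the foliation -/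

/-- The block matrix with time-time entry `a`, time row `b`, time column `c` and spatial block
`D`. -/
def blk (a : ℝ) (b c : Pt N) (D : Mat N) : Mat (N + 1) :=
  Matrix.of (Fin.cons (Fin.cons a b) fun i => Fin.cons (c i) (D i))

section Blk

variable (a : ℝ) (b c : Pt N) (D : Mat N)

@[simp] theorem blk_zero_zero : blk a b c D 0 0 = a := rfl
@[simp] theorem blk_zero_succ (j : Fin N) : blk a b c D 0 j.succ = b j := rfl
@[simp] theorem blk_succ_zero (i : Fin N) : blk a b c D i.succ 0 = c i := rfl
@[simp] theorem blk_succ_succ (i j : Fin N) : blk a b c D i.succ j.succ = D i j := rfl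

theorem ext_blk {A B : Mat (N + 1)} (h00 : A 0 0 = B 0 0) (h0 : ∀ j : Fin N, A 0 j.succ = B 0 j.succ)
    (h1 : ∀ i : Fin N, A i.succ 0 = B i.succ 0)
    (h2 : ∀ i j : Fin N, A i.succ j.succ = B i.succ j.succ) : A = B := by
  ext i j
  refine Fin.cases ?_ (fun i => ?_) i <;> refine Fin.cases ?_ (fun j => ?_) j
  exacts [h00, h0 j, h1 i, h2 i j]

theorem shear_eq_blk (ξ : Pt N) : shear ξ = blk 1 0 ξ 1 := by
  refine ext_blk rfl (fun j => rfl) (fun i => rfl) fun i j => ?_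
  simp [shear, Matrix.one_apply, Pi.single_apply, eq_comm]

theorem blockDiag_eq_blk : blockDiag a D = blk a 0 0 D :=
  ext_blk rfl (fun _ => rfl) (fun _ => rfl) fun _ _ => rfl

theorem one_eq_blk : (1 : Mat (N + 1)) = blk 1 0 0 1 := by
  refine ext_blk ?_ (fun j => ?_) (fun i => ?_) fun i j => ?_ <;>
    simp [Matrix.one_apply, Fin.succ_ne_zero, (Fin.succ_ne_zero _).symm]

theorem blk_mul (a' : ℝ) (b' c' : Pt N) (D' : Mat N) :
    blk a b c D * blk a' b' c' D'
      = blk (a * a' + b ⬝ᵥ c') (a • b' + D'ᵀ *ᵥ b) (a' • c + D *ᵥ c') (vecMulVec c b' + D * D') := by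
  refine ext_blk ?_ (fun j => ?_) (fun i => ?_) fun i j => ?_ <;>
    simp [Matrix.mul_apply, Fin.sum_univ_succ, dotProduct, Matrix.mulVec, vecMulVec_apply, mul_comm]

theorem blk_add (a' : ℝ) (b' c' : Pt N) (D' : Mat N) :
    blk a b c D + blk a' b' c' D' = blk (a + a') (b + b') (c + c') (D + D') :=
  ext_blk rfl (fun _ => rfl) (fun _ => rfl) fun _ _ => rfl

theorem smul_blk (r : ℝ) : r • blk a b c D = blk (r * a) (r • b) (r • c) (r • D) :=
  ext_blk rfl (fun _ => rfl) (fun _ => rfl) fun _ _ => rfl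

theorem blk_transpose : (blk a b c D)ᵀ = blk a c b Dᵀ :=
  ext_blk rfl (fun _ => rfl) (fun _ => rfl) fun _ _ => rfl

theorem det_blk : (blk a b 0 D).det = a * D.det := by
  rw [Matrix.det_succ_column_zero, Fin.sum_univ_succ]
  simp only [blk_zero_zero, blk_succ_zero, Pi.zero_apply, mul_zero, zero_mul, Finset.sum_const_zero,
    add_zero, Fin.val_zero, pow_zero, one_mul]
  rfl

theorem det_blk' : (blk a 0 c D).det = a * D.det := by
  rw [← Matrix.det_transpose, blk_transpose, det_blk, Matrix.det_transpose]

theorem dotProduct_blk_mulVec (x : Pt (N + 1)) :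
    x ⬝ᵥ (blk a b c D *ᵥ x) = x 0 * a * x 0 + x 0 * (b ⬝ᵥ Fin.tail x)
      + x 0 * (Fin.tail x ⬝ᵥ c) + Fin.tail x ⬝ᵥ (D *ᵥ Fin.tail x) := by
  simp only [dotProduct, Matrix.mulVec, Fin.sum_univ_succ, blk_zero_zero, blk_zero_succ,
    blk_succ_zero, blk_succ_succ, Fin.tail, mul_add, Finset.sum_add_distrib, Finset.mul_sum]
  have : ∀ i : Fin N, x i.succ * (c i * x 0) = x 0 * (x i.succ * c i) := fun i => by ring
  simp only [this]
  ring

/-- Opposite off-diagonal blocks cancel in the quadratic form; positive forms are not assumed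
symmetric precisely for this use. -/
theorem FormPos.blk {a : ℝ} (ha : 0 < a) {D : Mat N} (hD : FormPos D) (b : Pt N) :
    FormPos (blk a b (-b) D) := by
  intro x hx
  rw [dotProduct_blk_mulVec, dotProduct_neg, dotProduct_comm b]
  have h1 : 0 ≤ x 0 * a * x 0 := by nlinarith [mul_self_nonneg (x 0)]
  have h2 : x 0 * a * x 0 + x 0 * (Fin.tail x ⬝ᵥ b) + x 0 * -(Fin.tail x ⬝ᵥ b)
      = x 0 * a * x 0 := by ring
  rw [h2]
  by_cases ht : Fin.tail x = 0
  · have h0 : x 0 ≠ 0 := by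
      intro h0
      apply hx
      ext i
      refine Fin.cases h0 (fun i => ?_) i
      exact congrFun ht i
    have : 0 < x 0 * x 0 := mul_self_pos.mpr h0
    rw [ht, zero_dotProduct, add_zero]
    nlinarith
  · exact add_pos_of_nonneg_of_pos h1 (hD _ ht)

theorem FormPos.conj {n : ℕ} {k A : Mat n} (hk : FormPos k) (hA : IsUnit A.det) :
    FormPos (Aᵀ * k * A) := by
  intro x hx
  rw [Matrix.mul_assoc, ← Matrix.mulVec_mulVec, Matrix.dotProduct_mulVec, Matrix.vecMul_transpose,
    ← Matrix.mulVec_mulVec]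
  exact hk _ fun h0 => hx (Matrix.eq_zero_of_mulVec_eq_zero hA.ne_zero h0)

theorem shear_mul (ξ η : Pt N) : shear ξ * shear η = shear (ξ + η) := by
  simp only [shear_eq_blk, blk_mul]
  simp

theorem shear_zero : shear (0 : Pt N) = 1 := by rw [shear_eq_blk, one_eq_blk]

theorem shear_neg_mul (q : Pt N) : shear (-q) * shear q = 1 := by
  rw [shear_mul, neg_add_cancel, shear_zero]

theorem shear_mul_neg (q : Pt N) : shear q * shear (-q) = 1 := by
  rw [shear_mul, add_neg_cancel, shear_zero]

theorem det_shear (q : Pt N) : (shear q).det = 1 := by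
  rw [shear_eq_blk, det_blk', Matrix.det_one, one_mul]

theorem adjugate_shear (q : Pt N) : (shear q).adjugate = shear (-q) := by
  have h := congrArg (fun X => X * shear (-q)) (Matrix.adjugate_mul (shear q))
  simp only [Matrix.mul_assoc, shear_mul_neg, Matrix.mul_one, det_shear, one_smul, Matrix.one_mul] at h
  exact h

/-- A common part of the shifts is a congruence by a shear, so the square root can be computed as if
`q = 0`. -/
theorem metricOf_add (l : ℝ) (q ξ : Pt N) (γ : Mat N) :
    metricOf l (q + ξ) γ = (shear q)ᵀ * metricOf l ξ γ * shear q := by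
  rw [add_comm q ξ, metricOf, metricOf, ← shear_mul, Matrix.transpose_mul]
  simp only [Matrix.mul_assoc, shear_mul]

theorem metricOf_eq_blk (l : ℝ) (ξ : Pt N) {γ : Mat N} (hγ : γᵀ = γ) :
    metricOf l ξ γ = blk (-l ^ 2 + ξ ⬝ᵥ (γ *ᵥ ξ)) (γ *ᵥ ξ) (γ *ᵥ ξ) γ := by
  rw [metricOf, shear_eq_blk, blockDiag_eq_blk, blk_transpose, blk_mul, blk_mul]
  simp [hγ, dotProduct_comm]

theorem metricOf_symm (l : ℝ) (ξ : Pt N) {γ : Mat N} (hγ : γᵀ = γ) :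
    (metricOf l ξ γ)ᵀ = metricOf l ξ γ := by
  rw [metricOf_eq_blk l ξ hγ, blk_transpose, hγ]

theorem det_metricOf (l : ℝ) (ξ : Pt N) (γ : Mat N) : (metricOf l ξ γ).det = -l ^ 2 * γ.det := by
  rw [metricOf, Matrix.det_mul, Matrix.det_mul, Matrix.det_transpose, det_shear, one_mul, mul_one,
    blockDiag_eq_blk, det_blk]

theorem metricOf_inv {l : ℝ} (hl : l ≠ 0) (ξ : Pt N) {γ : Mat N} (hγ : IsUnit γ.det) :
    (metricOf l ξ γ)⁻¹ = shear (-ξ) * blk (-(l ^ 2)⁻¹) 0 0 γ⁻¹ * (shear (-ξ))ᵀ := by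
  refine Matrix.inv_eq_right_inv ?_
  have h1 : blockDiag (-l ^ 2) γ * blk (-(l ^ 2)⁻¹) 0 0 γ⁻¹ = 1 := by
    rw [blockDiag_eq_blk, blk_mul, one_eq_blk, Matrix.mul_nonsing_inv _ hγ]
    simp [hl]
  have h2 : (shear ξ)ᵀ * (shear (-ξ))ᵀ = 1 := by
    rw [← Matrix.transpose_mul, shear_neg_mul, Matrix.transpose_one]
  rw [metricOf]
  calc _ = (shear ξ)ᵀ * (blockDiag (-l ^ 2) γ * (shear ξ * shear (-ξ)) * blk (-(l ^ 2)⁻¹) 0 0 γ⁻¹)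
        * (shear (-ξ))ᵀ := by simp only [Matrix.mul_assoc]
    _ = 1 := by rw [shear_mul_neg, Matrix.mul_one, h1, Matrix.mul_one, h2]

theorem metricOf_inv_col {l : ℝ} (hl : l ≠ 0) (ξ : Pt N) {γ : Mat N} (hγ : IsUnit γ.det) :
    (metricOf l ξ γ)⁻¹ 0 0 = -(l ^ 2)⁻¹ ∧
      ∀ i : Fin N, (metricOf l ξ γ)⁻¹ i.succ 0 = (l ^ 2)⁻¹ * ξ i := by
  rw [metricOf_inv hl ξ hγ, shear_eq_blk, blk_transpose, blk_mul, blk_mul]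
  simp

theorem unitNormal_metricOf {l : ℝ} (hl : 0 < l) (ξ : Pt N) {γ : Mat N} (hγ : IsUnit γ.det) :
    unitNormal (metricOf l ξ γ) = Fin.cons l⁻¹ (-(l⁻¹ • ξ)) := by
  obtain ⟨h0, h1⟩ := metricOf_inv_col hl.ne' ξ hγ
  have hs : Real.sqrt (-(metricOf l ξ γ)⁻¹ 0 0) = l⁻¹ := by
    rw [h0, neg_neg, ← inv_pow, Real.sqrt_sq (inv_pos.mpr hl).le]
  ext μ
  refine Fin.cases ?_ (fun i => ?_) μ
  · rw [unitNormal, hs, h0, Fin.cons_zero]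
    field_simp
  · rw [unitNormal, hs, h1, Fin.cons_succ, Pi.neg_apply, Pi.smul_apply, smul_eq_mul]
    field_simp

theorem metricOf_mulVec_unitNormal {l : ℝ} (hl : 0 < l) (ξ : Pt N) {γ : Mat N} (hγ : IsUnit γ.det)
    (hγs : γᵀ = γ) : metricOf l ξ γ *ᵥ unitNormal (metricOf l ξ γ) = Fin.cons (-l) 0 := by
  have hl' := hl.ne'
  rw [unitNormal_metricOf hl ξ hγ, metricOf_eq_blk l ξ hγs]
  ext μ
  refine Fin.cases ?_ (fun i => ?_) μ
  · simp only [Matrix.mulVec, dotProduct, Fin.sum_univ_succ, blk_zero_zero, blk_zero_succ,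
      Fin.cons_zero, Fin.cons_succ, Pi.neg_apply, Pi.smul_apply, smul_eq_mul, mul_neg,
      Finset.sum_neg_distrib]
    have : ∑ x, (∑ i, γ x i * ξ i) * (l⁻¹ * ξ x) = l⁻¹ * ∑ x, ξ x * ∑ i, γ x i * ξ i := by
      rw [Finset.mul_sum]
      exact Finset.sum_congr rfl fun _ _ => by ring
    rw [this]
    field_simp
    ring
  · simp only [Matrix.mulVec, dotProduct, Fin.sum_univ_succ, blk_succ_zero, blk_succ_succ,
      Fin.cons_zero, Fin.cons_succ, Pi.neg_apply, Pi.smul_apply, smul_eq_mul, mul_neg,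
      Finset.sum_neg_distrib, Pi.zero_apply]
    have : ∑ x, γ i x * (l⁻¹ * ξ x) = l⁻¹ * ∑ x, γ i x * ξ x := by
      rw [Finset.mul_sum]
      exact Finset.sum_congr rfl fun _ _ => by ring
    rw [this]
    ring

theorem inducedMetric_metricOf {l : ℝ} (hl : 0 < l) (ξ : Pt N) {γ : Mat N} (hγ : IsUnit γ.det)
    (hγs : γᵀ = γ) :
    inducedMetric (metricOf l ξ γ) = blk (ξ ⬝ᵥ (γ *ᵥ ξ)) (γ *ᵥ ξ) (γ *ᵥ ξ) γ := by
  rw [inducedMetric, metricOf_mulVec_unitNormal hl ξ hγ hγs, metricOf_eq_blk l ξ hγs]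
  refine ext_blk ?_ (fun j => ?_) (fun i => ?_) fun i j => ?_ <;> simp [vecMulVec_apply]
  ring

theorem projector_metricOf_succ {l : ℝ} (hl : 0 < l) (ξ : Pt N) {γ : Mat N} (hγ : IsUnit γ.det)
    (hγs : γᵀ = γ) (ν : Fin (N + 1)) (i : Fin N) :
    projector (metricOf l ξ γ) ν i.succ = (1 : Mat (N + 1)) ν i.succ := by
  rw [projector, metricOf_mulVec_unitNormal hl ξ hγ hγs]
  simp [vecMulVec_apply]

end Blk

/-! ### The square root in the frame adapted to the geometric mean -/

/-- The square root `(g⁻¹ f)^{1/2}` in the frame `(∂ₜ - qⁱ ∂ᵢ, ∂ᵢ)`. -/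
noncomputable def frameS (L M lam : ℝ) (n : Pt N) (χ D : Mat N) : Mat (N + 1) :=
  blk (M / (L * lam)) (L⁻¹ • (χ *ᵥ n)) (-((M / lam) • n)) D

namespace BoostRel

variable {γ φ χ : Mat N} {n nt : Pt N} {lam : ℝ} (h : BoostRel γ φ χ n nt lam)
  {L M : ℝ} (hL : 0 < L) (hM : 0 < M)

include h hL hM

/-- The factorisation `g S = h`. Together with `h S = f` from `mean_mul_frameS` it yields `S² = g⁻¹
f` without squaring a block matrix, and it exhibits `h` as having shift `q` and spatial metric `χ`.
-/
theorem metric_mul_frameS : metricOf L (L • n) γ * frameS L M lam n χ (relD γ χ n)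
    = blk (-(L * M / lam)) 0 0 χ := by
  have hl := h.lam_pos
  have hγn : n ⬝ᵥ (γ *ᵥ n) = 1 - (lam ^ 2)⁻¹ := by
    have := h.lam_eq
    field_simp
    linarith
  have hγγ : γ *ᵥ (γ⁻¹ *ᵥ (χ *ᵥ n)) = χ *ᵥ n := by
    rw [Matrix.mulVec_mulVec, Matrix.mul_nonsing_inv _ h.γ_unit, Matrix.one_mulVec]
  have hDt : (relD γ χ n)ᵀ *ᵥ (γ *ᵥ n) = (lam ^ 2)⁻¹ • (χ *ᵥ n) := by
    rw [relD, Matrix.transpose_mul, Matrix.transpose_sub, h.γinv_symm, Matrix.transpose_vecMulVec,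
      h.χ_symm, ← Matrix.mulVec_mulVec, h.sub_vecMulVec_mulVec, Matrix.mulVec_smul]
  have hγD : γ * relD γ χ n = χ - vecMulVec (γ *ᵥ n) (χ *ᵥ n) := by
    rw [eq_sub_iff_add_eq, ← mul_vecMulVec', ← Matrix.mul_add, ← h.relB_eq, h.γ_mul_relB]
  rw [metricOf_eq_blk _ _ h.γ_symm, frameS, blk_mul]
  have e1 : (-L ^ 2 + (L • n) ⬝ᵥ (γ *ᵥ (L • n))) = -(L ^ 2 * (lam ^ 2)⁻¹) := by
    rw [Matrix.mulVec_smul, smul_dotProduct, dotProduct_smul, hγn, smul_eq_mul, smul_eq_mul]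
    ring
  have e2 : (γ *ᵥ (L • n)) ⬝ᵥ (-((M / lam) • n)) = -(L * (M / lam) * (1 - (lam ^ 2)⁻¹)) := by
    rw [Matrix.mulVec_smul, smul_dotProduct, dotProduct_neg, dotProduct_smul, dotProduct_comm, hγn,
      smul_eq_mul, smul_eq_mul]
    ring
  rw [e1, e2, hγD, Matrix.mulVec_smul, Matrix.mulVec_smul, hDt, Matrix.mulVec_neg,
    Matrix.mulVec_smul, smul_smul, smul_smul, smul_smul, ← add_smul, ← neg_smul, ← add_smul]
  congr 1
  · field_simp
    ring
  · have : -(L ^ 2 * (lam ^ 2)⁻¹) * L⁻¹ + L * (lam ^ 2)⁻¹ = 0 := by field_simp; ring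
    rw [this, zero_smul]
  · have : M / (L * lam) * L + -(M / lam) = 0 := by field_simp; ring
    rw [this, zero_smul]
  · rw [Matrix.smul_vecMulVec, Matrix.vecMulVec_smul, smul_smul, mul_inv_cancel₀ hL.ne', one_smul,
      add_sub_cancel]

theorem mean_mul_frameS : blk (-(L * M / lam)) 0 0 χ * frameS L M lam n χ (relD γ χ n)
    = metricOf M (-(M • nt)) φ := by
  have hl := h.lam_pos
  have hφn : nt ⬝ᵥ (φ *ᵥ nt) = 1 - (lam ^ 2)⁻¹ := by
    have := h.dual.lam_eq
    field_simp
    linarith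
  rw [metricOf_eq_blk _ _ h.φ_symm, frameS, blk_mul, h.χ_mul_relD]
  simp only [Matrix.mulVec_neg, Matrix.mulVec_smul, h.nt_eq, neg_dotProduct_neg, smul_dotProduct,
    dotProduct_smul, Matrix.mulVec_zero, smul_zero, zero_dotProduct, zero_add, add_zero, smul_smul]
  congr 1
  · have h1 : lam⁻¹ * (nt ⬝ᵥ (χ *ᵥ n)) = 1 - (lam ^ 2)⁻¹ := by
      rw [← hφn, h.nt_eq, dotProduct_smul, smul_eq_mul]
    simp only [smul_eq_mul]
    have h2 : M * lam⁻¹ * M * (nt ⬝ᵥ (χ *ᵥ n)) = M * M * (1 - (lam ^ 2)⁻¹) := by rw [← h1]; ring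
    rw [h2]
    field_simp
    ring
  · rw [← neg_smul]
    congr 1
    field_simp
  · ext i j; simp

/-- With the sign of its time entry reversed, the mean metric becomes a positive form `k`. Then `k
S` has diagonal blocks `(M / λ)²` and `φ` and opposite off-diagonal blocks, so Lyapunov's criterion
applies. -/
theorem formPos_frameS :
    FormPos (blk (L * M / lam) 0 0 χ * frameS L M lam n χ (relD γ χ n)) := by
  have hl := h.lam_pos
  have e : blk (L * M / lam) 0 0 χ * frameS L M lam n χ (relD γ χ n)
      = blk ((M / lam) ^ 2) ((M / lam) • (χ *ᵥ n)) (-((M / lam) • (χ *ᵥ n))) φ := by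
    rw [frameS, blk_mul, h.χ_mul_relD]
    simp only [Matrix.mulVec_neg, Matrix.mulVec_smul, Matrix.mulVec_zero, smul_zero,
      zero_dotProduct, zero_add, add_zero, smul_smul]
    congr 1
    · field_simp
    · congr 1
      field_simp
    · ext i j; simp
  rw [e]
  exact FormPos.blk (by positivity) h.φ_pos _

variable (q : Pt N)

theorem formPos_mean : FormPos ((shear q)ᵀ * blk (L * M / lam) 0 0 χ * shear q) := by
  have hl := h.lam_pos
  refine FormPos.conj ?_ (by rw [det_shear]; exact isUnit_one)
  have := FormPos.blk (show 0 < L * M / lam by positivity) h.χ_pos 0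
  rwa [neg_zero] at this

theorem formPos_mean_mul : FormPos ((shear q)ᵀ * blk (L * M / lam) 0 0 χ * shear q
    * (shear (-q) * frameS L M lam n χ (relD γ χ n) * shear q)) := by
  have e : (shear q)ᵀ * blk (L * M / lam) 0 0 χ * shear q
      * (shear (-q) * frameS L M lam n χ (relD γ χ n) * shear q)
      = (shear q)ᵀ * (blk (L * M / lam) 0 0 χ * frameS L M lam n χ (relD γ χ n)) * shear q := by
    have := shear_mul_neg q
    calc _ = (shear q)ᵀ * blk (L * M / lam) 0 0 χ * (shear q * shear (-q))
          * frameS L M lam n χ (relD γ χ n) * shear q := by simp only [Matrix.mul_assoc]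
      _ = _ := by rw [this, Matrix.mul_one]; simp only [Matrix.mul_assoc]
  rw [e]
  exact (h.formPos_frameS hL hM).conj (by rw [det_shear]; exact isUnit_one)

theorem metric_mul_sqrt : metricOf L (q + L • n) γ
      * (shear (-q) * frameS L M lam n χ (relD γ χ n) * shear q)
    = (shear q)ᵀ * blk (-(L * M / lam)) 0 0 χ * shear q := by
  rw [metricOf_add, ← h.metric_mul_frameS hL hM]
  calc _ = (shear q)ᵀ * metricOf L (L • n) γ * (shear q * shear (-q))
        * frameS L M lam n χ (relD γ χ n) * shear q := by simp only [Matrix.mul_assoc]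
    _ = _ := by rw [shear_mul_neg, Matrix.mul_one]; simp only [Matrix.mul_assoc]

theorem mean_mul_sqrt : (shear q)ᵀ * blk (-(L * M / lam)) 0 0 χ * shear q
      * (shear (-q) * frameS L M lam n χ (relD γ χ n) * shear q)
    = metricOf M (q - M • nt) φ := by
  rw [sub_eq_add_neg, metricOf_add, ← h.mean_mul_frameS hL hM]
  calc _ = (shear q)ᵀ * blk (-(L * M / lam)) 0 0 χ * (shear q * shear (-q))
        * frameS L M lam n χ (relD γ χ n) * shear q := by simp only [Matrix.mul_assoc]
    _ = _ := by rw [shear_mul_neg, Matrix.mul_one]; simp only [Matrix.mul_assoc]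

theorem isPrincipalSqrt_frame :
    IsPrincipalSqrt ((metricOf L (q + L • n) γ)⁻¹ * metricOf M (q - M • nt) φ)
      (shear (-q) * frameS L M lam n χ (relD γ χ n) * shear q) := by
  refine ⟨?_, re_pos_of_formPos ?_ (h.formPos_mean hL hM q) (h.formPos_mean_mul hL hM q)⟩
  · have hg : IsUnit (metricOf L (q + L • n) γ).det := by
      rw [det_metricOf]
      exact isUnit_iff_ne_zero.mpr (mul_ne_zero (neg_ne_zero.mpr (pow_ne_zero 2 hL.ne'))
        h.γ_pos.det_ne_zero)
    rw [← h.mean_mul_sqrt hL hM, ← h.metric_mul_sqrt hL hM, Matrix.mul_assoc (metricOf _ _ _),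
      Matrix.nonsing_inv_mul_cancel_left _ _ hg]
  · rw [Matrix.transpose_mul, Matrix.transpose_mul, Matrix.transpose_transpose, blk_transpose,
      h.χ_symm, Matrix.mul_assoc]

theorem det_frame {s : ℝ} (hs : 0 < s) : (1 + s • frameS L M lam n χ (relD γ χ n)).det
    = (1 + s • relD γ χ n).det + s * (M / (L * lam)) * (1 + s • relB γ χ).det := by
  have hl := h.lam_pos
  have hX := h.det_relD hs.le
  set X := 1 + s • relD γ χ n with hXdef
  -- The shear by `y` clears the time column, because `X y = s (M / λ) n`, and it does not change
  -- the determinant.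
  set y : Pt N := (s * (M / lam) * X.det⁻¹) • (X.adjugate *ᵥ n) with hy
  have hXy : X *ᵥ y = (s * (M / lam)) • n := by
    rw [hy, Matrix.mulVec_smul, Matrix.mulVec_mulVec, Matrix.mul_adjugate, Matrix.smul_mulVec,
      Matrix.one_mulVec, smul_smul]
    congr 1
    field_simp
  have hZ : 1 + s • frameS L M lam n χ (relD γ χ n)
      = blk (1 + s * (M / (L * lam))) ((s * L⁻¹) • (χ *ᵥ n)) (-((s * (M / lam)) • n)) X := by
    rw [frameS, smul_blk, one_eq_blk, blk_add, hXdef, smul_smul, smul_neg, smul_smul, zero_add,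
      zero_add]
  have hZy : (1 + s • frameS L M lam n χ (relD γ χ n)) * shear y
      = blk (1 + s * (M / (L * lam)) + ((s * L⁻¹) • (χ *ᵥ n)) ⬝ᵥ y) ((s * L⁻¹) • (χ *ᵥ n)) 0 X := by
    rw [hZ, shear_eq_blk, blk_mul, hXy]
    congr 1
    · ring
    · simp
    · simp
    · ext i j; simp
  have hdet := congrArg Matrix.det hZy
  rw [Matrix.det_mul, det_shear, mul_one, det_blk] at hdet
  rw [hdet, h.det_one_add_relB hs.le, hy, smul_dotProduct, dotProduct_smul, smul_eq_mul,
    smul_eq_mul]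
  field_simp
  ring

/-- The candidate is verified by multiplication and cancellation of the determinant. The rank one
relation, in column and row form, expresses all off-diagonal entries through the single vector `adj
(1 + s D) n`. -/
theorem adjugate_frame {s : ℝ} (hs : 0 < s) :
    (1 + s • frameS L M lam n χ (relD γ χ n)).adjugate
      = blk (1 + s • relD γ χ n).det
          (-((s * L⁻¹) • (χ *ᵥ ((1 + s • relD γ χ n).adjugate *ᵥ n))))
          ((M * lam⁻¹ * s) • ((1 + s • relD γ χ n).adjugate *ᵥ n))
          ((1 + s • relD γ χ n).adjugate + (M / L * lam⁻¹ * s) • (1 + s • relB γ χ).adjugate) := by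
  have hl := h.lam_pos
  have hX := h.det_relD hs.le
  have hdet := h.det_frame hL hM hs
  set Z := 1 + s • frameS L M lam n χ (relD γ χ n) with hZdef
  have hZ0 : Z.det ≠ 0 := by
    have := det_one_add_smul_ne_zero (h.formPos_mean hL hM 0) (h.formPos_mean_mul hL hM 0) hs.le
    simpa [shear_zero] using this
  have hB := h.det_one_add_relB hs.le
  have hrow := h.adjugate_relB_transpose_mulVec hs.le
  have hrowX : (1 + s • relD γ χ n).adjugateᵀ *ᵥ (χ *ᵥ n)
      = χ *ᵥ ((1 + s • relD γ χ n).adjugate *ᵥ n) := by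
    rw [Matrix.mulVec_mulVec, ← h.χ_mul_adjugate_relD hs.le, Matrix.mulVec_mulVec]
  have hXY : (1 + s • relD γ χ n) * (1 + s • relB γ χ).adjugate = (1 + s • relB γ χ).det • 1
      - s • vecMulVec n (χ *ᵥ ((1 + s • relD γ χ n).adjugate *ᵥ n)) := by
    rw [eq_sub_iff_add_eq, ← hrowX, ← hrow, ← vecMulVec_mul', ← Matrix.smul_mul, ← Matrix.add_mul,
      ← Matrix.mul_adjugate, h.relB_eq, smul_add, add_assoc]
  have hXX := Matrix.mul_adjugate (1 + s • relD γ χ n)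
  set X := 1 + s • relD γ χ n with hXdef
  set Y := 1 + s • relB γ χ with hYdef
  set u := X.adjugate *ᵥ n with hu
  have hXu : X *ᵥ u = X.det • n := by
    rw [hu, Matrix.mulVec_mulVec, hXX, Matrix.smul_mulVec, Matrix.one_mulVec]
  have hZb : Z = blk (1 + s * (M / (L * lam))) ((s * L⁻¹) • (χ *ᵥ n)) (-((s * (M / lam)) • n)) X := by
    rw [hZdef, frameS, smul_blk, one_eq_blk, blk_add, hXdef, smul_smul, smul_neg, smul_smul,
      zero_add, zero_add]
  have hmul : Z * blk X.det (-((s * L⁻¹) • (χ *ᵥ u))) ((M * lam⁻¹ * s) • u)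
      (X.adjugate + (M / L * lam⁻¹ * s) • Y.adjugate) = Z.det • 1 := by
    rw [hdet, hZb, blk_mul, one_eq_blk, smul_blk, Matrix.mulVec_smul X, hXu, Matrix.mul_add, hXX,
      Matrix.mul_smul, hXY, Matrix.transpose_add, Matrix.add_mulVec, Matrix.mulVec_smul, hrowX,
      Matrix.transpose_smul, Matrix.smul_mulVec, Matrix.mulVec_smul, hrow, hrowX]
    congr 1
    · rw [hB, smul_dotProduct, dotProduct_smul, smul_eq_mul, smul_eq_mul]
      field_simp
      ring
    · module
    · rw [smul_zero, smul_neg, smul_smul, smul_smul, ← neg_smul, ← add_smul]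
      have : -(X.det * (s * (M / lam))) + M * lam⁻¹ * s * X.det = 0 := by field_simp; ring
      rw [this, zero_smul]
    · rw [Matrix.neg_vecMulVec, Matrix.vecMulVec_neg, neg_neg, Matrix.smul_vecMulVec,
        Matrix.vecMulVec_smul, smul_sub, smul_smul, smul_smul, smul_smul]
      have e1 : s * (M / lam) * (s * L⁻¹) = M / L * lam⁻¹ * s * s := by field_simp
      have e2 : s * (M / (L * lam)) * Y.det = M / L * lam⁻¹ * s * Y.det := by field_simp
      rw [e1, e2]
      module
  have h3 := congrArg (fun T => Z.adjugate * T) hmul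
  simp only [← Matrix.mul_assoc, Matrix.adjugate_mul, Matrix.smul_mul, Matrix.one_mul,
    Matrix.mul_smul, Matrix.mul_one] at h3
  exact (smul_right_injective _ hZ0 h3).symm

variable {K : ℕ} {c s : Fin K → ℝ}

/-- `V_g` in the frame adapted to the geometric mean. -/
theorem opX_sqrt (hs : ∀ j, 0 < s j) :
    opX c s (shear (-q) * frameS L M lam n χ (relD γ χ n) * shear q)
      = shear (-q) * blk (potV c s (relD γ χ n))
          (-(L⁻¹ • (χ *ᵥ (opY c s (relD γ χ n) *ᵥ n))))
          (M • (lam⁻¹ • (opY c s (relD γ χ n) *ᵥ n)))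
          (opX c s (relD γ χ n) + (M / L) • (lam⁻¹ • opY c s (relB γ χ))) * shear q := by
  have hconj : ∀ j, (1 + s j • (shear (-q) * frameS L M lam n χ (relD γ χ n) * shear q)).adjugate
      = shear (-q) * (1 + s j • frameS L M lam n χ (relD γ χ n)).adjugate * shear q := by
    intro j
    have : 1 + s j • (shear (-q) * frameS L M lam n χ (relD γ χ n) * shear q)
        = shear (-q) * (1 + s j • frameS L M lam n χ (relD γ χ n)) * shear q := by
      rw [Matrix.mul_add, Matrix.mul_one, Matrix.add_mul, shear_neg_mul, Matrix.mul_smul,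
        Matrix.smul_mul]
    rw [this, Matrix.adjugate_mul_distrib, Matrix.adjugate_mul_distrib, adjugate_shear,
      adjugate_shear, neg_neg, Matrix.mul_assoc]
  have hX : opX c s (shear (-q) * frameS L M lam n χ (relD γ χ n) * shear q)
      = shear (-q) * opX c s (frameS L M lam n χ (relD γ χ n)) * shear q := by
    simp only [opX, Finset.mul_sum, Finset.sum_mul]
    exact Finset.sum_congr rfl fun j _ => by rw [hconj, Matrix.mul_smul, Matrix.smul_mul]
  rw [hX]
  congr 2
  have hsum : ∀ (a : Fin K → ℝ) (b d : Fin K → Pt N) (E : Fin K → Mat N),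
      ∑ j, blk (a j) (b j) (d j) (E j) = blk (∑ j, a j) (∑ j, b j) (∑ j, d j) (∑ j, E j) := by
    intro a b d E
    refine ext_blk ?_ (fun j => ?_) (fun i => ?_) fun i j => ?_ <;>
      simp [Matrix.sum_apply, Finset.sum_apply]
  have hadj := fun j => h.adjugate_frame hL hM (hs j)
  rw [opX]
  simp only [hadj, smul_blk]
  rw [hsum]
  congr 1
  · simp only [opY, Matrix.sum_mulVec, Matrix.smul_mulVec, Matrix.mulVec_sum, Matrix.mulVec_smul,
      Finset.smul_sum, smul_smul, smul_neg, Finset.sum_neg_distrib]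
    congr 1
    exact Finset.sum_congr rfl fun j _ => by congr 1; ring
  · simp only [opY, Matrix.sum_mulVec, Matrix.smul_mulVec, Finset.smul_sum, smul_smul]
    exact Finset.sum_congr rfl fun j _ => by congr 1; ring
  · simp only [opX, opY, smul_add, Finset.sum_add_distrib, Finset.smul_sum, smul_smul]
    congr 1
    exact Finset.sum_congr rfl fun j _ => by congr 1; ring

theorem potV_sqrt (hs : ∀ j, 0 < s j) :
    L * potV c s (shear (-q) * frameS L M lam n χ (relD γ χ n) * shear q)
      = L * potV c s (relD γ χ n) + M * (lam⁻¹ * potW c s (relB γ χ)) := by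
  have hl := h.lam_pos
  have hconj : ∀ j, (1 + s j • (shear (-q) * frameS L M lam n χ (relD γ χ n) * shear q)).det
      = (1 + s j • frameS L M lam n χ (relD γ χ n)).det := by
    intro j
    have : 1 + s j • (shear (-q) * frameS L M lam n χ (relD γ χ n) * shear q)
        = shear (-q) * (1 + s j • frameS L M lam n χ (relD γ χ n)) * shear q := by
      rw [Matrix.mul_add, Matrix.mul_one, Matrix.add_mul, shear_neg_mul, Matrix.mul_smul,
        Matrix.smul_mul]
    rw [this, Matrix.det_mul, Matrix.det_mul, det_shear, det_shear, one_mul, mul_one]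
  have hdet := fun j => h.det_frame hL hM (hs j)
  simp only [potV, potW, hconj, hdet, Finset.mul_sum, ← Finset.sum_add_distrib]
  refine Finset.sum_congr rfl fun j _ => ?_
  field_simp

end BoostRel

end Bimetric

namespace Bimetric

open Matrix

/-! ### Differential calculus of matrix fields -/

section Calculus

variable {E : Type*} [NormedAddCommGroup E] [NormedSpace ℝ E] {a b d n : ℕ}

/-- All entries of the matrix field are `Cᵏ` at `x`. -/
def MatCD (k : WithTop ℕ∞) (F : E → Matrix (Fin a) (Fin b) ℝ) (x : E) : Prop :=
  ∀ i j, ContDiffAt ℝ k (fun y => F y i j) x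

/-- All components of the vector field are `Cᵏ` at `x`. -/
def VecCD (k : WithTop ℕ∞) (u : E → Pt n) (x : E) : Prop :=
  ∀ i, ContDiffAt ℝ k (fun y => u y i) x

/-- The derivative of a matrix field in a direction. -/
noncomputable def dM (F : E → Matrix (Fin a) (Fin b) ℝ) (x v : E) : Matrix (Fin a) (Fin b) ℝ :=
  Matrix.of fun i j => fderiv ℝ (fun y => F y i j) x v

/-- The componentwise derivative of a vector field in a direction. -/
noncomputable def dV (u : E → Pt n) (x v : E) : Pt n := fun i => fderiv ℝ (fun y => u y i) x v

variable {k : WithTop ℕ∞} {x : E}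

section Regularity

variable {F G : E → Mat n} {u w : E → Pt n} {f : E → ℝ}

theorem MatCD.congr (hF : MatCD k F x) (h : ∀ᶠ y in 𝓝 x, G y = F y) : MatCD k G x :=
  fun i j => (hF i j).congr_of_eventuallyEq (h.mono fun y hy => by simp only [hy])

theorem MatCD.of_le {k' : WithTop ℕ∞} (hF : MatCD k F x) (h : k' ≤ k) : MatCD k' F x :=
  fun i j => (hF i j).of_le h

theorem VecCD.of_le {k' : WithTop ℕ∞} (hu : VecCD k u x) (h : k' ≤ k) : VecCD k' u x :=
  fun i => (hu i).of_le h

theorem matCD_const (A : Mat n) : MatCD k (fun _ : E => A) x := fun _ _ => contDiffAt_const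

theorem vecCD_const (z : Pt n) : VecCD k (fun _ : E => z) x := fun _ => contDiffAt_const

theorem MatCD.add (hF : MatCD k F x) (hG : MatCD k G x) : MatCD k (fun y => F y + G y) x :=
  fun i j => (hF i j).add (hG i j)

theorem MatCD.sub (hF : MatCD k F x) (hG : MatCD k G x) : MatCD k (fun y => F y - G y) x :=
  fun i j => (hF i j).sub (hG i j)

theorem MatCD.smul (hf : ContDiffAt ℝ k f x) (hF : MatCD k F x) :
    MatCD k (fun y => f y • F y) x := fun i j => hf.mul (hF i j)

theorem MatCD.transpose (hF : MatCD k F x) : MatCD k (fun y => (F y)ᵀ) x := fun i j => hF j i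

theorem MatCD.mul (hF : MatCD k F x) (hG : MatCD k G x) : MatCD k (fun y => F y * G y) x :=
  fun i j => by
    simp only [Matrix.mul_apply]
    exact ContDiffAt.sum fun l _ => (hF i l).mul (hG l j)

theorem MatCD.sum {ι : Type*} {t : Finset ι} {F : ι → E → Mat n} (h : ∀ i ∈ t, MatCD k (F i) x) :
    MatCD k (fun y => ∑ i ∈ t, F i y) x := fun i j => by
  simp only [Matrix.sum_apply]
  exact ContDiffAt.sum fun l hl => h l hl i j

theorem MatCD.det (hF : MatCD k F x) : ContDiffAt ℝ k (fun y => (F y).det) x := by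
  simp only [Matrix.det_apply']
  exact ContDiffAt.sum fun σ _ => contDiffAt_const.mul (contDiffAt_prod fun i _ => hF _ _)

theorem MatCD.adjugate (hF : MatCD k F x) : MatCD k (fun y => (F y).adjugate) x := fun i j => by
  simp only [Matrix.adjugate_apply]
  refine MatCD.det (F := fun y => (F y).updateRow j (Pi.single i 1)) fun p q => ?_
  by_cases hp : p = j
  · subst hp
    simpa [Matrix.updateRow_self] using contDiffAt_const
  · simpa [Matrix.updateRow_ne hp] using hF p q

theorem MatCD.inv (hF : MatCD k F x) (hx : IsUnit (F x).det) : MatCD k (fun y => (F y)⁻¹) x :=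
  fun i j => by
    simp only [Matrix.inv_def, Ring.inverse_eq_inv', Matrix.smul_apply, smul_eq_mul]
    exact (hF.det.inv hx.ne_zero).mul (hF.adjugate i j)

theorem MatCD.mulVec (hF : MatCD k F x) (hu : VecCD k u x) : VecCD k (fun y => F y *ᵥ u y) x :=
  fun i => by
    simp only [Matrix.mulVec, dotProduct]
    exact ContDiffAt.sum fun l _ => (hF i l).mul (hu l)

theorem VecCD.dotProduct (hu : VecCD k u x) (hw : VecCD k w x) :
    ContDiffAt ℝ k (fun y => u y ⬝ᵥ w y) x := by
  simp only [_root_.dotProduct]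
  exact ContDiffAt.sum fun l _ => (hu l).mul (hw l)

theorem VecCD.vecMulVec (hu : VecCD k u x) (hw : VecCD k w x) :
    MatCD k (fun y => Matrix.vecMulVec (u y) (w y)) x := fun i j => (hu i).mul (hw j)

theorem VecCD.smul (hf : ContDiffAt ℝ k f x) (hu : VecCD k u x) : VecCD k (fun y => f y • u y) x :=
  fun i => hf.mul (hu i)

theorem VecCD.add (hu : VecCD k u x) (hw : VecCD k w x) : VecCD k (fun y => u y + w y) x :=
  fun i => (hu i).add (hw i)

theorem VecCD.neg (hu : VecCD k u x) : VecCD k (fun y => -u y) x := fun i => (hu i).neg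

theorem MatCD.trace (hF : MatCD k F x) : ContDiffAt ℝ k (fun y => (F y).trace) x := by
  simp only [Matrix.trace, Matrix.diag_apply]
  exact ContDiffAt.sum fun l _ => hF l l

variable {K : ℕ} {c s : Fin K → ℝ}

theorem MatCD.one_add_smul (hF : MatCD k F x) (r : ℝ) : MatCD k (fun y => 1 + r • F y) x :=
  (matCD_const 1).add (MatCD.smul contDiffAt_const hF)

theorem MatCD.opY (hF : MatCD k F x) : MatCD k (fun y => opY c s (F y)) x :=
  MatCD.sum fun j _ => MatCD.smul contDiffAt_const (hF.one_add_smul (s j)).adjugate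

theorem MatCD.potV (hF : MatCD k F x) : ContDiffAt ℝ k (fun y => potV c s (F y)) x :=
  ContDiffAt.sum fun j _ => contDiffAt_const.mul (hF.one_add_smul (s j)).det

theorem MatCD.potW (hF : MatCD k F x) : ContDiffAt ℝ k (fun y => potW c s (F y)) x :=
  ContDiffAt.sum fun j _ => contDiffAt_const.mul (hF.one_add_smul (s j)).det

theorem MatCD.relD (hF : MatCD k F x) (hx : IsUnit (F x).det) (hG : MatCD k G x)
    (hu : VecCD k u x) : MatCD k (fun y => relD (F y) (G y) (u y)) x :=
  ((hF.inv hx).sub (hu.vecMulVec hu)).mul hG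

theorem MatCD.relB (hF : MatCD k F x) (hx : IsUnit (F x).det) (hG : MatCD k G x) :
    MatCD k (fun y => relB (F y) (G y)) x := (hF.inv hx).mul hG

end Regularity

section Derivatives

variable {F G : E → Mat n} {u w : E → Pt n} {f g : E → ℝ} (v : E)

theorem _root_.ContDiffAt.diff (hf : ContDiffAt ℝ 1 f x) : DifferentiableAt ℝ f x :=
  hf.differentiableAt one_ne_zero

theorem fderiv_mul_apply (hf : DifferentiableAt ℝ f x) (hg : DifferentiableAt ℝ g x) :
    fderiv ℝ (fun y => f y * g y) x v = f x * fderiv ℝ g x v + fderiv ℝ f x v * g x := by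
  rw [fderiv_fun_mul hf hg]
  simp [mul_comm]

theorem fderiv_sum_apply {ι : Type*} {t : Finset ι} {A : ι → E → ℝ}
    (h : ∀ i ∈ t, DifferentiableAt ℝ (A i) x) :
    fderiv ℝ (fun y => ∑ i ∈ t, A i y) x v = ∑ i ∈ t, fderiv ℝ (A i) x v := by
  rw [fderiv_fun_sum h]
  simp

theorem dM_congr (h : ∀ᶠ y in 𝓝 x, G y = F y) : dM G x v = dM F x v := by
  ext i j
  have : (fun y => G y i j) =ᶠ[𝓝 x] fun y => F y i j := h.mono fun y hy => by simp only [hy]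
  simp only [dM, Matrix.of_apply, this.fderiv_eq]

theorem dV_congr (h : ∀ᶠ y in 𝓝 x, w y = u y) : dV w x v = dV u x v := by
  ext i
  have : (fun y => w y i) =ᶠ[𝓝 x] fun y => u y i := h.mono fun y hy => by simp only [hy]
  simp only [dV, this.fderiv_eq]

theorem dM_const (A : Mat n) : dM (fun _ : E => A) x v = 0 := by
  ext i j
  simp [dM]

theorem dM_transpose (F : E → Mat n) : dM (fun y => (F y)ᵀ) x v = (dM F x v)ᵀ := rfl

theorem dM_symm (h : ∀ᶠ y in 𝓝 x, (F y)ᵀ = F y) : (dM F x v)ᵀ = dM F x v :=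
  (dM_transpose v F).symm.trans (dM_congr v h)

theorem dM_add (hF : MatCD 1 F x) (hG : MatCD 1 G x) :
    dM (fun y => F y + G y) x v = dM F x v + dM G x v := by
  ext i j
  simp only [dM, Matrix.of_apply, Matrix.add_apply]
  rw [fderiv_fun_add (hF i j).diff (hG i j).diff]
  rfl

theorem dM_sub (hF : MatCD 1 F x) (hG : MatCD 1 G x) :
    dM (fun y => F y - G y) x v = dM F x v - dM G x v := by
  ext i j
  simp only [dM, Matrix.of_apply, Matrix.sub_apply]
  rw [fderiv_fun_sub (hF i j).diff (hG i j).diff]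
  rfl

theorem dM_smul (hf : ContDiffAt ℝ 1 f x) (hF : MatCD 1 F x) :
    dM (fun y => f y • F y) x v = f x • dM F x v + fderiv ℝ f x v • F x := by
  ext i j
  simp only [dM, Matrix.of_apply, Matrix.smul_apply, Matrix.add_apply, smul_eq_mul]
  exact fderiv_mul_apply v hf.diff (hF i j).diff

theorem dM_mul (hF : MatCD 1 F x) (hG : MatCD 1 G x) :
    dM (fun y => F y * G y) x v = dM F x v * G x + F x * dM G x v := by
  ext i j
  simp only [dM, Matrix.of_apply, Matrix.mul_apply, Matrix.add_apply]
  rw [fderiv_sum_apply v fun l _ => ((hF i l).mul (hG l j)).diff, ← Finset.sum_add_distrib]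
  exact Finset.sum_congr rfl fun l _ => by
    rw [fderiv_mul_apply v (hF i l).diff (hG l j).diff, add_comm]

theorem dM_vecMulVec (hu : VecCD 1 u x) (hw : VecCD 1 w x) :
    dM (fun y => vecMulVec (u y) (w y)) x v
      = vecMulVec (dV u x v) (w x) + vecMulVec (u x) (dV w x v) := by
  ext i j
  simp only [dM, Matrix.of_apply, vecMulVec_apply, Matrix.add_apply, dV]
  rw [fderiv_mul_apply v (hu i).diff (hw j).diff, add_comm]

theorem dM_inv (hF : MatCD 1 F x) (hx : IsUnit (F x).det) :
    dM (fun y => (F y)⁻¹) x v = -((F x)⁻¹ * dM F x v * (F x)⁻¹) := by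
  have hi := hF.inv hx
  have hev : ∀ᶠ y in 𝓝 x, F y * (F y)⁻¹ = 1 := by
    have : ∀ᶠ y in 𝓝 x, (F y).det ≠ 0 := hF.det.continuousAt.eventually_ne hx.ne_zero
    exact this.mono fun y hy => Matrix.mul_nonsing_inv _ (isUnit_iff_ne_zero.mpr hy)
  have h1 := dM_mul v hF hi
  rw [dM_congr v hev, dM_const] at h1
  have h2 := congrArg (fun X => (F x)⁻¹ * X) h1
  simp only [Matrix.mul_zero, Matrix.mul_add] at h2
  rw [Matrix.nonsing_inv_mul_cancel_left _ _ hx, ← Matrix.mul_assoc] at h2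
  exact eq_neg_of_add_eq_zero_right h2.symm

theorem dV_add (hu : VecCD 1 u x) (hw : VecCD 1 w x) :
    dV (fun y => u y + w y) x v = dV u x v + dV w x v := by
  ext i
  simp only [dV, Pi.add_apply]
  rw [fderiv_fun_add (hu i).diff (hw i).diff]
  rfl

theorem dV_neg (u : E → Pt n) : dV (fun y => -u y) x v = -dV u x v := by
  ext i
  simp only [dV, Pi.neg_apply]
  rw [fderiv_fun_neg]
  rfl

theorem dV_smul (hf : ContDiffAt ℝ 1 f x) (hu : VecCD 1 u x) :
    dV (fun y => f y • u y) x v = f x • dV u x v + fderiv ℝ f x v • u x := by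
  ext i
  simp only [dV, Pi.smul_apply, Pi.add_apply, smul_eq_mul]
  exact fderiv_mul_apply v hf.diff (hu i).diff

theorem dV_mulVec (hF : MatCD 1 F x) (hu : VecCD 1 u x) :
    dV (fun y => F y *ᵥ u y) x v = dM F x v *ᵥ u x + F x *ᵥ dV u x v := by
  ext i
  simp only [dV, Matrix.mulVec, dotProduct, Pi.add_apply, dM, Matrix.of_apply]
  rw [fderiv_sum_apply v fun l _ => ((hF i l).mul (hu l)).diff, ← Finset.sum_add_distrib]
  exact Finset.sum_congr rfl fun l _ => by
    rw [fderiv_mul_apply v (hF i l).diff (hu l).diff, add_comm]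

/-- Jacobi's formula. -/
theorem fderiv_det (hF : MatCD 1 F x) :
    fderiv ℝ (fun y => (F y).det) x v = ((F x).adjugate * dM F x v).trace := by
  have h1 : ∀ σ : Equiv.Perm (Fin n), fderiv ℝ (fun y => ∏ i, F y (σ i) i) x v
      = ∑ i, (∏ j ∈ Finset.univ.erase i, F x (σ j) j) * dM F x v (σ i) i := by
    intro σ
    have := (HasFDerivAt.finsetProd (u := Finset.univ) (g := fun i y => F y (σ i) i)
      fun i _ => (hF (σ i) i).diff.hasFDerivAt).fderiv
    rw [this]
    simp [dM]
  -- By Cramer's rule this diagonal entry is the determinant with one column replaced by its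
  -- derivative.
  have h2 : ∀ i, ((F x).adjugate * dM F x v) i i = ∑ σ : Equiv.Perm (Fin n),
      ((Equiv.Perm.sign σ : ℤ) : ℝ) * ((∏ j ∈ Finset.univ.erase i, F x (σ j) j) * dM F x v (σ i) i) := by
    intro i
    have e : ((F x).adjugate * dM F x v) i i = ((F x).updateCol i fun l => dM F x v l i).det := by
      rw [← Matrix.cramer_apply, Matrix.cramer_eq_adjugate_mulVec]
      rfl
    rw [e, Matrix.det_apply']
    refine Finset.sum_congr rfl fun σ _ => ?_
    congr 1
    rw [← Finset.prod_erase_mul _ _ (Finset.mem_univ i)]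
    congr 1
    · refine Finset.prod_congr rfl fun j hj => ?_
      rw [Matrix.updateCol_ne (Finset.ne_of_mem_erase hj)]
    · rw [Matrix.updateCol_self]
  simp only [Matrix.det_apply']
  rw [fderiv_sum_apply v fun σ _ =>
    (contDiffAt_const.mul (contDiffAt_prod fun i _ => hF (σ i) i)).diff]
  simp only [Matrix.trace, Matrix.diag_apply, h2]
  rw [Finset.sum_comm]
  refine Finset.sum_congr rfl fun σ _ => ?_
  rw [fderiv_const_mul (contDiffAt_prod fun i _ => hF (σ i) i).diff, _root_.smul_apply, h1,
    smul_eq_mul, Finset.mul_sum]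

theorem fderiv_det_of_isUnit (hF : MatCD 1 F x) (hx : IsUnit (F x).det) :
    fderiv ℝ (fun y => (F y).det) x v = (F x).det * ((F x)⁻¹ * dM F x v).trace := by
  rw [fderiv_det v hF, Matrix.inv_def, Ring.inverse_eq_inv', Matrix.smul_mul, Matrix.trace_smul,
    smul_eq_mul, ← mul_assoc, mul_inv_cancel₀ hx.ne_zero, one_mul]

theorem sqrtDet_contDiffAt (hF : MatCD k F x) (hx : 0 < (F x).det) :
    ContDiffAt ℝ k (fun y => sqrtDet (F y)) x := hF.det.sqrt hx.ne'

theorem fderiv_sqrtDet (hF : MatCD 1 F x) (hx : 0 < (F x).det) :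
    fderiv ℝ (fun y => sqrtDet (F y)) x v
      = sqrtDet (F x) * (1 / 2 * ((F x)⁻¹ * dM F x v).trace) := by
  have h1 := (hF.det.diff.hasFDerivAt.sqrt hx.ne').fderiv
  have h2 : fderiv ℝ (fun y => sqrtDet (F y)) x = fderiv ℝ (fun y => Real.sqrt (F y).det) x := rfl
  rw [h2, h1, _root_.smul_apply, fderiv_det_of_isUnit v hF (isUnit_iff_ne_zero.mpr hx.ne'),
    smul_eq_mul, sqrtDet]
  have h3 := Real.sqrt_pos.mpr hx
  nth_rewrite 2 [← Real.mul_self_sqrt hx.le]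
  field_simp

variable {K : ℕ} {c s : Fin K → ℝ}

/-- Jacobi's formula; the chain rule supplies the extra factor `sⱼ` that turns the weights of `potV`
into those of `opY`. -/
theorem fderiv_potV (hF : MatCD 1 F x) :
    fderiv ℝ (fun y => potV c s (F y)) x v = (opY c s (F x) * dM F x v).trace := by
  simp only [potV]
  rw [fderiv_sum_apply v fun j _ => (contDiffAt_const.mul (hF.one_add_smul (s j)).det).diff, opY,
    Finset.sum_mul, Matrix.trace_sum]
  refine Finset.sum_congr rfl fun j _ => ?_
  rw [fderiv_const_mul (hF.one_add_smul (s j)).det.diff, _root_.smul_apply,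
    fderiv_det v (hF.one_add_smul (s j)), dM_add v (matCD_const 1) (MatCD.smul contDiffAt_const hF),
    dM_const, zero_add, dM_smul v contDiffAt_const hF]
  simp [mul_assoc]

end Derivatives

end Calculus

end Bimetric

namespace Bimetric

open Matrix

variable {N : ℕ}

/-! ### Variation of the potential with the metrics -/

section Variation

variable {E : Type*} [NormedAddCommGroup E] [NormedSpace ℝ E] {x : E} {K : ℕ} {c s : Fin K → ℝ}

theorem trace_mul_symm {A : Mat N} (hA : Aᵀ = A) (B : Mat N) : (A * Bᵀ).trace = (A * B).trace := by
  rw [← Matrix.trace_transpose, Matrix.transpose_mul, Matrix.transpose_transpose, hA,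
    Matrix.trace_mul_comm]

/-- The variation of the potential `𝒱 = ∑ c det (1 + s D)`. -/
theorem fderiv_potV_relD {γ φ χ : E → Mat N} {n : E → Pt N} {nt : Pt N} {lam : ℝ}
    (h : BoostRel (γ x) (φ x) (χ x) (n x) nt lam) (hγ : MatCD 1 γ x) (hχ : MatCD 1 χ x)
    (hn : VecCD 1 n x)
    (hφ : ∀ᶠ y in 𝓝 x, φ y = χ y * ((γ y)⁻¹ - vecMulVec (n y) (n y)) * χ y)
    (hs : ∀ j, 0 < s j) (v : E) :
    fderiv ℝ (fun y => potV c s (relD (γ y) (χ y) (n y))) x v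
      = -((χ x *ᵥ (opY c s (relD (γ x) (χ x) (n x)) *ᵥ n x)) ⬝ᵥ dV n x v)
        - 1 / 2 * ((relD (γ x) (χ x) (n x) * opY c s (relD (γ x) (χ x) (n x))
            + vecMulVec (n x) (χ x *ᵥ (opY c s (relD (γ x) (χ x) (n x)) *ᵥ n x)))
            * (γ x)⁻¹ * dM γ x v).trace
        + 1 / 2 * (relD (γ x) (χ x) (n x) * opY c s (relD (γ x) (χ x) (n x))
            * (φ x)⁻¹ * dM φ x v).trace := by
  have hD : MatCD 1 (fun y => relD (γ y) (χ y) (n y)) x := hγ.relD h.γ_unit hχ hn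
  have hi := hγ.inv h.γ_unit
  have hP : MatCD 1 (fun y => (γ y)⁻¹ - vecMulVec (n y) (n y)) x := hi.sub (hn.vecMulVec hn)
  rw [fderiv_potV v hD]
  have hχY := h.χ_mul_opY (c := c) hs
  have hDY := opY_commute (c := c) (s := s) (relD (γ x) (χ x) (n x))
  set D := relD (γ x) (χ x) (n x) with hDdef
  set Y := opY c s D with hYdef
  set P := (γ x)⁻¹ - vecMulVec (n x) (n x) with hPdef
  set dP := dM (fun y => (γ y)⁻¹ - vecMulVec (n y) (n y)) x v with hdP
  have hdD : dM (fun y => relD (γ y) (χ y) (n y)) x v = dP * χ x + P * dM χ x v := dM_mul v hP hχ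
  have hdφ : dM φ x v = dM χ x v * D + χ x * dP * χ x + Dᵀ * dM χ x v := by
    have h1 : χ x * P = Dᵀ := by
      rw [hDdef, relD, Matrix.transpose_mul, h.χ_symm, Matrix.transpose_sub, h.γinv_symm,
        Matrix.transpose_vecMulVec]
    rw [dM_congr v hφ, dM_mul v (hχ.mul hP) hχ, dM_mul v hχ hP, Matrix.add_mul, h1,
      Matrix.mul_assoc (dM χ x v)]
    rfl
  have hdPv : dP = -((γ x)⁻¹ * dM γ x v * (γ x)⁻¹)
      - (vecMulVec (dV n x v) (n x) + vecMulVec (n x) (dV n x v)) := by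
    rw [hdP, dM_sub v hi (hn.vecMulVec hn), dM_inv v hγ h.γ_unit, dM_vecMulVec v hn hn]
  have hφD : (φ x)⁻¹ = D⁻¹ * (χ x)⁻¹ := by rw [← h.χ_mul_relD, Matrix.mul_inv_rev]
  have hUφ : D * Y * (φ x)⁻¹ = Y * (χ x)⁻¹ := by
    rw [hφD, hDY, ← Matrix.mul_assoc, Matrix.mul_nonsing_inv_cancel_right _ _ h.relD_unit]
  have hχD : (χ x)⁻¹ * Dᵀ = P := by
    rw [hDdef, relD, Matrix.transpose_mul, h.χ_symm, Matrix.transpose_sub, h.γinv_symm,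
        Matrix.transpose_vecMulVec, Matrix.nonsing_inv_mul_cancel_left _ _ h.χ_unit]
  have hDχ : D * (χ x)⁻¹ = P := by
    rw [hDdef, relD, Matrix.mul_nonsing_inv_cancel_right _ _ h.χ_unit]
  -- Both `dχ` terms of `dφ` have the same trace against `Ũ φ⁻¹ = Y χ⁻¹`. Half the `φ` variation
  -- therefore reproduces the `dχ` term of `dD`, and the derivative of the square root is never
  -- needed explicitly; half of `tr (Y dP χ)` remains.
  have t1 : (Y * (χ x)⁻¹ * (dM χ x v * D)).trace = (Y * P * dM χ x v).trace := by
    rw [← Matrix.mul_assoc, Matrix.trace_mul_comm, ← Matrix.mul_assoc, ← Matrix.mul_assoc, hDY,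
      Matrix.mul_assoc Y, hDχ]
  have t2 : (Y * (χ x)⁻¹ * (Dᵀ * dM χ x v)).trace = (Y * P * dM χ x v).trace := by
    rw [← Matrix.mul_assoc, Matrix.mul_assoc Y, hχD]
  have t3 : (Y * (χ x)⁻¹ * (χ x * dP * χ x)).trace = (Y * dP * χ x).trace := by
    rw [Matrix.mul_assoc (χ x), Matrix.mul_assoc Y, Matrix.nonsing_inv_mul_cancel_left _ _ h.χ_unit,
      ← Matrix.mul_assoc]
  have hB : (γ x)⁻¹ * χ x = D + vecMulVec (n x) (χ x *ᵥ n x) := h.relB_eq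
  have hYc : Yᵀ *ᵥ (χ x *ᵥ n x) = χ x *ᵥ (Y *ᵥ n x) := by
    rw [Matrix.mulVec_mulVec, ← hχY, ← Matrix.mulVec_mulVec]
  have t4 : (Y * dP * χ x).trace
      = -((D * Y + vecMulVec (n x) (χ x *ᵥ (Y *ᵥ n x))) * (γ x)⁻¹ * dM γ x v).trace
        - 2 * ((χ x *ᵥ (Y *ᵥ n x)) ⬝ᵥ dV n x v) := by
    have s1 : (Y * ((γ x)⁻¹ * dM γ x v * (γ x)⁻¹) * χ x).trace
        = ((D * Y + vecMulVec (n x) (χ x *ᵥ (Y *ᵥ n x))) * (γ x)⁻¹ * dM γ x v).trace := by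
      have e : Y * ((γ x)⁻¹ * dM γ x v * (γ x)⁻¹) * χ x
          = Y * ((γ x)⁻¹ * dM γ x v) * ((γ x)⁻¹ * χ x) := by simp only [Matrix.mul_assoc]
      rw [e, Matrix.trace_mul_comm, hB, ← Matrix.mul_assoc, Matrix.add_mul D, vecMulVec_mul', hYc,
        Matrix.mul_assoc _ (γ x)⁻¹]
    have s2 : (Y * vecMulVec (dV n x v) (n x) * χ x).trace
        = (χ x *ᵥ (Y *ᵥ n x)) ⬝ᵥ dV n x v := by
      rw [Matrix.mul_assoc, Matrix.trace_mul_comm, vecMulVec_mul', h.χ_symm, vecMulVec_mul', hYc,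
        Matrix.trace_vecMulVec, dotProduct_comm]
    have s3 : (Y * vecMulVec (n x) (dV n x v) * χ x).trace
        = (χ x *ᵥ (Y *ᵥ n x)) ⬝ᵥ dV n x v := by
      rw [Matrix.trace_mul_comm, ← Matrix.mul_assoc, mul_vecMulVec', Matrix.trace_vecMulVec,
        ← Matrix.mulVec_mulVec]
    rw [hdPv, Matrix.mul_sub, Matrix.mul_add, Matrix.sub_mul, Matrix.add_mul, Matrix.mul_neg,
      Matrix.neg_mul, Matrix.trace_sub, Matrix.trace_add, Matrix.trace_neg, s1, s2, s3]
    ring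
  have t5 : (Y * (dP * χ x)).trace = (Y * dP * χ x).trace := by rw [Matrix.mul_assoc]
  have t6 : (Y * (P * dM χ x v)).trace = (Y * P * dM χ x v).trace := by rw [Matrix.mul_assoc]
  rw [hdD, hdφ, hUφ, Matrix.mul_add, Matrix.mul_add, Matrix.mul_add, Matrix.trace_add,
    Matrix.trace_add, Matrix.trace_add, t1, t2, t3, t5, t6]
  linear_combination 1 / 2 * t4

end Variation

/-! ### Contractions of the Christoffel symbols -/

section Christoffel

variable {n : ℕ} {k : Pt n → Mat n} {x : Pt n}

/-- Against a symmetric tensor two of the three derivatives in a Christoffel symbol cancel. -/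
theorem sum_contract {T : Mat n} (hT : Tᵀ = T) (P : Fin n → Mat n) (l : Fin n) :
    ∑ i, ∑ d, T i d * (P i d l + P l d i - P d i l) = (T * P l).trace := by
  have hsym : ∀ i d, T d i = T i d := fun i d => congrFun (congrFun hT i) d
  have h1 : ∑ i, ∑ d, T i d * P d i l = ∑ i, ∑ d, T i d * P i d l := by
    rw [Finset.sum_comm]
    exact Finset.sum_congr rfl fun i _ => Finset.sum_congr rfl fun d _ => by rw [hsym]
  simp only [mul_sub, mul_add, Finset.sum_sub_distrib, Finset.sum_add_distrib, h1]
  simp only [Matrix.trace, Matrix.diag_apply, Matrix.mul_apply]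
  ring

theorem sum_christoffel (T : Mat n) (hT : (T * (k x)⁻¹)ᵀ = T * (k x)⁻¹) (l : Fin n) :
    ∑ i, ∑ j, T i j * christoffel k x j i l
      = 1 / 2 * (T * (k x)⁻¹ * dM k x (Pi.single l 1)).trace := by
  rw [← sum_contract hT (fun i => dM k x (Pi.single i 1)) l, Finset.mul_sum]
  refine Finset.sum_congr rfl fun i _ => ?_
  simp only [christoffel, Finset.mul_sum, Matrix.mul_apply, Finset.sum_mul]
  rw [Finset.sum_comm]
  refine Finset.sum_congr rfl fun d _ => Finset.sum_congr rfl fun j _ => ?_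
  simp only [dM, pd, Matrix.of_apply]
  ring

theorem sum_christoffel_diag (hk : ((k x)⁻¹)ᵀ = (k x)⁻¹) (l : Fin n) :
    ∑ i, christoffel k x i i l = 1 / 2 * ((k x)⁻¹ * dM k x (Pi.single l 1)).trace := by
  have h := sum_christoffel (k := k) (x := x) 1 (by rw [Matrix.one_mul, hk]) l
  rw [Matrix.one_mul] at h
  rw [← h]
  refine Finset.sum_congr rfl fun i _ => ?_
  simp [Matrix.one_apply]

/-- The usual formula for a symmetric tensor: the first Christoffel contraction is the logarithmic
derivative of the volume, and the second is half the tensor paired with `∂_ν k`. -/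
theorem divOperator_eq (X : Pt n → Mat n) (hk : ((k x)⁻¹)ᵀ = (k x)⁻¹)
    (hX : (X x * (k x)⁻¹)ᵀ = X x * (k x)⁻¹) (ν : Fin n) :
    divOperator k X x ν = (∑ μ, (dM X x (Pi.single μ 1) μ ν
        + 1 / 2 * ((k x)⁻¹ * dM k x (Pi.single μ 1)).trace * X x μ ν))
      - 1 / 2 * (X x * (k x)⁻¹ * dM k x (Pi.single ν 1)).trace := by
  rw [← sum_christoffel (X x) hX ν]
  simp only [divOperator, Finset.sum_add_distrib, Finset.sum_sub_distrib]
  have h1 : ∑ μ, ∑ σ, christoffel k x μ μ σ * X x σ ν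
      = ∑ μ, 1 / 2 * ((k x)⁻¹ * dM k x (Pi.single μ 1)).trace * X x μ ν := by
    rw [Finset.sum_comm]
    refine Finset.sum_congr rfl fun σ _ => ?_
    rw [← Finset.sum_mul, sum_christoffel_diag hk]
  have h2 : ∑ μ, ∑ σ, christoffel k x σ μ ν * X x μ σ = ∑ i, ∑ j, X x i j * christoffel k x j i ν :=
    Finset.sum_congr rfl fun _ _ => Finset.sum_congr rfl fun _ _ => mul_comm _ _
  rw [h1, h2]
  simp only [dM, pd, Matrix.of_apply]
  ring

theorem sum_mul_covDeriv {T : Mat n} (hT : (T * (k x)⁻¹)ᵀ = T * (k x)⁻¹) (ξ : Pt n → Pt n) :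
    ∑ i, ∑ j, T i j * covDeriv k ξ x i j = (∑ i, ∑ j, T i j * dV ξ x (Pi.single i 1) j)
      + ∑ l, ξ x l * (1 / 2 * (T * (k x)⁻¹ * dM k x (Pi.single l 1)).trace) := by
  simp only [covDeriv, mul_add, Finset.sum_add_distrib, ← sum_christoffel T hT, Finset.mul_sum]
  congr 1
  conv_rhs => rw [Finset.sum_comm]
  refine Finset.sum_congr rfl fun i _ => ?_
  rw [Finset.sum_comm]
  refine Finset.sum_congr rfl fun l _ => Finset.sum_congr rfl fun j _ => ?_
  ring

theorem divVector_eq (hk : ((k x)⁻¹)ᵀ = (k x)⁻¹) (ξ : Pt n → Pt n) :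
    divVector k ξ x = (∑ i, dV ξ x (Pi.single i 1) i)
      + ∑ l, ξ x l * (1 / 2 * ((k x)⁻¹ * dM k x (Pi.single l 1)).trace) := by
  simp only [divVector, covDeriv, Finset.sum_add_distrib, ← sum_christoffel_diag hk, Finset.mul_sum]
  congr 1
  rw [Finset.sum_comm]
  exact Finset.sum_congr rfl fun _ _ => Finset.sum_congr rfl fun _ _ => mul_comm _ _

end Christoffel

/-! ### Regularity of the fields built from vielbeins -/

section Regularity

variable {E : Type*} [NormedAddCommGroup E] [NormedSpace ℝ E]

/-- Vielbeins and a boost vector which are `Cᵏ` at `x`, with positive definite `χ` nearby. -/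
structure VielbeinReg (k : WithTop ℕ∞) (e m : E → Mat N) (p : E → Pt N) (x : E) : Prop where
  e_cd : MatCD k e x
  m_cd : MatCD k m x
  p_cd : VecCD k p x
  posDef : ∀ᶠ y in 𝓝 x, (chi (e y) (m y) (p y)).PosDef

namespace VielbeinReg

variable {k : WithTop ℕ∞} {e m : E → Mat N} {p : E → Pt N} {x : E} (r : VielbeinReg k e m p x)

include r

theorem of_le {k' : WithTop ℕ∞} (h : k' ≤ k) : VielbeinReg k' e m p x :=
  ⟨r.e_cd.of_le h, r.m_cd.of_le h, r.p_cd.of_le h, r.posDef⟩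

theorem rel_eventually : ∀ᶠ y in 𝓝 x, BoostRel (gram (e y)) (gram (m y)) (chi (e y) (m y) (p y))
    (boostVec (e y) (p y)) (boostVec (m y) (p y)) (lorentz (p y)) :=
  r.posDef.mono fun _ hy => boostRel_of_vielbein hy

theorem rel : BoostRel (gram (e x)) (gram (m x)) (chi (e x) (m x) (p x))
    (boostVec (e x) (p x)) (boostVec (m x) (p x)) (lorentz (p x)) := r.rel_eventually.self_of_nhds

theorem gram_cd : MatCD k (fun y => gram (e y)) x := r.e_cd.transpose.mul r.e_cd

theorem gram_cd' : MatCD k (fun y => gram (m y)) x := r.m_cd.transpose.mul r.m_cd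

theorem lorentz_cd : ContDiffAt ℝ k (fun y => lorentz (p y)) x := by
  refine (contDiffAt_const.add (r.p_cd.dotProduct r.p_cd)).sqrt ?_
  rw [← lorentz_sq]
  exact (pow_pos (lorentz_pos _) 2).ne'

theorem vel_cd : VecCD k (fun y => vel (p y)) x :=
  r.p_cd.smul (r.lorentz_cd.inv (lorentz_pos _).ne')

theorem boost_cd : MatCD k (fun y => boost (p y)) x := by
  simp only [boost_eq]
  refine (matCD_const 1).add (MatCD.smul ?_ (r.p_cd.vecMulVec r.p_cd))
  exact (contDiffAt_const.add r.lorentz_cd).inv (add_pos one_pos (lorentz_pos _)).ne'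

theorem chi_cd : MatCD k (fun y => chi (e y) (m y) (p y)) x :=
  (r.e_cd.transpose.mul r.boost_cd).mul r.m_cd

theorem nv_cd : VecCD k (fun y => boostVec (e y) (p y)) x :=
  (r.e_cd.inv (vielbein_unit r.posDef.self_of_nhds).1).mulVec r.vel_cd

theorem nt_cd : VecCD k (fun y => boostVec (m y) (p y)) x :=
  (r.m_cd.inv (vielbein_unit r.posDef.self_of_nhds).2).mulVec r.vel_cd

theorem relD_cd : MatCD k (fun y => relD (gram (e y)) (chi (e y) (m y) (p y))
    (boostVec (e y) (p y))) x := r.gram_cd.relD r.rel.γ_unit r.chi_cd r.nv_cd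

theorem relB_cd : MatCD k (fun y => relB (gram (e y)) (chi (e y) (m y) (p y))) x :=
  r.gram_cd.relB r.rel.γ_unit r.chi_cd

variable {β : ℕ → ℝ} {ℓ : ℝ}

theorem Uop_cd : MatCD k (fun y => Uop β ℓ (e y) (m y) (p y)) x := by
  obtain ⟨c, s, hM⟩ := exists_isMoment N β ℓ
  exact MatCD.congr (MatCD.smul (r.lorentz_cd.inv (lorentz_pos _).ne')
    (MatCD.opY (c := c) (s := s) r.relB_cd)) (r.posDef.mono fun y hy => Uop_eq hy hM)

theorem Utop_cd : MatCD k (fun y => Utop β ℓ (e y) (m y) (p y)) x := by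
  obtain ⟨c, s, hM⟩ := exists_isMoment N β ℓ
  exact MatCD.congr (r.relD_cd.mul (MatCD.opY (c := c) (s := s) r.relD_cd))
    (r.posDef.mono fun y hy => Utop_eq hy hM)

end VielbeinReg

end Regularity

/-! ### Volume factors and the duality of the operators -/

theorem posDef_of_formPos {k : Mat N} (hk : FormPos k) (hs : kᵀ = k) : k.PosDef := by
  refine Matrix.PosDef.of_dotProduct_mulVec_pos ?_ fun x hx => ?_
  · rw [Matrix.IsHermitian, Matrix.conjTranspose_eq_transpose_of_trivial, hs]
  · simpa using hk x hx

theorem FormPos.det_pos {k : Mat N} (hk : FormPos k) (hs : kᵀ = k) : 0 < k.det :=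
  (posDef_of_formPos hk hs).det_pos

theorem sqrtDet_pos {k : Mat N} (hk : 0 < k.det) : 0 < sqrtDet k := Real.sqrt_pos.mpr hk

theorem covDeriv_neg (k : Pt N → Mat N) (ξ : Pt N → Pt N) (y : Pt N) (i j : Fin N) :
    covDeriv k (fun z => -ξ z) y i j = -covDeriv k ξ y i j := by
  have : pd i (fun z => -ξ z j) y = -pd i (fun z => ξ z j) y :=
    congrFun (dV_neg (Pi.single i 1) ξ) j
  simp only [covDeriv, this, Pi.neg_apply, mul_neg, Finset.sum_neg_distrib]
  ring

namespace BoostRel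

variable {γ φ χ : Mat N} {n nt : Pt N} {lam : ℝ} (h : BoostRel γ φ χ n nt lam)

include h

theorem γ_det_pos : 0 < γ.det := h.γ_pos.det_pos h.γ_symm

theorem φ_det_pos : 0 < φ.det := h.dual.γ_det_pos

theorem relD_det_pos : 0 < (relD γ χ n).det := by
  have h1 := h.φ_det_pos
  rw [← h.χ_mul_relD, Matrix.det_mul] at h1
  exact pos_of_mul_pos_right h1 (h.χ_pos.det_pos h.χ_symm).le

theorem det_relB_eq : (relB γ χ).det = lam ^ 2 * (relD γ χ n).det := by
  have h1 : vecMulVec n n * γ = vecMulVec n (γ *ᵥ n) := by rw [vecMulVec_mul', h.γ_symm]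
  rw [h.relB_eq_mul_relD, Matrix.det_mul, h1, ← Matrix.vecMulVec_smul,
    det_add_vecMulVec (by rw [Matrix.det_one]; exact one_ne_zero), Matrix.adjugate_one,
    Matrix.one_mulVec, Matrix.det_one, smul_dotProduct, dotProduct_comm, smul_eq_mul]
  congr 1
  linarith [h.lam_eq]

/-- From `χ D = φ`, `γ B = χ` and `det B = λ² det D` the square of `det D` is known; positivity
selects the root. -/
theorem det_relD_eq : (relD γ χ n).det = lam⁻¹ * (sqrtDet φ / sqrtDet γ) := by
  have hl := h.lam_pos
  have hD := h.relD_det_pos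
  have hγ := h.γ_det_pos
  have hφ := h.φ_det_pos
  have hχ := h.χ_pos.det_pos h.χ_symm
  have h1 : χ.det * (relD γ χ n).det = φ.det := by rw [← Matrix.det_mul, h.χ_mul_relD]
  have h2 : γ.det * (lam ^ 2 * (relD γ χ n).det) = χ.det := by
    rw [← h.det_relB_eq, ← Matrix.det_mul, h.γ_mul_relB]
  have h3 : (relD γ χ n).det ^ 2 = (lam⁻¹ * (sqrtDet φ / sqrtDet γ)) ^ 2 := by
    rw [mul_pow, div_pow, sqrtDet, sqrtDet, Real.sq_sqrt hφ.le, Real.sq_sqrt hγ.le, ← h1, ← h2]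
    field_simp
  exact (pow_left_inj₀ hD.le (by have := sqrtDet_pos hφ; have := sqrtDet_pos hγ; positivity)
    two_ne_zero).mp h3

variable {K : ℕ} {c s : Fin K → ℝ} (hs : ∀ j, 0 < s j)

include hs

/-- The ratio of volumes is `λ⁻¹ (det D)⁻¹`: one factor is the prefactor of `U`, the other comes
from inverting `D`. -/
theorem dual_U : lam⁻¹ • opY (fun j => c j * s j ^ (N + 1)) (fun j => (s j)⁻¹) (relB φ χ)
    = (sqrtDet γ / sqrtDet φ) • (relD γ χ n * opY c s (relD γ χ n)) := by
  have hl := h.lam_pos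
  have := sqrtDet_pos h.γ_det_pos
  have := sqrtDet_pos h.φ_det_pos
  rw [h.relB_dual, opY_dual h.relD_unit hs fun j => h.det_relD (hs j).le, smul_smul, h.det_relD_eq]
  congr 1
  field_simp

theorem dual_Ut : relD φ χ nt * opY (fun j => c j * s j ^ (N + 1)) (fun j => (s j)⁻¹)
      (relD φ χ nt) = (sqrtDet γ / sqrtDet φ) • (lam⁻¹ • opY c s (relB γ χ)) := by
  have hl := h.lam_pos
  have := sqrtDet_pos h.γ_det_pos
  have := sqrtDet_pos h.φ_det_pos
  rw [h.relD_dual, opY_dual h.relB_unit hs fun j => h.det_relB (hs j).le, Matrix.mul_smul,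
    Matrix.nonsing_inv_mul_cancel_left _ _ h.relB_unit, smul_smul, h.det_relB_eq, h.det_relD_eq]
  congr 1
  field_simp

/-- This identifies the coefficient of `M` with the coefficient of the lapse in the exchanged
theory, so the variation formula of `𝒱` can be reused for `𝒱̃`. -/
theorem dual_potV : sqrtDet γ * (lam⁻¹ * potW c s (relB γ χ))
    = sqrtDet φ * potV (fun j => c j * s j ^ (N + 1)) (fun j => (s j)⁻¹) (relD φ χ nt) := by
  have hl := h.lam_pos
  have := sqrtDet_pos h.γ_det_pos
  have := sqrtDet_pos h.φ_det_pos
  rw [h.relD_dual, potW_dual h.relB_unit hs, h.det_relB_eq, h.det_relD_eq]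
  field_simp

end BoostRel

theorem chi_dual {e m : Mat N} {p : Pt N} (hχ : (chi e m p).PosDef) : chi m e (-p) = chi e m p := by
  rw [chi, boost_neg, chi_eq hχ]

namespace VielbeinReg

variable {E : Type*} [NormedAddCommGroup E] [NormedSpace ℝ E] {k : WithTop ℕ∞} {e m : E → Mat N}
  {p : E → Pt N} {x : E} (r : VielbeinReg k e m p x)

include r

theorem dual : VielbeinReg k m e (fun y => -p y) x :=
  ⟨r.m_cd, r.e_cd, r.p_cd.neg, r.posDef.mono fun y hy => by rwa [chi_dual hy]⟩

end VielbeinReg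

/-! ### The symmetric equation and its behaviour under duality -/

namespace SliceData

variable {s : SliceData N} {y : Pt N} (r : VielbeinReg 1 s.e s.m s.p y) {β : ℕ → ℝ} {ℓ : ℝ}

include r

theorem U_mulVec_eq : (s.U β ℓ y) *ᵥ s.nv y = (s.Ut β ℓ y) *ᵥ s.nt y := by
  obtain ⟨c, w, hM⟩ := exists_isMoment N β ℓ
  have hp := r.posDef.self_of_nhds
  rw [U, Ut, Uop_eq hp hM, Utop_eq hp hM]
  exact r.rel.current_eq hM.pos

theorem current_cd : VecCD 1 (fun z => (s.U β ℓ z) *ᵥ s.nv z) y := r.Uop_cd.mulVec r.nv_cd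

theorem current_eventually : ∀ᶠ z in 𝓝 y, (s.Ut β ℓ z) *ᵥ s.nt z = (s.U β ℓ z) *ᵥ s.nv z := by
  obtain ⟨c, w, hM⟩ := exists_isMoment N β ℓ
  refine r.posDef.mono fun z hp => ?_
  rw [U, Ut, Uop_eq hp hM, Utop_eq hp hM]
  exact ((boostRel_of_vielbein hp).current_eq hM.pos).symm

theorem U_symm : (s.U β ℓ y * (s.γ y)⁻¹)ᵀ = s.U β ℓ y * (s.γ y)⁻¹ := by
  obtain ⟨c, w, hM⟩ := exists_isMoment N β ℓ
  have hp := r.posDef.self_of_nhds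
  rw [U, Uop_eq hp hM]
  exact r.rel.U_symm hM.pos

theorem Ut_symm : (s.Ut β ℓ y * (s.φ y)⁻¹)ᵀ = s.Ut β ℓ y * (s.φ y)⁻¹ := by
  obtain ⟨c, w, hM⟩ := exists_isMoment N β ℓ
  have hp := r.posDef.self_of_nhds
  rw [Ut, Utop_eq hp hM]
  exact r.rel.Ut_symm hM.pos

theorem pd_sqrtDet_div (i : Fin N) : pd i (fun z => sqrtDet (s.γ z)) y / sqrtDet (s.γ y)
    = 1 / 2 * ((s.γ y)⁻¹ * dM s.γ y (Pi.single i 1)).trace := by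
  have h1 := r.rel.γ_det_pos
  have h2 := fderiv_sqrtDet (Pi.single i 1) r.gram_cd h1
  have h3 := (sqrtDet_pos h1).ne'
  rw [pd, div_eq_iff (by exact h3), mul_comm (1 / 2 * _)]
  exact h2

theorem pd_sqrtDet_div' (i : Fin N) : pd i (fun z => sqrtDet (s.φ z)) y / sqrtDet (s.φ y)
    = 1 / 2 * ((s.φ y)⁻¹ * dM s.φ y (Pi.single i 1)).trace := by
  have h1 := r.rel.φ_det_pos
  have h2 := fderiv_sqrtDet (Pi.single i 1) r.gram_cd' h1
  have h3 := (sqrtDet_pos h1).ne'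
  rw [pd, div_eq_iff (by exact h3), mul_comm (1 / 2 * _)]
  exact h2

theorem rhs_eq : s.rhs β ℓ y
    = (∑ i, dV (fun z => (s.U β ℓ z) *ᵥ s.nv z) y (Pi.single i 1) i)
      + ∑ l, ((s.U β ℓ y) *ᵥ s.nv y) l
        * (1 / 2 * ((s.γ y)⁻¹ * dM s.γ y (Pi.single l 1)).trace) :=
  divVector_eq r.rel.γinv_symm _

/-- The currents `U n` and `Ũ ñ` agree in a neighbourhood, so both divergences share the coordinate
divergence and differ only in the volume term. -/
theorem symLhs_eq : s.symLhs β ℓ y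
    = (∑ i, dV (fun z => (s.U β ℓ z) *ᵥ s.nv z) y (Pi.single i 1) i)
      + 1 / 2 * (∑ l, ((s.U β ℓ y) *ᵥ s.nv y) l
        * (1 / 2 * ((s.γ y)⁻¹ * dM s.γ y (Pi.single l 1)).trace))
      + 1 / 2 * (∑ l, ((s.U β ℓ y) *ᵥ s.nv y) l
        * (1 / 2 * ((s.φ y)⁻¹ * dM s.φ y (Pi.single l 1)).trace)) := by
  have h1 := divVector_eq (k := s.γ) r.rel.γinv_symm (fun z => (s.U β ℓ z) *ᵥ s.nv z)
  have h2 := divVector_eq (k := s.φ) r.rel.dual.γinv_symm (fun z => (s.Ut β ℓ z) *ᵥ s.nt z)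
  rw [symLhs, h1, h2, ← U_mulVec_eq r]
  simp only [dV_congr _ (current_eventually r)]
  ring

theorem symRhs_eq : s.symRhs β ℓ y = s.lhs β ℓ y
      - 1 / 2 * (∑ l, ((s.U β ℓ y) *ᵥ s.nv y) l
        * (1 / 2 * ((s.γ y)⁻¹ * dM s.γ y (Pi.single l 1)).trace))
      + 1 / 2 * (∑ l, ((s.U β ℓ y) *ᵥ s.nv y) l
        * (1 / 2 * ((s.φ y)⁻¹ * dM s.φ y (Pi.single l 1)).trace)) := by
  have e1 : ∀ (T : Mat N) (C : Fin N → Fin N → ℝ) (τ : Fin N → ℝ) (ξ : Pt N) (L : Mat N),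
      ∑ i, ∑ j, T i j * (C i j - 1 / 2 * τ i * ξ j - L j i)
        = (∑ i, ∑ j, T i j * (C i j - L j i)) - 1 / 2 * ∑ i, (T *ᵥ ξ) i * τ i := by
    intro T C τ ξ L
    simp only [Matrix.mulVec, dotProduct, Finset.mul_sum, Finset.sum_mul,
      ← Finset.sum_sub_distrib]
    exact Finset.sum_congr rfl fun i _ => Finset.sum_congr rfl fun j _ => by ring
  have e2 : ∀ (T : Mat N) (C : Fin N → Fin N → ℝ) (τ : Fin N → ℝ) (ξ : Pt N) (L : Mat N),
      ∑ i, ∑ j, T i j * (C i j + 1 / 2 * τ i * ξ j + L j i)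
        = (∑ i, ∑ j, T i j * (C i j + L j i)) + 1 / 2 * ∑ i, (T *ᵥ ξ) i * τ i := by
    intro T C τ ξ L
    simp only [Matrix.mulVec, dotProduct, Finset.mul_sum, Finset.sum_mul,
      ← Finset.sum_add_distrib]
    exact Finset.sum_congr rfl fun i _ => Finset.sum_congr rfl fun j _ => by ring
  simp only [symRhs, pd_sqrtDet_div r, pd_sqrtDet_div' r]
  rw [e1 (s.U β ℓ y) (covDeriv s.γ s.nv y), e2 (s.Ut β ℓ y) (covDeriv s.φ s.nt y),
    ← U_mulVec_eq r, lhs]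
  ring

/-- The logarithmic volume derivatives added on the right compensate exactly for replacing the `γ`
divergence of the common current by the mean of the two divergences. -/
theorem symRhs_sub_symLhs : s.symRhs β ℓ y - s.symLhs β ℓ y = s.lhs β ℓ y - s.rhs β ℓ y := by
  rw [symRhs_eq r, symLhs_eq r, rhs_eq r]
  ring

theorem dual_U_eq : s.dual.U (dualBeta N β) ℓ y
    = (sqrtDet (s.γ y) / sqrtDet (s.φ y)) • s.Ut β ℓ y := by
  obtain ⟨c, w, hM⟩ := exists_isMoment N β ℓ
  have hp := r.posDef.self_of_nhds
  have h1 : s.dual.U (dualBeta N β) ℓ y = Uop (dualBeta N β) ℓ (s.m y) (s.e y) (-s.p y) := rfl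
  rw [h1, Uop_eq (by rwa [chi_dual hp]) hM.dual, chi_dual hp, lorentz_neg, r.rel.dual_U hM.pos, Ut,
    Utop_eq hp hM]
  rfl

theorem dual_Ut_eq : s.dual.Ut (dualBeta N β) ℓ y
    = (sqrtDet (s.γ y) / sqrtDet (s.φ y)) • s.U β ℓ y := by
  obtain ⟨c, w, hM⟩ := exists_isMoment N β ℓ
  have hp := r.posDef.self_of_nhds
  have h1 : s.dual.Ut (dualBeta N β) ℓ y = Utop (dualBeta N β) ℓ (s.m y) (s.e y) (-s.p y) := rfl
  have h2 : ∀ g x : Mat N, ∀ ξ : Pt N, relD g x (-ξ) = relD g x ξ := fun g x ξ => by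
    rw [relD, relD, Matrix.neg_vecMulVec, Matrix.vecMulVec_neg, neg_neg]
  rw [h1, Utop_eq (by rwa [chi_dual hp]) hM.dual, chi_dual hp, boostVec_neg, h2,
    r.rel.dual_Ut hM.pos, U, Uop_eq hp hM]
  rfl

/-- The boost parameters change sign, and the exchanged curvatures enter with opposite signs, hence
the overall minus; the operators contribute the volume ratio. -/
theorem dual_lhs : s.dual.lhs (dualBeta N β) ℓ y
    = -(sqrtDet (s.γ y) / sqrtDet (s.φ y)) * s.lhs β ℓ y := by
  have hn : s.dual.nv = fun z => -s.nt z := funext fun z => boostVec_neg _ _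
  have ht : s.dual.nt = fun z => -s.nv z := funext fun z => boostVec_neg _ _
  have hγ : s.dual.γ = s.φ := rfl
  have hφ : s.dual.φ = s.γ := rfl
  have hK : s.dual.K = s.Kt := rfl
  have hKt : s.dual.Kt = s.K := rfl
  rw [lhs, lhs, dual_U_eq r, dual_Ut_eq r, hn, ht, hγ, hφ, hK, hKt]
  simp only [covDeriv_neg, Matrix.smul_apply, smul_eq_mul]
  rw [add_comm, mul_add]
  simp only [Finset.mul_sum]
  congr 1 <;>
    exact Finset.sum_congr rfl fun i _ => Finset.sum_congr rfl fun j _ => by ring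

/-- The volume ratio is not constant, but its derivative is what converts one divergence into the
other: for the common current `a`, both `√φ D̃ᵢ((√γ/√φ) aⁱ)` and `√γ Dᵢ aⁱ` equal `∂ᵢ(√γ aⁱ)`. -/
theorem dual_rhs : s.dual.rhs (dualBeta N β) ℓ y
    = -(sqrtDet (s.γ y) / sqrtDet (s.φ y)) * s.rhs β ℓ y := by
  have hn : ∀ z, s.dual.nv z = -s.nt z := fun z => boostVec_neg _ _
  have hev : ∀ᶠ z in 𝓝 y, (s.dual.U (dualBeta N β) ℓ z) *ᵥ s.dual.nv z
      = (-(sqrtDet (s.γ z) / sqrtDet (s.φ z))) • ((s.U β ℓ z) *ᵥ s.nv z) := by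
    -- The identity of currents is going to be differentiated, so regularity is spread to nearby
    -- points.
    have h1 : ∀ᶠ z in 𝓝 y, VielbeinReg 1 s.e s.m s.p z := by
      have := r.posDef.eventually_nhds
      have he : ∀ᶠ z in 𝓝 y, MatCD 1 s.e z := by
        simp only [MatCD, Filter.eventually_all]
        exact fun i j => (r.e_cd i j).eventually (by simp)
      have hm : ∀ᶠ z in 𝓝 y, MatCD 1 s.m z := by
        simp only [MatCD, Filter.eventually_all]
        exact fun i j => (r.m_cd i j).eventually (by simp)
      have hp : ∀ᶠ z in 𝓝 y, VecCD 1 s.p z := by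
        simp only [VecCD, Filter.eventually_all]
        exact fun i => (r.p_cd i).eventually (by simp)
      filter_upwards [this, he, hm, hp] with z h1 h2 h3 h4 using ⟨h2, h3, h4, h1⟩
    filter_upwards [h1] with z hz
    rw [dual_U_eq hz, hn, Matrix.smul_mulVec, Matrix.mulVec_neg, ← U_mulVec_eq hz, smul_neg,
      neg_smul]
  have hγ := sqrtDet_pos r.rel.γ_det_pos
  have hφ := sqrtDet_pos r.rel.φ_det_pos
  have hcγ : ContDiffAt ℝ 1 (fun z => sqrtDet (s.γ z)) y := sqrtDet_contDiffAt r.gram_cd r.rel.γ_det_pos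
  have hcφ : ContDiffAt ℝ 1 (fun z => sqrtDet (s.φ z)) y :=
    sqrtDet_contDiffAt r.gram_cd' r.rel.φ_det_pos
  have hc : ContDiffAt ℝ 1 (fun z => -(sqrtDet (s.γ z) / sqrtDet (s.φ z))) y :=
    (hcγ.div hcφ hφ.ne').neg
  have hdc : ∀ l : Fin N, fderiv ℝ (fun z => -(sqrtDet (s.γ z) / sqrtDet (s.φ z))) y (Pi.single l 1)
      = -(sqrtDet (s.γ y) / sqrtDet (s.φ y))
        * (1 / 2 * ((s.γ y)⁻¹ * dM s.γ y (Pi.single l 1)).trace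
          - 1 / 2 * ((s.φ y)⁻¹ * dM s.φ y (Pi.single l 1)).trace) := by
    intro l
    have h1 := fderiv_mul_apply (Pi.single l 1) hc.diff hcφ.diff
    have h2 : (fun z => -(sqrtDet (s.γ z) / sqrtDet (s.φ z)) * sqrtDet (s.φ z))
        =ᶠ[𝓝 y] fun z => -sqrtDet (s.γ z) := by
      filter_upwards [r.rel_eventually] with z hz
      have := (sqrtDet_pos hz.φ_det_pos).ne'
      have h3 : sqrtDet (s.φ z) ≠ 0 := this
      field_simp
    have h4 : fderiv ℝ (fun z => -sqrtDet (s.γ z)) y (Pi.single l 1)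
        = -fderiv ℝ (fun z => sqrtDet (s.γ z)) y (Pi.single l 1) := by
      rw [fderiv_fun_neg]; rfl
    rw [h2.fderiv_eq, h4] at h1
    have e1 := pd_sqrtDet_div r l
    have e2 := pd_sqrtDet_div' r l
    rw [pd, div_eq_iff (by exact hγ.ne')] at e1
    rw [pd, div_eq_iff (by exact hφ.ne')] at e2
    rw [e1, e2] at h1
    have h3 : sqrtDet (s.φ y) ≠ 0 := hφ.ne'
    field_simp at h1 ⊢
    linarith
  have h1 := divVector_eq (k := s.φ) (x := y) r.rel.dual.γinv_symm
    (fun z => (s.dual.U (dualBeta N β) ℓ z) *ᵥ s.dual.nv z)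
  have h2 : s.dual.rhs (dualBeta N β) ℓ y
    = divVector s.φ (fun z => (s.dual.U (dualBeta N β) ℓ z) *ᵥ s.dual.nv z) y := rfl
  rw [h2, h1, rhs_eq r]
  simp only [dV_congr _ hev, hev.self_of_nhds, dV_smul _ hc (current_cd r), hdc]
  simp only [Pi.add_apply, Pi.smul_apply, smul_eq_mul, mul_add, Finset.mul_sum,
    Finset.sum_add_distrib, add_assoc]
  congr 1
  rw [← Finset.sum_add_distrib]
  exact Finset.sum_congr rfl fun l _ => by ring

theorem dual_symm : s.dual.symRhs (dualBeta N β) ℓ y - s.dual.symLhs (dualBeta N β) ℓ y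
    = -(sqrtDet (s.γ y) / sqrtDet (s.φ y)) * (s.symRhs β ℓ y - s.symLhs β ℓ y) := by
  have r' : VielbeinReg 1 s.dual.e s.dual.m s.dual.p y := r.dual
  rw [symRhs_sub_symLhs r, symRhs_sub_symLhs r', dual_lhs r, dual_rhs r]
  ring

end SliceData

/-! ### Derivatives of metrics in terms of lapse and shift -/

theorem trace_blk (a : ℝ) (b c : Pt N) (D : Mat N) : (blk a b c D).trace = a + D.trace := by
  simp [Matrix.trace, Fin.sum_univ_succ]

section MetricDerivative

variable {E : Type*} [NormedAddCommGroup E] [NormedSpace ℝ E] {x : E} {k : WithTop ℕ∞}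

theorem MatCD.blk {a : E → ℝ} {b c : E → Pt N} {D : E → Mat N} (ha : ContDiffAt ℝ k a x)
    (hb : VecCD k b x) (hc : VecCD k c x) (hD : MatCD k D x) :
    MatCD k (fun y => blk (a y) (b y) (c y) (D y)) x := by
  intro i j
  refine Fin.cases ?_ (fun i => ?_) i <;> refine Fin.cases ?_ (fun j => ?_) j
  exacts [ha, hb j, hc i, hD i j]

theorem dM_blk (a : E → ℝ) (b c : E → Pt N) (D : E → Mat N) (v : E) :
    dM (fun y => blk (a y) (b y) (c y) (D y)) x v
      = blk (fderiv ℝ a x v) (dV b x v) (dV c x v) (dM D x v) :=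
  ext_blk rfl (fun _ => rfl) (fun _ => rfl) fun _ _ => rfl

theorem VecCD.shear {ξ : E → Pt N} (hξ : VecCD k ξ x) : MatCD k (fun y => shear (ξ y)) x := by
  simp only [shear_eq_blk]
  exact MatCD.blk contDiffAt_const (vecCD_const 0) hξ (matCD_const 1)

theorem dM_shear (ξ : E → Pt N) (v : E) :
    dM (fun y => shear (ξ y)) x v = blk 0 0 (dV ξ x v) 0 := by
  simp only [shear_eq_blk]
  rw [dM_blk, dM_const]
  refine ext_blk ?_ (fun j => ?_) (fun _ => rfl) fun _ _ => rfl
  · simp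
  · simp [dV]

/-- The trace of an operator against the variation of a metric, in the frame adapted to lapse and
shift. -/
theorem trace_mul_dM_metricOf {l : E → ℝ} {ξ : E → Pt N} {γ : E → Mat N}
    (hl : ContDiffAt ℝ 1 l x) (hξ : VecCD 1 ξ x) (hγ : MatCD 1 γ x) (hl0 : l x ≠ 0)
    (hu : IsUnit (γ x).det) (hγs : (γ x)ᵀ = γ x) {V : Mat (N + 1)} {a : ℝ} {b c : Pt N} {D : Mat N}
    (hV : V = shear (-ξ x) * blk a b c D * shear (ξ x))
    (hs : (V * (metricOf (l x) (ξ x) (γ x))⁻¹)ᵀ = V * (metricOf (l x) (ξ x) (γ x))⁻¹) (v : E) :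
    1 / 2 * (V * (metricOf (l x) (ξ x) (γ x))⁻¹
        * dM (fun y => metricOf (l y) (ξ y) (γ y)) x v).trace
      = b ⬝ᵥ dV ξ x v + fderiv ℝ l x v / l x * a + 1 / 2 * (D * (γ x)⁻¹ * dM γ x v).trace := by
  set G := blk (-l x ^ 2) 0 0 (γ x) with hG
  have hGs : Gᵀ = G := by rw [hG, blk_transpose, hγs]
  set T := shear (ξ x) with hT
  have hTi : shear (-ξ x) * T = 1 := shear_neg_mul _
  have hTi' : T * shear (-ξ x) = 1 := shear_mul_neg _
  set dT := blk 0 0 (dV ξ x v) (0 : Mat N) with hdT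
  have hdl : fderiv ℝ (fun y => -l y ^ 2) x v = -(2 * l x * fderiv ℝ l x v) := by
    have : (fun y => -l y ^ 2) = fun y => -(l y * l y) := funext fun y => by ring
    rw [this, fderiv_fun_neg, _root_.neg_apply, fderiv_mul_apply v hl.diff hl.diff]
    ring
  set dG := blk (-(2 * l x * fderiv ℝ l x v)) 0 0 (dM γ x v) with hdG
  have hz : dV (fun _ : E => (0 : Pt N)) x v = 0 := by ext; simp [dV]
  have hGc : MatCD 1 (fun y => blk (-l y ^ 2) 0 0 (γ y)) x :=
    MatCD.blk (hl.pow 2).neg (vecCD_const 0) (vecCD_const 0) hγ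
  have hdg : dM (fun y => metricOf (l y) (ξ y) (γ y)) x v
      = (dTᵀ * G + Tᵀ * dG) * T + Tᵀ * G * dT := by
    simp only [metricOf, blockDiag_eq_blk]
    rw [dM_mul v (hξ.shear.transpose.mul hGc) hξ.shear, dM_mul v hξ.shear.transpose hGc,
      dM_transpose, dM_shear, dM_blk, hdl, hz]
  have hinv := metricOf_inv hl0 (ξ x) hu
  set gi := (metricOf (l x) (ξ x) (γ x))⁻¹ with hgi
  set H := blk (-(l x ^ 2)⁻¹) 0 0 (γ x)⁻¹ with hH
  have hgT : gi * Tᵀ = shear (-ξ x) * H := by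
    rw [hinv, Matrix.mul_assoc, ← Matrix.transpose_mul, hTi', Matrix.transpose_one, Matrix.mul_one]
  have hHG : H * G = 1 := by
    rw [hH, hG, blk_mul, one_eq_blk, Matrix.nonsing_inv_mul _ hu]
    congr 1
    · simp; field_simp
    · simp
    · simp
    · ext i j; simp
  have hdTT : dT * shear (-ξ x) = dT := by
    rw [hdT, shear_eq_blk, blk_mul]
    congr 1 <;> simp
  have t1 : (V * gi * (Tᵀ * G * dT)).trace = b ⬝ᵥ dV ξ x v := by
    have : V * gi * (Tᵀ * G * dT) = shear (-ξ x) * (blk a b c D * dT) := by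
      calc V * gi * (Tᵀ * G * dT) = V * (gi * Tᵀ) * (G * dT) := by simp only [Matrix.mul_assoc]
        _ = V * shear (-ξ x) * (H * G) * dT := by rw [hgT]; simp only [Matrix.mul_assoc]
        _ = shear (-ξ x) * blk a b c D * (T * shear (-ξ x)) * dT := by
          rw [hHG, Matrix.mul_one, hV]; simp only [Matrix.mul_assoc]
        _ = _ := by rw [hTi', Matrix.mul_one, Matrix.mul_assoc]
    rw [this, Matrix.trace_mul_comm, Matrix.mul_assoc, hdTT, hdT, blk_mul, trace_blk]
    simp
  -- The two variations of the shift are transposes of each other, and `V g⁻¹` is symmetric.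
  have t2 : (V * gi * (dTᵀ * G * T)).trace = b ⬝ᵥ dV ξ x v := by
    rw [← t1, ← trace_mul_symm hs (Tᵀ * G * dT), Matrix.transpose_mul, Matrix.transpose_mul, hGs,
      Matrix.transpose_transpose, Matrix.mul_assoc dTᵀ]
  have t3 : (V * gi * (Tᵀ * dG * T)).trace
      = 2 * (fderiv ℝ l x v / l x * a) + (D * (γ x)⁻¹ * dM γ x v).trace := by
    have : V * gi * (Tᵀ * dG * T) = shear (-ξ x) * (blk a b c D * (H * dG) * T) := by
      calc V * gi * (Tᵀ * dG * T) = V * (gi * Tᵀ) * (dG * T) := by simp only [Matrix.mul_assoc]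
        _ = shear (-ξ x) * blk a b c D * (T * shear (-ξ x)) * (H * dG * T) := by
          rw [hgT, hV]; simp only [Matrix.mul_assoc]
        _ = _ := by rw [hTi', Matrix.mul_one]; simp only [Matrix.mul_assoc]
    rw [this, Matrix.trace_mul_comm, Matrix.mul_assoc, hTi', Matrix.mul_one, hH, hdG, blk_mul,
      blk_mul, trace_blk]
    simp only [Matrix.mulVec_zero, smul_zero, add_zero, dotProduct_zero, Matrix.vecMulVec_zero,
      zero_add, Matrix.mul_assoc]
    field_simp
  rw [hdg, Matrix.add_mul, Matrix.mul_add, Matrix.mul_add, Matrix.trace_add, Matrix.trace_add, t1,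
    t2, t3]
  ring

end MetricDerivative

/-! ### Extrinsic curvature and restriction to slices -/

section Slices

variable {x : Pt (N + 1)}

/-- The ADM formula. Derivatives of the lapse drop out because the induced metric annihilates the
normal, so those from its time component cancel those from its spatial components. -/
theorem extrinsicCurv_metricOf {l : Pt (N + 1) → ℝ} {ξ : Pt (N + 1) → Pt N}
    {γ : Pt (N + 1) → Mat N} (hl : ContDiffAt ℝ 1 l x) (hξ : VecCD 1 ξ x)
    (hl0 : ∀ᶠ y in 𝓝 x, 0 < l y) (hu : ∀ᶠ y in 𝓝 x, IsUnit (γ y).det)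
    (hγs : ∀ᶠ y in 𝓝 x, (γ y)ᵀ = γ y) (i j : Fin N) :
    l x * extrinsicCurv (fun y => metricOf (l y) (ξ y) (γ y)) x i j
      = -(1 / 2) * (dM γ x (Pi.single 0 1) i j - ∑ k, ξ x k * dM γ x (Pi.single k.succ 1) i j
          - (∑ k, γ x k j * dV ξ x (Pi.single i.succ 1) k)
          - ∑ k, γ x i k * dV ξ x (Pi.single j.succ 1) k) := by
  have hn : ∀ᶠ y in 𝓝 x, unitNormal (metricOf (l y) (ξ y) (γ y))
      = Fin.cons (l y)⁻¹ (-((l y)⁻¹ • ξ y)) := by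
    filter_upwards [hl0, hu] with y h1 h2 using unitNormal_metricOf h1 _ h2
  have hI : ∀ᶠ y in 𝓝 x, inducedMetric (metricOf (l y) (ξ y) (γ y))
      = blk (ξ y ⬝ᵥ (γ y *ᵥ ξ y)) (γ y *ᵥ ξ y) (γ y *ᵥ ξ y) (γ y) := by
    filter_upwards [hl0, hu, hγs] with y h1 h2 h3 using inducedMetric_metricOf h1 _ h2 h3
  have hlx := hl0.self_of_nhds
  have hc := hγs.self_of_nhds
  have hli : ContDiffAt ℝ 1 (fun y => (l y)⁻¹) x := hl.inv hlx.ne'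
  have p0 : ∀ (σ : Fin (N + 1)), pd σ (fun y => inducedMetric (metricOf (l y) (ξ y) (γ y)) i.succ j.succ) x
      = dM γ x (Pi.single σ 1) i j := fun σ =>
    congrFun (congrFun (dM_congr (Pi.single σ 1) hI) i.succ) j.succ
  have p1 : ∀ (σ : Fin (N + 1)), pd σ (fun y => unitNormal (metricOf (l y) (ξ y) (γ y)) 0) x
      = fderiv ℝ (fun y => (l y)⁻¹) x (Pi.single σ 1) := fun σ =>
    congrFun (dV_congr (Pi.single σ 1) hn) 0
  have p2 : ∀ (σ : Fin (N + 1)) (k : Fin N),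
      pd σ (fun y => unitNormal (metricOf (l y) (ξ y) (γ y)) k.succ) x
      = -((l x)⁻¹ * dV ξ x (Pi.single σ 1) k
        + fderiv ℝ (fun y => (l y)⁻¹) x (Pi.single σ 1) * ξ x k) := fun σ k => by
    have e1 := congrFun (dV_congr (Pi.single σ 1) hn) k.succ
    have e2 : dV (fun y => (Fin.cons (l y)⁻¹ (-((l y)⁻¹ • ξ y)) : Pt (N + 1))) x (Pi.single σ 1)
        k.succ = dV (fun y => -((l y)⁻¹ • ξ y)) x (Pi.single σ 1) k := rfl
    rw [e2, dV_neg, dV_smul _ hli hξ] at e1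
    exact e1
  have hγξ : ∀ a : Fin N, (γ x *ᵥ ξ x) a = ∑ k, γ x a k * ξ x k := fun a => rfl
  have hγξ' : ∀ a : Fin N, (γ x *ᵥ ξ x) a = ∑ k, γ x k a * ξ x k := fun a =>
    congrFun (congrArg (· *ᵥ ξ x) hc.symm) a
  rw [extrinsicCurv, Matrix.of_apply, lieDeriv]
  simp only [Fin.sum_univ_succ, p0, p1, p2, hI.self_of_nhds, hn.self_of_nhds, Fin.cons_zero,
    Fin.cons_succ, blk_zero_succ, blk_succ_zero, blk_succ_succ, Pi.neg_apply, Pi.smul_apply,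
    smul_eq_mul]
  rw [hγξ i, hγξ' j]
  have e : ∀ (D a b : Fin N → ℝ) (u w z : ℝ), ∑ k, (-(z * ξ x k) * D k
        + γ x k j * -(z * a k + u * ξ x k) + γ x i k * -(z * b k + w * ξ x k))
      = -(z * ∑ k, ξ x k * D k) - z * (∑ k, γ x k j * a k) - u * (∑ k, γ x k j * ξ x k)
        - z * (∑ k, γ x i k * b k) - w * ∑ k, γ x i k * ξ x k := fun D a b u w z => by
    simp only [Finset.mul_sum, ← Finset.sum_sub_distrib, ← Finset.sum_neg_distrib]
    exact Finset.sum_congr rfl fun _ _ => by ring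
  rw [e]
  field_simp
  ring

/-- The frame vector `∂ₜ - qⁱ ∂ᵢ`, which is normal to the slices for every metric with shift `q`. -/
def frameVec (q : Pt N) : Pt (N + 1) := Fin.cons 1 (-q)

theorem frameVec_eq (q : Pt N) : frameVec q
    = Pi.single 0 1 - ∑ k : Fin N, q k • (Pi.single k.succ 1 : Pt (N + 1)) := by
  ext i
  rw [Pi.sub_apply, Finset.sum_apply]
  refine Fin.cases ?_ (fun i => ?_) i
  · simp [frameVec]
  · simp [frameVec, Pi.single_apply]

theorem apply_frameVec (f : Pt (N + 1) →L[ℝ] ℝ) (q : Pt N) :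
    f (frameVec q) = f (Pi.single 0 1) - ∑ k : Fin N, q k * f (Pi.single k.succ 1) := by
  rw [frameVec_eq, map_sub, map_sum]
  simp only [map_smul, smul_eq_mul]

theorem dM_frameVec {n : ℕ} (F : Pt (N + 1) → Mat n) (q : Pt N) : dM F x (frameVec q)
    = dM F x (Pi.single 0 1) - ∑ k : Fin N, q k • dM F x (Pi.single k.succ 1) := by
  ext i j
  rw [Matrix.sub_apply, Matrix.sum_apply]
  exact apply_frameVec _ q

theorem dV_frameVec {n : ℕ} (u : Pt (N + 1) → Pt n) (q : Pt N) : dV u x (frameVec q)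
    = dV u x (Pi.single 0 1) - ∑ k : Fin N, q k • dV u x (Pi.single k.succ 1) := by
  ext i
  rw [Pi.sub_apply, Finset.sum_apply]
  exact apply_frameVec _ q

theorem fderiv_slice {u : Pt (N + 1) → ℝ} {t : ℝ} {y : Pt N}
    (hu : ContDiffAt ℝ 1 u (Fin.cons t y)) (i : Fin N) :
    fderiv ℝ (fun z : Pt N => u (Fin.cons t z)) y (Pi.single i 1)
      = fderiv ℝ u (Fin.cons t y) (Pi.single i.succ 1) := by
  have h1 : HasFDerivAt (fun z : Pt N => (Fin.cons t z : Pt (N + 1)))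
      (ContinuousLinearMap.pi (Fin.cons 0 fun i => ContinuousLinearMap.proj i) :
        Pt N →L[ℝ] Pt (N + 1)) y := by
    rw [hasFDerivAt_pi']
    refine Fin.cases ?_ fun i => ?_
    · exact hasFDerivAt_const t y
    · exact hasFDerivAt_apply i y
  have h2 := (hu.diff.hasFDerivAt.comp y h1).fderiv
  have h3 : (fun z : Pt N => u (Fin.cons t z)) = u ∘ fun z : Pt N => (Fin.cons t z : Pt (N + 1)) :=
    rfl
  rw [h3, h2, ContinuousLinearMap.comp_apply]
  congr 1
  ext j
  refine Fin.cases ?_ (fun j => ?_) j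
  · simp
  · simp [Pi.single_apply]

theorem contDiffAt_slice {k : WithTop ℕ∞} {u : Pt (N + 1) → ℝ} {t : ℝ} {y : Pt N}
    (hu : ContDiffAt ℝ k u (Fin.cons t y)) : ContDiffAt ℝ k (fun z : Pt N => u (Fin.cons t z)) y := by
  refine ContDiffAt.comp (g := u) (f := fun z : Pt N => (Fin.cons t z : Pt (N + 1))) y hu ?_
  refine contDiffAt_pi.mpr (Fin.cases contDiffAt_const fun i => ?_)
  exact (ContinuousLinearMap.proj (R := ℝ) (φ := fun _ : Fin N => ℝ) i).contDiff.contDiffAt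

theorem continuous_slice (t : ℝ) : Continuous fun z : Pt N => (Fin.cons t z : Pt (N + 1)) :=
  continuous_pi (Fin.cases continuous_const fun i => continuous_apply i)

theorem eventually_slice {t : ℝ} {y : Pt N} {P : Pt (N + 1) → Prop}
    (h : ∀ᶠ x in 𝓝 (Fin.cons t y : Pt (N + 1)), P x) : ∀ᶠ z in 𝓝 y, P (Fin.cons t z) :=
  ((continuous_slice t).tendsto y).eventually h

theorem dM_slice {n : ℕ} {F : Pt (N + 1) → Mat n} {t : ℝ} {y : Pt N}
    (hF : MatCD 1 F (Fin.cons t y)) (i : Fin N) :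
    dM (fun z : Pt N => F (Fin.cons t z)) y (Pi.single i 1)
      = dM F (Fin.cons t y) (Pi.single i.succ 1) :=
  Matrix.ext fun a b => fderiv_slice (hF a b) i

theorem dV_slice {n : ℕ} {u : Pt (N + 1) → Pt n} {t : ℝ} {y : Pt N}
    (hu : VecCD 1 u (Fin.cons t y)) (i : Fin N) :
    dV (fun z : Pt N => u (Fin.cons t z)) y (Pi.single i 1)
      = dV u (Fin.cons t y) (Pi.single i.succ 1) :=
  funext fun a => fderiv_slice (hu a) i

theorem VielbeinReg.slice {k : WithTop ℕ∞} {e m : Pt (N + 1) → Mat N} {p : Pt (N + 1) → Pt N}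
    {t : ℝ} {y : Pt N} (r : VielbeinReg k e m p (Fin.cons t y)) :
    VielbeinReg k (fun z => e (Fin.cons t z)) (fun z => m (Fin.cons t z))
      (fun z => p (Fin.cons t z)) y :=
  ⟨fun i j => contDiffAt_slice (r.e_cd i j), fun i j => contDiffAt_slice (r.m_cd i j),
    fun i => contDiffAt_slice (r.p_cd i), eventually_slice r.posDef⟩

theorem sum_mul_extrinsicCurv {l : Pt (N + 1) → ℝ} {ξ : Pt (N + 1) → Pt N}
    {γ : Pt (N + 1) → Mat N} (hl : ContDiffAt ℝ 1 l x) (hξ : VecCD 1 ξ x)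
    (hl0 : ∀ᶠ y in 𝓝 x, 0 < l y) (hu : ∀ᶠ y in 𝓝 x, IsUnit (γ y).det)
    (hγs : ∀ᶠ y in 𝓝 x, (γ y)ᵀ = γ y) {T : Mat N} (hT : (T * (γ x)⁻¹)ᵀ = T * (γ x)⁻¹) :
    l x * ∑ i, ∑ j, T i j
        * ((γ x)⁻¹ * extrinsicCurv (fun y => metricOf (l y) (ξ y) (γ y)) x) j i
      = -(1 / 2) * (T * (γ x)⁻¹ * dM γ x (frameVec (ξ x))).trace
        + ∑ i, ∑ j, T i j * dV ξ x (Pi.single i.succ 1) j := by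
  set K := extrinsicCurv (fun y => metricOf (l y) (ξ y) (γ y)) x with hK
  set P : Mat N := Matrix.of fun i k => dV ξ x (Pi.single i.succ 1) k with hP
  have hux := hu.self_of_nhds
  have hsx := hγs.self_of_nhds
  have h1 : ∑ i, ∑ j, T i j * ((γ x)⁻¹ * K) j i = (T * (γ x)⁻¹ * K).trace := by
    rw [Matrix.mul_assoc]; rfl
  have h2 : ∑ i, ∑ j, T i j * dV ξ x (Pi.single i.succ 1) j = (T * Pᵀ).trace := rfl
  have h3 : l x • K = -(1 / 2 : ℝ) • (dM γ x (frameVec (ξ x)) - (γ x * Pᵀ)ᵀ - γ x * Pᵀ) := by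
    ext i j
    rw [dM_frameVec]
    have := extrinsicCurv_metricOf hl hξ hl0 hu hγs i j
    rw [Matrix.smul_apply, smul_eq_mul, this, Matrix.transpose_mul, Matrix.transpose_transpose, hsx]
    simp only [Matrix.smul_apply, Matrix.sub_apply, Matrix.sum_apply, Matrix.mul_apply, hP,
      Matrix.transpose_apply, Matrix.of_apply, smul_eq_mul]
    congr 3
    exact Finset.sum_congr rfl fun k _ => mul_comm _ _
  have h4 : (T * (γ x)⁻¹ * (γ x * Pᵀ)).trace = (T * Pᵀ).trace := by
    rw [Matrix.mul_assoc, Matrix.nonsing_inv_mul_cancel_left _ _ hux]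
  rw [h1, h2, ← smul_eq_mul, ← Matrix.trace_smul, ← Matrix.mul_smul, h3, Matrix.mul_smul,
    Matrix.trace_smul, Matrix.mul_sub, Matrix.mul_sub, Matrix.trace_sub, Matrix.trace_sub,
    trace_mul_symm hT, h4, smul_eq_mul]
  ring

/-- The combination of extrinsic curvature and boost which enters the projected conservation law,
for a metric with lapse `l` and shift `q + a n`. -/
theorem sum_mul_extrinsicCurv_sub_covDeriv {l a : Pt (N + 1) → ℝ} {q n : Pt (N + 1) → Pt N}
    {γ : Pt (N + 1) → Mat N} {t : ℝ} {y : Pt N} (hx : x = Fin.cons t y) (hl : ContDiffAt ℝ 1 l x)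
    (ha : ContDiffAt ℝ 1 a x) (hq : VecCD 1 q x) (hn : VecCD 1 n x) (hγ : MatCD 1 γ x)
    (hl0 : ∀ᶠ y in 𝓝 x, 0 < l y) (hu : ∀ᶠ y in 𝓝 x, IsUnit (γ y).det)
    (hγs : ∀ᶠ y in 𝓝 x, (γ y)ᵀ = γ y) {T : Mat N} (hT : (T * (γ x)⁻¹)ᵀ = T * (γ x)⁻¹) :
    l x * (∑ i, ∑ j, T i j
        * ((γ x)⁻¹ * extrinsicCurv (fun y => metricOf (l y) (q y + a y • n y) (γ y)) x) j i)
      - a x * ∑ i, ∑ j, T i j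
        * covDeriv (fun z => γ (Fin.cons t z)) (fun z => n (Fin.cons t z)) y i j
      = -(1 / 2) * (T * (γ x)⁻¹ * dM γ x (frameVec (q x))).trace
        + (∑ i, ∑ j, T i j * dV q x (Pi.single i.succ 1) j)
        + ∑ i, (T *ᵥ n x) i * fderiv ℝ a x (Pi.single i.succ 1) := by
  subst hx
  set x : Pt (N + 1) := Fin.cons t y with hx
  have h1 := sum_mul_extrinsicCurv hl (hq.add (hn.smul ha)) hl0 hu hγs hT
  have h2 := sum_mul_covDeriv (k := fun z => γ (Fin.cons t z)) (x := y) hT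
    fun z => n (Fin.cons t z)
  simp only [dM_slice hγ, dV_slice hn] at h2
  rw [h1, h2]
  have h3 : ∀ i j, T i j * dV (fun y => q y + a y • n y) x (Pi.single i.succ 1) j
      = T i j * dV q x (Pi.single i.succ 1) j + a x * (T i j * dV n x (Pi.single i.succ 1) j)
        + T i j * n x j * fderiv ℝ a x (Pi.single i.succ 1) := fun i j => by
    rw [dV_add _ hq (hn.smul ha), dV_smul _ ha hn]
    simp only [Pi.add_apply, Pi.smul_apply, smul_eq_mul]
    ring
  simp only [h3, Finset.sum_add_distrib, ← Finset.mul_sum]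
  have h4 : ∑ i, ∑ j, T i j * n x j * fderiv ℝ a x (Pi.single i.succ 1)
      = ∑ i, (T *ᵥ n x) i * fderiv ℝ a x (Pi.single i.succ 1) := by
    simp only [← Finset.sum_mul]; rfl
  -- The part of the shift along `n` gives spatial derivatives of `γ`, which the Christoffel terms
  -- of `D n` cancel.
  have h5 : (T * (γ x)⁻¹ * dM γ x (frameVec (q x + a x • n x))).trace
      = (T * (γ x)⁻¹ * dM γ x (frameVec (q x))).trace
        - a x * ∑ k, n x k * (T * (γ x)⁻¹ * dM γ x (Pi.single k.succ 1)).trace := by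
    simp only [dM_frameVec, Matrix.mul_sub, Matrix.trace_sub, Matrix.trace_sum,
      Matrix.mul_smul, Matrix.trace_smul, smul_eq_mul, Pi.add_apply, Pi.smul_apply, add_mul,
      Finset.sum_add_distrib, Finset.mul_sum, mul_assoc]
    ring
  rw [h4, h5, mul_add]
  have h6 : ∑ l, n x l * (1 / 2 * (T * (γ x)⁻¹ * dM γ x (Pi.single l.succ 1)).trace)
      = 1 / 2 * ∑ k, n x k * (T * (γ x)⁻¹ * dM γ x (Pi.single k.succ 1)).trace := by
    rw [Finset.mul_sum]
    exact Finset.sum_congr rfl fun _ _ => by ring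
  rw [h6]
  ring

end Slices

/-! ### Sheared block operators and contracted divergences -/

theorem shear_mulVec_cons (ξ : Pt N) (s : ℝ) (u : Pt N) :
    shear ξ *ᵥ (Fin.cons s u : Pt (N + 1)) = Fin.cons s (s • ξ + u) := by
  ext i
  refine Fin.cases ?_ (fun i => ?_) i
  · simp [shear_eq_blk, Matrix.mulVec, dotProduct, Fin.sum_univ_succ]
  · simp [shear_eq_blk, Matrix.mulVec, dotProduct, Fin.sum_univ_succ, Matrix.one_apply, mul_comm]

theorem blk_mulVec_cons (a : ℝ) (b c : Pt N) (D : Mat N) (s : ℝ) (u : Pt N) :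
    blk a b c D *ᵥ (Fin.cons s u : Pt (N + 1)) = Fin.cons (a * s + b ⬝ᵥ u) (s • c + D *ᵥ u) := by
  ext i
  refine Fin.cases ?_ (fun i => ?_) i
  · simp [Matrix.mulVec, dotProduct, Fin.sum_univ_succ]
  · simp [Matrix.mulVec, dotProduct, Fin.sum_univ_succ, mul_comm]

theorem dM_eq_sum {n d : ℕ} {x : Pt n} (F : Pt n → Mat d) (v : Pt n) :
    dM F x v = ∑ ν, v ν • dM F x (Pi.single ν 1) := by
  ext i j
  rw [Matrix.sum_apply]
  have h : v = ∑ ν, v ν • (Pi.single ν 1 : Pt n) := by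
    ext k
    simp [Finset.sum_apply, Pi.single_apply]
  have h2 := congrArg (fderiv ℝ (fun y => F y i j) x) h
  rw [map_sum] at h2
  simp only [map_smul] at h2
  exact h2

/-- The contraction of the divergence of an operator with a vector. -/
theorem sum_mul_divOperator {n : ℕ} {k X : Pt n → Mat n} {x : Pt n} (hk : ((k x)⁻¹)ᵀ = (k x)⁻¹)
    (hX : (X x * (k x)⁻¹)ᵀ = X x * (k x)⁻¹) (w : Pt n) :
    ∑ ν, w ν * divOperator k X x ν = (∑ μ, (dM X x (Pi.single μ 1) *ᵥ w) μ)
      + (∑ μ, 1 / 2 * ((k x)⁻¹ * dM k x (Pi.single μ 1)).trace * (X x *ᵥ w) μ)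
      - 1 / 2 * (X x * (k x)⁻¹ * dM k x w).trace := by
  have h1 : (X x * (k x)⁻¹ * dM k x w).trace
      = ∑ ν, w ν * (X x * (k x)⁻¹ * dM k x (Pi.single ν 1)).trace := by
    rw [dM_eq_sum]
    simp only [Finset.mul_sum, Matrix.mul_smul, Matrix.trace_sum, Matrix.trace_smul, smul_eq_mul]
  simp only [divOperator_eq X hk hX, mul_sub, Finset.sum_sub_distrib, Finset.mul_sum, mul_add,
    Finset.sum_add_distrib, h1, Matrix.mulVec, dotProduct]
  congr 1
  · congr 1
    · rw [Finset.sum_comm]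
      exact Finset.sum_congr rfl fun _ _ => Finset.sum_congr rfl fun _ _ => mul_comm _ _
    · rw [Finset.sum_comm]
      exact Finset.sum_congr rfl fun _ _ => Finset.sum_congr rfl fun _ _ => by ring
  · exact Finset.sum_congr rfl fun _ _ => by ring

section ShearedBlock

variable (q : Pt N) (a : ℝ) (b c : Pt N) (D : Mat N)

theorem sheared_blk_mulVec_frameVec :
    (shear (-q) * blk a b c D * shear q) *ᵥ frameVec q = Fin.cons a (c - a • q) := by
  rw [← Matrix.mulVec_mulVec, ← Matrix.mulVec_mulVec, frameVec, shear_mulVec_cons, blk_mulVec_cons,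
    shear_mulVec_cons]
  simp [sub_eq_neg_add]

theorem sheared_blk_mulVec_spatial (u : Pt N) :
    (shear (-q) * blk a b c D * shear q) *ᵥ (Fin.cons 0 u : Pt (N + 1))
      = Fin.cons (b ⬝ᵥ u) (D *ᵥ u - (b ⬝ᵥ u) • q) := by
  rw [← Matrix.mulVec_mulVec, ← Matrix.mulVec_mulVec, shear_mulVec_cons, blk_mulVec_cons,
    shear_mulVec_cons]
  simp [sub_eq_neg_add]

/-- `V_g` is explicit in the frame of `h`, while the variation of `g` is explicit in the frame of
`g`; this changes between them. The time column is left unspecified since `trace_mul_dM_metricOf`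
does not see it. -/
theorem sheared_blk_shift (u : Pt N) : ∃ c', shear (-q) * blk a b c D * shear q
    = shear (-(q + u)) * blk (a - b ⬝ᵥ u) b c' (D + vecMulVec u b) * shear (q + u) := by
  have h1 : shear u * blk a b c D * shear (-u) = blk (a - b ⬝ᵥ u) b
      (a • u + c - (b ⬝ᵥ u) • u - D *ᵥ u) (D + vecMulVec u b) := by
    rw [shear_eq_blk, shear_eq_blk, blk_mul, blk_mul]
    congr 1
    · simp [sub_eq_add_neg]
    · simp
    · simp [Matrix.add_mulVec, vecMulVec_mulVec', Matrix.mulVec_neg]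
      abel
    · simp [add_comm]
  refine ⟨a • u + c - (b ⬝ᵥ u) • u - D *ᵥ u, ?_⟩
  rw [← h1, neg_add, ← shear_mul, add_comm q u, ← shear_mul]
  calc _ = shear (-q) * (shear (-u) * shear u) * blk a b c D * (shear (-u) * shear u) * shear q := by
        rw [shear_neg_mul, Matrix.mul_one, Matrix.mul_one]
    _ = _ := by simp only [Matrix.mul_assoc]

end ShearedBlock

/-! ### The conservation law projected onto the normal of the geometric mean -/

namespace Fields

/-- The fields are `C¹` at `x`, with positive lapses and positive definite `χ` nearby. -/
structure Reg (c : Fields N) (x : Pt (N + 1)) : Prop where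
  viel : VielbeinReg 1 c.e c.m c.p x
  L_cd : ContDiffAt ℝ 1 c.lapseG x
  M_cd : ContDiffAt ℝ 1 c.lapseF x
  q_cd : VecCD 1 c.q x
  L_pos : ∀ᶠ y in 𝓝 x, 0 < c.lapseG y
  M_pos : ∀ᶠ y in 𝓝 x, 0 < c.lapseF y

theorem Admissible.reg {c : Fields N} {Ω : Set (Pt (N + 1))} (h : c.Admissible Ω) (hΩ : IsOpen Ω)
    {x : Pt (N + 1)} (hx : x ∈ Ω) : c.Reg x := by
  have hn := hΩ.mem_nhds hx
  refine ⟨⟨fun i j => (h.e_diff i j).contDiffAt hn, fun i j => (h.m_diff i j).contDiffAt hn,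
    contDiffAt_pi.mp (h.p_diff.contDiffAt hn), ?_⟩, h.lapseG_diff.contDiffAt hn,
    h.lapseF_diff.contDiffAt hn, contDiffAt_pi.mp (h.q_diff.contDiffAt hn), ?_, ?_⟩
  · filter_upwards [hn] using h.chi_posDef
  · filter_upwards [hn] using h.lapseG_pos
  · filter_upwards [hn] using h.lapseF_pos

/-- The square root `(g⁻¹ f)^{1/2}` in terms of the fields. -/
noncomputable def rootS (c : Fields N) (x : Pt (N + 1)) : Mat (N + 1) :=
  shear (-c.q x) * frameS (c.lapseG x) (c.lapseF x) (lorentz (c.p x)) (boostVec (c.e x) (c.p x))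
    (chi (c.e x) (c.m x) (c.p x)) (relD (gram (c.e x)) (chi (c.e x) (c.m x) (c.p x))
      (boostVec (c.e x) (c.p x))) * shear (c.q x)

section Pointwise

variable {c : Fields N} {x : Pt (N + 1)} (hp : (chi (c.e x) (c.m x) (c.p x)).PosDef)
  (hL : 0 < c.lapseG x) (hM : 0 < c.lapseF x) {β : ℕ → ℝ} {ℓ : ℝ}

include hp

theorem g_symm : (c.g x)ᵀ = c.g x := metricOf_symm _ _ (boostRel_of_vielbein hp).γ_symm

include hL

theorem g_unit : IsUnit (c.g x).det := by
  rw [g, det_metricOf]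
  exact isUnit_iff_ne_zero.mpr (mul_ne_zero (neg_ne_zero.mpr (pow_ne_zero 2 hL.ne'))
    (boostRel_of_vielbein hp).γ_pos.det_ne_zero)

include hM

theorem S_eq : c.S x = c.rootS x :=
  ((boostRel_of_vielbein hp).isPrincipalSqrt_frame hL hM (c.q x)).principalSqrt_eq

theorem isPrincipalSqrt_S : IsPrincipalSqrt ((c.g x)⁻¹ * c.f x) (c.S x) := by
  rw [S_eq hp hL hM]
  exact (boostRel_of_vielbein hp).isPrincipalSqrt_frame hL hM (c.q x)

theorem det_one_add_S {s : ℝ} (hs : 0 ≤ s) : (1 + s • c.S x).det ≠ 0 := by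
  rw [S_eq hp hL hM]
  exact det_one_add_smul_ne_zero ((boostRel_of_vielbein hp).formPos_mean hL hM (c.q x))
    ((boostRel_of_vielbein hp).formPos_mean_mul hL hM (c.q x)) hs

theorem h_eq : c.h x = metricOf (Real.sqrt (c.lapseG x * c.lapseF x / lorentz (c.p x))) (c.q x)
    (chi (c.e x) (c.m x) (c.p x)) := by
  have hl := (boostRel_of_vielbein hp).lam_pos
  rw [h, S_eq hp hL hM, metricOf, Real.sq_sqrt (by positivity), blockDiag_eq_blk]
  exact (boostRel_of_vielbein hp).metric_mul_sqrt hL hM (c.q x)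

theorem unitNormal_h : unitNormal (c.h x)
    = (Real.sqrt (c.lapseG x * c.lapseF x / lorentz (c.p x)))⁻¹ • frameVec (c.q x) := by
  have hl := (boostRel_of_vielbein hp).lam_pos
  rw [h_eq hp hL hM, unitNormal_metricOf (Real.sqrt_pos.mpr (by positivity)) _
    (boostRel_of_vielbein hp).χ_unit]
  ext i
  refine Fin.cases ?_ (fun i => ?_) i <;> simp [frameVec]

theorem g_mul_S_symm : (c.g x * c.S x)ᵀ = c.g x * c.S x := by
  have := h_eq hp hL hM
  rw [h] at this
  rw [this, metricOf_symm _ _ (boostRel_of_vielbein hp).χ_symm]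

variable {K : ℕ} {w s : Fin K → ℝ} (hm : IsMoment N β ℓ w s)

include hm

theorem Vg_eq_opX : c.Vg β ℓ x = opX w s (c.S x) :=
  hm.sum_adjugate le_rfl fun j => det_one_add_S hp hL hM (hm.pos j).le

theorem Vg_eq : c.Vg β ℓ x = shear (-c.q x) * blk
      (potV w s (relD (gram (c.e x)) (chi (c.e x) (c.m x) (c.p x)) (boostVec (c.e x) (c.p x))))
      (-((c.lapseG x)⁻¹ • (chi (c.e x) (c.m x) (c.p x) *ᵥ (opY w s (relD (gram (c.e x))
        (chi (c.e x) (c.m x) (c.p x)) (boostVec (c.e x) (c.p x))) *ᵥ boostVec (c.e x) (c.p x)))))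
      (c.lapseF x • (Uop β ℓ (c.e x) (c.m x) (c.p x) *ᵥ boostVec (c.e x) (c.p x)))
      (potV w s (relD (gram (c.e x)) (chi (c.e x) (c.m x) (c.p x)) (boostVec (c.e x) (c.p x))) • 1
        - Utop β ℓ (c.e x) (c.m x) (c.p x)
        + (c.lapseF x / c.lapseG x) • Uop β ℓ (c.e x) (c.m x) (c.p x)) * shear (c.q x) := by
  have hr := boostRel_of_vielbein hp
  rw [Vg_eq_opX hp hL hM hm, S_eq hp hL hM, rootS, hr.opX_sqrt hL hM _ hm.pos, Utop_eq hp hm,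
    ← opX_add, add_sub_cancel_right, Uop_eq hp hm, Matrix.smul_mulVec, hr.opY_mulVec hm.pos]

/-- `S` is selfadjoint for `g` because `g S = h` is symmetric, and the adjugates of `1 + s S`
inherit this. -/
theorem Vg_mul_inv_symm : (c.Vg β ℓ x * (c.g x)⁻¹)ᵀ = c.Vg β ℓ x * (c.g x)⁻¹ := by
  refine mul_inv_symm_of_comm (g_unit hp hL) (g_symm hp) ?_
  rw [Vg_eq_opX hp hL hM hm]
  have hS : c.g x * c.S x = (c.S x)ᵀ * c.g x := by
    have := g_mul_S_symm hp hL hM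
    rwa [Matrix.transpose_mul, g_symm hp, eq_comm] at this
  simp only [opX, Finset.mul_sum, Matrix.transpose_sum, Finset.sum_mul, Matrix.mul_smul,
    Matrix.transpose_smul, Matrix.smul_mul]
  exact Finset.sum_congr rfl fun j _ => by
    rw [adjugate_mul_comm (det_one_add_S hp hL hM (hm.pos j).le) (mul_one_add_smul_comm hS _)]

theorem V_eq : Real.sqrt (-(c.g x).det) * c.V β ℓ x
    = sqrtDet (gram (c.e x)) * (c.lapseG x * phV β ℓ (gram (c.e x)) (gram (c.m x))
        (boostVec (c.e x) (c.p x)) + c.lapseF x * phVt β ℓ (gram (c.e x)) (gram (c.m x))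
          (boostVec (c.e x) (c.p x))) := by
  have hr := boostRel_of_vielbein hp
  have h1 : Real.sqrt (-(c.g x).det) = sqrtDet (gram (c.e x)) * c.lapseG x := by
    rw [g, det_metricOf, neg_mul, neg_neg, mul_comm, Real.sqrt_mul hr.γ_det_pos.le,
      Real.sqrt_sq hL.le, sqrtDet]
  rw [h1, V, hm.sum_det le_rfl, S_eq hp hL hM, mul_assoc, rootS, hr.potV_sqrt hL hM _ hm.pos,
    hr.phV_eq hm, hr.phVt_eq hm]

end Pointwise

section Conservation

variable {c : Fields N} {t : ℝ} {y : Pt N}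

/-- The contraction of `∇_μ V_g^μ_ν` with the frame vector `∂ₜ - qⁱ ∂ᵢ`, which is normal to the
slices for the geometric mean. -/
theorem sum_frameVec_mul_divVg_aux {x : Pt (N + 1)} (r : c.Reg x) {β : ℕ → ℝ} {ℓ : ℝ} {K : ℕ}
    {w s : Fin K → ℝ} (hm : IsMoment N β ℓ w s) :
    ∑ ν, frameVec (c.q x) ν * c.divVg β ℓ x ν
      = (∑ i, dV (fun z => c.lapseF z • (Uop β ℓ (c.e z) (c.m z) (c.p z)
            *ᵥ boostVec (c.e z) (c.p z))) x (Pi.single i.succ 1) i)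
        + (∑ i, (fderiv ℝ c.lapseG x (Pi.single i.succ 1) / c.lapseG x
            + 1 / 2 * ((gram (c.e x))⁻¹ * dM (fun z => gram (c.e z)) x (Pi.single i.succ 1)).trace)
            * (c.lapseF x * (Uop β ℓ (c.e x) (c.m x) (c.p x) *ᵥ boostVec (c.e x) (c.p x)) i))
        + (∑ i, ((-Utop β ℓ (c.e x) (c.m x) (c.p x)
            + (c.lapseF x / c.lapseG x) • Uop β ℓ (c.e x) (c.m x) (c.p x))
              *ᵥ dV c.q x (Pi.single i.succ 1)) i)
        + 1 / 2 * (Utop β ℓ (c.e x) (c.m x) (c.p x) * (gram (c.m x))⁻¹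
            * dM (fun z => gram (c.m z)) x (frameVec (c.q x))).trace
        - 1 / 2 * (c.lapseF x / c.lapseG x) * (Uop β ℓ (c.e x) (c.m x) (c.p x) * (gram (c.e x))⁻¹
            * dM (fun z => gram (c.e z)) x (frameVec (c.q x))).trace := by
  have hp := r.viel.posDef.self_of_nhds
  have hL := r.L_pos.self_of_nhds
  have hM := r.M_pos.self_of_nhds
  have hr := r.viel.rel
  set 𝒱 : Pt (N + 1) → ℝ := fun z => potV w s (relD (gram (c.e z)) (chi (c.e z) (c.m z) (c.p z))
    (boostVec (c.e z) (c.p z))) with h𝒱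
  set J : Pt (N + 1) → Pt N := fun z => -((c.lapseG z)⁻¹ • (chi (c.e z) (c.m z) (c.p z) *ᵥ
    (opY w s (relD (gram (c.e z)) (chi (c.e z) (c.m z) (c.p z)) (boostVec (c.e z) (c.p z)))
      *ᵥ boostVec (c.e z) (c.p z)))) with hJ
  set C : Pt (N + 1) → Pt N := fun z => c.lapseF z • (Uop β ℓ (c.e z) (c.m z) (c.p z)
    *ᵥ boostVec (c.e z) (c.p z)) with hC
  set U := Uop β ℓ (c.e x) (c.m x) (c.p x) with hU
  set Ut := Utop β ℓ (c.e x) (c.m x) (c.p x) with hUt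
  set D : Pt (N + 1) → Mat N := fun z => 𝒱 z • 1 - Utop β ℓ (c.e z) (c.m z) (c.p z)
    + (c.lapseF z / c.lapseG z) • Uop β ℓ (c.e z) (c.m z) (c.p z) with hD
  have hVev : ∀ᶠ z in 𝓝 x, c.Vg β ℓ z
      = shear (-c.q z) * blk (𝒱 z) (J z) (C z) (D z) * shear (c.q z) := by
    filter_upwards [r.viel.posDef, r.L_pos, r.M_pos] with z h1 h2 h3 using Vg_eq h1 h2 h3 hm
  have hVx := hVev.self_of_nhds
  have hsym := Vg_mul_inv_symm hp hL hM hm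
  -- regularity
  have h𝒱c : ContDiffAt ℝ 1 𝒱 x := r.viel.relD_cd.potV
  have hCc : VecCD 1 C x := (r.viel.Uop_cd.mulVec r.viel.nv_cd).smul r.M_cd
  have hYc : MatCD 1 (fun z => opY w s (relD (gram (c.e z)) (chi (c.e z) (c.m z) (c.p z))
    (boostVec (c.e z) (c.p z)))) x := r.viel.relD_cd.opY
  have hJc : VecCD 1 J x :=
    ((r.viel.chi_cd.mulVec (hYc.mulVec r.viel.nv_cd)).smul (r.L_cd.inv hL.ne')).neg
  have hDc : MatCD 1 D x := ((MatCD.smul h𝒱c (matCD_const 1)).sub r.viel.Utop_cd).add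
    (MatCD.smul (r.M_cd.div r.L_cd hL.ne') r.viel.Uop_cd)
  have hVc : MatCD 1 (c.Vg β ℓ) x :=
    MatCD.congr ((r.q_cd.neg.shear.mul (MatCD.blk h𝒱c hJc hCc hDc)).mul r.q_cd.shear) hVev
  have hWc : VecCD 1 (fun z => frameVec (c.q z)) x :=
    Fin.cases contDiffAt_const fun i => (r.q_cd i).neg
  -- the flux of the contracted operator
  have hVW : ∀ᶠ z in 𝓝 x, c.Vg β ℓ z *ᵥ frameVec (c.q z) = Fin.cons (𝒱 z) (C z - 𝒱 z • c.q z) := by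
    filter_upwards [hVev] with z hz
    rw [hz, sheared_blk_mulVec_frameVec]
  have hdW : ∀ v, dV (fun z => frameVec (c.q z)) x v = Fin.cons 0 (-dV c.q x v) := fun v => by
    ext i
    refine Fin.cases ?_ (fun i => ?_) i
    · simp [dV, frameVec]
    · exact congrFun (dV_neg v c.q) i
  -- The product rule gives `(dV) W = d(V W) - V dW`, where `dW = -dq` is purely spatial; no
  -- derivative of the remaining blocks is needed.
  have hflux : ∀ v, dM (c.Vg β ℓ) x v *ᵥ frameVec (c.q x)
      = Fin.cons (fderiv ℝ 𝒱 x v) (dV C x v - (𝒱 x • dV c.q x v + fderiv ℝ 𝒱 x v • c.q x))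
        + Fin.cons (J x ⬝ᵥ dV c.q x v) (D x *ᵥ dV c.q x v - (J x ⬝ᵥ dV c.q x v) • c.q x) := by
    intro v
    have e1 := dV_mulVec v hVc hWc
    have e2 := dV_congr v hVW
    have e3 : dV (fun z => (Fin.cons (𝒱 z) (C z - 𝒱 z • c.q z) : Pt (N + 1))) x v
        = Fin.cons (fderiv ℝ 𝒱 x v) (dV C x v - (𝒱 x • dV c.q x v + fderiv ℝ 𝒱 x v • c.q x)) := by
      have e4 : dV (fun z => C z - 𝒱 z • c.q z) x v
          = dV C x v - (𝒱 x • dV c.q x v + fderiv ℝ 𝒱 x v • c.q x) := by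
        have : (fun z => C z - 𝒱 z • c.q z) = fun z => C z + -(𝒱 z • c.q z) :=
          funext fun z => sub_eq_add_neg _ _
        rw [this, dV_add _ hCc (r.q_cd.smul h𝒱c).neg, dV_neg, dV_smul _ h𝒱c r.q_cd, sub_eq_add_neg]
      rw [← e4]
      ext i
      refine Fin.cases ?_ (fun i => ?_) i <;> rfl
    have e5 : c.Vg β ℓ x *ᵥ (Fin.cons 0 (-dV c.q x v) : Pt (N + 1))
        = -Fin.cons (J x ⬝ᵥ dV c.q x v) (D x *ᵥ dV c.q x v - (J x ⬝ᵥ dV c.q x v) • c.q x) := by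
      have : (Fin.cons 0 (-dV c.q x v) : Pt (N + 1)) = -Fin.cons 0 (dV c.q x v) := by
        ext i
        refine Fin.cases ?_ (fun i => ?_) i <;> simp
      rw [this, Matrix.mulVec_neg, hVx, sheared_blk_mulVec_spatial]
    rw [hdW, e5, e2, e3] at e1
    rw [e1, neg_add_cancel_right]
  -- traces against the variation of the metric
  have hξc : VecCD 1 (fun z => c.q z + c.lapseG z • boostVec (c.e z) (c.p z)) x :=
    r.q_cd.add (r.viel.nv_cd.smul r.L_cd)
  -- The trace formula for the identity operator: the logarithmic derivative of `√-g = L √γ`.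
  have htr1 : ∀ v, 1 / 2 * ((c.g x)⁻¹ * dM c.g x v).trace = fderiv ℝ c.lapseG x v / c.lapseG x
      + 1 / 2 * ((gram (c.e x))⁻¹ * dM (fun z => gram (c.e z)) x v).trace := fun v => by
    have := trace_mul_dM_metricOf r.L_cd hξc r.viel.gram_cd hL.ne' hr.γ_unit hr.γ_symm
      (V := 1) (a := 1) (b := 0) (c := 0) (D := 1)
      (by rw [← one_eq_blk, Matrix.mul_one, shear_neg_mul])
      (by rw [Matrix.one_mul, Matrix.transpose_nonsing_inv, metricOf_symm _ _ hr.γ_symm]) v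
    simp only [Matrix.one_mul, zero_dotProduct, zero_add, mul_one] at this
    exact this
  obtain ⟨C', hC'⟩ := sheared_blk_shift (c.q x) (𝒱 x) (J x) (C x) (D x)
    (c.lapseG x • boostVec (c.e x) (c.p x))
  have htr2 := trace_mul_dM_metricOf r.L_cd hξc r.viel.gram_cd hL.ne' hr.γ_unit hr.γ_symm
    (hVx.trans hC') hsym (frameVec (c.q x))
  rw [dV_add _ r.q_cd (r.viel.nv_cd.smul r.L_cd), dV_smul _ r.L_cd r.viel.nv_cd] at htr2
  -- The derivative of `𝒱` along the frame vector cancels the `dn` and rank one terms of the metric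
  -- variation and trades the `Ũ` trace with `dγ` for one with `dφ`.
  have hpot := fderiv_potV_relD (c := w) hr r.viel.gram_cd r.viel.chi_cd r.viel.nv_cd
    (r.viel.rel_eventually.mono fun z hz => hz.φ_eq) hm.pos (frameVec (c.q x))
  have hgi : ((c.g x)⁻¹)ᵀ = (c.g x)⁻¹ := by rw [Matrix.transpose_nonsing_inv, g_symm hp]
  have hdiv := sum_mul_divOperator (X := c.Vg β ℓ) hgi hsym (frameVec (c.q x))
  have htr2' : 1 / 2 * (c.Vg β ℓ x * (c.g x)⁻¹ * dM c.g x (frameVec (c.q x))).trace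
      = _ := htr2
  have hlin1 := apply_frameVec (fderiv ℝ 𝒱 x) (c.q x)
  have hlin2 := congrArg (fun u => J x ⬝ᵥ u) (dV_frameVec (x := x) c.q (c.q x))
  have hlin3 := apply_frameVec (fderiv ℝ c.lapseG x) (c.q x)
  have hlin4 := congrArg (fun A => ((gram (c.e x))⁻¹ * A).trace)
    (dM_frameVec (x := x) (fun z => gram (c.e z)) (c.q x))
  simp only [dotProduct_sub, dotProduct_sum, dotProduct_smul, smul_eq_mul] at hlin2
  simp only [Matrix.mul_sub, Matrix.trace_sub, Finset.mul_sum, Matrix.trace_sum, Matrix.mul_smul,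
    Matrix.trace_smul, smul_eq_mul] at hlin4
  have hDx : D x = 𝒱 x • 1 + (-Ut + (c.lapseF x / c.lapseG x) • U) := by
    rw [hD]; simp only; rw [sub_eq_add_neg, add_assoc]
  change ∑ ν, frameVec (c.q x) ν * divOperator c.g (c.Vg β ℓ) x ν = _
  rw [hdiv, htr2']
  simp only [hflux, htr1, hVW.self_of_nhds, Pi.add_apply, Fin.sum_univ_succ, Fin.cons_zero,
    Fin.cons_succ]
  have s1 : ∑ i : Fin N, ((dV C x (Pi.single i.succ 1) - (𝒱 x • dV c.q x (Pi.single i.succ 1)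
        + fderiv ℝ 𝒱 x (Pi.single i.succ 1) • c.q x)) i + (D x *ᵥ dV c.q x (Pi.single i.succ 1)
        - (J x ⬝ᵥ dV c.q x (Pi.single i.succ 1)) • c.q x) i)
      = (∑ i, dV C x (Pi.single i.succ 1) i)
        - (∑ k, c.q x k * fderiv ℝ 𝒱 x (Pi.single k.succ 1))
        + (∑ i, ((-Ut + (c.lapseF x / c.lapseG x) • U) *ᵥ dV c.q x (Pi.single i.succ 1)) i)
        - ∑ k, c.q x k * (J x ⬝ᵥ dV c.q x (Pi.single k.succ 1)) := by
    rw [hDx]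
    simp only [← Finset.sum_sub_distrib, ← Finset.sum_add_distrib]
    refine Finset.sum_congr rfl fun i _ => ?_
    rw [Matrix.add_mulVec (𝒱 x • 1), Matrix.smul_mulVec, Matrix.one_mulVec]
    simp only [Pi.sub_apply, Pi.add_apply, Pi.smul_apply, smul_eq_mul]
    ring
  have s2 : ∑ i : Fin N, (fderiv ℝ c.lapseG x (Pi.single i.succ 1) / c.lapseG x
        + 1 / 2 * ((gram (c.e x))⁻¹ * dM (fun z => gram (c.e z)) x (Pi.single i.succ 1)).trace)
        * (C x - 𝒱 x • c.q x) i
      = (∑ i, (fderiv ℝ c.lapseG x (Pi.single i.succ 1) / c.lapseG x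
        + 1 / 2 * ((gram (c.e x))⁻¹ * dM (fun z => gram (c.e z)) x (Pi.single i.succ 1)).trace)
        * (c.lapseF x * (U *ᵥ boostVec (c.e x) (c.p x)) i))
        - 𝒱 x * (1 / c.lapseG x * (∑ k, c.q x k * fderiv ℝ c.lapseG x (Pi.single k.succ 1))
          + 1 / 2 * ∑ k, c.q x k
            * ((gram (c.e x))⁻¹ * dM (fun z => gram (c.e z)) x (Pi.single k.succ 1)).trace) := by
    simp only [Finset.mul_sum, ← Finset.sum_sub_distrib, ← Finset.sum_add_distrib]
    refine Finset.sum_congr rfl fun i _ => ?_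
    simp only [hC, Pi.sub_apply, Pi.smul_apply, smul_eq_mul]
    ring
  rw [s1, s2]
  have hUt' : relD (gram (c.e x)) (chi (c.e x) (c.m x) (c.p x)) (boostVec (c.e x) (c.p x))
    * opY w s (relD (gram (c.e x)) (chi (c.e x) (c.m x) (c.p x)) (boostVec (c.e x) (c.p x)))
      = Ut := (Utop_eq hp hm).symm
  rw [hUt'] at hpot
  set κ := chi (c.e x) (c.m x) (c.p x) *ᵥ (opY w s (relD (gram (c.e x))
    (chi (c.e x) (c.m x) (c.p x)) (boostVec (c.e x) (c.p x))) *ᵥ boostVec (c.e x) (c.p x)) with hκ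
  have hJx : J x = -((c.lapseG x)⁻¹ • κ) := rfl
  have hpot' : fderiv ℝ 𝒱 x (frameVec (c.q x)) = _ := hpot
  have t1 : ((D x + vecMulVec (c.lapseG x • boostVec (c.e x) (c.p x)) (J x)) * (gram (c.e x))⁻¹
        * dM (fun z => gram (c.e z)) x (frameVec (c.q x))).trace
      = 𝒱 x * ((gram (c.e x))⁻¹ * dM (fun z => gram (c.e z)) x (frameVec (c.q x))).trace
        - (Ut * (gram (c.e x))⁻¹ * dM (fun z => gram (c.e z)) x (frameVec (c.q x))).trace
        + c.lapseF x / c.lapseG x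
          * (U * (gram (c.e x))⁻¹ * dM (fun z => gram (c.e z)) x (frameVec (c.q x))).trace
        - (vecMulVec (boostVec (c.e x) (c.p x)) κ * (gram (c.e x))⁻¹
          * dM (fun z => gram (c.e z)) x (frameVec (c.q x))).trace := by
    rw [hDx, hJx, Matrix.vecMulVec_neg, Matrix.smul_vecMulVec, Matrix.vecMulVec_smul, smul_smul,
      mul_inv_cancel₀ hL.ne', one_smul]
    simp only [Matrix.add_mul, Matrix.neg_mul, Matrix.smul_mul, Matrix.one_mul, Matrix.trace_add,
      Matrix.trace_neg, Matrix.trace_smul, smul_eq_mul]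
    ring
  rw [t1]
  rw [Matrix.add_mul, Matrix.add_mul, Matrix.trace_add] at hpot'
  rw [dotProduct_add, dotProduct_add, dotProduct_smul, dotProduct_smul, dotProduct_smul]
  have j1 : c.lapseG x * (J x ⬝ᵥ dV (fun y => boostVec (c.e y) (c.p y)) x (frameVec (c.q x)))
      = -(κ ⬝ᵥ dV (fun y => boostVec (c.e y) (c.p y)) x (frameVec (c.q x))) := by
    rw [hJx, neg_dotProduct, smul_dotProduct, smul_eq_mul]
    field_simp
  simp only [smul_eq_mul]
  rw [j1]
  field_simp
  linear_combination -2 * c.lapseG x * hlin1 + 2 * c.lapseG x * hpot' - 2 * c.lapseG x * hlin2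
    - c.lapseG x * 𝒱 x * hlin4 - 2 * 𝒱 x * hlin3

/-- The projection of the conservation law onto the normal of the geometric mean. -/
theorem sum_frameVec_mul_divVg {β : ℕ → ℝ} {ℓ : ℝ} (r : c.Reg (Fin.cons t y)) :
    ∑ ν, frameVec (c.q (Fin.cons t y)) ν * c.divVg β ℓ (Fin.cons t y) ν
      = -c.lapseF (Fin.cons t y) * ((c.slice t).lhs β ℓ y - (c.slice t).rhs β ℓ y) := by
  obtain ⟨w, s, hm⟩ := exists_isMoment N β ℓ
  rw [sum_frameVec_mul_divVg_aux r hm]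
  have rs : VielbeinReg 1 (c.slice t).e (c.slice t).m (c.slice t).p y := r.viel.slice
  set x : Pt (N + 1) := Fin.cons t y with hx
  have hL := r.L_pos.self_of_nhds
  have hM := r.M_pos.self_of_nhds
  have hr := r.viel.rel
  have hUs : (Uop β ℓ (c.e x) (c.m x) (c.p x) * (gram (c.e x))⁻¹)ᵀ
      = Uop β ℓ (c.e x) (c.m x) (c.p x) * (gram (c.e x))⁻¹ := SliceData.U_symm rs
  have hUts : (Utop β ℓ (c.e x) (c.m x) (c.p x) * (gram (c.m x))⁻¹)ᵀ
      = Utop β ℓ (c.e x) (c.m x) (c.p x) * (gram (c.m x))⁻¹ := SliceData.Ut_symm rs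
  have hcur : Uop β ℓ (c.e x) (c.m x) (c.p x) *ᵥ boostVec (c.e x) (c.p x)
      = Utop β ℓ (c.e x) (c.m x) (c.p x) *ᵥ boostVec (c.m x) (c.p x) := SliceData.U_mulVec_eq rs
  have h1 := sum_mul_extrinsicCurv_sub_covDeriv hx r.L_cd r.L_cd r.q_cd r.viel.nv_cd r.viel.gram_cd
    r.L_pos (r.viel.rel_eventually.mono fun z hz => hz.γ_unit)
    (r.viel.rel_eventually.mono fun z hz => hz.γ_symm) hUs
  -- The second metric has shift `q - M ñ`, hence the coefficient `-M`.
  have h2 := sum_mul_extrinsicCurv_sub_covDeriv hx r.M_cd r.M_cd.neg r.q_cd r.viel.nt_cd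
    r.viel.gram_cd' r.M_pos (r.viel.rel_eventually.mono fun z hz => hz.φ_unit)
    (r.viel.rel_eventually.mono fun z hz => hz.φ_symm) hUts
  set a : Pt (N + 1) → Pt N := fun z => Uop β ℓ (c.e z) (c.m z) (c.p z)
    *ᵥ boostVec (c.e z) (c.p z) with ha
  have hac : VecCD 1 a x := r.viel.Uop_cd.mulVec r.viel.nv_cd
  have h3 : (c.slice t).rhs β ℓ y = (∑ i, dV a x (Pi.single i.succ 1) i)
      + ∑ l, a x l * (1 / 2 * ((gram (c.e x))⁻¹
        * dM (fun z => gram (c.e z)) x (Pi.single l.succ 1)).trace) := by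
    have e1 : ∀ i, dV (fun z : Pt N => a (Fin.cons t z)) y (Pi.single i 1)
        = dV a x (Pi.single i.succ 1) := dV_slice hac
    have e2 : ∀ i, dM (fun z : Pt N => gram (c.e (Fin.cons t z))) y (Pi.single i 1)
        = dM (fun z => gram (c.e z)) x (Pi.single i.succ 1) := dM_slice r.viel.gram_cd
    simp only [← e1, ← e2]
    exact SliceData.rhs_eq rs
  set U := Uop β ℓ (c.e x) (c.m x) (c.p x) with hU
  set Ut := Utop β ℓ (c.e x) (c.m x) (c.p x) with hUt
  have hf : c.f = fun z => metricOf (c.lapseF z) (c.q z + (-c.lapseF z) • boostVec (c.m z) (c.p z))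
      (gram (c.m z)) := funext fun z => by rw [f, sub_eq_add_neg, neg_smul]
  rw [← hf] at h2
  have hg : (fun z => metricOf (c.lapseG z) (c.q z + c.lapseG z • boostVec (c.e z) (c.p z))
      (gram (c.e z))) = c.g := rfl
  rw [hg] at h1
  have h4 : (c.slice t).lhs β ℓ y
      = (∑ i, ∑ j, U i j * (covDeriv (fun z => gram (c.e (Fin.cons t z)))
            (fun z => boostVec (c.e (Fin.cons t z)) (c.p (Fin.cons t z))) y i j
          - ((gram (c.e x))⁻¹ * extrinsicCurv c.g x) j i))
        + ∑ i, ∑ j, Ut i j * (covDeriv (fun z => gram (c.m (Fin.cons t z)))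
            (fun z => boostVec (c.m (Fin.cons t z)) (c.p (Fin.cons t z))) y i j
          + ((gram (c.m x))⁻¹ * extrinsicCurv c.f x) j i) := rfl
  simp only [mul_sub, mul_add, Finset.sum_sub_distrib, Finset.sum_add_distrib] at h4
  have h5 : ∀ i : Fin N, fderiv ℝ (fun z => -c.lapseF z) x (Pi.single i.succ 1)
      = -fderiv ℝ c.lapseF x (Pi.single i.succ 1) := fun i => by
    rw [fderiv_fun_neg, _root_.neg_apply]
  -- With `Ũ ñ = U n` the gradient of `M` coming from `K̃` cancels the one in the flux `M U n`; the
  -- gradient of the other lapse cancels between `K` and `√-g`.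
  rw [← hcur] at h2
  simp only [h5, mul_neg, Finset.sum_neg_distrib] at h2
  have s1 : ∑ i, dV (fun z => c.lapseF z • a z) x (Pi.single i.succ 1) i
      = c.lapseF x * (∑ i, dV a x (Pi.single i.succ 1) i)
        + ∑ i, (U *ᵥ boostVec (c.e x) (c.p x)) i * fderiv ℝ c.lapseF x (Pi.single i.succ 1) := by
    simp only [Finset.mul_sum, ← Finset.sum_add_distrib]
    refine Finset.sum_congr rfl fun i _ => ?_
    rw [dV_smul _ r.M_cd hac]
    simp only [Pi.add_apply, Pi.smul_apply, smul_eq_mul, ha, hU]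
    ring
  have s2 : ∑ i : Fin N, (fderiv ℝ c.lapseG x (Pi.single i.succ 1) / c.lapseG x
        + 1 / 2 * ((gram (c.e x))⁻¹ * dM (fun z => gram (c.e z)) x (Pi.single i.succ 1)).trace)
        * (c.lapseF x * (U *ᵥ boostVec (c.e x) (c.p x)) i)
      = c.lapseF x / c.lapseG x * (∑ i, (U *ᵥ boostVec (c.e x) (c.p x)) i
          * fderiv ℝ c.lapseG x (Pi.single i.succ 1))
        + c.lapseF x * ∑ l, a x l * (1 / 2 * ((gram (c.e x))⁻¹
          * dM (fun z => gram (c.e z)) x (Pi.single l.succ 1)).trace) := by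
    simp only [Finset.mul_sum, ← Finset.sum_add_distrib]
    refine Finset.sum_congr rfl fun i _ => ?_
    simp only [ha, hU]
    ring
  have s3 : ∑ i : Fin N, ((-Ut + (c.lapseF x / c.lapseG x) • U)
        *ᵥ dV c.q x (Pi.single i.succ 1)) i
      = -(∑ i, ∑ j, Ut i j * dV c.q x (Pi.single i.succ 1) j)
        + c.lapseF x / c.lapseG x * ∑ i, ∑ j, U i j * dV c.q x (Pi.single i.succ 1) j := by
    simp only [Matrix.add_mulVec, Matrix.neg_mulVec, Matrix.smul_mulVec, Pi.add_apply, Pi.neg_apply,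
      Pi.smul_apply, smul_eq_mul, Finset.sum_add_distrib, Finset.sum_neg_distrib, ← Finset.mul_sum]
    rfl
  rw [s1, s2, s3, h3, h4]
  field_simp
  linear_combination -2 * c.lapseF x * h1 + 2 * c.lapseG x * h2

variable {β : ℕ → ℝ} {ℓ : ℝ} (r : c.Reg (Fin.cons t y))

include r

theorem mean_lapse_pos : 0 < Real.sqrt (c.lapseG (Fin.cons t y) * c.lapseF (Fin.cons t y)
    / lorentz (c.p (Fin.cons t y))) :=
  Real.sqrt_pos.mpr (div_pos (mul_pos r.L_pos.self_of_nhds r.M_pos.self_of_nhds)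
    r.viel.rel.lam_pos)

theorem normalProj_eq : c.normalProj β ℓ (Fin.cons t y)
    = -(c.lapseF (Fin.cons t y) / Real.sqrt (c.lapseG (Fin.cons t y) * c.lapseF (Fin.cons t y)
        / lorentz (c.p (Fin.cons t y))))
      * ((c.slice t).lhs β ℓ y - (c.slice t).rhs β ℓ y) := by
  have h := sum_frameVec_mul_divVg (β := β) (ℓ := ℓ) r
  rw [normalProj, unitNormal_h r.viel.posDef.self_of_nhds r.L_pos.self_of_nhds
    r.M_pos.self_of_nhds]
  simp only [Pi.smul_apply, smul_eq_mul, mul_assoc, ← Finset.mul_sum]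
  rw [h]
  ring

/-- The spatial columns of the projector are coordinate vectors, so the contracting vector is `n_g +
𝗇ⁱ ∂ᵢ`; the boost shift cancels and leaves the frame vector over the lapse. -/
theorem sum_projector_mul_divVg :
    (∑ ν, (unitNormal (c.g (Fin.cons t y)) ν
        + ∑ i, (c.slice t).nv y i * projector (c.g (Fin.cons t y)) ν (Fin.succ i))
          * c.divVg β ℓ (Fin.cons t y) ν)
      = -(c.lapseF (Fin.cons t y) / c.lapseG (Fin.cons t y))
        * ((c.slice t).lhs β ℓ y - (c.slice t).rhs β ℓ y) := by
  have h := sum_frameVec_mul_divVg (β := β) (ℓ := ℓ) r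
  have hL := r.L_pos.self_of_nhds
  have hr := r.viel.rel
  have hv : ∀ ν, unitNormal (c.g (Fin.cons t y)) ν
      + ∑ i, (c.slice t).nv y i * projector (c.g (Fin.cons t y)) ν (Fin.succ i)
      = (c.lapseG (Fin.cons t y))⁻¹ * frameVec (c.q (Fin.cons t y)) ν := by
    intro ν
    rw [g, unitNormal_metricOf hL _ hr.γ_unit]
    simp only [projector_metricOf_succ hL _ hr.γ_unit hr.γ_symm]
    refine Fin.cases ?_ (fun j => ?_) ν
    · simp [frameVec, (Fin.succ_ne_zero _).symm]
    · simp [frameVec, Matrix.one_apply, SliceData.nv, slice]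
      field_simp
      ring
  simp only [hv, mul_assoc, ← Finset.mul_sum]
  rw [h]
  ring

theorem normalProj_eq_zero_iff : c.normalProj β ℓ (Fin.cons t y) = 0
    ↔ (c.slice t).lhs β ℓ y = (c.slice t).rhs β ℓ y := by
  rw [normalProj_eq r, mul_eq_zero, sub_eq_zero, or_iff_right]
  exact neg_ne_zero.mpr (div_pos r.M_pos.self_of_nhds (mean_lapse_pos r)).ne'

/-- The frame vector has time component one, so the projection and the spatial components determine
the time component. -/
theorem divVg_eq_zero_iff : (∀ ν, c.divVg β ℓ (Fin.cons t y) ν = 0)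
    ↔ (c.slice t).lhs β ℓ y = (c.slice t).rhs β ℓ y
      ∧ ∀ i : Fin N, c.divVg β ℓ (Fin.cons t y) i.succ = 0 := by
  have h := sum_frameVec_mul_divVg (β := β) (ℓ := ℓ) r
  constructor
  · intro h0
    refine ⟨?_, fun i => h0 _⟩
    rw [← normalProj_eq_zero_iff r, normalProj]
    simp only [h0, mul_zero, Finset.sum_const_zero]
  · rintro ⟨h1, h2⟩
    rw [h1, sub_self, mul_zero, Fin.sum_univ_succ] at h
    simp only [h2, mul_zero, Finset.sum_const_zero, add_zero, frameVec, Fin.cons_zero,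
      one_mul] at h
    exact Fin.cases h h2

end Conservation

end Fields

/-! ### Locality of the scalar equation -/

theorem covDeriv_congr {n : ℕ} {k k' : Pt n → Mat n} {ξ ξ' : Pt n → Pt n} {x : Pt n}
    (hk : ∀ᶠ z in 𝓝 x, k' z = k z) (hξ : ∀ᶠ z in 𝓝 x, ξ' z = ξ z) (i j : Fin n) :
    covDeriv k' ξ' x i j = covDeriv k ξ x i j := by
  have h1 : ∀ i a b, pd i (fun y => k' y a b) x = pd i (fun y => k y a b) x := fun i a b =>
    congrFun (congrFun (dM_congr (Pi.single i 1) hk) a) b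
  have h2 : ∀ i a, pd i (fun y => ξ' y a) x = pd i (fun y => ξ y a) x := fun i a =>
    congrFun (dV_congr (Pi.single i 1) hξ) a
  simp only [covDeriv, christoffel, h1, h2, hk.self_of_nhds, hξ.self_of_nhds]

namespace SliceData

variable {s s' : SliceData N} {y : Pt N} {β : ℕ → ℝ} {ℓ : ℝ}
  (h : ∀ᶠ z in 𝓝 y, s'.e z = s.e z ∧ s'.m z = s.m z ∧ s'.p z = s.p z)

include h

/-- The extrinsic curvatures enter undifferentiated, so agreement at the point suffices for them. -/
theorem lhs_congr (hK : s'.K y = s.K y) (hKt : s'.Kt y = s.Kt y) :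
    s'.lhs β ℓ y = s.lhs β ℓ y := by
  have hγ : ∀ᶠ z in 𝓝 y, s'.γ z = s.γ z := h.mono fun z hz => by rw [γ, γ, hz.1]
  have hφ : ∀ᶠ z in 𝓝 y, s'.φ z = s.φ z := h.mono fun z hz => by rw [φ, φ, hz.2.1]
  have hn : ∀ᶠ z in 𝓝 y, s'.nv z = s.nv z := h.mono fun z hz => by rw [nv, nv, hz.1, hz.2.2]
  have ht : ∀ᶠ z in 𝓝 y, s'.nt z = s.nt z := h.mono fun z hz => by rw [nt, nt, hz.2.1, hz.2.2]
  have hU : s'.U β ℓ y = s.U β ℓ y := by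
    obtain ⟨h1, h2, h3⟩ := h.self_of_nhds
    rw [U, U, h1, h2, h3]
  have hUt : s'.Ut β ℓ y = s.Ut β ℓ y := by
    obtain ⟨h1, h2, h3⟩ := h.self_of_nhds
    rw [Ut, Ut, h1, h2, h3]
  simp only [lhs, covDeriv_congr hγ hn, covDeriv_congr hφ ht, hU, hUt, hK, hKt, hγ.self_of_nhds,
    hφ.self_of_nhds]

theorem rhs_congr : s'.rhs β ℓ y = s.rhs β ℓ y := by
  have hγ : ∀ᶠ z in 𝓝 y, s'.γ z = s.γ z := h.mono fun z hz => by rw [γ, γ, hz.1]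
  have hU : ∀ᶠ z in 𝓝 y, (s'.U β ℓ z) *ᵥ s'.nv z = (s.U β ℓ z) *ᵥ s.nv z := h.mono fun z hz => by
    rw [U, U, nv, nv, hz.1, hz.2.1, hz.2.2]
  simp only [rhs, divVector, covDeriv_congr hγ hU]

end SliceData

/-! ### Stability of positivity and of principal square roots -/

section Stability

variable {E : Type*} [NormedAddCommGroup E] [NormedSpace ℝ E] {k : WithTop ℕ∞} {x : E}

theorem MatCD.continuousAt {F : E → Mat N} (hF : MatCD k F x) : ContinuousAt F x :=
  continuousAt_pi.mpr fun i => continuousAt_pi.mpr fun j => (hF i j).continuousAt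

theorem formPos_of_sphere {k : Mat N} (h : ∀ u ∈ Metric.sphere (0 : Pt N) 1, 0 < u ⬝ᵥ (k *ᵥ u)) :
    FormPos k := by
  intro v hv
  have hn : 0 < ‖v‖ := norm_pos_iff.mpr hv
  have h1 := h (‖v‖⁻¹ • v) (by simp [norm_smul, hn.ne'])
  rw [Matrix.mulVec_smul, smul_dotProduct, dotProduct_smul, smul_eq_mul, smul_eq_mul] at h1
  exact pos_of_mul_pos_right (pos_of_mul_pos_right h1 (inv_nonneg.mpr hn.le))
    (inv_nonneg.mpr hn.le)

/-- Positivity on the compact unit sphere is an open condition, and homogeneity extends it to all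
vectors. -/
theorem FormPos.eventually {k : Mat N} (h : FormPos k) : ∀ᶠ M in 𝓝 k, FormPos M := by
  have h1 : ∀ᶠ M in 𝓝 k, ∀ u ∈ Metric.sphere (0 : Pt N) 1, 0 < u ⬝ᵥ (M *ᵥ u) := by
    refine (isCompact_sphere 0 1).eventually_forall_of_forall_eventually fun u hu => ?_
    have hu0 : u ≠ 0 := by
      rintro rfl
      simp at hu
    have hc : Continuous fun z : Mat N × Pt N => z.2 ⬝ᵥ (z.1 *ᵥ z.2) := by
      simp only [dotProduct, Matrix.mulVec]
      refine continuous_finsetSum _ fun i _ => Continuous.mul (by fun_prop) ?_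
      refine continuous_finsetSum _ fun j _ => Continuous.mul ?_ (by fun_prop)
      exact (continuous_apply_apply i j).comp continuous_fst
    exact hc.continuousAt.eventually (lt_mem_nhds (h u hu0))
  exact h1.mono fun M hM => formPos_of_sphere hM

theorem FormPos.eventually_of_cd {F : E → Mat N} (h : FormPos (F x)) (hF : MatCD k F x) :
    ∀ᶠ y in 𝓝 x, FormPos (F y) := hF.continuousAt.eventually h.eventually

theorem contDiffAt_pi_pi {a b : ℕ} {G : E → Fin a → Fin b → ℝ} :
    ContDiffAt ℝ k G x ↔ ∀ i j, ContDiffAt ℝ k (fun y => G y i j) x := by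
  rw [contDiffAt_pi]
  exact forall_congr' fun i => contDiffAt_pi

section ImplicitFunction

attribute [local instance] Matrix.normedAddCommGroup Matrix.normedSpace

theorem matCD_iff {F : E → Mat N} : MatCD k F x ↔ ContDiffAt ℝ k F x :=
  (contDiffAt_pi_pi (G := F)).symm

/-- A matrix field has a square root of the same regularity near a principal square root. -/
theorem exists_sqrt_field (hk : k ≠ 0) {A : E → Mat N} (hA : MatCD k A x) {X : Mat N}
    (hX : IsPrincipalSqrt (A x) X) :
    ∃ S : E → Mat N, MatCD k S x ∧ S x = X ∧ ∀ᶠ y in 𝓝 x, S y * S y = A y := by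
  set B := (LinearMap.mul ℝ (Mat N)).toContinuousBilinearMap with hB
  set f : Mat N → Mat N := fun Z => B Z Z with hf
  have hfd : ContDiffAt ℝ k f X :=
    (B.isBoundedBilinearMap.contDiff.comp (contDiff_id.prodMk contDiff_id)).contDiffAt
  set L : Mat N →ₗ[ℝ] Mat N := LinearMap.mulLeft ℝ X + LinearMap.mulRight ℝ X with hL
  -- The derivative of `Z ↦ Z²` at `X` is the Sylvester operator, injective because the spectrum
  -- lies in the right half plane; the inverse function theorem then applies.
  have hinj : Function.Injective L := by
    rw [← LinearMap.ker_eq_bot, LinearMap.ker_eq_bot']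
    intro Z hZ
    exact eq_zero_of_mul_add_mul_eq_zero hX.2 hX.2 hZ
  set e := (LinearEquiv.ofInjectiveEndo L hinj).toContinuousLinearEquiv with he
  have hder : HasFDerivAt f (e : Mat N →L[ℝ] Mat N) X := by
    have h1 := B.hasFDerivAt_of_bilinear (hasFDerivAt_id X) (hasFDerivAt_id X)
    refine h1.congr_fderiv ?_
    ext1 Z
    rfl
  have hfX : f X = A x := hX.1
  have hinv := hfd.to_localInverse hder hk
  rw [hfX] at hinv
  refine ⟨hfd.localInverse hder hk ∘ A, matCD_iff.mpr (hinv.comp x (matCD_iff.mp hA)), ?_, ?_⟩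
  · rw [Function.comp_apply, ← hfX]
    exact hfd.localInverse_apply_image hder hk
  · have h2 := (hfd.hasStrictFDerivAt' hder hk).eventually_right_inverse
    rw [hfX] at h2
    exact hA.continuousAt.eventually h2

end ImplicitFunction

theorem phLorentz_contDiffAt {γ : E → Mat N} {n : E → Pt N} (hγ : MatCD k γ x) (hn : VecCD k n x)
    (h : 0 < 1 - n x ⬝ᵥ (γ x *ᵥ n x)) : ContDiffAt ℝ k (fun y => phLorentz (γ y) (n y)) x :=
  ((contDiffAt_const.sub (hn.dotProduct (hγ.mulVec hn))).sqrt h.ne').inv (Real.sqrt_pos.mpr h).ne'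

/-- The relations between the metrics, the boost and the geometric mean extend to neighbouring
metrics. -/
theorem BoostRel.exists_near (hk : k ≠ 0) {γ φ : E → Mat N} {n : E → Pt N} {χ₀ : Mat N} {nt₀ : Pt N}
    {lam₀ : ℝ} (h : BoostRel (γ x) (φ x) χ₀ (n x) nt₀ lam₀) (hγ : MatCD k γ x) (hφ : MatCD k φ x)
    (hn : VecCD k n x) (hγs : ∀ᶠ y in 𝓝 x, (γ y)ᵀ = γ y) (hφs : ∀ᶠ y in 𝓝 x, (φ y)ᵀ = φ y) :
    ∃ (χ : E → Mat N) (nt : E → Pt N) (lam : E → ℝ), MatCD k χ x ∧ VecCD k nt x ∧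
      ContDiffAt ℝ k lam x ∧ χ x = χ₀ ∧
      ∀ᶠ y in 𝓝 x, BoostRel (γ y) (φ y) (χ y) (n y) (nt y) (lam y) := by
  set P : E → Mat N := fun y => (γ y)⁻¹ - vecMulVec (n y) (n y) with hP
  have hPc : MatCD k P x := (hγ.inv h.γ_unit).sub (hn.vecMulVec hn)
  obtain ⟨X, hXc, hX0, hXA⟩ := exists_sqrt_field hk (hPc.mul hφ) h.isPrincipalSqrt_relD
  have hXu : IsUnit (X x).det := by rw [hX0]; exact h.relD_unit
  have hχ0 : φ x * (X x)⁻¹ = χ₀ := by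
    rw [hX0, ← h.χ_mul_relD, Matrix.mul_assoc, Matrix.mul_nonsing_inv _ h.relD_unit, Matrix.mul_one]
  have hlam : 0 < 1 - n x ⬝ᵥ (γ x *ᵥ n x) := by
    refine pos_of_mul_pos_right (a := lam₀ ^ 2) ?_ (pow_pos h.lam_pos 2).le
    rw [h.lam_eq]
    exact one_pos
  have hχc : MatCD k (fun y => φ y * (X y)⁻¹) x := hφ.mul (hXc.inv hXu)
  have hlc := phLorentz_contDiffAt hγ hn hlam
  have hl0 : 0 < phLorentz (γ x) (n x) := by rw [h.phLorentz_eq]; exact h.lam_pos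
  refine ⟨fun y => φ y * (X y)⁻¹, fun y => (phLorentz (γ y) (n y))⁻¹ •
    ((φ y)⁻¹ *ᵥ ((φ y * (X y)⁻¹) *ᵥ n y)), fun y => phLorentz (γ y) (n y), hχc,
    ((hφ.inv h.φ_unit).mulVec (hχc.mulVec hn)).smul (hlc.inv hl0.ne'), hlc, hχ0, ?_⟩
  have hEc : MatCD k (fun y => (φ y)⁻¹ * (X y)ᵀ * φ y) x :=
    ((hφ.inv h.φ_unit).mul hXc.transpose).mul hφ
  have hE0 : (φ x)⁻¹ * (X x)ᵀ * φ x = X x := by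
    rw [hX0, Matrix.mul_assoc, ← h.φ_comm_relD, Matrix.nonsing_inv_mul_cancel_left _ _ h.φ_unit]
  -- The fixed `χ₀` serves as Lyapunov form at nearby points, for the root `X` and for its
  -- `φ`-adjoint, before `φ X⁻¹` is known to be symmetric.
  have hpX : FormPos (χ₀ * X x) := by rw [hX0, h.χ_mul_relD]; exact h.φ_pos
  have hcχ : MatCD k (fun _ : E => χ₀) x := matCD_const χ₀
  have e1 := h.γ_pos.eventually_of_cd hγ
  have e2 := h.φ_pos.eventually_of_cd hφ
  have e3 := hpX.eventually_of_cd (F := fun y => χ₀ * X y) (hcχ.mul hXc)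
  have e4 := FormPos.eventually_of_cd (F := fun y => χ₀ * ((φ y)⁻¹ * (X y)ᵀ * φ y))
    (by rw [hE0]; exact hpX) (hcχ.mul hEc)
  have e5 := FormPos.eventually_of_cd (F := fun y => φ y * (X y)⁻¹)
    (by rw [hχ0]; exact h.χ_pos) hχc
  have e6 : ∀ᶠ y in 𝓝 x, 0 < 1 - n y ⬝ᵥ (γ y *ᵥ n y) :=
    (contDiffAt_const.sub (hn.dotProduct (hγ.mulVec hn))).continuousAt.eventually
      (lt_mem_nhds hlam)
  filter_upwards [hXA, hγs, hφs, e1, e2, e3, e4, e5, e6] with y hA hγy hφy p1 p2 p3 p4 p5 p6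
  have hφu : IsUnit (φ y).det := isUnit_iff_ne_zero.mpr p2.det_ne_zero
  have hXy : IsUnit (X y).det := by
    have := p3.det_ne_zero
    rw [Matrix.det_mul] at this
    exact isUnit_iff_ne_zero.mpr (right_ne_zero_of_mul this)
  have hPs : (P y)ᵀ = P y := by
    rw [hP]
    simp only [Matrix.transpose_sub, Matrix.transpose_nonsing_inv, hγy, Matrix.transpose_vecMulVec]
  -- Both sides are principal roots of the same matrix. Their equality is the symmetry of `χ = φ
  -- X⁻¹`.
  have hXE : X y = (φ y)⁻¹ * (X y)ᵀ * φ y := by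
    refine IsPrincipalSqrt.unique (A := P y * φ y) ⟨hA, re_pos_of_formPos h.χ_symm h.χ_pos p3⟩
      ⟨?_, re_pos_of_formPos h.χ_symm h.χ_pos p4⟩
    have hT : (X y)ᵀ * (X y)ᵀ = φ y * P y := by
      rw [← Matrix.transpose_mul, hA, Matrix.transpose_mul, hPs, hφy]
    calc (φ y)⁻¹ * (X y)ᵀ * φ y * ((φ y)⁻¹ * (X y)ᵀ * φ y)
        = (φ y)⁻¹ * (X y)ᵀ * (φ y * (φ y)⁻¹) * (X y)ᵀ * φ y := by simp only [Matrix.mul_assoc]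
      _ = (φ y)⁻¹ * ((X y)ᵀ * (X y)ᵀ) * φ y := by
        rw [Matrix.mul_nonsing_inv _ hφu, Matrix.mul_one]; simp only [Matrix.mul_assoc]
      _ = P y * φ y := by
        rw [hT, ← Matrix.mul_assoc, Matrix.nonsing_inv_mul _ hφu, Matrix.one_mul]
  have hφX : φ y * X y = (X y)ᵀ * φ y := by
    conv_lhs => rw [hXE]
    rw [← Matrix.mul_assoc, ← Matrix.mul_assoc, Matrix.mul_nonsing_inv _ hφu, Matrix.one_mul]
  have hs := Real.sqrt_pos.mpr p6
  refine ⟨hγy, ?_, p1, p2, p5, inv_pos.mpr hs, ?_, ?_, ?_⟩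
  · have hXt : IsUnit (X y)ᵀ.det := by rwa [Matrix.det_transpose]
    rw [Matrix.transpose_mul, hφy, Matrix.transpose_nonsing_inv]
    calc ((X y)ᵀ)⁻¹ * φ y = ((X y)ᵀ)⁻¹ * (φ y * X y) * (X y)⁻¹ := by
          rw [Matrix.mul_assoc, Matrix.mul_assoc, Matrix.mul_nonsing_inv _ hXy, Matrix.mul_one]
      _ = φ y * (X y)⁻¹ := by
        rw [hφX, ← Matrix.mul_assoc, Matrix.nonsing_inv_mul _ hXt, Matrix.one_mul]
  · calc φ y = φ y * (X y)⁻¹ * (X y * X y) * (X y)⁻¹ := by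
          rw [← Matrix.mul_assoc, Matrix.mul_assoc (φ y), Matrix.nonsing_inv_mul _ hXy,
            Matrix.mul_one, Matrix.mul_assoc, Matrix.mul_nonsing_inv _ hXy, Matrix.mul_one]
      _ = φ y * (X y)⁻¹ * P y * (φ y * (X y)⁻¹) := by rw [hA]; simp only [Matrix.mul_assoc]
  · rw [phLorentz, inv_pow, Real.sq_sqrt p6.le, inv_mul_cancel₀ p6.ne']
  · rw [Matrix.mulVec_smul, Matrix.mulVec_mulVec, Matrix.mul_nonsing_inv _ hφu, Matrix.one_mulVec]

end Stability

end Bimetric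

namespace Bimetric

open Matrix MeasureTheory

variable {N : ℕ}

/-! ### Test functions -/

section Test

variable {A : Set (Pt N)} {ξ : Pt N → ℝ}

theorem IsTest.eventually_zero (h : IsTest A ξ) {y : Pt N} (hy : y ∉ A) : ∀ᶠ z in 𝓝 y, ξ z = 0 :=
  notMem_tsupport_iff_eventuallyEq.mp fun hy' => hy (h.2.2 hy')

/-- The factor need be smooth only on `A`: outside `A` the test function vanishes in a
neighbourhood. -/
theorem IsTest.mul (h : IsTest A ξ) {f : Pt N → ℝ} (hf : ∀ y ∈ A, ContDiffAt ℝ ∞ f y) :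
    IsTest A fun y => ξ y * f y := by
  refine ⟨contDiff_iff_contDiffAt.mpr fun y => ?_, h.2.1.mul_right,
    (tsupport_mul_subset_left (f := ξ) (g := f)).trans h.2.2⟩
  by_cases hy : y ∈ A
  · exact h.1.contDiffAt.mul (hf y hy)
  · refine (contDiffAt_const (c := (0 : ℝ))).congr_of_eventuallyEq ?_
    exact (h.eventually_zero hy).mono fun z hz => by simp only [hz, zero_mul]

theorem IsTest.integrable (h : IsTest A ξ) : Integrable ξ :=
  h.1.continuous.integrable_of_hasCompactSupport h.2.1

theorem IsTest.setIntegral_eq (h : IsTest A ξ) : ∫ y in A, ξ y = ∫ y, ξ y :=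
  setIntegral_eq_integral_of_forall_compl_eq_zero fun _ hy => (h.eventually_zero hy).self_of_nhds

theorem contDiffAt_pd {f : Pt N → ℝ} {y : Pt N} (hf : ContDiffAt ℝ ∞ f y) (i : Fin N) :
    ContDiffAt ℝ ∞ (pd i f) y :=
  ((hf.fderiv_right (m := ∞) (by simp)).clm_apply contDiffAt_const)

theorem IsTest.pd (h : IsTest A ξ) (i : Fin N) : IsTest A (pd i ξ) := by
  refine ⟨contDiff_iff_contDiffAt.mpr fun y => contDiffAt_pd h.1.contDiffAt i,
    h.2.1.fderiv_apply ℝ _, ?_⟩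
  exact (tsupport_fderiv_apply_subset ℝ _).trans h.2.2

theorem IsTest.integral_pd (h : IsTest A ξ) (i : Fin N) : ∫ y in A, Bimetric.pd i ξ y = 0 := by
  have e : Bimetric.pd i ξ = fun y => fderiv ℝ ξ y (Pi.single i 1) := rfl
  have hi := (h.pd i).integrable
  rw [(h.pd i).setIntegral_eq]
  rw [e] at hi ⊢
  have h1 := integral_mul_fderiv_eq_neg_fderiv_mul_of_integrable (μ := volume) (𝕜 := ℝ)
    (f := fun _ : Pt N => (1 : ℝ)) (g := ξ) (v := Pi.single i 1) (by simp)
    (by simpa using hi) (by simpa using h.integrable)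
    (fun _ _ => differentiableAt_const _)
    fun y _ => (h.1.differentiable (by simp)).differentiableAt
  simpa using h1

/-- The fundamental lemma of the calculus of variations; continuity upgrades almost everywhere to
everywhere on `A`. -/
theorem eq_zero_of_integral_test (hA : IsOpen A) {f : Pt N → ℝ} (hf : ContinuousOn f A)
    (h : ∀ g, IsTest A g → ∫ y in A, g y * f y = 0) : ∀ y ∈ A, f y = 0 := by
  have h1 := hA.ae_eq_zero_of_integral_contDiff_smul_eq_zero (μ := volume)
    (hf.locallyIntegrableOn hA.measurableSet) fun g g1 g2 g3 => by
      rw [← h g ⟨g1, g2, g3⟩]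
      refine (setIntegral_eq_integral_of_forall_compl_eq_zero fun y hy => ?_).symm
      have : g y = 0 := image_eq_zero_of_notMem_tsupport fun hy' => hy (g3 hy')
      rw [this, zero_smul]
  exact Measure.eqOn_open_of_ae_eq (μ := volume) ((ae_restrict_iff' hA.measurableSet).mpr h1) hA hf
    continuousOn_const

theorem exists_isTest_eq_one (hA : IsOpen A) {y : Pt N} (hy : y ∈ A) : ∃ g, IsTest A g ∧ g y = 1 := by
  obtain ⟨g, g1, g2, g3, -, g5⟩ := exists_contDiff_tsupport_subset (n := ⊤) (hA.mem_nhds hy)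
  exact ⟨g, ⟨g3, g2, g1⟩, g5⟩

end Test

/-! ### Differentiation under the integral sign -/

theorem hasDerivAt_setIntegral {A K : Set (Pt N)} (hA : IsOpen A) (hK : IsCompact K) (hKA : K ⊆ A)
    {H : ℝ → Pt N → ℝ} (h0 : ∀ t, ∀ y ∉ K, H t y = 0)
    (hH : ∀ y ∈ K, ContDiffAt ℝ 1 (fun z : ℝ × Pt N => H z.1 z.2) (0, y)) :
    HasDerivAt (fun t => ∫ y in A, H t y)
      (∫ y in A, fderiv ℝ (fun z : ℝ × Pt N => H z.1 z.2) (0, y) (1, 0)) 0 := by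
  set F : ℝ × Pt N → ℝ := fun z => H z.1 z.2 with hF
  set V : Set (ℝ × Pt N) := {z | ContDiffAt ℝ 1 F z} with hV
  have hVo : IsOpen V := isOpen_iff_mem_nhds.mpr fun z hz =>
    ContDiffAt.eventually (n := 1) hz (by simp)
  -- Regularity is known only at parameter zero over the compact set; the tube lemma gives a uniform
  -- parameter interval, on which the derivative is bounded by a constant.
  obtain ⟨u, v, huo, -, hu, hv, huv⟩ := generalized_tube_lemma (isCompact_singleton (x := (0 : ℝ)))
    hK hVo (by rintro ⟨t, y⟩ ⟨ht, hy⟩; rw [Set.mem_singleton_iff] at ht; subst ht; exact hH y hy)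
  obtain ⟨ε, hε, hεu⟩ := Metric.isOpen_iff.mp huo 0 (hu rfl)
  have hsub : ∀ t ∈ Metric.closedBall (0 : ℝ) (ε / 2), ∀ y ∈ K, ContDiffAt ℝ 1 F (t, y) :=
    fun t ht y hy => huv ⟨hεu (Metric.closedBall_subset_ball (half_lt_self hε) ht), hv hy⟩
  have hcomp : IsCompact (Metric.closedBall (0 : ℝ) (ε / 2) ×ˢ K) :=
    (isCompact_closedBall 0 _).prod hK
  have hdc : ContinuousOn (fun z => fderiv ℝ F z (1, 0)) (Metric.closedBall (0 : ℝ) (ε / 2) ×ˢ K) :=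
    fun z hz => (((hsub z.1 hz.1 z.2 hz.2).fderiv_right (m := 0) (by simp)).continuousAt.clm_apply
      continuousAt_const).continuousWithinAt
  obtain ⟨C, hC⟩ := hcomp.exists_bound_of_continuousOn hdc
  have hFc : ∀ t ∈ Metric.closedBall (0 : ℝ) (ε / 2), ContinuousOn (H t) K := fun t ht y hy =>
    ((hsub t ht y hy).continuousAt.comp (f := fun y => (t, y))
      (by fun_prop)).continuousWithinAt
  have hz0 : (0 : ℝ) ∈ Metric.closedBall (0 : ℝ) (ε / 2) := Metric.mem_closedBall_self (by positivity)
  have hball : Metric.closedBall (0 : ℝ) (ε / 2) ∈ 𝓝 (0 : ℝ) :=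
    Metric.closedBall_mem_nhds 0 (by positivity)
  have hres : ∀ G : Pt N → ℝ, (∀ y ∉ K, G y = 0) → ∫ y in A, G y = ∫ y in K, G y := fun G hG =>
    setIntegral_eq_of_subset_of_forall_sdiff_eq_zero hA.measurableSet hKA fun y hy => hG y hy.2
  have hfd0 : ∀ y ∉ K, fderiv ℝ F (0, y) (1, 0) = 0 := fun y hy => by
    have : F =ᶠ[𝓝 ((0 : ℝ), y)] fun _ => 0 := by
      have h1 : ∀ᶠ z in 𝓝 ((0 : ℝ), y), z.2 ∈ Kᶜ :=
        continuousAt_snd.eventually (hK.isClosed.isOpen_compl.mem_nhds hy)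
      exact h1.mono fun z hz => h0 _ _ hz
    rw [this.fderiv_eq]
    simp
  rw [hres _ hfd0]
  simp only [fun t => hres (H t) (h0 t)]
  refine (hasDerivAt_integral_of_dominated_loc_of_deriv_le (μ := volume.restrict K)
    (F' := fun t y => fderiv ℝ F (t, y) (1, 0)) (bound := fun _ => C) hball ?_ ?_ ?_ ?_ ?_ ?_).2
  · exact Filter.mem_of_superset hball fun t ht => (hFc t ht).aestronglyMeasurable hK.measurableSet
  · exact (hFc 0 hz0).integrableOn_compact hK
  · refine ContinuousOn.aestronglyMeasurable (fun y hy => ?_) hK.measurableSet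
    exact (hdc.comp (f := fun y => ((0 : ℝ), y)) (by fun_prop) fun y hy => ⟨hz0, hy⟩) y hy
  · exact (ae_restrict_iff' hK.measurableSet).mpr
      (Filter.Eventually.of_forall fun y hy t ht => hC (t, y) ⟨ht, hy⟩)
  · have : IsFiniteMeasure (volume.restrict K) := ⟨by
      rw [Measure.restrict_apply_univ]; exact hK.measure_lt_top⟩
    exact integrable_const C
  · refine (ae_restrict_iff' hK.measurableSet).mpr (Filter.Eventually.of_forall fun y hy t ht => ?_)
    have h1 := (hsub t ht y hy).diff.hasFDerivAt
    have h2 : HasDerivAt (fun t : ℝ => (t, y)) (1, 0) t :=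
      (hasDerivAt_id t).prodMk (hasDerivAt_const t y)
    exact h1.comp_hasDerivAt t h2

/-! ### Functional derivatives -/

section FunctionalDerivative

variable {A : Set (Pt N)} {F : (Pt N → Mat N) → ℝ} {u : Pt N → Mat N}

theorem HasFunctionalDeriv.eq (hA : IsOpen A) {E E' : Pt N → Mat N}
    (h : HasFunctionalDeriv A F u E) (h' : HasFunctionalDeriv A F u E') : ∀ y ∈ A, E y = E' y := by
  obtain ⟨hc, hs, hd⟩ := h
  obtain ⟨hc', hs', hd'⟩ := h'
  have key : ∀ i j, ∀ y ∈ A, E y i j - E' y i j = 0 := by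
    intro i j
    refine eq_zero_of_integral_test hA ((hc i j).sub (hc' i j)) fun g hg => ?_
    -- Only symmetric variations are allowed. This one picks out the `(i, j)` entry of a symmetric
    -- matrix twice, also when `i = j`.
    set S : Mat N := Matrix.single i j 1 + (Matrix.single i j 1)ᵀ with hS
    have h1 : ∀ a b, IsTest A fun y => (g y • S) a b := fun a b =>
      hg.mul (f := fun _ => S a b) fun _ _ => contDiffAt_const
    have h2 : ∀ y, (g y • S).IsSymm := fun y => by
      rw [Matrix.IsSymm, Matrix.transpose_smul, hS, Matrix.transpose_add,
        Matrix.transpose_transpose, add_comm]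
    have h3 := (hd _ h1 h2).unique (hd' _ h1 h2)
    have h4 : ∀ G : Pt N → Mat N, (∀ y ∈ A, (G y).IsSymm) → ∀ y ∈ A,
        ∑ a, ∑ b, G y a b * (g y • S) a b = 2 * (g y * G y i j) := fun G hG y hy => by
      have h5 : ∀ a b, (g y • S) a b = g y * ((if i = a ∧ j = b then 1 else 0)
          + if i = b ∧ j = a then 1 else 0) := fun a b => by
        simp only [hS, Matrix.smul_apply, Matrix.add_apply, Matrix.transpose_apply,
          Matrix.single_apply, smul_eq_mul, and_comm (a := i = b)]
      have h6 : G y j i = G y i j := (hG y hy).apply i j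
      simp only [h5, mul_add, Finset.sum_add_distrib, ite_and, mul_ite, mul_one, mul_zero,
        Finset.sum_ite_eq, Finset.mem_univ, if_true, Finset.sum_ite_irrel, Finset.sum_const_zero]
      rw [h6]
      ring
    rw [setIntegral_congr_fun hA.measurableSet (h4 E hs),
      setIntegral_congr_fun hA.measurableSet (h4 E' hs'), integral_const_mul,
      integral_const_mul] at h3
    have hint : ∀ G : Pt N → Mat N, (∀ i j, ContinuousOn (fun y => G y i j) A) →
        IntegrableOn (fun y => g y * G y i j) A := fun G hG => by
      have h7 : Integrable fun y => g y * G y i j := by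
        refine Continuous.integrable_of_hasCompactSupport ?_ hg.2.1.mul_right
        refine continuous_iff_continuousAt.mpr fun y => ?_
        by_cases hy : y ∈ A
        · exact hg.1.continuous.continuousAt.mul ((hG i j).continuousAt (hA.mem_nhds hy))
        · refine ContinuousAt.congr (f := fun _ => (0 : ℝ)) continuousAt_const ?_
          exact (hg.eventually_zero hy).mono fun z hz => by simp only [hz, zero_mul]
      exact h7.integrableOn
    simp only [mul_sub]
    rw [integral_sub (hint E hc) (hint E' hc')]
    linarith
  intro y hy
  ext i j
  exact sub_eq_zero.mp (key i j y hy)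

theorem HasFunctionalDeriv.functionalDeriv_eq (hA : IsOpen A) {E : Pt N → Mat N}
    (h : HasFunctionalDeriv A F u E) : ∀ y ∈ A, functionalDeriv A F u y = E y := by
  have hex : ∃ E, HasFunctionalDeriv A F u E := ⟨E, h⟩
  rw [functionalDeriv, dif_pos hex]
  exact hex.choose_spec.eq hA h

theorem hasFunctionalDeriv_const (r : ℝ) :
    HasFunctionalDeriv A (fun _ : Pt N → Mat N => r) u 0 := by
  refine ⟨fun _ _ => continuousOn_const, fun _ _ => Matrix.isSymm_zero, fun η _ _ => ?_⟩
  simpa using hasDerivAt_const (0 : ℝ) r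

end FunctionalDerivative

/-! ### Smoothness of the geometric densities -/

section Smoothness

variable {n : ℕ} {k : Pt n → Mat n} {y : Pt n}

theorem christoffel_contDiffAt (hk : MatCD ∞ k y) (hu : IsUnit (k y).det) (a b c : Fin n) :
    ContDiffAt ℝ ∞ (fun z => christoffel k z a b c) y :=
  contDiffAt_const.mul (ContDiffAt.sum fun d _ => (hk.inv hu a d).mul
    (((contDiffAt_pd (hk d c) b).add (contDiffAt_pd (hk d b) c)).sub (contDiffAt_pd (hk b c) d)))

theorem scalarCurv_contDiffAt (hk : MatCD ∞ k y) (hu : IsUnit (k y).det) :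
    ContDiffAt ℝ ∞ (fun z => scalarCurv k z) y :=
  ContDiffAt.sum fun i _ => ContDiffAt.sum fun j _ => (hk.inv hu i j).mul
    (ContDiffAt.sum fun a _ => ((contDiffAt_pd (christoffel_contDiffAt hk hu a i j) a).sub
      (contDiffAt_pd (christoffel_contDiffAt hk hu a i a) j)).add (ContDiffAt.sum fun b _ =>
        ((christoffel_contDiffAt hk hu a a b).mul (christoffel_contDiffAt hk hu b i j)).sub
          ((christoffel_contDiffAt hk hu a j b).mul (christoffel_contDiffAt hk hu b i a))))

theorem covDeriv_contDiffAt (hk : MatCD ∞ k y) (hu : IsUnit (k y).det) {ξ : Pt n → Pt n}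
    (hξ : VecCD ∞ ξ y) (i j : Fin n) : ContDiffAt ℝ ∞ (fun z => covDeriv k ξ z i j) y :=
  (contDiffAt_pd (hξ j) i).add (ContDiffAt.sum fun l _ =>
    (christoffel_contDiffAt hk hu j i l).mul (hξ l))

theorem lieDeriv_contDiffAt (hk : MatCD ∞ k y) {w : Pt n → Pt n} (hw : VecCD ∞ w y) (i j : Fin n) :
    ContDiffAt ℝ ∞ (fun z => lieDeriv w k z i j) y :=
  ContDiffAt.sum fun l _ => (((hw l).mul (contDiffAt_pd (hk i j) l)).add
    ((hk l j).mul (contDiffAt_pd (hw l) i))).add ((hk i l).mul (contDiffAt_pd (hw l) j))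

theorem superMom_contDiffAt {γ π : Pt N → Mat N} {y : Pt N} (hγ : MatCD ∞ γ y)
    (hu : IsUnit (γ y).det) (hπ : MatCD ∞ π y) (i : Fin N) :
    ContDiffAt ℝ ∞ (fun z => superMom γ π z i) y :=
  contDiffAt_const.mul (ContDiffAt.sum fun j _ => (hγ i j).mul (ContDiffAt.sum fun l _ =>
    (contDiffAt_pd (hπ j l) l).add (ContDiffAt.sum fun m _ =>
      (christoffel_contDiffAt hγ hu j l m).mul (hπ l m))))

theorem superHam_contDiffAt (κ : ℝ) {γ π : Pt N → Mat N} {y : Pt N} (hγ : MatCD ∞ γ y)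
    (hp : 0 < (γ y).det) (hπ : MatCD ∞ π y) :
    ContDiffAt ℝ ∞ (fun z => superHam κ γ π z) y := by
  have hu : IsUnit (γ y).det := isUnit_iff_ne_zero.mpr hp.ne'
  have hs := sqrtDet_contDiffAt hγ hp
  exact ((hs.div_const _).mul (scalarCurv_contDiffAt hγ hu)).sub
    ((contDiffAt_const.div hs (sqrtDet_pos hp).ne').mul
      ((((hγ.mul hπ).mul hγ).mul hπ).trace.sub (((hγ.mul hπ).trace.pow 2).div_const _)))

theorem momentumOf_cd (κ : ℝ) {γ K : Pt N → Mat N} {y : Pt N} (hγ : MatCD ∞ γ y)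
    (hp : 0 < (γ y).det) (hK : MatCD ∞ K y) :
    MatCD ∞ (fun z => momentumOf κ (γ z) (K z)) y := by
  have hi := hγ.inv (isUnit_iff_ne_zero.mpr hp.ne')
  exact MatCD.smul ((sqrtDet_contDiffAt hγ hp).div_const _).neg
    (((hi.mul hK).mul hi).sub (MatCD.smul (hi.mul hK).trace hi))

end Smoothness

/-! ### The functional derivative with respect to the momentum -/

section Momentum

theorem sum_mul_christoffel {k : Pt N → Mat N} {y : Pt N} (hks : (k y)ᵀ = k y)
    (hu : IsUnit (k y).det) (w : Pt N) (a b : Fin N) :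
    ∑ j, (k y *ᵥ w) j * christoffel k y j a b
      = 1 / 2 * ∑ d, w d * (dM k y (Pi.single a 1) d b + dM k y (Pi.single b 1) d a
          - dM k y (Pi.single d 1) a b) := by
  have h1 : (k y)⁻¹ᵀ *ᵥ (k y *ᵥ w) = w := by
    rw [Matrix.transpose_nonsing_inv, hks, Matrix.mulVec_mulVec, Matrix.nonsing_inv_mul _ hu,
      Matrix.one_mulVec]
  have h2 : ∀ d, w d = ∑ j, (k y)⁻¹ j d * (k y *ᵥ w) j := fun d => (congrFun h1 d).symm
  simp only [christoffel, Finset.mul_sum]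
  rw [Finset.sum_comm]
  refine Finset.sum_congr rfl fun d _ => ?_
  rw [h2 d, Finset.sum_mul, Finset.mul_sum]
  refine Finset.sum_congr rfl fun j _ => ?_
  simp only [dM, pd, Matrix.of_apply]
  ring

/-- The momentum constraint generates spatial diffeomorphisms: up to a divergence its smearing with
`w` pairs the momentum with `-ℒ_w k`. -/
theorem sum_superMom_mul {k η : Pt N → Mat N} {w : Pt N → Pt N} {y : Pt N} (hk : MatCD 1 k y)
    (hη : MatCD 1 η y) (hw : VecCD 1 w y) (hks : ∀ᶠ z in 𝓝 y, (k z)ᵀ = k z)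
    (hηs : (η y)ᵀ = η y) (hu : IsUnit (k y).det) :
    ∑ i, superMom k η y i * w y i
      = (∑ m, pd m (fun z => 2 * ∑ j, (k z *ᵥ w z) j * η z j m) y)
        - ∑ i, ∑ j, lieDeriv w k y i j * η y i j := by
  have hksy := hks.self_of_nhds
  have hkw : VecCD 1 (fun z => k z *ᵥ w z) y := hk.mulVec hw
  have hη' : ∀ a b, η y a b = η y b a := fun a b => congrFun (congrFun hηs b) a
  have hk' : ∀ a b, k y a b = k y b a := fun a b => congrFun (congrFun hksy b) a
  have hd' : ∀ m a b, dM k y (Pi.single m 1) a b = dM k y (Pi.single m 1) b a := fun m a b =>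
    congrFun (congrFun (dM_symm (Pi.single m 1) hks) b) a
  have h1 : ∑ i, superMom k η y i * w y i
      = 2 * (∑ m, ∑ j, (k y *ᵥ w y) j * pd m (fun z => η z j m) y)
        + ∑ m, ∑ l, ∑ d, w y d * (dM k y (Pi.single m 1) d l + dM k y (Pi.single l 1) d m
          - dM k y (Pi.single d 1) m l) * η y m l := by
    have e1 : ∑ i, superMom k η y i * w y i = 2 * ∑ j, (k y *ᵥ w y) j
        * ∑ m, (pd m (fun z => η z j m) y + ∑ l, christoffel k y j m l * η y m l) := by
      simp only [superMom, Finset.mul_sum, Finset.sum_mul, Matrix.mulVec, dotProduct]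
      rw [Finset.sum_comm]
      refine Finset.sum_congr rfl fun j _ => ?_
      rw [Finset.sum_comm]
      refine Finset.sum_congr rfl fun m _ => Finset.sum_congr rfl fun i _ => ?_
      rw [hk' j i]
      ring
    have e2 : ∀ m l, ∑ d, w y d * (dM k y (Pi.single m 1) d l + dM k y (Pi.single l 1) d m
          - dM k y (Pi.single d 1) m l) * η y m l
        = 2 * ∑ j, (k y *ᵥ w y) j * christoffel k y j m l * η y m l := fun m l => by
      rw [← Finset.sum_mul, ← Finset.sum_mul, sum_mul_christoffel hksy hu]
      ring
    rw [e1]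
    simp only [e2, mul_add, Finset.sum_add_distrib, Finset.mul_sum]
    congr 1
    · exact Finset.sum_comm
    · rw [Finset.sum_comm]
      refine Finset.sum_congr rfl fun m _ => ?_
      rw [Finset.sum_comm]
      exact Finset.sum_congr rfl fun l _ => Finset.sum_congr rfl fun j _ => by ring
  have h2 : ∑ m, pd m (fun z => 2 * ∑ j, (k z *ᵥ w z) j * η z j m) y
      = 2 * (∑ m, ∑ j, (k y *ᵥ w y) j * pd m (fun z => η z j m) y)
        + 2 * ∑ m, ∑ j, dV (fun z => k z *ᵥ w z) y (Pi.single m 1) j * η y j m := by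
    rw [← mul_add, ← Finset.sum_add_distrib, Finset.mul_sum]
    refine Finset.sum_congr rfl fun m _ => ?_
    rw [← Finset.sum_add_distrib]
    have e3 : ContDiffAt ℝ 1 (fun z => ∑ j, (k z *ᵥ w z) j * η z j m) y :=
      ContDiffAt.sum fun j _ => (hkw j).mul (hη j m)
    rw [pd, fderiv_const_mul e3.diff, _root_.smul_apply, smul_eq_mul,
      fderiv_sum_apply _ fun j _ => ((hkw j).mul (hη j m)).diff]
    congr 1
    refine Finset.sum_congr rfl fun j _ => ?_
    rw [fderiv_mul_apply _ (hkw j).diff (hη j m).diff]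
    rfl
  have h3 : ∀ m j, dV (fun z => k z *ᵥ w z) y (Pi.single m 1) j
      = ∑ d, (dM k y (Pi.single m 1) j d * w y d + k y j d * pd m (fun z => w z d) y) :=
    fun m j => by
      rw [dV_mulVec _ hk hw, Finset.sum_add_distrib]
      rfl
  have h4 : ∀ i j, lieDeriv w k y i j = ∑ d, (w y d * dM k y (Pi.single d 1) i j
      + k y d j * pd i (fun z => w z d) y + k y i d * pd j (fun z => w z d) y) := fun i j => rfl
  rw [h1, h2]
  simp only [h3, h4, Finset.sum_mul, mul_add, add_mul, mul_sub, sub_mul, Finset.sum_add_distrib,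
    Finset.sum_sub_distrib]
  have a2 : ∑ m, ∑ l, ∑ d, w y d * dM k y (Pi.single l 1) d m * η y m l
      = ∑ m, ∑ l, ∑ d, w y d * dM k y (Pi.single m 1) d l * η y m l := by
    rw [Finset.sum_comm]
    exact Finset.sum_congr rfl fun l _ => Finset.sum_congr rfl fun m _ =>
      Finset.sum_congr rfl fun d _ => by rw [hη' l m]
  have a3 : ∑ m, ∑ j, ∑ d, dM k y (Pi.single m 1) j d * w y d * η y j m
      = ∑ m, ∑ l, ∑ d, w y d * dM k y (Pi.single m 1) d l * η y m l :=
    Finset.sum_congr rfl fun m _ => Finset.sum_congr rfl fun j _ =>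
      Finset.sum_congr rfl fun d _ => by rw [hη' m j, hd' m j d]; ring
  have a4 : ∑ m, ∑ j, ∑ d, k y j d * pd m (fun z => w z d) y * η y j m
      = ∑ i, ∑ j, ∑ d, k y d j * pd i (fun z => w z d) y * η y i j :=
    Finset.sum_congr rfl fun m _ => Finset.sum_congr rfl fun j _ =>
      Finset.sum_congr rfl fun d _ => by rw [hη' m j, hk' j d]
  have a5 : ∑ i, ∑ j, ∑ d, k y i d * pd j (fun z => w z d) y * η y i j
      = ∑ i, ∑ j, ∑ d, k y d j * pd i (fun z => w z d) y * η y i j := by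
    rw [Finset.sum_comm]
    exact Finset.sum_congr rfl fun l _ => Finset.sum_congr rfl fun m _ =>
      Finset.sum_congr rfl fun d _ => by rw [hη' m l, hk' m d]
  rw [a2, a3, a4, a5]
  ring

theorem lieDeriv_symm {k : Pt N → Mat N} {y : Pt N} (hks : ∀ᶠ z in 𝓝 y, (k z)ᵀ = k z)
    (w : Pt N → Pt N) (i j : Fin N) : lieDeriv w k y i j = lieDeriv w k y j i := by
  have hksy := hks.self_of_nhds
  have hk' : ∀ a b, k y a b = k y b a := fun a b => congrFun (congrFun hksy b) a
  have hd' : ∀ m, pd m (fun z => k z i j) y = pd m (fun z => k z j i) y := fun m =>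
    congrFun (congrFun (dM_symm (Pi.single m 1) hks) j) i
  refine Finset.sum_congr rfl fun d _ => ?_
  rw [hd' d, hk' d j, hk' i d]
  ring

/-- Inverse Legendre transformation: the momentum derivative of the kinetic term gives back `K`. The
trace part is removed by the coefficient `1 / (N - 1)`, which requires `N ≠ 1`. -/
theorem trace_momentum_mul {κ : ℝ} (hκ : κ ≠ 0) (hN : 2 ≤ N) {k K η : Mat N} (hk : 0 < k.det) :
    4 * κ / sqrtDet k * ((k * momentumOf κ k K * k * η).trace
        - (k * momentumOf κ k K).trace * (k * η).trace / ((N : ℝ) - 1))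
      = -(2 * (K * η).trace) := by
  have hu : IsUnit k.det := isUnit_iff_ne_zero.mpr hk.ne'
  have hs := (sqrtDet_pos hk).ne'
  have hN' : (N : ℝ) - 1 ≠ 0 := by
    have : (2 : ℝ) ≤ N := by exact_mod_cast hN
    linarith
  have h1 : k * momentumOf κ k K
      = -(sqrtDet k / (2 * κ)) • (K * k⁻¹ - (k⁻¹ * K).trace • 1) := by
    rw [momentumOf, Matrix.mul_smul, Matrix.mul_sub, Matrix.mul_smul, Matrix.mul_nonsing_inv _ hu,
      Matrix.mul_assoc k⁻¹, Matrix.mul_nonsing_inv_cancel_left _ _ hu]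
  have h2 : k * momentumOf κ k K * k
      = -(sqrtDet k / (2 * κ)) • (K - (k⁻¹ * K).trace • k) := by
    rw [h1, Matrix.smul_mul, Matrix.sub_mul, Matrix.mul_assoc, Matrix.nonsing_inv_mul _ hu,
      Matrix.mul_one, Matrix.smul_mul, Matrix.one_mul]
  have h3 : (K * k⁻¹).trace = (k⁻¹ * K).trace := Matrix.trace_mul_comm _ _
  rw [h2, h1]
  simp only [Matrix.smul_mul, Matrix.sub_mul, Matrix.trace_smul, Matrix.trace_sub, smul_eq_mul, h3,
    Matrix.trace_one, Fintype.card_fin]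
  field_simp
  ring

end Momentum

/-! ### The functional derivative with respect to the momentum: the variation -/

section MomentumVariation

theorem fderiv_fst_apply {F : ℝ × Pt N → ℝ} {y : Pt N} {d : ℝ} (hF : ContDiffAt ℝ 1 F (0, y))
    (hd : HasDerivAt (fun t => F (t, y)) d 0) : fderiv ℝ F (0, y) (1, 0) = d := by
  have h1 : HasDerivAt (fun t : ℝ => (t, y)) (1, 0) 0 :=
    (hasDerivAt_id 0).prodMk (hasDerivAt_const 0 y)
  exact (hF.diff.hasFDerivAt.comp_hasDerivAt (0 : ℝ) h1).unique hd

/-- The first variation of `R⁰` with respect to the momentum. -/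
noncomputable def superHamVar (κ : ℝ) (k π η : Mat N) : ℝ :=
  -(4 * κ / sqrtDet k * ((k * π * k * η).trace - (k * π).trace * (k * η).trace / ((N : ℝ) - 1)))

/-- `R⁰` is quadratic in the momentum, so the expansion is exact; subtracting the value at zero
momentum removes the curvature from the coefficient of `t²`. -/
theorem superHam_add_smul (κ : ℝ) (k π η : Pt N → Mat N) (y : Pt N) (t : ℝ) :
    superHam κ k (fun z => π z + t • η z) y = superHam κ k π y + t * superHamVar κ (k y) (π y) (η y)
      + t ^ 2 * (superHam κ k η y - superHam κ k (fun _ => 0) y) := by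
  have h1 : (k y * η y * k y * π y).trace = (k y * π y * k y * η y).trace := by
    rw [Matrix.mul_assoc (k y * η y), Matrix.trace_mul_comm, ← Matrix.mul_assoc]
  simp only [superHam, superHamVar, Matrix.mul_add, Matrix.add_mul, Matrix.mul_smul,
    Matrix.smul_mul, Matrix.trace_add, Matrix.trace_smul, smul_eq_mul, h1, Matrix.mul_zero,
    Matrix.trace_zero]
  ring

theorem superMom_add_smul {k π η : Pt N → Mat N} {y : Pt N} (hπ : MatCD 1 π y) (hη : MatCD 1 η y)
    (t : ℝ) (i : Fin N) :
    superMom k (fun z => π z + t • η z) y i = superMom k π y i + t * superMom k η y i := by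
  have h1 : ∀ j m, pd m (fun z => (π z + t • η z) j m) y
      = pd m (fun z => π z j m) y + t * pd m (fun z => η z j m) y := fun j m => by
    have : (fun z => (π z + t • η z) j m) = fun z => π z j m + t * η z j m := rfl
    rw [this, pd, fderiv_fun_add (hπ j m).diff ((hη j m).diff.const_mul t),
      fderiv_const_mul (hη j m).diff]
    rfl
  have h2 : ∀ j m, pd m (fun z => (π z + t • η z) j m) y
      + ∑ l, christoffel k y j m l * (π y + t • η y) m l
      = (pd m (fun z => π z j m) y + ∑ l, christoffel k y j m l * π y m l)
        + t * (pd m (fun z => η z j m) y + ∑ l, christoffel k y j m l * η y m l) := fun j m => by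
    rw [h1, mul_add, Finset.mul_sum]
    have : ∀ l, christoffel k y j m l * (π y + t • η y) m l = christoffel k y j m l * π y m l
        + t * (christoffel k y j m l * η y m l) := fun l => by
      rw [Matrix.add_apply, Matrix.smul_apply, smul_eq_mul]
      ring
    simp only [this, Finset.sum_add_distrib]
    ring
  have h3 : ∀ j, k y i j * ∑ m, (pd m (fun z => (π z + t • η z) j m) y
      + ∑ l, christoffel k y j m l * (π y + t • η y) m l)
      = k y i j * (∑ m, (pd m (fun z => π z j m) y + ∑ l, christoffel k y j m l * π y m l))
        + t * (k y i j * ∑ m, (pd m (fun z => η z j m) y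
          + ∑ l, christoffel k y j m l * η y m l)) := fun j => by
    simp only [h2]
    rw [Finset.sum_add_distrib, ← Finset.mul_sum]
    ring
  simp only [superMom, h3]
  rw [Finset.sum_add_distrib, ← Finset.mul_sum]
  ring

variable {A : Set (Pt N)}

theorem IsTest.integrable_sum_mul {E η : Pt N → Mat N} (hη : ∀ i j, IsTest A fun y => η y i j)
    (hE : ∀ y ∈ A, MatCD ∞ E y) : Integrable fun y => ∑ i, ∑ j, E y i j * η y i j :=
  integrable_finsetSum _ fun i _ => integrable_finsetSum _ fun j _ => by
    simpa only [mul_comm] using ((hη i j).mul fun y hy => hE y hy i j).integrable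

/-- Used for both constraints, with `ν = 𝗇` and `ν = -𝗇̃`; `r` is the potential, free of momenta.
The kinetic term gives `K`, the shift term gives the Lie derivative, and the divergence integrates
to zero. -/
theorem hasFunctionalDeriv_momentum {κ : ℝ} (hκ : κ ≠ 0) (hN : 2 ≤ N) (hA : IsOpen A)
    {k K : Pt N → Mat N} {ν : Pt N → Pt N} {r ξ : Pt N → ℝ} (hk : ∀ y ∈ A, MatCD ∞ k y)
    (hks : ∀ y ∈ A, (k y)ᵀ = k y) (hkp : ∀ y ∈ A, 0 < (k y).det) (hK : ∀ y ∈ A, MatCD ∞ K y)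
    (hKs : ∀ y ∈ A, (K y)ᵀ = K y) (hν : ∀ y ∈ A, VecCD ∞ ν y)
    (hr : ∀ y ∈ A, ContDiffAt ℝ ∞ r y) (hξ : IsTest A ξ) :
    HasFunctionalDeriv A
      (fun u => ∫ y in A, ξ y * (superHam κ k u y + (∑ i, superMom k u y i * ν y i) + r y))
      (fun y => momentumOf κ (k y) (K y))
      (fun y => (2 * ξ y) • K y - Matrix.of (lieDeriv (fun z => ξ z • ν z) k y)) := by
  have hev : ∀ y ∈ A, ∀ᶠ z in 𝓝 y, (k z)ᵀ = k z := fun y hy =>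
    Filter.mem_of_superset (hA.mem_nhds hy) hks
  have hu : ∀ y ∈ A, IsUnit (k y).det := fun y hy => isUnit_iff_ne_zero.mpr (hkp y hy).ne'
  have hw : ∀ y ∈ A, VecCD ∞ (fun z => ξ z • ν z) y := fun y hy i => hξ.1.contDiffAt.mul (hν y hy i)
  have hE : ∀ y ∈ A, MatCD ∞
      (fun y => (2 * ξ y) • K y - Matrix.of (lieDeriv (fun z => ξ z • ν z) k y)) y :=
    fun y hy i j => ((contDiffAt_const.mul hξ.1.contDiffAt).mul (hK y hy i j)).sub
      (lieDeriv_contDiffAt (hk y hy) (hw y hy) i j)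
  refine ⟨fun i j y hy => (hE y hy i j).continuousAt.continuousWithinAt, fun y hy => ?_,
    fun η hη hηs => ?_⟩
  · ext i j
    simp only [Matrix.transpose_apply, Matrix.sub_apply, Matrix.smul_apply, Matrix.of_apply]
    rw [lieDeriv_symm (hev y hy) _ j i, show K y j i = K y i j from congrFun (congrFun (hKs y hy) i) j]
  set π : Pt N → Mat N := fun y => momentumOf κ (k y) (K y) with hπdef
  have hπ : ∀ y ∈ A, MatCD ∞ π y := fun y hy => momentumOf_cd κ (hk y hy) (hkp y hy) (hK y hy)
  have hηc : ∀ y, MatCD ∞ η y := fun y i j => (hη i j).1.contDiffAt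
  set a : Pt N → ℝ := fun y => superHam κ k π y + (∑ i, superMom k π y i * ν y i) + r y with ha
  set b : Pt N → ℝ := fun y => superHamVar κ (k y) (π y) (η y) + ∑ i, superMom k η y i * ν y i
    with hb
  set c : Pt N → ℝ := fun y => superHam κ k η y - superHam κ k (fun _ => 0) y with hc
  have hac : ∀ y ∈ A, ContDiffAt ℝ ∞ a y := fun y hy =>
    ((superHam_contDiffAt κ (hk y hy) (hkp y hy) (hπ y hy)).add (ContDiffAt.sum fun i _ =>
      (superMom_contDiffAt (hk y hy) (hu y hy) (hπ y hy) i).mul (hν y hy i))).add (hr y hy)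
  have hbc : ∀ y ∈ A, ContDiffAt ℝ ∞ b y := fun y hy => by
    have h1 := (hk y hy).mul (hπ y hy)
    have h2 := (hk y hy).mul (hηc y)
    refine ContDiffAt.add ?_ (ContDiffAt.sum fun i _ =>
      (superMom_contDiffAt (hk y hy) (hu y hy) (hηc y) i).mul (hν y hy i))
    exact ((contDiffAt_const.div (sqrtDet_contDiffAt (hk y hy) (hkp y hy))
      (sqrtDet_pos (hkp y hy)).ne').mul ((((h1.mul (hk y hy)).mul (hηc y)).trace).sub
        ((h1.trace.mul h2.trace).div_const _))).neg
  have hcc : ∀ y ∈ A, ContDiffAt ℝ ∞ c y := fun y hy =>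
    (superHam_contDiffAt κ (hk y hy) (hkp y hy) (hηc y)).sub
      (superHam_contDiffAt κ (hk y hy) (hkp y hy) fun _ _ => contDiffAt_const)
  have hpoly : ∀ (t : ℝ), ∀ y ∈ A, ξ y * (superHam κ k (fun z => π z + t • η z) y
      + (∑ i, superMom k (fun z => π z + t • η z) y i * ν y i) + r y)
      = ξ y * (a y + t * b y + t ^ 2 * c y) := fun t y hy => by
    simp only [superHam_add_smul, superMom_add_smul ((hπ y hy).of_le (by simp))
      ((hηc y).of_le (by simp)), ha, hb, hc, add_mul, Finset.sum_add_distrib, mul_assoc,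
      ← Finset.mul_sum]
    ring
  set H : ℝ → Pt N → ℝ := fun t y => ξ y * (a y + t * b y + t ^ 2 * c y) with hH
  have hHc : ∀ y ∈ A, ContDiffAt ℝ 1 (fun z : ℝ × Pt N => H z.1 z.2) (0, y) := fun y hy => by
    have hs : ∀ {f : Pt N → ℝ}, ContDiffAt ℝ ∞ f y →
        ContDiffAt ℝ 1 (fun z : ℝ × Pt N => f z.2) (0, y) := fun hf =>
      (hf.of_le (by simp)).comp (f := fun z : ℝ × Pt N => z.2) _ contDiffAt_snd
    exact (hs hξ.1.contDiffAt).mul (((hs (hac y hy)).add (contDiffAt_fst.mul (hs (hbc y hy)))).add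
      ((contDiffAt_fst.pow 2).mul (hs (hcc y hy))))
  have hder := hasDerivAt_setIntegral hA hξ.2.1 hξ.2.2 (H := H)
    (fun t y hy => by rw [hH]; simp only [image_eq_zero_of_notMem_tsupport hy, zero_mul])
    fun y hy => hHc y (hξ.2.2 hy)
  have hfd : ∀ y ∈ A, fderiv ℝ (fun z : ℝ × Pt N => H z.1 z.2) (0, y) (1, 0) = ξ y * b y :=
    fun y hy => fderiv_fst_apply (hHc y hy) (by
      have h1 := (((((hasDerivAt_id (0 : ℝ)).mul_const (b y)).const_add (a y)).add
        (((hasDerivAt_id (0 : ℝ)).pow 2).mul_const (c y))).const_mul (ξ y))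
      simpa using h1)
  set W : Fin N → Pt N → ℝ := fun m z => ∑ j, η z j m * (2 * (k z *ᵥ (ξ z • ν z)) j) with hWdef
  have hWt : ∀ m j, IsTest A fun z => η z j m * (2 * (k z *ᵥ (ξ z • ν z)) j) := fun m j =>
    (hη j m).mul fun y hy => contDiffAt_const.mul ((hk y hy).mulVec (hw y hy) j)
  have hkey : ∀ y ∈ A, ξ y * b y = (∑ i, ∑ j, ((2 * ξ y) • K y
      - Matrix.of (lieDeriv (fun z => ξ z • ν z) k y)) i j * η y i j)
      + ∑ m, ∑ j, pd m (fun z => η z j m * (2 * (k z *ᵥ (ξ z • ν z)) j)) y := fun y hy => by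
    have h1 := sum_superMom_mul (w := fun z => ξ z • ν z) ((hk y hy).of_le (by simp))
      ((hηc y).of_le (by simp)) ((hw y hy).of_le (by simp)) (hev y hy) (hηs y) (hu y hy)
    have h2 : ∑ m, pd m (fun z => 2 * ∑ j, (k z *ᵥ (ξ z • ν z)) j * η z j m) y
        = ∑ m, ∑ j, pd m (fun z => η z j m * (2 * (k z *ᵥ (ξ z • ν z)) j)) y := by
      refine Finset.sum_congr rfl fun m _ => ?_
      have e : (fun z => 2 * ∑ j, (k z *ᵥ (ξ z • ν z)) j * η z j m)
          = fun z => ∑ j, η z j m * (2 * (k z *ᵥ (ξ z • ν z)) j) := by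
        funext z
        rw [Finset.mul_sum]
        exact Finset.sum_congr rfl fun j _ => by ring
      rw [e, pd, fderiv_sum_apply _ fun j _ => ((hWt m j).1.contDiffAt.of_le (by simp)).diff]
      rfl
    have h3 : superHamVar κ (k y) (π y) (η y) = 2 * (K y * η y).trace := by
      rw [superHamVar, trace_momentum_mul hκ hN (hkp y hy), neg_neg]
    have h4 : ∑ i, ∑ j, ξ y * (K y i j * η y i j) = ξ y * (K y * η y).trace := by
      rw [Matrix.trace, Finset.mul_sum]
      refine Finset.sum_congr rfl fun i _ => ?_
      rw [Matrix.diag_apply, Matrix.mul_apply, Finset.mul_sum]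
      exact Finset.sum_congr rfl fun j _ => by rw [(hηs y).apply]
    have h5 : ξ y * ∑ i, superMom k η y i * ν y i = ∑ i, superMom k η y i * (ξ y • ν y) i := by
      rw [Finset.mul_sum]
      exact Finset.sum_congr rfl fun i _ => by rw [Pi.smul_apply, smul_eq_mul]; ring
    simp only [Matrix.sub_apply, Matrix.smul_apply, Matrix.of_apply, smul_eq_mul, sub_mul,
      Finset.sum_sub_distrib, mul_assoc, ← Finset.mul_sum] at h4 ⊢
    rw [hb]
    simp only []
    rw [mul_add, h5, h1, h2, h3, h4]
    ring
  have hint : ∫ y in A, fderiv ℝ (fun z : ℝ × Pt N => H z.1 z.2) (0, y) (1, 0)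
      = ∫ y in A, ∑ i, ∑ j, ((2 * ξ y) • K y
        - Matrix.of (lieDeriv (fun z => ξ z • ν z) k y)) i j * η y i j := by
    rw [setIntegral_congr_fun hA.measurableSet fun y hy => (hfd y hy).trans (hkey y hy),
      integral_add (IsTest.integrable_sum_mul hη hE).integrableOn
        (integrable_finsetSum _ fun m _ => integrable_finsetSum _ fun j _ =>
          ((hWt m j).pd m).integrable.integrableOn),
      integral_finsetSum _ fun m _ => integrable_finsetSum _ fun j _ =>
          ((hWt m j).pd m).integrable.integrableOn,
      Finset.sum_eq_zero, add_zero]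
    intro m _
    rw [integral_finsetSum _ fun j _ => ((hWt m j).pd m).integrable.integrableOn]
    exact Finset.sum_eq_zero fun j _ => (hWt m j).integral_pd m
  rw [← hint]
  refine hder.congr_of_eventuallyEq (Filter.Eventually.of_forall fun t => ?_)
  exact setIntegral_congr_fun hA.measurableSet fun y hy => hpoly t y hy

end MomentumVariation

/-! ### The variations of the potentials -/

section PotentialVariation

variable {E : Type*} [NormedAddCommGroup E] [NormedSpace ℝ E] {x : E} {γ φ : E → Mat N}
  {n : E → Pt N} {χ : Mat N} {nt : Pt N} {lam : ℝ} {β : ℕ → ℝ} {ℓ : ℝ} {K : ℕ} {c s : Fin K → ℝ}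

/-- The variation of `𝒱` with respect to `φ`. -/
theorem fderiv_phV (hM : IsMoment N β ℓ c s) (h : BoostRel (γ x) (φ x) χ (n x) nt lam)
    (hγ : MatCD 1 γ x) (hφ : MatCD 1 φ x) (hn : VecCD 1 n x) (hγs : ∀ᶠ y in 𝓝 x, (γ y)ᵀ = γ y)
    (hφs : ∀ᶠ y in 𝓝 x, (φ y)ᵀ = φ y) {v : E} (hdγ : dM γ x v = 0) (hdn : dV n x v = 0) :
    ContDiffAt ℝ 1 (fun y => phV β ℓ (γ y) (φ y) (n y)) x ∧
      fderiv ℝ (fun y => phV β ℓ (γ y) (φ y) (n y)) x v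
        = 1 / 2 * (relD (γ x) χ (n x) * opY c s (relD (γ x) χ (n x)) * (φ x)⁻¹
            * dM φ x v).trace := by
  obtain ⟨χ', nt', lam', hχ', -, -, hχx, hrel⟩ :=
    h.exists_near one_ne_zero hγ hφ hn hγs hφs
  have hx := hrel.self_of_nhds
  have e : (fun y => phV β ℓ (γ y) (φ y) (n y))
      =ᶠ[𝓝 x] fun y => potV c s (relD (γ y) (χ' y) (n y)) :=
    hrel.mono fun y hy => hy.phV_eq hM
  refine ⟨(MatCD.potV (hγ.relD h.γ_unit hχ' hn)).congr_of_eventuallyEq e, ?_⟩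
  rw [e.fderiv_eq, fderiv_potV_relD hx hγ hχ' hn (hrel.mono fun y hy => hy.φ_eq) hM.pos v, hdγ, hdn,
    hχx]
  simp

/-- The variation of `√γ 𝒱̃ - R̃ᵢ 𝗇̃ⁱ` with respect to `γ`, where `R̃ᵢ` is the energy flux. The
variation of `𝗇̃` drops out. -/
theorem fderiv_phVt (hM : IsMoment N β ℓ c s) (h : BoostRel (γ x) (φ x) χ (n x) nt lam)
    (hγ : MatCD 1 γ x) (hφ : MatCD 1 φ x) (hn : VecCD 1 n x) (hγs : ∀ᶠ y in 𝓝 x, (γ y)ᵀ = γ y)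
    (hφs : ∀ᶠ y in 𝓝 x, (φ y)ᵀ = φ y) {v : E} (hdφ : dM φ x v = 0) {R : E → Pt N}
    (hR : VecCD 1 R x) (hdR : dV R x v = 0)
    (hRx : R x = -(sqrtDet (γ x) • (χ *ᵥ (opY c s (relB (γ x) χ) *ᵥ n x)))) :
    ContDiffAt ℝ 1 (fun y => sqrtDet (γ y) * phVt β ℓ (γ y) (φ y) (n y)
        - R y ⬝ᵥ phNt (γ y) (φ y) (n y)) x ∧
      fderiv ℝ (fun y => sqrtDet (γ y) * phVt β ℓ (γ y) (φ y) (n y)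
        - R y ⬝ᵥ phNt (γ y) (φ y) (n y)) x v
        = sqrtDet (γ x) * (1 / 2 * (lam⁻¹ • opY c s (relB (γ x) χ) * (γ x)⁻¹ * dM γ x v).trace) := by
  obtain ⟨χ', nt', lam', hχ', hnt', -, hχx, hrel⟩ :=
    h.exists_near one_ne_zero hγ hφ hn hγs hφs
  have hx := hrel.self_of_nhds
  have hntx : nt' x = nt := hx.phNt_eq.symm.trans h.phNt_eq
  set c' : Fin K → ℝ := fun j => c j * s j ^ (N + 1)
  set s' : Fin K → ℝ := fun j => (s j)⁻¹
  have hs' : ∀ j, 0 < s' j := fun j => inv_pos.mpr (hM.pos j)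
  -- In dual form the prefactor `√φ` is not varied, and the known variation of the potential applies
  -- with `ñ` as the boost parameter.
  have e : (fun y => sqrtDet (γ y) * phVt β ℓ (γ y) (φ y) (n y) - R y ⬝ᵥ phNt (γ y) (φ y) (n y))
      =ᶠ[𝓝 x] fun y => sqrtDet (φ y) * potV c' s' (relD (φ y) (χ' y) (nt' y))
        - ∑ i, R y i * nt' y i :=
    hrel.mono fun y hy => by
      simp only []
      rw [hy.phVt_eq hM, hy.phNt_eq, hy.dual_potV hM.pos]
      rfl
  have c1 := sqrtDet_contDiffAt hφ h.φ_det_pos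
  have c2 : ContDiffAt ℝ 1 (fun y => potV c' s' (relD (φ y) (χ' y) (nt' y))) x :=
    MatCD.potV (hφ.relD h.φ_unit hχ' hnt')
  have c3 : ContDiffAt ℝ 1 (fun y => ∑ i, R y i * nt' y i) x :=
    ContDiffAt.sum fun i _ => (hR i).mul (hnt' i)
  refine ⟨((c1.mul c2).sub c3).congr_of_eventuallyEq e, ?_⟩
  have d1 : fderiv ℝ (fun y => sqrtDet (φ y)) x v = 0 := by
    rw [fderiv_sqrtDet v hφ h.φ_det_pos, hdφ]
    simp
  have d2 := fderiv_potV_relD (c := c') hx.dual hφ hχ' hnt' (hrel.mono fun y hy => hy.dual.φ_eq) hs' v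
  have d3 : fderiv ℝ (fun y => ∑ i, R y i * nt' y i) x v = R x ⬝ᵥ dV nt' x v := by
    rw [fderiv_sum_apply _ fun i _ => ((hR i).mul (hnt' i)).diff]
    refine Finset.sum_congr rfl fun i _ => ?_
    rw [fderiv_mul_apply _ (hR i).diff (hnt' i).diff, show fderiv ℝ (fun y => R y i) x v = 0 from
      congrFun hdR i, zero_mul, add_zero]
    rfl
  rw [hdφ, hχx, hntx, h.dual_Ut hM.pos] at d2
  have hsγ := (sqrtDet_pos h.γ_det_pos).ne'
  have hsφ := (sqrtDet_pos h.φ_det_pos).ne'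
  -- The potential contributes this vector, lowered by `χ`, times `-dñ`, and the term with `R`
  -- contributes its opposite; so the variation of `ñ` cancels.
  have hcur : sqrtDet (φ x) • (opY c' s' (relD (φ x) χ nt) *ᵥ nt)
      = sqrtDet (γ x) • (opY c s (relB (γ x) χ) *ᵥ n x) := by
    have hl := h.lam_pos.ne'
    have a1 : opY c' s' (relB (φ x) χ)
        = lam • (sqrtDet (γ x) / sqrtDet (φ x)) •
          (relD (γ x) χ (n x) * opY c s (relD (γ x) χ (n x))) := by
      rw [← h.dual_U hM.pos, smul_inv_smul₀ hl]
    rw [← h.dual.opY_mulVec hs', a1, Matrix.smul_mulVec, Matrix.smul_mulVec,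
      ← h.current_eq hM.pos, Matrix.smul_mulVec, smul_smul, smul_smul, smul_smul]
    congr 1
    field_simp
  rw [e.fderiv_eq, fderiv_fun_sub (c1.mul c2).diff c3.diff, _root_.sub_apply,
    fderiv_mul_apply _ c1.diff c2.diff, d1, d2, d3, hRx, ← Matrix.mulVec_smul, ← hcur,
    Matrix.mulVec_smul, neg_dotProduct, smul_dotProduct, smul_eq_mul, Matrix.smul_mul,
    Matrix.smul_mul, Matrix.trace_smul, Matrix.mul_zero, Matrix.trace_zero, smul_eq_mul]
  field_simp
  ring

end PotentialVariation

/-! ### Functional derivatives of ultralocal functionals -/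

section Ultralocal

variable {A : Set (Pt N)} {ξ : Pt N → ℝ} {u : Pt N → Mat N} {y : Pt N}

theorem contDiffAt_comp_snd {k : WithTop ℕ∞} {f : Pt N → ℝ} (hf : ContDiffAt ℝ k f y) :
    ContDiffAt ℝ k (fun z : ℝ × Pt N => f z.2) (0, y) :=
  hf.comp (f := fun z : ℝ × Pt N => z.2) (0, y) contDiffAt_snd

theorem MatCD.comp_snd {k : WithTop ℕ∞} {F : Pt N → Mat N} (hF : MatCD k F y) :
    MatCD k (fun z : ℝ × Pt N => F z.2) (0, y) := fun i j =>
  contDiffAt_comp_snd (hF i j)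

theorem VecCD.comp_snd {k : WithTop ℕ∞} {w : Pt N → Pt N} (hw : VecCD k w y) :
    VecCD k (fun z : ℝ × Pt N => w z.2) (0, y) := fun i =>
  contDiffAt_comp_snd (hw i)

theorem fderiv_comp_snd {f : Pt N → ℝ} (hf : ContDiffAt ℝ 1 f y) :
    fderiv ℝ (fun z : ℝ × Pt N => f z.2) (0, y) (1, 0) = 0 :=
  fderiv_fst_apply (contDiffAt_comp_snd hf) (hasDerivAt_const 0 (f y))

theorem dM_comp_snd {F : Pt N → Mat N} (hF : MatCD 1 F y) :
    dM (fun z : ℝ × Pt N => F z.2) (0, y) (1, 0) = 0 := by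
  ext i j
  exact fderiv_comp_snd (hF i j)

theorem dV_comp_snd {w : Pt N → Pt N} (hw : VecCD 1 w y) :
    dV (fun z : ℝ × Pt N => w z.2) (0, y) (1, 0) = 0 := by
  ext i
  exact fderiv_comp_snd (hw i)

/-- The density depends on the varied field only through its value at the point, so no integration
by parts occurs. -/
theorem hasFunctionalDeriv_of_ultralocal (hA : IsOpen A) (hξ : IsTest A ξ)
    {G : Mat N → Pt N → ℝ} {e : Pt N → Mat N}
    (he : ∀ y ∈ A, MatCD ∞ e y) (hes : ∀ y ∈ A, (e y)ᵀ = e y)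
    (hG : ∀ y ∈ A, ∀ η : Pt N → Mat N, MatCD ∞ η y → (∀ z, (η z)ᵀ = η z) →
      ContDiffAt ℝ 1 (fun z : ℝ × Pt N => G (u z.2 + z.1 • η z.2) z.2) (0, y) ∧
      fderiv ℝ (fun z : ℝ × Pt N => G (u z.2 + z.1 • η z.2) z.2) (0, y) (1, 0)
        = ∑ i, ∑ j, e y i j * η y i j) :
    HasFunctionalDeriv A (fun u => ∫ y in A, ξ y * G (u y) y) u fun y => ξ y • e y := by
  refine ⟨fun i j y hy => (hξ.1.contDiffAt.mul (he y hy i j)).continuousAt.continuousWithinAt,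
    fun y hy => ?_, fun η hη hηs => ?_⟩
  · rw [Matrix.IsSymm, Matrix.transpose_smul, hes y hy]
  set H : ℝ → Pt N → ℝ := fun t y => ξ y * G (u y + t • η y) y with hH
  have hηc : ∀ y, MatCD ∞ η y := fun y i j => (hη i j).1.contDiffAt
  have hξ1 : ∀ y, ContDiffAt ℝ 1 ξ y := fun y => hξ.1.contDiffAt.of_le (by simp)
  have hder := hasDerivAt_setIntegral hA hξ.2.1 hξ.2.2 (H := H)
    (fun t y hy => by rw [hH]; simp only [image_eq_zero_of_notMem_tsupport hy, zero_mul])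
    fun y hy => (contDiffAt_comp_snd (hξ1 y)).mul (hG y (hξ.2.2 hy) η (hηc y) hηs).1
  refine hder.congr_deriv (setIntegral_congr_fun hA.measurableSet fun y hy => ?_)
  obtain ⟨h1, h2⟩ := hG y hy η (hηc y) hηs
  simp only [hH, fderiv_mul_apply _ (contDiffAt_comp_snd (hξ1 y)).diff h1.diff, h2,
    fderiv_comp_snd (hξ1 y), zero_mul, add_zero,
    Matrix.smul_apply, smul_eq_mul, Finset.mul_sum, mul_assoc]

theorem MatCD.variation {k : WithTop ℕ∞} {F η : Pt N → Mat N} (hF : MatCD k F y)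
    (hη : MatCD k η y) : MatCD k (fun z : ℝ × Pt N => F z.2 + z.1 • η z.2) (0, y) :=
  hF.comp_snd.add (MatCD.smul contDiffAt_fst hη.comp_snd)

theorem dM_variation {F η : Pt N → Mat N} (hF : MatCD 1 F y) (hη : MatCD 1 η y) :
    dM (fun z : ℝ × Pt N => F z.2 + z.1 • η z.2) (0, y) (1, 0) = η y := by
  ext i j
  refine fderiv_fst_apply (MatCD.variation hF hη i j) ?_
  simpa using ((hasDerivAt_id (0 : ℝ)).mul_const (η y i j)).const_add (F y i j)

end Ultralocal

/-! ### Lie derivatives of the metric and covariant derivatives -/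

section Killing

variable {k : Pt N → Mat N} {y : Pt N}

/-- The Lie derivative of a metric is the symmetrised covariant derivative of the lowered vector,
and the contracting tensor is symmetric. -/
theorem sum_mul_lieDeriv (hks : ∀ᶠ z in 𝓝 y, (k z)ᵀ = k z) (hu : IsUnit (k y).det) {T : Mat N}
    (hT : (T * (k y)⁻¹)ᵀ = T * (k y)⁻¹) (w : Pt N → Pt N) :
    ∑ i, ∑ j, (T * (k y)⁻¹) i j * lieDeriv w k y i j = 2 * ∑ i, ∑ j, T i j * covDeriv k w y i j := by
  have hksy := hks.self_of_nhds
  set S := T * (k y)⁻¹ with hS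
  have hTk : S * k y = T := by
    rw [hS, Matrix.mul_assoc, Matrix.nonsing_inv_mul _ hu, Matrix.mul_one]
  have hS' : ∀ i j, S i j = S j i := fun i j => congrFun (congrFun hT j) i
  have hk' : ∀ i j, k y i j = k y j i := fun i j => congrFun (congrFun hksy j) i
  have h1 : ∑ i, ∑ j, T i j * dV w y (Pi.single i 1) j
      = ∑ i, ∑ j, ∑ l, S i j * (k y l j * pd i (fun z => w z l) y) := by
    refine Finset.sum_congr rfl fun i _ => ?_
    rw [Finset.sum_comm]
    refine Finset.sum_congr rfl fun l _ => ?_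
    rw [← hTk, Matrix.mul_apply, Finset.sum_mul]
    refine Finset.sum_congr rfl fun j _ => ?_
    rw [hk' l j, mul_assoc]
    rfl
  have h2 : ∑ i, ∑ j, ∑ l, S i j * (k y i l * pd j (fun z => w z l) y)
      = ∑ i, ∑ j, ∑ l, S i j * (k y l j * pd i (fun z => w z l) y) := by
    rw [Finset.sum_comm]
    exact Finset.sum_congr rfl fun i _ => Finset.sum_congr rfl fun j _ =>
      Finset.sum_congr rfl fun l _ => by rw [hS' j i, hk' j l]
  have h3 : ∑ l, w y l * (1 / 2 * (S * dM k y (Pi.single l 1)).trace)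
      = 1 / 2 * ∑ i, ∑ j, ∑ l, S i j * (w y l * pd l (fun z => k z i j) y) := by
    have : ∀ l, (S * dM k y (Pi.single l 1)).trace
        = ∑ i, ∑ j, S i j * pd l (fun z => k z i j) y := fun l => by
      rw [← trace_mul_symm hT, Matrix.trace]
      exact Finset.sum_congr rfl fun i _ => rfl
    simp only [this, Finset.mul_sum]
    rw [Finset.sum_comm]
    refine Finset.sum_congr rfl fun i _ => ?_
    rw [Finset.sum_comm]
    exact Finset.sum_congr rfl fun j _ => Finset.sum_congr rfl fun l _ => by ring
  rw [sum_mul_covDeriv hT, h1, h3]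
  simp only [lieDeriv, Finset.mul_sum, mul_add, Finset.sum_add_distrib]
  rw [h2]
  simp only [← Finset.sum_add_distrib]
  exact Finset.sum_congr rfl fun i _ => Finset.sum_congr rfl fun j _ =>
    Finset.sum_congr rfl fun l _ => by ring

theorem sum_smul_mul {S η : Mat N} (hS : Sᵀ = S) (a : ℝ) :
    ∑ i, ∑ j, (a • S) i j * η i j = a * (S * η).trace := by
  rw [← trace_mul_symm hS, Matrix.trace, Finset.mul_sum]
  refine Finset.sum_congr rfl fun i _ => ?_
  rw [Matrix.diag_apply, Matrix.mul_apply, Finset.mul_sum]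
  exact Finset.sum_congr rfl fun j _ => mul_assoc _ _ _

theorem covDeriv_smul {f : Pt N → ℝ} {w : Pt N → Pt N} (hf : ContDiffAt ℝ 1 f y) (hw : VecCD 1 w y)
    (i j : Fin N) :
    covDeriv k (fun z => f z • w z) y i j = pd i f y * w y j + f y * covDeriv k w y i j := by
  have h1 : pd i (fun z => f z * w z j) y = f y * pd i (fun z => w z j) y + pd i f y * w y j :=
    fderiv_mul_apply _ hf.diff (hw j).diff
  have h2 : pd i (fun z => (f z • w z) j) y = f y * pd i (fun z => w z j) y + pd i f y * w y j := h1
  rw [covDeriv, covDeriv, h2, mul_add, Finset.mul_sum, ← add_assoc, add_comm (pd i f y * _)]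
  congr 1
  exact Finset.sum_congr rfl fun l _ => by rw [Pi.smul_apply, smul_eq_mul]; ring

end Killing

/-! ### The functional derivatives of the constraints -/

namespace SliceData

variable {s : SliceData N} {A : Set (Pt N)} {β : ℕ → ℝ} {ℓ κg κf : ℝ} {ξ ζ : Pt N → ℝ} {y : Pt N}

theorem Admissible.viel (h : s.Admissible A) (hA : IsOpen A) (hy : y ∈ A) :
    VielbeinReg ∞ s.e s.m s.p y where
  e_cd i j := (h.e_smooth i j).contDiffAt (hA.mem_nhds hy)
  m_cd i j := (h.m_smooth i j).contDiffAt (hA.mem_nhds hy)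
  p_cd := contDiffAt_pi.mp (h.p_smooth.contDiffAt (hA.mem_nhds hy))
  posDef := Filter.mem_of_superset (hA.mem_nhds hy) h.chi_posDef

theorem Admissible.K_cd (h : s.Admissible A) (hA : IsOpen A) (hy : y ∈ A) : MatCD ∞ s.K y :=
  fun i j => (h.K_smooth i j).contDiffAt (hA.mem_nhds hy)

theorem Admissible.Kt_cd (h : s.Admissible A) (hA : IsOpen A) (hy : y ∈ A) : MatCD ∞ s.Kt y :=
  fun i j => (h.Kt_smooth i j).contDiffAt (hA.mem_nhds hy)

theorem γ_symm (s : SliceData N) (y : Pt N) : (s.γ y)ᵀ = s.γ y := by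
  rw [γ, gram, Matrix.transpose_mul, Matrix.transpose_transpose]

theorem φ_symm (s : SliceData N) (y : Pt N) : (s.φ y)ᵀ = s.φ y := by
  rw [φ, gram, Matrix.transpose_mul, Matrix.transpose_transpose]

theorem phV_cd (r : VielbeinReg ∞ s.e s.m s.p y) :
    ContDiffAt ℝ ∞ (fun z => sqrtDet (s.γ z) * phV β ℓ (s.γ z) (s.φ z) (s.nv z)) y := by
  obtain ⟨c, w, hM⟩ := exists_isMoment N β ℓ
  refine (sqrtDet_contDiffAt r.gram_cd r.rel.γ_det_pos).mul
    ((MatCD.potV (c := c) (s := w) r.relD_cd).congr_of_eventuallyEq ?_)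
  exact r.rel_eventually.mono fun z hz => hz.phV_eq hM

theorem phVt_cd (r : VielbeinReg ∞ s.e s.m s.p y) :
    ContDiffAt ℝ ∞ (fun z => sqrtDet (s.γ z) * phVt β ℓ (s.γ z) (s.φ z) (s.nv z)) y := by
  obtain ⟨c, w, hM⟩ := exists_isMoment N β ℓ
  refine (sqrtDet_contDiffAt r.gram_cd r.rel.γ_det_pos).mul
    (((r.lorentz_cd.inv (lorentz_pos _).ne').mul
      (MatCD.potW (c := c) (s := w) r.relB_cd)).congr_of_eventuallyEq ?_)
  exact r.rel_eventually.mono fun z hz => hz.phVt_eq hM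

section

variable (hN : 2 ≤ N) (hA : IsOpen A) (h : s.Admissible A)

include hA h

include hN in
theorem hasFunctionalDeriv_constraintG_π (hκ : κg ≠ 0) (hξ : IsTest A ξ) :
    HasFunctionalDeriv A
      (fun u => constraintG β ℓ κg A s.nv ξ { s.phase κg κf with π := u }) (s.phase κg κf).π
      (fun y => (2 * ξ y) • s.K y - Matrix.of (lieDeriv (fun z => ξ z • s.nv z) s.γ y)) :=
  hasFunctionalDeriv_momentum hκ hN hA (fun _ hy => (h.viel hA hy).gram_cd)
    (fun y _ => s.γ_symm y) (fun _ hy => (h.viel hA hy).rel.γ_det_pos) (fun _ hy => h.K_cd hA hy)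
    h.K_symm (fun _ hy => (h.viel hA hy).nv_cd) (fun _ hy => phV_cd (h.viel hA hy)) hξ

include hN in
theorem hasFunctionalDeriv_constraintF_ϖ (hκ : κf ≠ 0) (hζ : IsTest A ζ) :
    HasFunctionalDeriv A
      (fun u => constraintF β ℓ κf A s.nv ζ { s.phase κg κf with ϖ := u }) (s.phase κg κf).ϖ
      (fun y => (2 * ζ y) • s.Kt y - Matrix.of (lieDeriv (fun z => ζ z • -s.nt z) s.φ y)) := by
  have h1 := hasFunctionalDeriv_momentum hκ hN hA (fun _ hy => (h.viel hA hy).gram_cd')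
    (fun y _ => s.φ_symm y) (fun _ hy => (h.viel hA hy).rel.φ_det_pos) (fun _ hy => h.Kt_cd hA hy)
    h.Kt_symm (ν := fun z => -s.nt z) (fun _ hy => (h.viel hA hy).nt_cd.neg)
    (fun _ hy => phVt_cd (β := β) (ℓ := ℓ) (h.viel hA hy)) hζ
  refine cast (congrArg (HasFunctionalDeriv A · _ _) (funext fun u => ?_)) h1
  refine setIntegral_congr_fun hA.measurableSet fun y hy => ?_
  have h2 : phNt (s.γ y) (s.φ y) (s.nv y) = s.nt y := (h.viel hA hy).rel.phNt_eq
  simp only [phase, h2, Pi.neg_apply, mul_neg, Finset.sum_neg_distrib, sub_eq_add_neg]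
  rfl

/-- Since `𝗇` is an independent variable, `φ` enters `C` only through the potential. -/
theorem hasFunctionalDeriv_constraintG_φ (hξ : IsTest A ξ) :
    HasFunctionalDeriv A
      (fun u => constraintG β ℓ κg A s.nv ξ { s.phase κg κf with φ := u }) (s.phase κg κf).φ
      (fun y => ξ y • (1 / 2 * sqrtDet (s.γ y)) • (s.Ut β ℓ y * (s.φ y)⁻¹)) := by
  obtain ⟨c, w, hM⟩ := exists_isMoment N β ℓ
  refine hasFunctionalDeriv_of_ultralocal hA hξ
    (G := fun M y => superHam κg s.γ (s.phase κg κf).π y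
      + (∑ i, superMom s.γ (s.phase κg κf).π y i * s.nv y i)
      + sqrtDet (s.γ y) * phV β ℓ (s.γ y) M (s.nv y)) (fun y hy => ?_) (fun y hy => ?_)
    fun y hy η hη hηs => ?_
  all_goals have r := h.viel hA hy
  · exact MatCD.smul (contDiffAt_const.mul (sqrtDet_contDiffAt r.gram_cd r.rel.γ_det_pos))
      (r.Utop_cd.mul (r.gram_cd'.inv r.rel.φ_unit))
  · rw [Matrix.transpose_smul, Ut_symm (r.of_le (by simp))]
  have r1 : VielbeinReg 1 s.e s.m s.p y := r.of_le (by simp)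
  have hη1 : MatCD 1 η y := hη.of_le (by simp)
  have hγ : MatCD 1 s.γ y := r1.gram_cd
  have hφ : MatCD 1 s.φ y := r1.gram_cd'
  have hn : VecCD 1 s.nv y := r1.nv_cd
  have c0 : ContDiffAt ℝ 1 (fun z => superHam κg s.γ (s.phase κg κf).π z
      + ∑ i, superMom s.γ (s.phase κg κf).π z i * s.nv z i) y := by
    have hπ := momentumOf_cd κg r.gram_cd r.rel.γ_det_pos (h.K_cd hA hy)
    exact ((superHam_contDiffAt κg r.gram_cd r.rel.γ_det_pos hπ).add (ContDiffAt.sum fun i _ =>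
      (superMom_contDiffAt r.gram_cd r.rel.γ_unit hπ i).mul (r.nv_cd i))).of_le (by simp)
  have c1 : ContDiffAt ℝ 1 (fun z => sqrtDet (s.γ z)) y := sqrtDet_contDiffAt hγ r.rel.γ_det_pos
  have c0' := contDiffAt_comp_snd c0
  have c1' := contDiffAt_comp_snd c1
  have hrel : BoostRel (s.γ y) (s.φ y + (0 : ℝ) • η y) (chi (s.e y) (s.m y) (s.p y)) (s.nv y)
      (s.nt y) (lorentz (s.p y)) := by
    rw [zero_smul, add_zero]
    exact r.rel
  obtain ⟨v1, v2⟩ := fderiv_phV (x := ((0 : ℝ), y)) (γ := fun z => s.γ z.2)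
    (φ := fun z => s.φ z.2 + z.1 • η z.2) (n := fun z => s.nv z.2) hM hrel hγ.comp_snd
    (hφ.variation hη1) hn.comp_snd (Filter.Eventually.of_forall fun z => s.γ_symm z.2)
    (Filter.Eventually.of_forall fun z => by
      rw [Matrix.transpose_add, Matrix.transpose_smul, hηs, φ_symm]) (v := (1, 0))
    (dM_comp_snd hγ) (dV_comp_snd hn)
  refine ⟨c0'.add (c1'.mul v1), ?_⟩
  have f0 := fderiv_comp_snd c0
  have f1 := fderiv_comp_snd c1
  have key : fderiv ℝ (fun z : ℝ × Pt N => (superHam κg s.γ (s.phase κg κf).π z.2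
      + ∑ i, superMom s.γ (s.phase κg κf).π z.2 i * s.nv z.2 i)
      + sqrtDet (s.γ z.2) * phV β ℓ (s.γ z.2) (s.φ z.2 + z.1 • η z.2) (s.nv z.2)) (0, y) (1, 0)
      = sqrtDet (s.γ y) * (1 / 2 * (s.Ut β ℓ y * (s.φ y)⁻¹ * η y).trace) := by
    rw [fderiv_fun_add c0'.diff (c1'.mul v1).diff, _root_.add_apply, f0,
      fderiv_mul_apply _ c1'.diff v1.diff, f1, v2, dM_variation hφ hη1, zero_smul, add_zero, zero_mul,
      add_zero, zero_add, Ut, Utop_eq r.posDef.self_of_nhds hM]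
    rfl
  refine key.trans ?_
  rw [sum_smul_mul (Ut_symm r1)]
  ring

/-- Here `γ` also enters through `𝗇̃`, which depends on `γ`, `φ` and `𝗇`. The vector constraints
give `R̃ᵢ` the value for which this dependence is stationary. -/
theorem hasFunctionalDeriv_constraintF_γ (hV : s.VectorConstraints β ℓ κg κf A)
    (hζ : IsTest A ζ) :
    HasFunctionalDeriv A
      (fun u => constraintF β ℓ κf A s.nv ζ { s.phase κg κf with γ := u }) (s.phase κg κf).γ
      (fun y => ζ y • (1 / 2 * sqrtDet (s.γ y)) • (s.U β ℓ y * (s.γ y)⁻¹)) := by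
  obtain ⟨c, w, hM⟩ := exists_isMoment N β ℓ
  refine hasFunctionalDeriv_of_ultralocal hA hζ
    (G := fun M y => superHam κf s.φ (s.phase κg κf).ϖ y
      - (∑ i, superMom s.φ (s.phase κg κf).ϖ y i * phNt M (s.φ y) (s.nv y) i)
      + sqrtDet M * phVt β ℓ M (s.φ y) (s.nv y)) (fun y hy => ?_) (fun y hy => ?_)
    fun y hy η hη hηs => ?_
  all_goals have r := h.viel hA hy
  · exact MatCD.smul (contDiffAt_const.mul (sqrtDet_contDiffAt r.gram_cd r.rel.γ_det_pos))
      (r.Uop_cd.mul (r.gram_cd.inv r.rel.γ_unit))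
  · rw [Matrix.transpose_smul, U_symm (r.of_le (by simp))]
  have r1 : VielbeinReg 1 s.e s.m s.p y := r.of_le (by simp)
  have hη1 : MatCD 1 η y := hη.of_le (by simp)
  have hγ : MatCD 1 s.γ y := r1.gram_cd
  have hφ : MatCD 1 s.φ y := r1.gram_cd'
  have hn : VecCD 1 s.nv y := r1.nv_cd
  have hϖ := momentumOf_cd κf r.gram_cd' r.rel.φ_det_pos (h.Kt_cd hA hy)
  have c0 : ContDiffAt ℝ 1 (fun z => superHam κf s.φ (s.phase κg κf).ϖ z) y :=
    (superHam_contDiffAt κf r.gram_cd' r.rel.φ_det_pos hϖ).of_le (by simp)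
  have hR : VecCD 1 (superMom s.φ (s.phase κg κf).ϖ) y := fun i =>
    (superMom_contDiffAt r.gram_cd' r.rel.φ_unit hϖ i).of_le (by simp)
  have c0' := contDiffAt_comp_snd c0
  have hp := r.posDef.self_of_nhds
  have hRy : superMom s.φ (s.phase κg κf).ϖ y
      = -(sqrtDet (s.γ y) • (chi (s.e y) (s.m y) (s.p y)
        *ᵥ (opY c w (relB (s.γ y) (chi (s.e y) (s.m y) (s.p y))) *ᵥ s.nv y))) := by
    -- Subtracting the two vector constraints gives `R̃ᵢ = -Rᵢ = √γ jᵢ`.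
    have h1 : superMom s.φ (s.phase κg κf).ϖ y = sqrtDet (s.γ y) • s.flux β ℓ y := by
      ext i
      obtain ⟨a, b⟩ := hV y hy i
      have b' : superMom (s.phase κg κf).γ (s.phase κg κf).π y i
        + superMom s.φ (s.phase κg κf).ϖ y i = 0 := b
      rw [Pi.smul_apply, smul_eq_mul]
      linarith
    have h2 : s.flux β ℓ y = _ := flux_eq hp hM
    rw [h1, h2, Uop_eq hp hM, Matrix.smul_mulVec, Matrix.mulVec_smul, smul_smul,
      mul_inv_cancel₀ (lorentz_pos _).ne', one_smul, smul_neg]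
    rfl
  have hrel : BoostRel (s.γ y + (0 : ℝ) • η y) (s.φ y) (chi (s.e y) (s.m y) (s.p y)) (s.nv y)
      (s.nt y) (lorentz (s.p y)) := by
    rw [zero_smul, add_zero]
    exact r.rel
  obtain ⟨v1, v2⟩ := fderiv_phVt (x := ((0 : ℝ), y)) (γ := fun z => s.γ z.2 + z.1 • η z.2)
    (φ := fun z => s.φ z.2) (n := fun z => s.nv z.2) hM hrel (hγ.variation hη1) hφ.comp_snd
    hn.comp_snd (Filter.Eventually.of_forall fun z => by
      rw [Matrix.transpose_add, Matrix.transpose_smul, hηs, γ_symm])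
    (Filter.Eventually.of_forall fun z => s.φ_symm z.2) (v := (1, 0))
    (dM_comp_snd hφ) (R := fun z => superMom s.φ (s.phase κg κf).ϖ z.2) hR.comp_snd
    (dV_comp_snd hR) (by simp only [zero_smul, add_zero]; exact hRy)
  have e : (fun z : ℝ × Pt N => superHam κf s.φ (s.phase κg κf).ϖ z.2
      - (∑ i, superMom s.φ (s.phase κg κf).ϖ z.2 i
        * phNt (s.γ z.2 + z.1 • η z.2) (s.φ z.2) (s.nv z.2) i)
      + sqrtDet (s.γ z.2 + z.1 • η z.2) * phVt β ℓ (s.γ z.2 + z.1 • η z.2) (s.φ z.2) (s.nv z.2))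
      = fun z => superHam κf s.φ (s.phase κg κf).ϖ z.2
        + (sqrtDet (s.γ z.2 + z.1 • η z.2)
            * phVt β ℓ (s.γ z.2 + z.1 • η z.2) (s.φ z.2) (s.nv z.2)
          - superMom s.φ (s.phase κg κf).ϖ z.2
            ⬝ᵥ phNt (s.γ z.2 + z.1 • η z.2) (s.φ z.2) (s.nv z.2)) := by
    funext z
    rw [dotProduct]
    ring
  have e' : (fun z : ℝ × Pt N => superHam κf s.φ (s.phase κg κf).ϖ z.2
      - (∑ i, superMom s.φ (s.phase κg κf).ϖ z.2 i
        * phNt ((s.phase κg κf).γ z.2 + z.1 • η z.2) (s.φ z.2) (s.nv z.2) i)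
      + sqrtDet ((s.phase κg κf).γ z.2 + z.1 • η z.2)
        * phVt β ℓ ((s.phase κg κf).γ z.2 + z.1 • η z.2) (s.φ z.2) (s.nv z.2)) = _ := e
  rw [e']
  refine ⟨c0'.add v1, ?_⟩
  rw [fderiv_fun_add c0'.diff v1.diff, _root_.add_apply, fderiv_comp_snd c0, v2,
    dM_variation hγ hη1, zero_smul, add_zero, zero_add, sum_smul_mul (U_symm r1), U, Uop_eq hp hM]
  simp only [γ]
  ring

end

end SliceData

/-! ### The Poisson bracket of the constraints -/

namespace SliceData

variable {s : SliceData N} {A : Set (Pt N)} {β : ℕ → ℝ} {ℓ κg κf : ℝ} {ξ ζ : Pt N → ℝ} {y : Pt N}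

section

variable (hA : IsOpen A) (h : s.Admissible A)

include hA h

theorem lhs_contDiffAt (hy : y ∈ A) : ContDiffAt ℝ ∞ (s.lhs β ℓ) y := by
  have r := h.viel hA hy
  refine ContDiffAt.add (ContDiffAt.sum fun i _ => ContDiffAt.sum fun j _ => ?_)
    (ContDiffAt.sum fun i _ => ContDiffAt.sum fun j _ => ?_)
  · exact (r.Uop_cd i j).mul ((covDeriv_contDiffAt r.gram_cd r.rel.γ_unit r.nv_cd i j).sub
      (((r.gram_cd.inv r.rel.γ_unit).mul (h.K_cd hA hy)) j i))
  · exact (r.Utop_cd i j).mul ((covDeriv_contDiffAt r.gram_cd' r.rel.φ_unit r.nt_cd i j).add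
      (((r.gram_cd'.inv r.rel.φ_unit).mul (h.Kt_cd hA hy)) j i))

theorem rhs_contDiffAt (hy : y ∈ A) : ContDiffAt ℝ ∞ (s.rhs β ℓ) y := by
  have r := h.viel hA hy
  have hc : VecCD ∞ (fun z => s.U β ℓ z *ᵥ s.nv z) y := r.Uop_cd.mulVec r.nv_cd
  exact ContDiffAt.sum (s := Finset.univ) fun i _ =>
    covDeriv_contDiffAt (k := s.γ) r.gram_cd r.rel.γ_unit hc i i

theorem sqrtDet_smul_current_cd (hy : y ∈ A) :
    VecCD ∞ (fun z => sqrtDet (s.γ z) • (s.U β ℓ z *ᵥ s.nv z)) y := by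
  have r := h.viel hA hy
  exact (r.Uop_cd.mulVec r.nv_cd).smul (sqrtDet_contDiffAt r.gram_cd r.rel.γ_det_pos)

/-- The divergence of the smeared current density. -/
theorem sum_pd_current (hy : y ∈ A) {f : Pt N → ℝ} (hf : ContDiffAt ℝ 1 f y) :
    ∑ i, pd i (fun z => f z * (sqrtDet (s.γ z) • (s.U β ℓ z *ᵥ s.nv z)) i) y
      = sqrtDet (s.γ y) * (f y * s.rhs β ℓ y + ∑ i, (s.U β ℓ y *ᵥ s.nv y) i * pd i f y) := by
  have r : VielbeinReg 1 s.e s.m s.p y := (h.viel hA hy).of_le (by simp)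
  have hγ := r.rel.γ_det_pos
  have c1 : ContDiffAt ℝ 1 (fun z => sqrtDet (s.γ z)) y := sqrtDet_contDiffAt r.gram_cd hγ
  have c2 : VecCD 1 (fun z => s.U β ℓ z *ᵥ s.nv z) y := current_cd r
  have h1 : ∀ i, pd i (fun z => f z * (sqrtDet (s.γ z) • (s.U β ℓ z *ᵥ s.nv z)) i) y
      = f y * (sqrtDet (s.γ y) * dV (fun z => s.U β ℓ z *ᵥ s.nv z) y (Pi.single i 1) i
        + pd i (fun z => sqrtDet (s.γ z)) y * (s.U β ℓ y *ᵥ s.nv y) i)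
        + pd i f y * (sqrtDet (s.γ y) * (s.U β ℓ y *ᵥ s.nv y) i) := fun i => by
    have h2 : pd i (fun z => f z * (sqrtDet (s.γ z) * (s.U β ℓ z *ᵥ s.nv z) i)) y
        = _ := fderiv_mul_apply (Pi.single i 1) hf.diff (c1.mul (c2 i)).diff
    rw [fderiv_mul_apply _ c1.diff (c2 i).diff] at h2
    exact h2
  have h3 : ∀ i, pd i (fun z => sqrtDet (s.γ z)) y
      = sqrtDet (s.γ y) * (1 / 2 * ((s.γ y)⁻¹ * dM s.γ y (Pi.single i 1)).trace) := fun i =>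
    fderiv_sqrtDet _ r.gram_cd hγ
  rw [rhs_eq r, mul_add, mul_add, mul_add, Finset.mul_sum, Finset.mul_sum, Finset.mul_sum,
    Finset.mul_sum, Finset.mul_sum, ← Finset.sum_add_distrib, ← Finset.sum_add_distrib]
  refine Finset.sum_congr rfl fun i _ => ?_
  rw [h1, h3]
  ring

/-- The integrand of the bracket, up to a divergence. -/
theorem bracket_density (hy : y ∈ A) (hξ : ContDiffAt ℝ 1 ξ y) (hζ : ContDiffAt ℝ 1 ζ y) :
    ∑ i, ∑ j, (-(((2 * ξ y) • s.K y - Matrix.of (lieDeriv (fun z => ξ z • s.nv z) s.γ y)) i j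
        * (ζ y • (1 / 2 * sqrtDet (s.γ y)) • (s.U β ℓ y * (s.γ y)⁻¹)) i j)
      + (ξ y • (1 / 2 * sqrtDet (s.γ y)) • (s.Ut β ℓ y * (s.φ y)⁻¹)) i j
        * ((2 * ζ y) • s.Kt y - Matrix.of (lieDeriv (fun z => ζ z • -s.nt z) s.φ y)) i j)
      = ξ y * ζ y * (sqrtDet (s.γ y) * (s.lhs β ℓ y - s.rhs β ℓ y))
        + ∑ i, pd i (fun z => ξ z * (ζ z * (sqrtDet (s.γ z) • (s.U β ℓ z *ᵥ s.nv z)) i)) y := by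
  have r : VielbeinReg 1 s.e s.m s.p y := (h.viel hA hy).of_le (by simp)
  have kγ := sum_mul_lieDeriv (k := s.γ) (Filter.Eventually.of_forall s.γ_symm) r.rel.γ_unit
    (U_symm r (β := β) (ℓ := ℓ)) fun z => ξ z • s.nv z
  have kφ := sum_mul_lieDeriv (k := s.φ) (Filter.Eventually.of_forall s.φ_symm) r.rel.φ_unit
    (Ut_symm r (β := β) (ℓ := ℓ)) fun z => ζ z • -s.nt z
  have hK : ∀ (T k K : Mat N), Kᵀ = K →
      ∑ i, ∑ j, (T * k⁻¹) i j * K i j = ∑ i, ∑ j, T i j * (k⁻¹ * K) j i := fun T k K hK => by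
    have e1 : ∑ i, ∑ j, (T * k⁻¹) i j * K i j = (T * k⁻¹ * Kᵀ).trace := rfl
    rw [e1, hK, Matrix.mul_assoc]
    rfl
  have kK := hK (s.U β ℓ y) (s.γ y) (s.K y) (h.K_symm y hy)
  have kKt := hK (s.Ut β ℓ y) (s.φ y) (s.Kt y) (h.Kt_symm y hy)
  have cγ : ∀ i j, covDeriv s.γ (fun z => ξ z • s.nv z) y i j
      = pd i ξ y * s.nv y j + ξ y * covDeriv s.γ s.nv y i j := covDeriv_smul hξ r.nv_cd
  have cφ : ∀ i j, covDeriv s.φ (fun z => ζ z • -s.nt z) y i j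
      = -(pd i ζ y * s.nt y j + ζ y * covDeriv s.φ s.nt y i j) := fun i j => by
    have hn : VecCD 1 (fun z => -s.nt z) y := r.nt_cd.neg
    rw [covDeriv_smul hζ hn, covDeriv_neg s.φ s.nt, Pi.neg_apply, mul_neg, mul_neg]
    ring
  have aU : ∀ f : Fin N → ℝ, ∑ i, ∑ j, s.U β ℓ y i j * (f i * s.nv y j)
      = ∑ i, (s.U β ℓ y *ᵥ s.nv y) i * f i := fun f => by
    refine Finset.sum_congr rfl fun i _ => ?_
    rw [Matrix.mulVec, dotProduct, Finset.sum_mul]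
    exact Finset.sum_congr rfl fun j _ => by ring
  -- The terms with `∂ξ` and `∂ζ` carry the same current, so they combine into the derivative of `ξ
  -- ζ` and then into a divergence minus `ξ ζ` times the divergence of the current.
  have aUt : ∀ f : Fin N → ℝ, ∑ i, ∑ j, s.Ut β ℓ y i j * (f i * s.nt y j)
      = ∑ i, (s.U β ℓ y *ᵥ s.nv y) i * f i := fun f => by
    rw [U_mulVec_eq r]
    refine Finset.sum_congr rfl fun i _ => ?_
    rw [Matrix.mulVec, dotProduct, Finset.sum_mul]
    exact Finset.sum_congr rfl fun j _ => by ring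
  have hpd : ∑ i, pd i (fun z => ξ z * (ζ z * (sqrtDet (s.γ z) • (s.U β ℓ z *ᵥ s.nv z)) i)) y
      = sqrtDet (s.γ y) * (ξ y * ζ y * s.rhs β ℓ y
        + (ξ y * ∑ i, (s.U β ℓ y *ᵥ s.nv y) i * pd i ζ y
          + ζ y * ∑ i, (s.U β ℓ y *ᵥ s.nv y) i * pd i ξ y)) := by
    simp only [← mul_assoc (ξ _)]
    rw [sum_pd_current hA h hy (hξ.mul hζ), Finset.mul_sum, Finset.mul_sum,
      ← Finset.sum_add_distrib]
    congr 2
    refine Finset.sum_congr rfl fun i _ => ?_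
    have : pd i (fun z => ξ z * ζ z) y = ξ y * pd i ζ y + pd i ξ y * ζ y :=
      fderiv_mul_apply _ hξ.diff hζ.diff
    rw [this]
    ring
  have key : ∑ i, ∑ j, (-(((2 * ξ y) • s.K y
        - Matrix.of (lieDeriv (fun z => ξ z • s.nv z) s.γ y)) i j
        * (ζ y • (1 / 2 * sqrtDet (s.γ y)) • (s.U β ℓ y * (s.γ y)⁻¹)) i j)
      + (ξ y • (1 / 2 * sqrtDet (s.γ y)) • (s.Ut β ℓ y * (s.φ y)⁻¹)) i j
        * ((2 * ζ y) • s.Kt y - Matrix.of (lieDeriv (fun z => ζ z • -s.nt z) s.φ y)) i j)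
      = sqrtDet (s.γ y) * (-(ξ y * ζ y * ∑ i, ∑ j, (s.U β ℓ y * (s.γ y)⁻¹) i j * s.K y i j)
          + 1 / 2 * ζ y * (∑ i, ∑ j, (s.U β ℓ y * (s.γ y)⁻¹) i j
              * lieDeriv (fun z => ξ z • s.nv z) s.γ y i j)
          + ξ y * ζ y * (∑ i, ∑ j, (s.Ut β ℓ y * (s.φ y)⁻¹) i j * s.Kt y i j)
          - 1 / 2 * ξ y * ∑ i, ∑ j, (s.Ut β ℓ y * (s.φ y)⁻¹) i j
              * lieDeriv (fun z => ζ z • -s.nt z) s.φ y i j) := by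
    simp only [Finset.mul_sum, ← Finset.sum_add_distrib, ← Finset.sum_sub_distrib,
      ← Finset.sum_neg_distrib]
    refine Finset.sum_congr rfl fun i _ => Finset.sum_congr rfl fun j _ => ?_
    simp only [Matrix.sub_apply, Matrix.smul_apply, Matrix.of_apply, smul_eq_mul]
    ring
  have eγ : ∑ i, ∑ j, s.U β ℓ y i j * covDeriv s.γ (fun z => ξ z • s.nv z) y i j
      = (∑ i, (s.U β ℓ y *ᵥ s.nv y) i * pd i ξ y)
        + ξ y * ∑ i, ∑ j, s.U β ℓ y i j * covDeriv s.γ s.nv y i j := by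
    rw [← aU]
    simp only [cγ, Finset.mul_sum, ← Finset.sum_add_distrib]
    exact Finset.sum_congr rfl fun i _ => Finset.sum_congr rfl fun j _ => by ring
  have eφ : ∑ i, ∑ j, s.Ut β ℓ y i j * covDeriv s.φ (fun z => ζ z • -s.nt z) y i j
      = -((∑ i, (s.U β ℓ y *ᵥ s.nv y) i * pd i ζ y)
        + ζ y * ∑ i, ∑ j, s.Ut β ℓ y i j * covDeriv s.φ s.nt y i j) := by
    rw [← aUt]
    simp only [cφ, Finset.mul_sum, ← Finset.sum_add_distrib, ← Finset.sum_neg_distrib]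
    exact Finset.sum_congr rfl fun i _ => Finset.sum_congr rfl fun j _ => by ring
  have hl : s.lhs β ℓ y = (∑ i, ∑ j, s.U β ℓ y i j * covDeriv s.γ s.nv y i j)
      - (∑ i, ∑ j, s.U β ℓ y i j * ((s.γ y)⁻¹ * s.K y) j i)
      + ((∑ i, ∑ j, s.Ut β ℓ y i j * covDeriv s.φ s.nt y i j)
        + ∑ i, ∑ j, s.Ut β ℓ y i j * ((s.φ y)⁻¹ * s.Kt y) j i) := by
    simp only [lhs, mul_sub, mul_add, Finset.sum_sub_distrib, Finset.sum_add_distrib]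
  rw [key, kγ, kφ, kK, kKt, eγ, eφ, hpd, hl]
  ring

theorem bracket_eq (hN : 2 ≤ N) (hκg : κg ≠ 0) (hκf : κf ≠ 0)
    (hV : s.VectorConstraints β ℓ κg κf A) (hξ : IsTest A ξ) (hζ : IsTest A ζ) :
    s.bracket β ℓ κg κf A ξ ζ
      = ∫ y in A, ξ y * ζ y * (sqrtDet (s.γ y) * (s.lhs β ℓ y - s.rhs β ℓ y)) := by
  have a1 := (hasFunctionalDeriv_constraintG_π (β := β) (ℓ := ℓ) (κf := κf) hN hA h hκg
    hξ).functionalDeriv_eq hA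
  have a2 := (hasFunctionalDeriv_constraintF_ϖ (β := β) (ℓ := ℓ) (κg := κg) hN hA h hκf
    hζ).functionalDeriv_eq hA
  have a3 := (hasFunctionalDeriv_constraintG_φ (β := β) (ℓ := ℓ) (κg := κg) (κf := κf) hA h
    hξ).functionalDeriv_eq hA
  have a4 := (hasFunctionalDeriv_constraintF_γ hA h hV hζ).functionalDeriv_eq hA
  -- `C̃` contains no `π` and `C` no `ϖ`. The derivatives of `C` by `γ` and of `C̃` by `φ`, which
  -- involve the curvature, are thus multiplied by zero; whether they exist is immaterial.
  have a5 : ∀ y ∈ A, functionalDeriv A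
      (fun u => constraintF β ℓ κf A s.nv ζ { s.phase κg κf with π := u }) (s.phase κg κf).π y = 0 :=
    (hasFunctionalDeriv_const (constraintF β ℓ κf A s.nv ζ (s.phase κg κf))).functionalDeriv_eq hA
  have a6 : ∀ y ∈ A, functionalDeriv A
      (fun u => constraintG β ℓ κg A s.nv ξ { s.phase κg κf with ϖ := u }) (s.phase κg κf).ϖ y = 0 :=
    (hasFunctionalDeriv_const (constraintG β ℓ κg A s.nv ξ (s.phase κg κf))).functionalDeriv_eq hA
  set W : Fin N → Pt N → ℝ := fun i z => ξ z * (ζ z * (sqrtDet (s.γ z) • (s.U β ℓ z *ᵥ s.nv z)) i)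
  have hW : ∀ i, IsTest A (W i) := fun i => hξ.mul fun y hy =>
    hζ.1.contDiffAt.mul (sqrtDet_smul_current_cd hA h hy i)
  have hF : IsTest A fun y => ξ y * (ζ y * (sqrtDet (s.γ y) * (s.lhs β ℓ y - s.rhs β ℓ y))) :=
    hξ.mul fun y hy => hζ.1.contDiffAt.mul ((sqrtDet_contDiffAt (h.viel hA hy).gram_cd
      (h.viel hA hy).rel.γ_det_pos).mul ((lhs_contDiffAt hA h hy).sub (rhs_contDiffAt hA h hy)))
  have hF' : Integrable fun y => ξ y * ζ y * (sqrtDet (s.γ y) * (s.lhs β ℓ y - s.rhs β ℓ y)) := by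
    simpa only [mul_assoc] using hF.integrable
  have hden : s.bracket β ℓ κg κf A ξ ζ
      = ∫ y in A, (ξ y * ζ y * (sqrtDet (s.γ y) * (s.lhs β ℓ y - s.rhs β ℓ y))
        + ∑ i, pd i (W i) y) := by
    refine setIntegral_congr_fun hA.measurableSet fun y hy => ?_
    refine Eq.trans ?_ (bracket_density hA h hy (hξ.1.contDiffAt.of_le (by simp))
      (hζ.1.contDiffAt.of_le (by simp)))
    refine Finset.sum_congr rfl fun i _ => Finset.sum_congr rfl fun j _ => ?_
    simp only [a1 y hy, a2 y hy, a3 y hy, a4 y hy, a5 y hy, a6 y hy, Matrix.zero_apply, mul_zero,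
      zero_mul, zero_sub, sub_zero]
  rw [hden, integral_add hF'.integrableOn
    (integrable_finsetSum _ fun i _ => ((hW i).pd i).integrable.integrableOn),
    integral_finsetSum _ fun i _ => ((hW i).pd i).integrable.integrableOn,
    Finset.sum_eq_zero fun i _ => (hW i).integral_pd i, add_zero]

theorem secondaryConstraint_iff (hN : 2 ≤ N) (hκg : κg ≠ 0) (hκf : κf ≠ 0)
    (hV : s.VectorConstraints β ℓ κg κf A) :
    s.SecondaryConstraint β ℓ κg κf A ↔ ∀ y ∈ A, s.lhs β ℓ y = s.rhs β ℓ y := by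
  refine ⟨fun hS y hy => ?_, fun hF ξ ζ hξ hζ => ?_⟩
  -- One test function is fixed with value one at the point; the fundamental lemma is applied in the
  -- other.
  · obtain ⟨ζ, hζ, hζy⟩ := exists_isTest_eq_one hA hy
    have h1 := eq_zero_of_integral_test hA
      (f := fun y => ζ y * (sqrtDet (s.γ y) * (s.lhs β ℓ y - s.rhs β ℓ y)))
      (fun z hz => (hζ.1.contDiffAt.mul ((sqrtDet_contDiffAt (h.viel hA hz).gram_cd
        (h.viel hA hz).rel.γ_det_pos).mul ((lhs_contDiffAt hA h hz).sub
          (rhs_contDiffAt hA h hz)))).continuousAt.continuousWithinAt)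
      (fun ξ hξ => by
        have h2 := bracket_eq hA h hN hκg hκf hV hξ hζ
        rw [hS ξ ζ hξ hζ] at h2
        simpa only [mul_assoc] using h2.symm) y hy
    simp only [hζy, one_mul] at h1
    exact sub_eq_zero.mp ((mul_eq_zero.mp h1).resolve_left
      (sqrtDet_pos (h.viel hA hy).rel.γ_det_pos).ne')
  · rw [bracket_eq hA h hN hκg hκf hV hξ hζ]
    exact setIntegral_eq_zero_of_forall_eq_zero fun y hy => by
      rw [hF y hy, sub_self, mul_zero, mul_zero]

end

end SliceData

end Bimetric

/-! ### Assembly of the theorem -/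

theorem mainTheorem3 (N : ℕ) (β : ℕ → ℝ) (ℓ : ℝ) (hℓ : 0 < ℓ) :
    -- the projection of the conservation law, for all spacetime fields on a chart domain
    (∀ (Ω : Set (Pt (N + 1))) (c : Fields N), IsOpen Ω → c.Admissible Ω →
      ∀ (t : ℝ) (y : Pt N), Fin.cons t y ∈ Ω →
        -- the principal square root exists
        IsPrincipalSqrt ((c.g (Fin.cons t y))⁻¹ * c.f (Fin.cons t y)) (c.S (Fin.cons t y)) ∧
        -- the normal projections of the conservation law
        c.normalProj β ℓ (Fin.cons t y)
          = -(c.lapseF (Fin.cons t y)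
              / Real.sqrt (c.lapseG (Fin.cons t y) * c.lapseF (Fin.cons t y)
                / lorentz (c.p (Fin.cons t y))))
            * ((c.slice t).lhs β ℓ y - (c.slice t).rhs β ℓ y) ∧
        (∑ ν, (unitNormal (c.g (Fin.cons t y)) ν
            + ∑ i, (c.slice t).nv y i * projector (c.g (Fin.cons t y)) ν (Fin.succ i))
              * c.divVg β ℓ (Fin.cons t y) ν)
          = -(c.lapseF (Fin.cons t y) / c.lapseG (Fin.cons t y))
            * ((c.slice t).lhs β ℓ y - (c.slice t).rhs β ℓ y) ∧
        -- the projected law is the scalar equation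
        (c.normalProj β ℓ (Fin.cons t y) = 0 ↔ (c.slice t).lhs β ℓ y = (c.slice t).rhs β ℓ y) ∧
        ((∀ ν, c.divVg β ℓ (Fin.cons t y) ν = 0) ↔
          (c.slice t).lhs β ℓ y = (c.slice t).rhs β ℓ y ∧
            ∀ i : Fin N, c.divVg β ℓ (Fin.cons t y) i.succ = 0) ∧
        -- the symmetric form, and its behaviour under duality
        (c.slice t).symRhs β ℓ y - (c.slice t).symLhs β ℓ y
          = (c.slice t).lhs β ℓ y - (c.slice t).rhs β ℓ y ∧
        ((c.slice t).lhs β ℓ y = (c.slice t).rhs β ℓ y ↔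
          (c.slice t).symLhs β ℓ y = (c.slice t).symRhs β ℓ y) ∧
        (c.slice t).dual.symRhs (dualBeta N β) ℓ y - (c.slice t).dual.symLhs (dualBeta N β) ℓ y
          = -(sqrtDet ((c.slice t).γ y) / sqrtDet ((c.slice t).φ y))
            * ((c.slice t).symRhs β ℓ y - (c.slice t).symLhs β ℓ y) ∧
        ((c.slice t).dual.symLhs (dualBeta N β) ℓ y = (c.slice t).dual.symRhs (dualBeta N β) ℓ y ↔
          (c.slice t).symLhs β ℓ y = (c.slice t).symRhs β ℓ y) ∧
        -- the interaction density is linear in the lapses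
        Real.sqrt (-(c.g (Fin.cons t y)).det) * c.V β ℓ (Fin.cons t y)
          = sqrtDet ((c.slice t).γ y) *
            (c.lapseG (Fin.cons t y)
                * phV β ℓ ((c.slice t).γ y) ((c.slice t).φ y) ((c.slice t).nv y)
              + c.lapseF (Fin.cons t y)
                * phVt β ℓ ((c.slice t).γ y) ((c.slice t).φ y) ((c.slice t).nv y))) ∧
    -- the lapses and the shift drop out of the projected law
    (∀ (Ω : Set (Pt (N + 1))) (c c' : Fields N), IsOpen Ω → c.Admissible Ω → c'.Admissible Ω →
      ∀ (t : ℝ) (y : Pt N), Fin.cons t y ∈ Ω →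
        (∀ᶠ z in 𝓝 y, (c'.slice t).e z = (c.slice t).e z ∧ (c'.slice t).m z = (c.slice t).m z ∧
          (c'.slice t).p z = (c.slice t).p z) →
        (c'.slice t).K y = (c.slice t).K y → (c'.slice t).Kt y = (c.slice t).Kt y →
        (c'.normalProj β ℓ (Fin.cons t y) = 0 ↔ c.normalProj β ℓ (Fin.cons t y) = 0)) ∧
    -- the scalar equation is the secondary constraint of the Hamiltonian analysis
    (2 ≤ N → ∀ (κg κf : ℝ), 0 < κg → 0 < κf →
      ∀ (A : Set (Pt N)) (s : SliceData N), IsOpen A → s.Admissible A →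
        s.VectorConstraints β ℓ κg κf A →
        (∀ ξ ζ : Pt N → ℝ, IsTest A ξ → IsTest A ζ →
          s.bracket β ℓ κg κf A ξ ζ
            = ∫ y in A, ξ y * ζ y * (sqrtDet (s.γ y) * (s.lhs β ℓ y - s.rhs β ℓ y))) ∧
        (s.SecondaryConstraint β ℓ κg κf A ↔ ∀ y ∈ A, s.lhs β ℓ y = s.rhs β ℓ y)) := by
  refine ⟨fun Ω c hΩ hc t y hy => ?_, fun Ω c c' hΩ hc hc' t y hy h hK hKt => ?_,
    fun hN κg κf hκg hκf A s hA hs hV =>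
      ⟨fun ξ ζ hξ hζ => SliceData.bracket_eq hA hs hN hκg.ne' hκf.ne' hV hξ hζ,
        SliceData.secondaryConstraint_iff hA hs hN hκg.ne' hκf.ne' hV⟩⟩
  · have r := hc.reg hΩ hy
    have rs : VielbeinReg 1 (c.slice t).e (c.slice t).m (c.slice t).p y := r.viel.slice
    have hp := hc.chi_posDef _ hy
    have hL := hc.lapseG_pos _ hy
    have hM := hc.lapseF_pos _ hy
    obtain ⟨w, z, hm⟩ := exists_isMoment N β ℓ
    have hsym := SliceData.symRhs_sub_symLhs rs (β := β) (ℓ := ℓ)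
    have hdual := SliceData.dual_symm rs (β := β) (ℓ := ℓ)
    have hne : -(sqrtDet ((c.slice t).γ y) / sqrtDet ((c.slice t).φ y)) ≠ 0 :=
      neg_ne_zero.mpr (div_pos (sqrtDet_pos rs.rel.γ_det_pos) (sqrtDet_pos rs.rel.φ_det_pos)).ne'
    refine ⟨Fields.isPrincipalSqrt_S hp hL hM, Fields.normalProj_eq r,
      Fields.sum_projector_mul_divVg r, Fields.normalProj_eq_zero_iff r, Fields.divVg_eq_zero_iff r,
      hsym, ?_, hdual, ?_, Fields.V_eq hp hL hM hm⟩
    · rw [← sub_eq_zero, ← hsym, sub_eq_zero, eq_comm]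
    · rw [eq_comm, ← sub_eq_zero, hdual, mul_eq_zero, or_iff_right hne, sub_eq_zero, eq_comm]
  · rw [Fields.normalProj_eq_zero_iff (hc'.reg hΩ hy), Fields.normalProj_eq_zero_iff (hc.reg hΩ hy),
      SliceData.lhs_congr h hK hKt, SliceData.rhs_congr h]
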